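/- Let $G$ be a finite simple undirected graph with $n$ vertices and $m$ edges. A vertex $u$ is avoidable if every induced path on three vertices with middle vertex $u$ is contained in an induced cycle, and simplicial if its neighbours are pairwise adjacent. A graph is chordal if it has no induced cycle of length more than three. A minimal triangulation of $G=(V,E)$ is a chordal graph $H=(V,E\cup F)$ with $F\cap E=\emptyset$ such that $(V,E\cup F')$ is not chordal for every proper subset $F'\subsetneq F$; the edges in $F$ are the fill edges. For an ordering $(v_1,\dots,v_n)$ of $V$, a vertex-incremental minimal triangulation $H(v_1,\dots,v_n)$ of $G$ is a graph $H$ on $V$ such that $H[\{v_1,\dots,v_i\}]$ is a minimal triangulation of $G[\{v_1,\dots,v_i\}]$ for every $0\le i\le n$ (so step $i$ adds only $v_i$ and edges incident to $v_i$). (1) For every vertex $u$, let $X=N_G(u)$ and $A=V\setminus N_G[u]$. Orderings $(A,u,X)$ of $V$ exist (first $A$ in any order, then $u$, then $X$ in any order); for each of them there is a vertex-incremental minimal triangulation $H(A,u,X)$ of $G$, and every such $H=H(A,u,X)$ is a minimal triangulation of $G$ in which no fill edge is incident to $u$, and $u$ is avoidable in $G$ if and only if $u$ is simplicial in $H$.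 (2) There is an algorithm that, given $G$ by adjacency lists and a vertex $u$, constructs some $H=H(A,u,X)$ as in (1), as a list of its edges, and answers whether $u$ is simplicial in $H$, in time $O(nm+1)$. Running this algorithm for every vertex $u$, and listing $u$ whenever the answer is yes, lists all avoidable vertices of $G$, each exactly once, in total time $O(n^2m+n+1)$, which is $O(n^2m)$ whenever $G$ has an edge. Here time is the number of steps of a word RAM with unit cost for each operation (constants, reading and writing of cells, addition, truncated subtraction, multiplication, comparison), whose words are the natural numbers below $(n+2)^c$ for a constant $c$; the algorithm, $c$ and the constants in the $O$-bounds do not depend on $G$. -/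

import Mathlib

namespace AvoidableVertices

/-! ### Graphs -/

/-- `u` is avoidable: every induced path `x, u, y` with middle vertex `u` is contained in an
induced cycle. -/
def IsAvoidable {V : Type*} (G : SimpleGraph V) (u : V) : Prop :=
  ∀ x y : V, G.Adj u x → G.Adj u y → x ≠ y → ¬ G.Adj x y →
    ∃ k : ℕ, 3 ≤ k ∧ ∃ f : SimpleGraph.cycleGraph k ↪g G,
      x ∈ Set.range f ∧ u ∈ Set.range f ∧ y ∈ Set.range f

/-- `u` is simplicial: its neighbours are pairwise adjacent. -/
def IsSimplicial {V : Type*} (G : SimpleGraph V) (u : V) : Prop :=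
  G.IsClique (G.neighborSet u)

/-- Chordal: there is no induced cycle of length more than three. -/
def IsChordal {V : Type*} (G : SimpleGraph V) : Prop :=
  ∀ k : ℕ, 4 ≤ k → IsEmpty (SimpleGraph.cycleGraph k ↪g G)

/-- `H` is a minimal triangulation of `G`: it is a chordal supergraph of `G` on the same vertices,
and no graph that contains `G` and lies strictly below `H` is chordal.
The fill edges are the edges of `H \ G`. -/
def IsMinimalTriangulation {V : Type*} (G H : SimpleGraph V) : Prop :=
  G ≤ H ∧ IsChordal H ∧ ∀ H' : SimpleGraph V, G ≤ H' → H' < H → ¬ IsChordal H'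

/-- `H` is a vertex-incremental minimal triangulation of `G` for the vertex ordering
`l = (v₁, …, vₙ)`: for every `i`, the graph `Hᵢ = H[v₁, …, vᵢ]` is a minimal triangulation of
`Gᵢ = G[v₁, …, vᵢ]`. So `Hᵢ` arises from `Hᵢ₋₁` by adding `vᵢ` and edges incident to `vᵢ` only. -/
def IsVertexIncremental {V : Type*} (G : SimpleGraph V) (l : List V) (H : SimpleGraph V) : Prop :=
  ∀ i : ℕ, i ≤ l.length →
    IsMinimalTriangulation (G.induce {v | v ∈ l.take i}) (H.induce {v | v ∈ l.take i})

/-- `l` is an ordering `(A, u, X)` of all vertices: first the non-neighbours of `u` (in any order),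
then `u`, then the neighbours of `u` (in any order). -/
def IsOrderingAt {V : Type*} (G : SimpleGraph V) (u : V) (l : List V) : Prop :=
  l.Nodup ∧ (∀ v, v ∈ l) ∧
    ∃ a x : List V, l = a ++ u :: x ∧ (∀ v ∈ a, ¬ G.Adj u v) ∧ (∀ v ∈ x, G.Adj u v)

/-! ### A word RAM with a step count

The machine has registers and arrays, both named by natural numbers, whose cells hold words, that
is, natural numbers below a word bound `W`. Programs are structured. An operation on words takes one
unit of time, and a program gets stuck when an operation has a result of at least `W`. -/

/-- A memory state: the contents of the registers and of the arrays. -/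
structure State where
  reg : ℕ → ℕ
  arr : ℕ → ℕ → ℕ

/-- Arithmetic expressions. -/
inductive Expr where
  | lit (k : ℕ)
  | var (r : ℕ)
  | get (a : ℕ) (i : Expr)
  | add (e f : Expr)
  | sub (e f : Expr)
  | mul (e f : Expr)
  | lt (e f : Expr)
  | eq (e f : Expr)

namespace Expr

/-- The value of an expression; subtraction is truncated, comparisons return `0` or `1`. -/
def eval (σ : State) : Expr → ℕ
  | lit k => k
  | var r => σ.reg r
  | get a i => σ.arr a (i.eval σ)
  | add e f => e.eval σ + f.eval σ
  | sub e f => e.eval σ - f.eval σ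
  | mul e f => e.eval σ * f.eval σ
  | lt e f => if e.eval σ < f.eval σ then 1 else 0
  | eq e f => if e.eval σ = f.eval σ then 1 else 0

/-- The time needed for evaluating an expression: one unit for each of its nodes. -/
def cost : Expr → ℕ
  | lit _ => 1
  | var _ => 1
  | get _ i => i.cost + 1
  | add e f => e.cost + f.cost + 1
  | sub e f => e.cost + f.cost + 1
  | mul e f => e.cost + f.cost + 1
  | lt e f => e.cost + f.cost + 1
  | eq e f => e.cost + f.cost + 1

/-- Every value that occurs in the evaluation, addresses included, is a word below `W`. -/
def Fits (W : ℕ) (σ : State) : Expr → Prop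
  | lit k => k < W
  | var r => σ.reg r < W
  | get a i => i.Fits W σ ∧ σ.arr a (i.eval σ) < W
  | add e f => e.Fits W σ ∧ f.Fits W σ ∧ e.eval σ + f.eval σ < W
  | sub e f => e.Fits W σ ∧ f.Fits W σ
  | mul e f => e.Fits W σ ∧ f.Fits W σ ∧ e.eval σ * f.eval σ < W
  | lt e f => e.Fits W σ ∧ f.Fits W σ ∧ 1 < W
  | eq e f => e.Fits W σ ∧ f.Fits W σ ∧ 1 < W

end Expr

/-- Programs: do nothing, assign to a register, assign to an array cell, sequential composition,
conditional (is the value nonzero?), and while loop (as long as the value is nonzero). -/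
inductive Prog where
  | skip
  | set (r : ℕ) (e : Expr)
  | put (a : ℕ) (i e : Expr)
  | seq (p q : Prog)
  | ite (e : Expr) (p q : Prog)
  | loop (e : Expr) (p : Prog)

/-- Assignment to a register. -/
def State.setReg (σ : State) (r v : ℕ) : State :=
  { σ with reg := Function.update σ.reg r v }

/-- Assignment to an array cell. -/
def State.setArr (σ : State) (a i v : ℕ) : State :=
  { σ with arr := Function.update σ.arr a (Function.update (σ.arr a) i v) }

/-- `Exec W p σ t σ'`: with word bound `W`, the program `p` started in the state `σ` halts after
exactly `t` units of time, in the state `σ'`. -/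
inductive Exec (W : ℕ) : Prog → State → ℕ → State → Prop where
  | skip (σ : State) : Exec W Prog.skip σ 1 σ
  | set (r : ℕ) (e : Expr) (σ : State) (he : e.Fits W σ) :
      Exec W (Prog.set r e) σ (e.cost + 1) (σ.setReg r (e.eval σ))
  | put (a : ℕ) (i e : Expr) (σ : State) (hi : i.Fits W σ) (he : e.Fits W σ) :
      Exec W (Prog.put a i e) σ (i.cost + e.cost + 1) (σ.setArr a (i.eval σ) (e.eval σ))
  | seq {p q : Prog} {σ σ' σ'' : State} {t t' : ℕ}
      (hp : Exec W p σ t σ') (hq : Exec W q σ' t' σ'') :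
      Exec W (Prog.seq p q) σ (t + t') σ''
  | ite_true {e : Expr} {p : Prog} (q : Prog) {σ σ' : State} {t : ℕ}
      (he : e.Fits W σ) (h : e.eval σ ≠ 0) (hp : Exec W p σ t σ') :
      Exec W (Prog.ite e p q) σ (e.cost + 1 + t) σ'
  | ite_false {e : Expr} (p : Prog) {q : Prog} {σ σ' : State} {t : ℕ}
      (he : e.Fits W σ) (h : e.eval σ = 0) (hq : Exec W q σ t σ') :
      Exec W (Prog.ite e p q) σ (e.cost + 1 + t) σ'
  | loop_done {e : Expr} (p : Prog) {σ : State} (he : e.Fits W σ) (h : e.eval σ = 0) :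
      Exec W (Prog.loop e p) σ (e.cost + 1) σ
  | loop_step {e : Expr} {p : Prog} {σ σ' σ'' : State} {t t' : ℕ}
      (he : e.Fits W σ) (h : e.eval σ ≠ 0) (hp : Exec W p σ t σ')
      (hl : Exec W (Prog.loop e p) σ' t' σ'') :
      Exec W (Prog.loop e p) σ (e.cost + 1 + t + t') σ''

/-- Execution is deterministic. -/
theorem Exec.deterministic {W : ℕ} {p : Prog} {σ σ₁ : State} {t₁ : ℕ}
    (h₁ : Exec W p σ t₁ σ₁) : ∀ {t₂ : ℕ} {σ₂ : State}, Exec W p σ t₂ σ₂ → t₁ = t₂ ∧ σ₁ = σ₂ := by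
  induction h₁ with
  | skip σ => intro t₂ σ₂ h₂; cases h₂; exact ⟨rfl, rfl⟩
  | set r e σ he => intro t₂ σ₂ h₂; cases h₂; exact ⟨rfl, rfl⟩
  | put a i e σ hi he => intro t₂ σ₂ h₂; cases h₂; exact ⟨rfl, rfl⟩
  | seq hp hq ihp ihq =>
    intro t₂ σ₂ h₂
    cases h₂ with
    | seq hp' hq' =>
      obtain ⟨rfl, rfl⟩ := ihp hp'
      obtain ⟨rfl, rfl⟩ := ihq hq'
      exact ⟨rfl, rfl⟩
  | ite_true q he h hp ih =>
    intro t₂ σ₂ h₂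
    cases h₂ with
    | ite_true _ _ _ hp' => obtain ⟨rfl, rfl⟩ := ih hp'; exact ⟨rfl, rfl⟩
    | ite_false _ _ h' _ => exact absurd h' h
  | ite_false p he h hq ih =>
    intro t₂ σ₂ h₂
    cases h₂ with
    | ite_true _ _ h' _ => exact absurd h h'
    | ite_false _ _ _ hq' => obtain ⟨rfl, rfl⟩ := ih hq'; exact ⟨rfl, rfl⟩
  | loop_done p he h =>
    intro t₂ σ₂ h₂
    cases h₂ with
    | loop_done _ _ _ => exact ⟨rfl, rfl⟩
    | loop_step _ h' _ _ => exact absurd h h'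
  | loop_step he h hp hl ihp ihl =>
    intro t₂ σ₂ h₂
    cases h₂ with
    | loop_done _ _ h' => exact absurd h' h
    | loop_step _ _ hp' hl' =>
      obtain ⟨rfl, rfl⟩ := ihp hp'
      obtain ⟨rfl, rfl⟩ := ihl hl'
      exact ⟨rfl, rfl⟩

/-! ### Memory layout, and the listing program -/

/-- The register with the number of vertices. -/
abbrev regN : ℕ := 0
/-- The register with the vertex that is to be tested. -/
abbrev regU : ℕ := 1
/-- The register with the length of the output list. -/
abbrev regOut : ℕ := 2
/-- The register with the answer of a test. -/
abbrev regAns : ℕ := 3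
/-- The register with the number of edges of the constructed triangulation. -/
abbrev regH : ℕ := 4
/-- The array with the positions at which the adjacency lists begin. -/
abbrev arrPos : ℕ := 0
/-- The array with the concatenated adjacency lists. -/
abbrev arrAdj : ℕ := 1
/-- The array with the output list. -/
abbrev arrOut : ℕ := 2
/-- The array with the first ends of the edges of the constructed triangulation. -/
abbrev arrSrc : ℕ := 3
/-- The array with the second ends of the edges of the constructed triangulation. -/
abbrev arrDst : ℕ := 4

/-- The memory holds the graph `G` on the vertices `0, …, n - 1`, given by adjacency lists: the
neighbours of `v`, each once and in any order, stand in the array `arrAdj` in the cells from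
`arrPos[v]` up to but not including `arrPos[v + 1]`. Nothing is assumed about the rest of the
memory. -/
structure HoldsGraph {n : ℕ} (G : SimpleGraph (Fin n)) (σ : State) : Prop where
  size : σ.reg regN = n
  start : σ.arr arrPos 0 = 0
  mono : ∀ v : Fin n, σ.arr arrPos v ≤ σ.arr arrPos (v.val + 1)
  lists : ∀ v : Fin n,
    Set.BijOn (σ.arr arrAdj) (Set.Ico (σ.arr arrPos v) (σ.arr arrPos (v.val + 1)))
      (Fin.val '' G.neighborSet v)

/-- The memory holds the graph `H` as a list of its edges, each of them once. -/
def HoldsTriangulation {n : ℕ} (H : SimpleGraph (Fin n)) (σ : State) : Prop :=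
  Set.BijOn (fun j => s(σ.arr arrSrc j, σ.arr arrDst j)) (Set.Iio (σ.reg regH))
    (Sym2.map Fin.val '' H.edgeSet)

/-- The output list consists of the elements of `S`, each of them once. -/
def OutputLists {n : ℕ} (S : Set (Fin n)) (σ : State) : Prop :=
  Set.BijOn (σ.arr arrOut) (Set.Iio (σ.reg regOut)) (Fin.val '' S)

/-- Listing by means of a test: run `test` for `u = 0, …, n - 1`, and append `u` to the output list
whenever the answer is nonzero. -/
def listProg (test : Prog) : Prog :=
  .seq (.set regU (.lit 0)) <|
  .seq (.set regOut (.lit 0)) <|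
  .loop (.lt (.var regU) (.var regN)) <|
    .seq test <|
    .seq (.ite (.var regAns)
      (.seq (.put arrOut (.var regOut) (.var regU))
        (.set regOut (.add (.var regOut) (.lit 1))))
      .skip)
    (.set regU (.add (.var regU) (.lit 1)))

/-- With word bound `W`, started in any state that holds `G` and the vertex `u`, the program `test`
halts within `T` units of time, without changing the input, `u` or the output list. It has then
constructed a vertex-incremental minimal triangulation `H` of `G` for an ordering that consists of
the non-neighbours of `u`, then `u`, then the neighbours of `u`, and its answer is `1` if `u` is
simplicial in `H`, and `0` if not. -/
def TestsByTriangulation (test : Prog) (W T : ℕ) {n : ℕ} (G : SimpleGraph (Fin n)) (u : Fin n) :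
    Prop :=
  ∀ σ : State, HoldsGraph G σ → σ.reg regU = u →
    ∃ (t : ℕ) (σ' : State), Exec W test σ t σ' ∧ t ≤ T ∧
      (∀ r ≤ regOut, σ'.reg r = σ.reg r) ∧ (∀ a ≤ arrOut, σ'.arr a = σ.arr a) ∧
      ∃ (l : List (Fin n)) (H : SimpleGraph (Fin n)),
        IsOrderingAt G u l ∧ IsVertexIncremental G l H ∧ HoldsTriangulation H σ' ∧
        (IsSimplicial H u → σ'.reg regAns = 1) ∧ (¬ IsSimplicial H u → σ'.reg regAns = 0)

/-- With word bound `W`, started in any state that holds `G`, the program `p` halts within `T` units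
of time with the list of all avoidable vertices of `G` as output. -/
def ListsAvoidable (p : Prog) (W T : ℕ) {n : ℕ} (G : SimpleGraph (Fin n)) : Prop :=
  ∀ σ : State, HoldsGraph G σ →
    ∃ (t : ℕ) (σ' : State), Exec W p σ t σ' ∧ t ≤ T ∧ OutputLists {u | IsAvoidable G u} σ'

end AvoidableVertices

open AvoidableVertices

namespace AvoidableVertices

/-! Avoidability is a statement about connectivity. A shortest path between two non-adjacent
neighbours of `u`, among those with interior outside of the closed neighbourhood of `u`, closes up
with `u` to an induced cycle. So `u` is avoidable iff any two non-adjacent neighbours are joined by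
such a path (`isAvoidable_iff_through`).

Let `H` be a minimal triangulation of `G` without fill edges at `u`, so that `u` has the same
neighbours in both graphs. If `u` is avoidable, two neighbours that are non-adjacent in `H` would
lie with `u` on a hole of `H`. If `u` is simplicial in `H` but the neighbours `x`, `y` are
non-adjacent in `G` and not joined as above, then the vertices split into a side `C` of `x`, a side
`D` of `y`, and a rest that is a clique of `H`. Deleting the edges of `H` between `C` and `D` keeps
`G` and chordality and loses the edge `xy`, against minimality (`IsChordal.of_clique_separator`).
For an ordering `(A, u, X)` there is no fill at `u`, because `u` is isolated in the input graph at
the moment of its insertion. Incremental triangulations exist because a new vertex may be given an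
inclusion-minimal neighbourhood `L` that contains its earlier neighbours and keeps the graph
chordal.

The algorithm has to find such a set `L` for a new vertex `v` in time `O(n + m)`. It keeps a perfect
elimination order of `H`, its elimination tree (the parent of a vertex is its first later neighbour)
and the number `d` of later neighbours of each vertex. The later neighbours of `t` lie in the bag of
the parent, which consists of the parent and its later neighbours. Let `U` be the set of the
neighbours of `v` and their ancestors. The subtree of each `t` in `U` meets the neighbourhood of
`v`. A vertex that sees two separated connected sets which both meet `L` must belong to `L` itself
(`mem_of_isChordal_addVertex`). The tree on `U` is cut into heavy paths, which continue to the child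
in `U` with the largest `d`. Two rules force vertices into `L`: (a) all later neighbours of the top
of a heavy path, since the heavy sibling provides the second connected set; (b) all later neighbours
of `t`, if some vertex of `L` is in the bag of the parent of `t` but no later neighbour of `t`.
Together with the neighbours of `v` these rules produce the whole of `L`: everything they produce is
forced (`InsertSpec.forced`), and the result is chordal, as the elimination order in which the
vertices outside of `U`, then `U` without `L`, then `L`, then `v` follow each other is perfect
(`InsertSpec.later_clique`).

Linear time is possible because of the minimality of `H`: a later neighbour `z` of `y` has a
neighbour in `G` within the subtree of `y` (`ElimTree.exists_adj_of_later`), so the lists of `G`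
suffice. Either `z` is recognized as an element of `L` from its own list, or all vertices of `U`
that have `z` as a later neighbour lie on the heavy path of `z`, and only the lowest of them, `bot
z`, matters (`BotSpec.bot_spec`). Rule (b) is then decided by counting: `d (par t) + 1 - d t`
vertices leave the bags at `t`, and `cnt (par t)` of them are outside of `L`. After the insertion
all bags are known explicitly (`InsertSpec.later_L`, `InsertSpec.later_nonL`,
`InsertSpec.later_nonU`), which yields the new parents and numbers
(`InsertSpec.elimTree_addVertex`). The parents in `U` without `L` are found with stacks whose total
work is linear.

Isolated vertices do not change `H` and are skipped. So at most `min n (2 * m) + 1` insertions take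
place, at a total cost of `O(n * m)` if there is an edge. An edgeless graph is answered in constant
time. Programs are verified by the triple `Runs`, which bounds time and growth of numbers
simultaneously: in `T` units of time no number grows by more than `T`, which gives the word bound.
-/

/-! ### Holes and chordality -/

/-- `g 0, …, g (k - 1)` is an induced cycle. -/
structure IsHole {V : Type*} (G : SimpleGraph V) (k : ℕ) (g : ℕ → V) : Prop where
  inj : ∀ a b, a < b → b < k → g a ≠ g b
  adj : ∀ a b, a < b → b < k → (G.Adj (g a) (g b) ↔ b = a + 1 ∨ (a = 0 ∧ b + 1 = k))

/-- There is a path from `x` to `y` all of whose interior vertices lie in `S`. -/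
def Through {V : Type*} (G : SimpleGraph V) (S : Set V) (x y : V) : Prop :=
  ∃ z, Relation.ReflTransGen (fun a b => G.Adj a b ∧ b ∈ S) x z ∧ G.Adj z y

/-- Differences in `Fin k` are what adjacency in `cycleGraph k` tests. They do not change when the
cycle is rotated by `i`, so a hole can be read from any of its vertices with ordinary inequalities
between indices. -/
theorem mod_sub_mod_aux {k a b i : ℕ} (hi : i < k) (hab : a < b) (hb : b < k) :
    (k - (i + b) % k + (i + a) % k) % k = k - (b - a) ∧
      (k - (i + a) % k + (i + b) % k) % k = b - a := by
  have h1 : (i + b) % k = if i + b < k then i + b else i + b - k := by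
    split_ifs with h
    · exact Nat.mod_eq_of_lt h
    · rw [Nat.mod_eq_sub_mod (by omega), Nat.mod_eq_of_lt (by omega)]
  have h2 : (i + a) % k = if i + a < k then i + a else i + a - k := by
    split_ifs with h
    · exact Nat.mod_eq_of_lt h
    · rw [Nat.mod_eq_sub_mod (by omega), Nat.mod_eq_of_lt (by omega)]
  rw [h1, h2]
  constructor <;> split_ifs <;> first
    | (rw [Nat.mod_eq_of_lt (by omega)]; omega)
    | (rw [Nat.mod_eq_sub_mod (by omega), Nat.mod_eq_of_lt (by omega)]; omega)

theorem IsHole.of_embedding {V : Type*} {G : SimpleGraph V} {k : ℕ}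
    (f : SimpleGraph.cycleGraph k ↪g G) (hk : 3 ≤ k) (i : Fin k) :
    ∃ g : ℕ → V, IsHole G k g ∧ g 0 = f i ∧ (∀ x ∈ Set.range f, ∃ a < k, g a = x) ∧
      ∀ a, g a ∈ Set.range f := by
  have hpos : 0 < k := by omega
  refine ⟨fun j => f ⟨(i.val + j) % k, Nat.mod_lt _ hpos⟩, ⟨?_, ?_⟩, ?_, ?_,
    fun a => ⟨_, rfl⟩⟩
  · intro a b hab hb h
    have := f.injective h
    rw [Fin.mk.injEq] at this
    have h2 : (i.val + a) ≡ (i.val + b) [MOD k] := this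
    have h3 := Nat.ModEq.add_left_cancel' _ h2
    have := Nat.ModEq.eq_of_lt_of_lt h3 (by omega) hb
    omega
  · intro a b hab hb
    have h := mod_sub_mod_aux i.2 hab hb
    rw [f.map_rel_iff, SimpleGraph.cycleGraph_adj', Fin.val_sub, Fin.val_sub, h.1, h.2]
    omega
  · simp [Nat.mod_eq_of_lt i.2]
  · rintro x ⟨j, rfl⟩
    refine ⟨(j.val + (k - i.val)) % k, Nat.mod_lt _ hpos, ?_⟩
    refine congrArg f (Fin.ext ?_)
    simp only [Nat.add_mod_mod]
    rw [show i.val + (j.val + (k - i.val)) = j.val + k by omega]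
    simp [Nat.mod_eq_of_lt j.2]

theorem IsHole.exists_embedding {V : Type*} {G : SimpleGraph V} {k : ℕ} {g : ℕ → V}
    (h : IsHole G k g) :
    ∃ f : SimpleGraph.cycleGraph k ↪g G, ∀ a < k, g a ∈ Set.range f := by
  have hinj : Function.Injective (fun i : Fin k => g i.val) := by
    intro a b hab
    rcases lt_trichotomy a.val b.val with hlt | heq | hlt
    · exact absurd hab (h.inj _ _ hlt b.2)
    · exact Fin.ext heq
    · exact absurd hab.symm (h.inj _ _ hlt a.2)
  refine ⟨⟨⟨fun i => g i.val, hinj⟩, ?_⟩, fun a ha => ⟨⟨a, ha⟩, rfl⟩⟩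
  intro a b
  have key : ∀ a b : Fin k, a.val < b.val →
      (G.Adj (g a) (g b) ↔ (SimpleGraph.cycleGraph k).Adj a b) := by
    intro a b hab
    have h' := mod_sub_mod_aux (i := 0) (by omega) hab b.2
    simp only [zero_add, Nat.mod_eq_of_lt a.2, Nat.mod_eq_of_lt b.2] at h'
    rw [h.adj _ _ hab b.2, SimpleGraph.cycleGraph_adj', Fin.val_sub, Fin.val_sub, h'.1, h'.2]
    omega
  change G.Adj (g a) (g b) ↔ _
  rcases lt_trichotomy a.val b.val with hlt | heq | hlt
  · exact key a b hlt
  · have := Fin.ext heq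
    subst this
    simp
  · rw [SimpleGraph.adj_comm, key b a hlt, SimpleGraph.adj_comm]

/-- An induced cycle leaves the closed neighbourhood of `g 0` except for the two cyclic neighbours,
so the remaining arc joins these two through non-neighbours of `g 0`. -/
theorem IsHole.through {V : Type*} {G : SimpleGraph V} {k : ℕ} {g : ℕ → V} (h : IsHole G k g)
    (hk : 4 ≤ k) :
    G.Adj (g 0) (g 1) ∧ G.Adj (g 0) (g (k - 1)) ∧ g 1 ≠ g (k - 1) ∧ ¬ G.Adj (g 1) (g (k - 1)) ∧
      Through G {w | w ≠ g 0 ∧ ¬ G.Adj (g 0) w} (g 1) (g (k - 1)) := by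
  refine ⟨(h.adj 0 1 (by omega) (by omega)).2 (by omega),
    (h.adj 0 (k - 1) (by omega) (by omega)).2 (by omega), h.inj _ _ (by omega) (by omega),
    fun hh => by have := (h.adj 1 (k - 1) (by omega) (by omega)).1 hh; omega,
    g (k - 2), ?_, (h.adj _ _ (by omega) (by omega)).2 (by omega)⟩
  have : ∀ j, 1 ≤ j → j ≤ k - 2 → Relation.ReflTransGen
      (fun a b => G.Adj a b ∧ b ∈ {w | w ≠ g 0 ∧ ¬ G.Adj (g 0) w}) (g 1) (g j) := by
    intro j hj
    induction j, hj using Nat.le_induction with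
    | base => intro _; exact .refl
    | succ j hj ih =>
      intro hj2
      refine .tail (ih (by omega)) ⟨(h.adj _ _ (by omega) (by omega)).2 (by omega),
        (h.inj 0 (j + 1) (by omega) (by omega)).symm, fun hh => ?_⟩
      have := (h.adj 0 (j + 1) (by omega) (by omega)).1 hh
      omega
  exact this _ (by omega) le_rfl

theorem Through.symm {V : Type*} {G : SimpleGraph V} {S : Set V} {x y : V}
    (h : Through G S x y) : Through G S y x := by
  obtain ⟨z, hz, hzy⟩ := h
  induction hz using Relation.ReflTransGen.head_induction_on with
  | refl => exact ⟨y, .refl, hzy.symm⟩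
  | head hab _ ih =>
    obtain ⟨w, hw, hwa⟩ := ih
    exact ⟨_, .tail hw ⟨hwa, hab.2⟩, hab.1.symm⟩

theorem Through.exists_seq {V : Type*} {G : SimpleGraph V} {S : Set V} {x y : V}
    (h : Through G S x y) : ∃ (l : ℕ) (p : ℕ → V), p 0 = x ∧ p (l + 1) = y ∧
      (∀ j < l + 1, G.Adj (p j) (p (j + 1))) ∧ ∀ j, 0 < j → j < l + 1 → p j ∈ S := by
  obtain ⟨z, hz, hzy⟩ := h
  induction hz generalizing y with
  | refl =>
    refine ⟨0, fun j => if j = 0 then x else y, by simp, by simp, ?_, ?_⟩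
    · intro j hj
      obtain rfl : j = 0 := by omega
      simpa using hzy
    · intro j h1 h2; omega
  | tail _ hbc ih =>
    rename_i b c
    obtain ⟨l, p, h0, h1, h2, h3⟩ := ih hbc.1
    refine ⟨l + 1, fun j => if j ≤ l + 1 then p j else y, by simpa using h0, by simp, ?_, ?_⟩
    · intro j hj
      by_cases hj' : j = l + 1
      · subst hj'; simpa [h1] using hzy
      · have := h2 j (by omega)
        simpa [show j ≤ l + 1 by omega, show j ≤ l by omega] using this
    · intro j hj hj2
      have hle : j ≤ l + 1 := by omega
      simp only [hle, if_true]
      by_cases hj' : j = l + 1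
      · subst hj'; rw [h1]; exact hbc.2
      · exact h3 j hj (by omega)

/-- A shortest connecting sequence is an induced path. The vertex `v` sees only its two ends, hence
closes it to an induced cycle; there is an interior vertex because `x` and `y` are not adjacent, so
the length is at least four. -/
theorem Through.exists_hole {V : Type*} {G : SimpleGraph V} {v x y : V} (hx : G.Adj v x)
    (hy : G.Adj v y) (hxy : x ≠ y) (hn : ¬ G.Adj x y)
    (h : Through G {w | w ≠ v ∧ ¬ G.Adj v w} x y) :
    ∃ (k : ℕ) (g : ℕ → V), 4 ≤ k ∧ IsHole G k g ∧ g 0 = x ∧ g (k - 2) = y ∧ g (k - 1) = v := by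
  classical
  have hex := h.exists_seq
  obtain ⟨p, h0, h1, h2, h3⟩ := Nat.find_spec hex
  have hmin := fun m (hm : m < Nat.find hex) => Nat.find_min hex hm
  generalize Nat.find hex = l at *
  have hl : l ≠ 0 := by
    rintro rfl
    have := h2 0 (by omega)
    rw [h0, h1] at this
    exact hn this
  -- A repetition lets one skip `b - a` indices, a chord `b - a - 1`; either contradicts the
  -- minimality of `l`.
  have short : ∀ a b, a < b → b ≤ l + 1 → p a ≠ p b ∧ (G.Adj (p a) (p b) → b = a + 1) := by
    intro a b hab hb
    constructor
    · intro he
      by_cases hfull : b - a = l + 1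
      · obtain rfl : a = 0 := by omega
        obtain rfl : b = l + 1 := by omega
        rw [h0, h1] at he
        exact hxy he
      refine hmin (l - (b - a)) (by omega) ⟨fun j => if j ≤ a then p j else p (j + (b - a)),
        by simpa using h0, ?_, ?_, ?_⟩
      · dsimp only
        split_ifs with hc
        · have : l - (b - a) + 1 = a := by omega
          rw [this, he]
          rw [show b = l + 1 by omega]
          exact h1
        · rw [show l - (b - a) + 1 + (b - a) = l + 1 by omega]; exact h1
      · intro j hj
        dsimp only
        split_ifs with hc hd hd
        · exact h2 j (by omega)
        · obtain rfl : j = a := by omega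
          rw [he, show j + 1 + (b - j) = b + 1 by omega]
          exact h2 b (by omega)
        · omega
        · rw [show j + 1 + (b - a) = j + (b - a) + 1 by omega]
          exact h2 _ (by omega)
      · intro j hj hj2
        dsimp only
        split_ifs with hc
        · exact h3 j hj (by omega)
        · exact h3 _ (by omega) (by omega)
    · intro hadj
      by_contra hne
      refine hmin (l - (b - a - 1)) (by omega)
        ⟨fun j => if j ≤ a then p j else p (j + (b - a - 1)), by simpa using h0, ?_, ?_, ?_⟩
      · dsimp only
        rw [if_neg (by omega), show l - (b - a - 1) + 1 + (b - a - 1) = l + 1 by omega]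
        exact h1
      · intro j hj
        dsimp only
        split_ifs with hc hd hd
        · exact h2 j (by omega)
        · obtain rfl : j = a := by omega
          rw [show j + 1 + (b - j - 1) = b by omega]
          exact hadj
        · omega
        · rw [show j + 1 + (b - a - 1) = j + (b - a - 1) + 1 by omega]
          exact h2 _ (by omega)
      · intro j hj hj2
        dsimp only
        split_ifs with hc
        · exact h3 j hj (by omega)
        · exact h3 _ (by omega) (by omega)
  have hpv : ∀ j ≤ l + 1, p j ≠ v := by
    intro j hj he
    by_cases hj0 : j = 0
    · subst hj0; rw [h0] at he; exact hx.ne he.symm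
    by_cases hj1 : j = l + 1
    · subst hj1; rw [h1] at he; exact hy.ne he.symm
    · exact (h3 j (by omega) (by omega)).1 he
  refine ⟨l + 3, fun j => if j ≤ l + 1 then p j else v, by omega, ⟨?_, ?_⟩, by simpa using h0,
    by simpa using h1, by simp⟩
  · intro a b hab hb
    rw [if_pos (by omega : a ≤ l + 1)]
    split_ifs with hc
    · exact (short a b hab hc).1
    · exact hpv a (by omega)
  · intro a b hab hb
    rw [if_pos (by omega : a ≤ l + 1)]
    split_ifs with hc
    · constructor
      · intro hadj
        exact .inl ((short a b hab hc).2 hadj)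
      · rintro (rfl | ⟨-, hb2⟩)
        · exact h2 a (by omega)
        · omega
    · obtain rfl : b = l + 2 := by omega
      constructor
      · intro hadj
        by_cases ha0 : a = 0
        · right; omega
        · by_cases ha1 : a = l + 1
          · left; omega
          · exact absurd hadj.symm (h3 a (by omega) (by omega)).2
      · rintro (h | ⟨rfl, -⟩)
        · obtain rfl : a = l + 1 := by omega
          rw [h1]; exact hy.symm
        · rw [h0]; exact hx.symm

theorem not_through_of_isChordal {V : Type*} {G : SimpleGraph V} (hG : IsChordal G) {v x y : V}
    (hx : G.Adj v x) (hy : G.Adj v y) (hxy : x ≠ y) (hn : ¬ G.Adj x y) :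
    ¬ Through G {w | w ≠ v ∧ ¬ G.Adj v w} x y := by
  intro h
  obtain ⟨k, g, hk, hg, -⟩ := h.exists_hole hx hy hxy hn
  obtain ⟨f, -⟩ := hg.exists_embedding
  exact (hG k hk).elim f

/-- The proof that a hole is impossible may choose the vertex at which it starts reading it, for
instance one of least rank. -/
theorem isChordal_of_forall_isHole {V : Type*} {G : SimpleGraph V}
    (h : ∀ (k : ℕ), 4 ≤ k → ∀ f : SimpleGraph.cycleGraph k ↪g G, ∃ i : Fin k, ∀ g : ℕ → V,
      g 0 = f i → IsHole G k g → (∀ a, g a ∈ Set.range f) → False) : IsChordal G := by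
  intro k hk
  refine ⟨fun f => ?_⟩
  obtain ⟨i, hi⟩ := h k hk f
  obtain ⟨g, hg, hg0, -, hr⟩ := IsHole.of_embedding f (by omega) i
  exact hi g hg0 hg hr

theorem exists_through_of_embedding {V : Type*} {G : SimpleGraph V} {k : ℕ}
    (f : SimpleGraph.cycleGraph k ↪g G) {u x y : V} (hk : 3 ≤ k) (hu : u ∈ Set.range f)
    (hxr : x ∈ Set.range f) (hyr : y ∈ Set.range f) (hx : G.Adj u x) (hy : G.Adj u y)
    (hxy : x ≠ y) (hn : ¬ G.Adj x y) : Through G {w | w ≠ u ∧ ¬ G.Adj u w} x y := by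
  obtain ⟨i, rfl⟩ := hu
  obtain ⟨g, hg, hg0, hr, -⟩ := IsHole.of_embedding f hk i
  rw [← hg0] at hx hy ⊢
  obtain ⟨a, ha, rfl⟩ := hr x hxr
  obtain ⟨b, hb, rfl⟩ := hr y hyr
  have ha0 : 0 < a := Nat.pos_of_ne_zero fun h => hx.ne (by rw [h])
  have hb0 : 0 < b := Nat.pos_of_ne_zero fun h => hy.ne (by rw [h])
  have ha1 := (hg.adj 0 a ha0 ha).1 hx
  have hb1 := (hg.adj 0 b hb0 hb).1 hy
  have hab : a ≠ b := fun h => hxy (by rw [h])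
  -- In a triangle the two neighbours of `u` would be adjacent.
  have hk4 : 4 ≤ k := by
    by_contra hlt
    obtain rfl : k = 3 := by omega
    rcases lt_or_gt_of_ne hab with h | h
    · exact hn ((hg.adj a b h hb).2 (by omega))
    · exact hn ((hg.adj b a h ha).2 (by omega)).symm
  have ht := (hg.through hk4).2.2.2.2
  rcases lt_or_gt_of_ne hab with h | h
  · obtain rfl : a = 1 := by omega
    obtain rfl : b = k - 1 := by omega
    exact ht
  · obtain rfl : b = 1 := by omega
    obtain rfl : a = k - 1 := by omega
    exact ht.symm

/-- A graph with a perfect elimination order is chordal. -/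
theorem isChordal_of_perfectElimination {V : Type*} {G : SimpleGraph V} (rk : V → ℕ)
    (hinj : ∀ x y, G.Adj x y → rk x ≠ rk y)
    (h : ∀ y a b, G.Adj y a → G.Adj y b → rk y < rk a → rk y < rk b → a ≠ b → G.Adj a b) :
    IsChordal G := by
  apply isChordal_of_forall_isHole
  intro k hk f
  have : Nonempty (Fin k) := ⟨⟨0, by omega⟩⟩
  obtain ⟨i, hi⟩ := Finite.exists_min (fun i => rk (f i))
  refine ⟨i, fun g hg0 hg hr => ?_⟩
  obtain ⟨h1, h2, h3, h4, -⟩ := hg.through hk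
  have hle : ∀ a < k, rk (g 0) ≤ rk (g a) := by
    intro a _
    obtain ⟨j, hj⟩ := hr a
    rw [hg0, ← hj]
    exact hi j
  exact h4 (h (g 0) _ _ h1 h2 (lt_of_le_of_ne (hle 1 (by omega)) (hinj _ _ h1))
    (lt_of_le_of_ne (hle _ (by omega)) (hinj _ _ h2)) h3)

/-- This removes the cycles from the definition: what remains is connectivity outside of the closed
neighbourhood of `u`, which can be transported from `G` to `H` and contradicted by a separation. -/
theorem isAvoidable_iff_through {V : Type*} (G : SimpleGraph V) (u : V) :
    IsAvoidable G u ↔ ∀ x y : V, G.Adj u x → G.Adj u y → x ≠ y → ¬ G.Adj x y →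
      Through G {w | w ≠ u ∧ ¬ G.Adj u w} x y := by
  constructor
  · intro h x y hx hy hxy hn
    obtain ⟨k, hk, f, hxr, hur, hyr⟩ := h x y hx hy hxy hn
    exact exists_through_of_embedding f hk hur hxr hyr hx hy hxy hn
  · intro h x y hx hy hxy hn
    obtain ⟨k, g, hk, hg, h0, h2, h1⟩ := (h x y hx hy hxy hn).exists_hole hx hy hxy hn
    obtain ⟨f, hf⟩ := hg.exists_embedding
    exact ⟨k, by omega, f, h0 ▸ hf 0 (by omega), h1 ▸ hf _ (by omega), h2 ▸ hf _ (by omega)⟩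

/-! ### Vertex-incremental minimal triangulations -/

/-- The edges of `G` with both ends in `P`, as a graph on all vertices. -/
def restr {V : Type*} (G : SimpleGraph V) (P : Set V) : SimpleGraph V where
  Adj a b := G.Adj a b ∧ a ∈ P ∧ b ∈ P
  symm := ⟨fun _ _ h => ⟨h.1.symm, h.2.2, h.2.1⟩⟩
  loopless := ⟨fun _ h => h.1.ne rfl⟩

/-- `H` together with the edges between `v` and the vertices of `L`. -/
def addVertex {V : Type*} (H : SimpleGraph V) (v : V) (L : Set V) : SimpleGraph V where
  Adj a b := H.Adj a b ∨ (a = v ∧ b ∈ L ∧ b ≠ v) ∨ (b = v ∧ a ∈ L ∧ a ≠ v)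
  symm := ⟨fun _ _ h => by
    rcases h with h | h | h
    · exact .inl h.symm
    · exact .inr (.inr h)
    · exact .inr (.inl h)⟩
  loopless := ⟨fun _ h => by
    rcases h with h | h | h
    · exact h.ne rfl
    · exact h.2.2 h.1
    · exact h.2.2 h.1⟩

theorem IsChordal.of_embedding {V W : Type*} {G : SimpleGraph V} {H : SimpleGraph W}
    (hH : IsChordal H) (f : G ↪g H) : IsChordal G :=
  fun k hk => ⟨fun g => (hH k hk).elim (g.trans f)⟩

theorem exists_cycleGraph_adj {k : ℕ} (hk : 4 ≤ k) (i : Fin k) :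
    ∃ j, (SimpleGraph.cycleGraph k).Adj i j := by
  have h0 : 0 < k := by omega
  refine ⟨⟨(i.val + 1) % k, Nat.mod_lt _ h0⟩, ?_⟩
  rw [SimpleGraph.cycleGraph_adj', Fin.val_sub, Fin.val_sub]
  right
  by_cases hi : i.val + 1 < k
  · simp only [Nat.mod_eq_of_lt hi]
    rw [show k - i.val + (i.val + 1) = 1 + k by omega, Nat.add_mod_right,
      Nat.mod_eq_of_lt (by omega)]
  · have : i.val + 1 = k := by omega
    simp only [this, Nat.mod_self]
    rw [show k - i.val + 0 = 1 by omega, Nat.mod_eq_of_lt (by omega)]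

/-- Every vertex of a long cycle has a neighbour, so a map that is injective and preserves adjacency
on the non-isolated vertices already transports holes. This allows all partial graphs to live on one
vertex type. -/
theorem IsChordal.of_cycles {V W : Type*} {G : SimpleGraph V} {H : SimpleGraph W}
    (hH : IsChordal H) (S : Set V) (e : V → W) (hS : ∀ x y, G.Adj x y → x ∈ S)
    (he : Set.InjOn e S) (hadj : ∀ x ∈ S, ∀ y ∈ S, (H.Adj (e x) (e y) ↔ G.Adj x y)) :
    IsChordal G := by
  intro k hk
  refine ⟨fun f => (hH k hk).elim ⟨⟨fun i => e (f i), ?_⟩, ?_⟩⟩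
  all_goals
    have hf : ∀ i, f i ∈ S := fun i => by
      obtain ⟨j, hj⟩ := exists_cycleGraph_adj hk i
      exact hS _ _ (f.map_rel_iff.2 hj)
  · intro i j hij
    exact f.injective (he (hf i) (hf j) hij)
  · intro i j
    exact (hadj _ (hf i) _ (hf j)).trans f.map_rel_iff

theorem isChordal_restr {V : Type*} {G : SimpleGraph V} (hG : IsChordal G) (P : Set V) :
    IsChordal (restr G P) :=
  hG.of_cycles P id (fun _ _ h => h.2.1) (fun _ _ _ _ h => h)
    fun _ hx _ hy => ⟨fun h => ⟨h, hx, hy⟩, fun h => h.1⟩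

theorem isChordal_induce_iff {V : Type*} {G : SimpleGraph V} {P : Set V} :
    IsChordal (G.induce P) ↔ IsChordal (restr G P) := by
  classical
  constructor
  · intro h
    by_cases hP : ∃ p, p ∈ P
    · obtain ⟨p, hp⟩ := hP
      refine h.of_cycles P (fun x => if hx : x ∈ P then ⟨x, hx⟩ else ⟨p, hp⟩)
        (fun _ _ h => h.2.1) ?_ ?_
      · intro x hx y hy hxy
        simpa [hx, hy] using hxy
      · intro x hx y hy
        simp [hx, hy, restr]
    · intro k hk
      refine ⟨fun f => hP ?_⟩
      obtain ⟨j, hj⟩ := exists_cycleGraph_adj hk ⟨0, by omega⟩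
      exact ⟨_, (f.map_rel_iff.2 hj).2.1⟩
  · intro h
    exact h.of_embedding ⟨⟨Subtype.val, Subtype.val_injective⟩,
      fun {a b} => ⟨fun h => h.1, fun h => ⟨h, a.2, b.2⟩⟩⟩

theorem restr_eq_self {V : Type*} {H : SimpleGraph V} {P : Set V}
    (h : ∀ x y, H.Adj x y → x ∈ P) : restr H P = H := by
  ext x y
  exact ⟨fun h => h.1, fun hxy => ⟨hxy, h _ _ hxy, h _ _ hxy.symm⟩⟩

theorem isMinimalTriangulation_induce_iff {V : Type*} {G H : SimpleGraph V} {P : Set V} :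
    IsMinimalTriangulation (G.induce P) (H.induce P) ↔
      IsMinimalTriangulation (restr G P) (restr H P) := by
  have hle : ∀ A B : SimpleGraph V, A.induce P ≤ B.induce P ↔ restr A P ≤ restr B P := by
    intro A B
    constructor
    · intro h x y hxy
      have : (A.induce P).Adj ⟨x, hxy.2.1⟩ ⟨y, hxy.2.2⟩ := hxy.1
      exact ⟨h this, hxy.2⟩
    · intro h x y hxy
      have : (restr A P).Adj x y := ⟨hxy, x.2, y.2⟩
      exact (h this).1
  unfold IsMinimalTriangulation
  rw [hle, isChordal_induce_iff]
  refine and_congr_right fun _ => and_congr_right fun _ => ⟨fun h H' h1 h2 h3 => ?_,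
    fun h H' h1 h2 h3 => ?_⟩
  · have hs : restr H' P = H' := restr_eq_self fun x y hxy => (h2.le hxy).2.1
    refine h (H'.induce P) ?_ (lt_of_le_not_ge ?_ ?_) ?_
    · rw [hle, hs]; exact h1
    · rw [hle, hs]; exact h2.le
    · rw [hle, hs]; exact h2.not_ge
    · rw [isChordal_induce_iff, hs]; exact h3
  · let K : SimpleGraph V :=
      { Adj := fun a b => ∃ (ha : a ∈ P) (hb : b ∈ P), H'.Adj ⟨a, ha⟩ ⟨b, hb⟩
        symm := ⟨fun _ _ ⟨ha, hb, h⟩ => ⟨hb, ha, h.symm⟩⟩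
        loopless := ⟨fun _ ⟨_, _, h⟩ => h.ne rfl⟩ }
    have hK : K.induce P = H' := by
      ext a b
      exact ⟨fun ⟨_, _, h⟩ => h, fun h => ⟨a.2, b.2, h⟩⟩
    have hs : restr K P = K := restr_eq_self fun x y hxy => hxy.1
    rw [← hK] at h1 h2 h3
    rw [hle, hs] at h1
    rw [isChordal_induce_iff, hs] at h3
    refine h K h1 (lt_of_le_not_ge ?_ ?_) h3
    · have := h2.le
      rwa [hle, hs] at this
    · have := h2.not_ge
      rwa [hle, hs] at this

/-- Deleting the edges that leave `P` keeps the graph chordal and keeps the edges of `G` inside `P`,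
so minimality forbids such edges. -/
theorem IsMinimalTriangulation.restr_eq {V : Type*} {G H : SimpleGraph V} {P : Set V}
    (h : IsMinimalTriangulation (restr G P) H) : restr H P = H := by
  have h1 : restr H P ≤ H := fun _ _ h => h.1
  by_contra hne
  exact h.2.2 (restr H P) (fun x y hxy => ⟨h.1 hxy, hxy.2⟩) (lt_of_le_of_ne h1 hne)
    (isChordal_restr h.2.1 P)

theorem isVertexIncremental_iff {V : Type*} {G H : SimpleGraph V} {l : List V} :
    IsVertexIncremental G l H ↔ ∀ i ≤ l.length,
      IsMinimalTriangulation (restr G {v | v ∈ l.take i}) (restr H {v | v ∈ l.take i}) := by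
  unfold IsVertexIncremental
  simp only [isMinimalTriangulation_induce_iff]

theorem restr_addVertex {V : Type*} {H : SimpleGraph V} {v : V} {L P : Set V} (hv : v ∉ P) :
    restr (addVertex H v L) P = restr H P := by
  ext x y
  constructor
  · rintro ⟨h | h | h, hx, hy⟩
    · exact ⟨h, hx, hy⟩
    · exact absurd (h.1 ▸ hx) hv
    · exact absurd (h.1 ▸ hy) hv
  · exact fun h => ⟨.inl h.1, h.2⟩

/-- A chordal graph between the two differs only at `v`: its restriction to `P` is chordal and
contains `G` on `P`, hence equals `H` by the minimality of `H`. Its neighbourhood of `v` then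
competes with `L`, and `hmin` decides. -/
theorem IsMinimalTriangulation.insert {V : Type*} {G H : SimpleGraph V} {P L : Set V} {v : V}
    (h : IsMinimalTriangulation (restr G P) H) (hv : v ∉ P)
    (hN : ∀ y ∈ P, G.Adj v y → y ∈ L) (hc : IsChordal (addVertex H v L))
    (hmin : ∀ L' ⊆ L, (∀ y ∈ P, G.Adj v y → y ∈ L') → IsChordal (addVertex H v L') → L ⊆ L') :
    IsMinimalTriangulation (restr G (insert v P)) (addVertex H v L) := by
  have hs := h.restr_eq
  have hHP : ∀ x y, H.Adj x y → x ∈ P ∧ y ∈ P := fun x y hxy => by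
    rw [← hs] at hxy
    exact hxy.2
  refine ⟨?_, hc, ?_⟩
  · rintro x y ⟨hxy, rfl | hx, rfl | hy⟩
    · exact absurd rfl hxy.ne
    · exact .inr (.inl ⟨rfl, hN _ hy hxy, hxy.ne'⟩)
    · exact .inr (.inr ⟨rfl, hN _ hx hxy.symm, hxy.ne⟩)
    · exact .inl (h.1 ⟨hxy, hx, hy⟩)
  · intro K hGK hK hKc
    have h1 : restr K P ≤ H := by
      rintro x y ⟨hxy, hx, hy⟩
      rcases hK.le hxy with h | h | h
      · exact h
      · exact absurd (h.1 ▸ hx) hv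
      · exact absurd (h.1 ▸ hy) hv
    have h2 : restr K P = H := by
      by_contra hne
      exact h.2.2 (restr K P) (fun x y hxy => ⟨hGK ⟨hxy.1, .inr hxy.2.1, .inr hxy.2.2⟩, hxy.2⟩)
        (lt_of_le_of_ne h1 hne) (isChordal_restr hKc P)
    have hKL : ∀ y, K.Adj v y → y ∈ L := by
      intro y hy
      rcases hK.le hy with h | h | h
      · exact absurd (hHP _ _ h).1 hv
      · exact h.2.1
      · exact absurd h.1 hy.ne'
    have hKe : K = addVertex H v {y | K.Adj v y} := by
      ext x y
      constructor
      · intro hxy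
        rcases hK.le hxy with h | h | h
        · refine .inl ?_
          rw [← h2]
          exact ⟨hxy, hHP _ _ h⟩
        · obtain ⟨rfl, -, h⟩ := h
          exact .inr (.inl ⟨rfl, hxy, h⟩)
        · obtain ⟨rfl, -, h⟩ := h
          exact .inr (.inr ⟨rfl, hxy.symm, h⟩)
      · rintro (h | ⟨rfl, h, -⟩ | ⟨rfl, h, -⟩)
        · rw [← h2] at h
          exact h.1
        · exact h
        · exact h.symm
    have hL : L = {y | K.Adj v y} :=
      Set.Subset.antisymm (hmin _ hKL
        (fun y hy hvy => hGK ⟨hvy, .inl rfl, .inr hy⟩) (hKe ▸ hKc)) hKL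
    rw [hL, ← hKe] at hK
    exact lt_irrefl _ hK

theorem IsVertexIncremental.concat {V : Type*} {G H : SimpleGraph V} {l : List V} {v : V}
    {L : Set V} (h : IsVertexIncremental G l H)
    (hv : v ∉ l)
    (hm : IsMinimalTriangulation (restr G (insert v {y | y ∈ l})) (addVertex H v L)) :
    IsVertexIncremental G (l ++ [v]) (addVertex H v L) := by
  rw [isVertexIncremental_iff] at h ⊢
  intro i hi
  by_cases hil : i ≤ l.length
  · rw [List.take_append_of_le_length hil, 
      restr_addVertex (P := {y | y ∈ l.take i}) (fun hm => hv (List.mem_of_mem_take hm))]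
    exact h i hil
  · have : i = (l ++ [v]).length := by simp at hi ⊢; omega
    rw [this, List.take_length]
    have hset : {y | y ∈ l ++ [v]} = insert v {y | y ∈ l} := by
      ext y; simp [or_comm]
    rw [hset, hm.restr_eq]
    exact hm

/-- A hole through `v` contains a vertex at distance two from `v`. It has a neighbour in `H`, so it
belongs to `P` and is adjacent to `v` after all. -/
theorem isChordal_addVertex_self {V : Type*} {H : SimpleGraph V} {P : Set V} {v : V}
    (hH : IsChordal H) (hP : ∀ x y, H.Adj x y → x ∈ P) :
    IsChordal (addVertex H v P) := by
  intro k hk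
  refine ⟨fun f => ?_⟩
  by_cases hvr : ∃ i, f i = v
  · obtain ⟨i, hi⟩ := hvr
    obtain ⟨g, hg, hg0, -⟩ := IsHole.of_embedding f (by omega) i
    have h12 := (hg.adj 1 2 (by omega) (by omega)).2 (by omega)
    have h02 : ¬ (addVertex H v P).Adj (g 0) (g 2) := fun h => by
      have := (hg.adj 0 2 (by omega) (by omega)).1 h
      omega
    rw [hg0, hi] at h02
    have hne2 : g 2 ≠ v := by
      have := hg.inj 0 2 (by omega) (by omega)
      rw [hg0, hi] at this
      exact this.symm
    have hne1 : g 1 ≠ v := by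
      have := hg.inj 0 1 (by omega) (by omega)
      rw [hg0, hi] at this
      exact this.symm
    rcases h12 with h | h | h
    · exact h02 (.inr (.inl ⟨rfl, hP _ _ h.symm, hne2⟩))
    · exact hne1 h.1
    · exact hne2 h.1
  · push Not at hvr
    refine (hH k hk).elim ⟨f.toEmbedding, fun {a b} => ⟨fun h => f.map_rel_iff.1 (.inl h),
      fun h => ?_⟩⟩
    rcases f.map_rel_iff.2 h with h | h | h
    · exact h
    · exact absurd h.1 (hvr _)
    · exact absurd h.1 (hvr _)

theorem isMinimalTriangulation_bot {V : Type*} : IsMinimalTriangulation (⊥ : SimpleGraph V) ⊥ := by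
  refine ⟨le_rfl, ?_, fun K _ h => absurd h not_lt_bot⟩
  exact isChordal_of_perfectElimination (fun _ => 0) (fun _ _ h => h.elim)
    fun _ _ _ h => h.elim

theorem IsVertexIncremental.isMinimalTriangulation {V : Type*} {G H : SimpleGraph V} {l : List V}
    (h : IsVertexIncremental G l H) :
    IsMinimalTriangulation (restr G {y | y ∈ l}) (restr H {y | y ∈ l}) := by
  simpa using isVertexIncremental_iff.1 h l.length le_rfl

/-- Among the finitely many neighbourhoods that keep the graph chordal and contain the earlier
neighbours of `v`, an inclusion-minimal one is chosen. The set of all earlier vertices shows that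
there are any. -/
theorem exists_isVertexIncremental {V : Type*} (G : SimpleGraph V) (l : List V) (hl : l.Nodup) :
    ∃ H : SimpleGraph V, IsVertexIncremental G l H ∧ restr H {y | y ∈ l} = H := by
  induction l using List.reverseRecOn with
  | nil =>
    refine ⟨⊥, isVertexIncremental_iff.2 fun i hi => ?_, by ext; simp [restr]⟩
    obtain rfl : i = 0 := by simpa using hi
    have : ∀ K : SimpleGraph V, restr K {v | v ∈ ([] : List V).take 0} = ⊥ := fun K => by
      ext; simp [restr]
    rw [this, this]
    exact isMinimalTriangulation_bot
  | append_singleton l v ih =>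
    rw [List.nodup_append] at hl
    have hv : v ∉ l := fun h => hl.2.2 v h v (by simp) rfl
    obtain ⟨H, hH, hs⟩ := ih hl.1
    have hm := hH.isMinimalTriangulation
    rw [hs] at hm
    let F : Set (Set V) := {L | L ⊆ {y | y ∈ l} ∧ (∀ y ∈ l, G.Adj v y → y ∈ L) ∧
      IsChordal (addVertex H v L)}
    have hfin : F.Finite := (List.finite_toSet l).finite_subsets.subset fun L hL => hL.1
    have hne : F.Nonempty := ⟨{y | y ∈ l}, subset_rfl, fun y hy _ => hy,
      isChordal_addVertex_self hm.2.1 (fun x y hxy => by rw [← hs] at hxy; exact hxy.2.1)⟩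
    obtain ⟨L, hL⟩ := hfin.exists_minimal hne
    have hmt : IsMinimalTriangulation (restr G (insert v {y | y ∈ l})) (addVertex H v L) :=
      hm.insert hv hL.prop.2.1 hL.prop.2.2 fun L' hL' hN hc =>
        hL.le_of_le ⟨hL'.trans hL.prop.1, hN, hc⟩ hL'
    refine ⟨_, hH.concat hv hmt, ?_⟩
    have : {y | y ∈ l ++ [v]} = insert v {y | y ∈ l} := by
      ext y; simp [or_comm]
    rw [this]
    exact hmt.restr_eq

/-! ### Avoidable vertices and simplicial vertices of the triangulation -/

theorem exists_isOrderingAt {V : Type*} [Finite V] (G : SimpleGraph V) (u : V) :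
    ∃ l : List V, IsOrderingAt G u l := by
  classical
  have := Fintype.ofFinite V
  let L := (Finset.univ : Finset V).toList
  have hL : L.Nodup := Finset.nodup_toList _
  have hm : ∀ v, v ∈ L := fun v => by simp [L]
  refine ⟨L.filter (fun w => w ≠ u ∧ ¬ G.Adj u w) ++ u :: L.filter (fun w => G.Adj u w),
    ?_, ?_, _, _, rfl, ?_, ?_⟩
  · rw [List.nodup_append, List.nodup_cons]
    refine ⟨hL.filter _, ⟨by simp, hL.filter _⟩, ?_⟩
    rintro a ha b hb rfl
    simp only [List.mem_filter, List.mem_cons, decide_eq_true_eq] at ha hb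
    rcases hb with rfl | hb
    · exact ha.2.1 rfl
    · exact ha.2.2 hb.2
  · intro v
    simp only [List.mem_append, List.mem_filter, List.mem_cons, decide_eq_true_eq, hm, true_and]
    tauto
  · intro v hv
    simp only [List.mem_filter, decide_eq_true_eq] at hv
    exact hv.2.2
  · intro v hv
    simp only [List.mem_filter, decide_eq_true_eq] at hv
    exact hv.2

/-- At the step that inserts `u`, the vertex has no neighbour among those present. Deleting all
edges at `u` would leave a chordal supergraph, so minimality says that there are none. All vertices
inserted later are neighbours of `u` in `G`. -/
theorem IsOrderingAt.not_fill {V : Type*} {G H : SimpleGraph V} {u : V} {l : List V}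
    (hl : IsOrderingAt G u l) (h : IsVertexIncremental G l H) (v : V) : ¬ (H \ G).Adj u v := by
  rintro ⟨hH, hG⟩
  obtain ⟨-, hmem, a, x, rfl, ha, hx⟩ := hl
  have hm := isVertexIncremental_iff.1 h (a.length + 1) (by simp)
  have hP : {y | y ∈ (a ++ u :: x).take (a.length + 1)} = insert u {y | y ∈ a} := by
    ext y
    simp [List.take_append, List.take_of_length_le, or_comm]
  rw [hP] at hm
  have hv : v ∈ a := by
    have := hmem v
    simp only [List.mem_append, List.mem_cons] at this
    rcases this with h | rfl | h
    · exact h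
    · exact absurd rfl hH.ne
    · exact absurd (hx v h) hG
  refine hm.2.2 (restr (restr H (insert u {y | y ∈ a})) {u}ᶜ) ?_ (lt_of_le_not_ge ?_ ?_)
    (isChordal_restr hm.2.1 _)
  · intro p q hpq
    refine ⟨hm.1 hpq, ?_, ?_⟩
    · rintro rfl
      rcases hpq.2.2 with rfl | hq
      · exact hpq.1.ne rfl
      · exact ha _ hq hpq.1
    · rintro rfl
      rcases hpq.2.1 with rfl | hq
      · exact hpq.1.ne rfl
      · exact ha _ hq hpq.1.symm
  · exact fun p q hpq => hpq.1
  · intro hle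
    have : (restr H (insert u {y | y ∈ a})).Adj u v := ⟨hH, .inl rfl, .inr hv⟩
    exact (hle this).2.1 rfl

/-- Gluing two chordal graphs along a clique. -/
theorem IsChordal.of_clique_separator {V : Type*} {H K : SimpleGraph V} {C D : Set V}
    (hH : IsChordal H) (hCD : Disjoint C D) (hle : K ≤ H)
    (hK : ∀ x y, H.Adj x y → ¬ (x ∈ C ∧ y ∈ D) → ¬ (x ∈ D ∧ y ∈ C) → K.Adj x y)
    (hno : ∀ x ∈ C, ∀ y ∈ D, ¬ K.Adj x y)
    (hcl : ∀ x y, x ∉ C → x ∉ D → y ∉ C → y ∉ D → x ≠ y → K.Adj x y) : IsChordal K := by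
  intro k hk
  refine ⟨fun f => ?_⟩
  -- Only edges between `C` and `D` were deleted, so a hole of `K` that does not meet both sets is a
  -- hole of `H`.
  have transfer : (∀ i j, ¬ (f i ∈ C ∧ f j ∈ D)) → False := fun hn =>
    (hH k hk).elim ⟨f.toEmbedding, fun {a b} => ⟨fun h => f.map_rel_iff.1
      (hK _ _ h (hn a b) fun hh => hn b a hh.symm), fun h => hle (f.map_rel_iff.2 h)⟩⟩
  apply transfer
  rintro i j ⟨hi, hj⟩
  obtain ⟨g, hg, hg0, hr, -⟩ := IsHole.of_embedding f (by omega) i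
  obtain ⟨b, hb, hbj⟩ := hr (f j) ⟨j, rfl⟩
  rw [← hg0] at hi
  rw [← hbj] at hj
  have hadj : ∀ a, a + 1 < k → K.Adj (g a) (g (a + 1)) := fun a ha =>
    (hg.adj _ _ (by omega) ha).2 (by omega)
  -- No edge of `K` joins `C` to `D`, so each of the two arcs between `g 0` and `g b` contains a
  -- vertex of the clique. These two vertices are adjacent although they are not consecutive on the
  -- cycle.
  have h1 : ∃ a, a < b ∧ g a ∉ C ∧ g a ∉ D := by
    by_contra hn
    push Not at hn
    have : ∀ a, a < b → g a ∈ C := by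
      intro a
      induction a with
      | zero => exact fun _ => hi
      | succ a ih =>
        intro ha
        by_contra hc
        exact hno _ (ih (by omega)) _ (hn _ ha hc) (hadj a (by omega))
    have hb0 : b ≠ 0 := by
      rintro rfl
      exact hCD.le_bot ⟨hi, hj⟩
    have h := this (b - 1) (by omega)
    have h' := hadj (b - 1) (by omega)
    rw [show b - 1 + 1 = b by omega] at h'
    exact hno _ h _ hj h'
  have h2 : ∃ a, b < a ∧ a < k ∧ g a ∉ C ∧ g a ∉ D := by
    by_contra hn
    push Not at hn
    have : ∀ a, b ≤ a → a < k → g a ∈ D := by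
      intro a hba
      induction a, hba using Nat.le_induction with
      | base => exact fun _ => hj
      | succ a hba ih =>
        intro ha
        refine hn _ (by omega) ha fun hc => ?_
        exact hno _ hc _ (ih (by omega)) (hadj a (by omega)).symm
    have h := this (k - 1) (by omega) (by omega)
    exact hno _ hi _ h ((hg.adj 0 (k - 1) (by omega) (by omega)).2 (by omega))
  obtain ⟨p, hp, hpC, hpD⟩ := h1
  obtain ⟨q, hq, hqk, hqC, hqD⟩ := h2
  have := (hg.adj p q (by omega) hqk).1 (hcl _ _ hpC hpD hqC hqD (hg.inj p q (by omega) hqk))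
  have h0 : p ≠ 0 := by
    rintro rfl
    exact hpC hi
  omega

/-- One direction uses that `H` has no hole through `u`, the other that `H` is minimal: a pair of
neighbours that is not connected outside of the closed neighbourhood of `u` gives a separation along
a clique, and the edge of `H` between the pair could be spared. -/
theorem IsMinimalTriangulation.isAvoidable_iff {V : Type*} {G H : SimpleGraph V} {u : V}
    (h : IsMinimalTriangulation G H) (hu : ∀ v, ¬ (H \ G).Adj u v) :
    IsAvoidable G u ↔ IsSimplicial H u := by
  have hN : ∀ v, H.Adj u v ↔ G.Adj u v := fun v =>
    ⟨fun hv => by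
      by_contra hG
      exact hu v ⟨hv, hG⟩, fun hv => h.1 hv⟩
  rw [isAvoidable_iff_through]
  constructor
  · intro ha x hx y hy hxy
    rw [SimpleGraph.mem_neighborSet] at hx hy
    by_contra hn
    obtain ⟨z, hz, hzy⟩ := ha x y ((hN x).1 hx) ((hN y).1 hy) hxy fun hG => hn (h.1 hG)
    refine not_through_of_isChordal h.2.1 hx hy hxy hn ⟨z, ?_, h.1 hzy⟩
    refine Relation.ReflTransGen.mono (fun a b => ?_) x z hz
    rintro ⟨hab, hb⟩
    exact ⟨h.1 hab, hb.1, fun hh => hb.2 ((hN b).1 hh)⟩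
  · intro hs x y hx hy hxy hn
    by_contra hT
    have hHxy : H.Adj x y := hs (h.1 hx) (h.1 hy) hxy
    let S : Set V := {w | w ≠ u ∧ ¬ G.Adj u w}
    let C : Set V := {w | Relation.ReflTransGen (fun a b => G.Adj a b ∧ b ∈ S) x w}
    let D : Set V := {w | w ∉ C ∧ (w ∈ S ∨ w = y)}
    have hyC : y ∉ C := by
      intro hy'
      rcases Relation.ReflTransGen.cases_tail hy' with h | ⟨_, _, h⟩
      · exact hxy h.symm
      · exact h.2.2 hy
    have hG : ∀ c ∈ C, ∀ d ∈ D, ¬ G.Adj c d := by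
      rintro c hc d ⟨hd, hd' | rfl⟩ hcd
      · exact hd (.tail hc ⟨hcd, hd'⟩)
      · exact hT ⟨c, hc, hcd⟩
    -- The vertices outside of `C` and `D` are `u` and some of its neighbours, a clique of `H`
    -- because `u` is simplicial. No edge of `G` runs between `C` and `D`, since `C` is closed under
    -- steps into `S` and `y` is not reached.
    let K : SimpleGraph V :=
      { Adj := fun a b => H.Adj a b ∧ ¬ (a ∈ C ∧ b ∈ D) ∧ ¬ (a ∈ D ∧ b ∈ C)
        symm := ⟨fun _ _ h => ⟨h.1.symm, fun h' => h.2.2 h'.symm, fun h' => h.2.1 h'.symm⟩⟩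
        loopless := ⟨fun _ h => h.1.ne rfl⟩ }
    have hKH : K ≤ H := fun _ _ h => h.1
    refine h.2.2 K (fun a b hab => ⟨h.1 hab, fun hh => hG _ hh.1 _ hh.2 hab,
      fun hh => hG _ hh.2 _ hh.1 hab.symm⟩) (lt_of_le_not_ge hKH fun hle => ?_) ?_
    · exact (hle hHxy).2.1 ⟨.refl, hyC, .inr rfl⟩
    · refine h.2.1.of_clique_separator (C := C) (D := D) ?_ hKH (fun _ _ h h1 h2 => ⟨h, h1, h2⟩)
        (fun _ hx _ hy h => h.2.1 ⟨hx, hy⟩) ?_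
      · rw [Set.disjoint_left]
        exact fun w hw hw' => hw'.1 hw
      · intro a b haC haD hbC hbD hab
        refine ⟨?_, fun hh => haC hh.1, fun hh => hbC hh.2⟩
        have key : ∀ w, w ∉ C → w ∉ D → w = u ∨ H.Adj u w := by
          intro w hwC hwD
          by_contra hh
          push Not at hh
          exact hwD ⟨hwC, .inl ⟨hh.1, fun hG => hh.2 (h.1 hG)⟩⟩
        rcases key a haC haD with rfl | ha
        · rcases key b hbC hbD with rfl | hb
          · exact absurd rfl hab
          · exact hb
        · rcases key b hbC hbD with rfl | hb
          · exact ha.symm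
          · exact hs ha hb hab

theorem IsOrderingAt.isMinimalTriangulation {V : Type*} {G H : SimpleGraph V} {u : V} {l : List V}
    (hl : IsOrderingAt G u l) (h : IsVertexIncremental G l H) : IsMinimalTriangulation G H := by
  have hm := h.isMinimalTriangulation
  have hr : ∀ K : SimpleGraph V, restr K {y | y ∈ l} = K := fun K =>
    restr_eq_self fun x _ _ => hl.2.1 x
  rwa [hr, hr] at hm

/-! ### Elimination trees -/

/-- The neighbours of `y` that come after `y`. -/
def later (H : SimpleGraph ℕ) (pos : ℕ → ℕ) (y : ℕ) : Set ℕ := {z | H.Adj y z ∧ pos y < pos z}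

/-- `z` is `y` or one of its ancestors. -/
def Anc (O : Set ℕ) (par : ℕ → ℕ) : ℕ → ℕ → Prop :=
  Relation.ReflTransGen fun a b => a ∈ O ∧ b ∈ O ∧ par a = b

/-- `H` is a minimal triangulation of `G` on the vertex set `O`, `pos` is a perfect elimination
order of `H`, `par` is its elimination tree, and `d` counts the later neighbours. -/
structure ElimTree (G H : SimpleGraph ℕ) (O : Set ℕ) (none : ℕ) (pos par d : ℕ → ℕ) : Prop where
  fin : O.Finite
  supp : ∀ x y, H.Adj x y → x ∈ O
  inj : Set.InjOn pos O
  clique : ∀ y a b, a ∈ later H pos y → b ∈ later H pos y → a ≠ b → H.Adj a b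
  par_mem : ∀ y ∈ O, par y ≠ none → par y ∈ later H pos y
  par_none : ∀ y ∈ O, par y = none → later H pos y = ∅
  par_le : ∀ y ∈ O, ∀ z ∈ later H pos y, pos (par y) ≤ pos z
  none_not : none ∉ O
  d_eq : ∀ y ∈ O, d y = (later H pos y).ncard
  min : IsMinimalTriangulation (restr G O) H

namespace ElimTree

variable {G H : SimpleGraph ℕ} {O : Set ℕ} {none : ℕ} {pos par d : ℕ → ℕ}

theorem supp' (h : ElimTree G H O none pos par d) {x y : ℕ} (hxy : H.Adj x y) : x ∈ O ∧ y ∈ O :=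
  ⟨h.supp _ _ hxy, h.supp _ _ hxy.symm⟩

theorem later_mem (h : ElimTree G H O none pos par d) {y z : ℕ} (hz : z ∈ later H pos y) :
    y ∈ O ∧ z ∈ O := h.supp' hz.1

theorem later_finite (h : ElimTree G H O none pos par d) (y : ℕ) : (later H pos y).Finite :=
  h.fin.subset fun _ hz => (h.later_mem hz).2

theorem adj_cases (h : ElimTree G H O none pos par d) {y z : ℕ} (hyz : H.Adj y z) :
    z ∈ later H pos y ∨ y ∈ later H pos z := by
  rcases lt_trichotomy (pos y) (pos z) with h1 | h1 | h1
  · exact .inl ⟨hyz, h1⟩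
  · exact absurd (h.inj (h.supp' hyz).1 (h.supp' hyz).2 h1) hyz.ne
  · exact .inr ⟨hyz.symm, h1⟩

theorem adj_of_G (h : ElimTree G H O none pos par d) {y z : ℕ} (hy : y ∈ O) (hz : z ∈ O)
    (hyz : G.Adj y z) : H.Adj y z := h.min.1 ⟨hyz, hy, hz⟩

theorem par_ne (h : ElimTree G H O none pos par d) {y z : ℕ} (hz : z ∈ later H pos y) :
    par y ≠ none := by
  intro he
  have := h.par_none y (h.later_mem hz).1 he
  rw [this] at hz
  exact hz

theorem par_mem_of_later (h : ElimTree G H O none pos par d) {y z : ℕ}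
    (hz : z ∈ later H pos y) : par y ∈ later H pos y :=
  h.par_mem y (h.later_mem hz).1 (h.par_ne hz)

theorem par_mem_iff (h : ElimTree G H O none pos par d) {y : ℕ} (hy : y ∈ O) :
    par y ∈ O ↔ par y ≠ none :=
  ⟨fun hp he => h.none_not (he ▸ hp), fun hp => (h.later_mem (h.par_mem y hy hp)).2⟩

theorem par_later (h : ElimTree G H O none pos par d) {y : ℕ} (hy : y ∈ O) (hp : par y ∈ O) :
    par y ∈ later H pos y := h.par_mem y hy ((h.par_mem_iff hy).1 hp)

/-- The later neighbours form a clique and the parent is the first of them, so each of the others is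
a later neighbour of the parent. All nesting properties of the bags come from this. -/
theorem later_par (h : ElimTree G H O none pos par d) {y z : ℕ} (hz : z ∈ later H pos y) :
    z = par y ∨ z ∈ later H pos (par y) := by
  have hp := h.par_mem_of_later hz
  by_cases he : z = par y
  · exact .inl he
  · refine .inr ⟨h.clique y _ _ hp hz (Ne.symm he), lt_of_le_of_ne
      (h.par_le y (h.later_mem hz).1 z hz) fun hh => he ?_⟩
    exact (h.inj (h.later_mem hp).2 (h.later_mem hz).2 hh).symm

/-- While climbing, `z` remains a later neighbour of the current vertex until it is its parent, and
the gap between the positions shrinks. -/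
theorem anc_par (h : ElimTree G H O none pos par d) {y z : ℕ} (hz : z ∈ later H pos y) :
    Anc O par (par y) z := by
  generalize hk : pos z - pos y = k
  induction k using Nat.strong_induction_on generalizing y with
  | _ k ih =>
    rcases h.later_par hz with he | hz'
    · rw [he]; exact .refl
    · have hp := h.par_mem_of_later hz
      have h1 := hp.2
      have h2 := hz'.2
      exact .head ⟨(h.later_mem hz').1, (h.later_mem (h.par_mem_of_later hz')).2, rfl⟩
        (ih (pos z - pos (par y)) (by omega) hz' rfl)

theorem anc_of_later (h : ElimTree G H O none pos par d) {y z : ℕ} (hz : z ∈ later H pos y) :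
    Anc O par y z :=
  .head ⟨(h.later_mem hz).1, (h.later_mem (h.par_mem_of_later hz)).2, rfl⟩ (h.anc_par hz)

theorem anc_pos (h : ElimTree G H O none pos par d) {y z : ℕ} (hz : Anc O par y z) :
    y = z ∨ (pos y < pos z ∧ y ∈ O ∧ z ∈ O) := by
  induction hz with
  | refl => exact .inl rfl
  | tail _ hbc ih =>
    obtain ⟨h1, h2, rfl⟩ := hbc
    have := (h.par_later h1 h2).2
    rcases ih with rfl | ih
    · exact .inr ⟨this, h1, h2⟩
    · exact .inr ⟨ih.1.trans this, ih.2.1, h2⟩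

theorem anc_le (h : ElimTree G H O none pos par d) {y z : ℕ} (hz : Anc O par y z) :
    pos y ≤ pos z := by
  rcases h.anc_pos hz with rfl | h
  · rfl
  · exact h.1.le

/-- The vertex `z` is handed on from a vertex to its parent by `later_par` until the path has
climbed up to `z` itself. -/
theorem later_of_anc (h : ElimTree G H O none pos par d) {y q z : ℕ} (hz : z ∈ later H pos y)
    (hq : Anc O par y q) (hqz : pos q < pos z) : z ∈ later H pos q := by
  induction hq with
  | refl => exact hz
  | tail _ hbc ih =>
    obtain ⟨h1, h2, rfl⟩ := hbc
    have := (h.par_later h1 h2).2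
    rcases h.later_par (ih (this.trans hqz)) with rfl | h'
    · omega
    · exact h'

theorem anc_par_of_ne {y z : ℕ} (hz : Anc O par y z) (hne : y ≠ z) : Anc O par (par y) z := by
  rcases Relation.ReflTransGen.cases_head hz with h | ⟨c, ⟨_, _, rfl⟩, h⟩
  · exact absurd h hne
  · exact h

theorem anc_total {y a b : ℕ} (ha : Anc O par y a) (hb : Anc O par y b) :
    Anc O par a b ∨ Anc O par b a :=
  Relation.ReflTransGen.total_of_right_unique
    (fun _ _ _ h1 h2 => h1.2.2.symm.trans h2.2.2) ha hb

theorem anc_of_pos_le (h : ElimTree G H O none pos par d) {y a b : ℕ} (ha : Anc O par y a)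
    (hb : Anc O par y b) (hab : pos a ≤ pos b) : Anc O par a b := by
  rcases anc_total ha hb with h1 | h1
  · exact h1
  · rcases h.anc_pos h1 with rfl | h2
    · exact .refl
    · omega

/-- This is where the minimality of `H` enters the algorithm. Without an edge of `G` from `z` into
the subtree of `y`, all edges of `H` from `z` into that subtree could be deleted together, and `pos`
would still be a perfect elimination order. Hence later neighbours in `H` can be detected by
scanning `G` only. -/
theorem exists_adj_of_later (h : ElimTree G H O none pos par d) {y z : ℕ}
    (hz : z ∈ later H pos y) : ∃ w ∈ O, Anc O par w y ∧ G.Adj w z := by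
  by_contra hn
  push Not at hn
  let K : SimpleGraph ℕ :=
    { Adj := fun a b => H.Adj a b ∧ ¬ (a = z ∧ Anc O par b y) ∧ ¬ (b = z ∧ Anc O par a y)
      symm := ⟨fun _ _ h => ⟨h.1.symm, h.2.2, h.2.1⟩⟩
      loopless := ⟨fun _ h => h.1.ne rfl⟩ }
  have hKH : K ≤ H := fun _ _ h => h.1
  refine h.min.2.2 K ?_ (lt_of_le_not_ge hKH fun hle => ?_) ?_
  · rintro a b hab
    refine ⟨h.min.1 hab, ?_, ?_⟩
    · rintro ⟨rfl, hb⟩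
      exact hn b hab.2.2 hb hab.1.symm
    · rintro ⟨rfl, ha⟩
      exact hn a hab.2.1 ha hab.1
  · exact (hle hz.1).2.2 ⟨rfl, .refl⟩
  · refine isChordal_of_perfectElimination pos (fun a b hab he => hab.1.ne
      (h.inj (h.supp' hab.1).1 (h.supp' hab.1).2 he)) ?_
    intro q a b ha hb hqa hqb hab
    -- An edge between the later neighbours `a = z` and `b` of `q` is deleted only if `b` is in the
    -- subtree of `y`. Then `q` is in it too, and the edge between `q` and `z` was deleted as well.
    refine ⟨h.clique q a b ⟨ha.1, hqa⟩ ⟨hb.1, hqb⟩ hab, ?_, ?_⟩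
    · rintro ⟨rfl, hb'⟩
      exact ha.2.2 ⟨rfl, (h.anc_of_later ⟨hb.1, hqb⟩).trans hb'⟩
    · rintro ⟨rfl, ha'⟩
      exact hb.2.2 ⟨rfl, (h.anc_of_later ⟨ha.1, hqa⟩).trans ha'⟩

/-- Every vertex of a subtree is joined to its root inside of the subtree. -/
theorem connected_subtree (h : ElimTree G H O none pos par d) {q a b : ℕ} (ha : Anc O par a q)
    (hb : Anc O par b q) :
    Relation.ReflTransGen (fun s t => H.Adj s t ∧ t ∈ {w | Anc O par w q}) a b := by
  have up : ∀ a, Anc O par a q →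
      Relation.ReflTransGen (fun s t => H.Adj s t ∧ t ∈ {w | Anc O par w q}) a q ∧
      Relation.ReflTransGen (fun s t => H.Adj s t ∧ t ∈ {w | Anc O par w q}) q a := by
    intro a ha
    induction ha using Relation.ReflTransGen.head_induction_on with
    | refl => exact ⟨.refl, .refl⟩
    | head hab hbq ih =>
      obtain ⟨h1, h2, rfl⟩ := hab
      have hadj := (h.par_later h1 h2).1
      exact ⟨.head ⟨hadj, hbq⟩ ih.1, .tail ih.2 ⟨hadj.symm, .head ⟨h1, h2, rfl⟩ hbq⟩⟩
  exact (up a ha).1.trans (up b hb).2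

/-- A vertex outside of a subtree that is adjacent to it is a later neighbour of its root. -/
theorem later_of_adj_subtree (h : ElimTree G H O none pos par d) {q a b : ℕ}
    (ha : Anc O par a q) (hab : H.Adj a b) (hb : ¬ Anc O par b q) : b ∈ later H pos q := by
  rcases h.adj_cases hab with h1 | h1
  · refine h.later_of_anc h1 ha ?_
    by_contra hle
    exact hb (h.anc_of_pos_le (h.anc_of_later h1) ha (by omega))
  · exact absurd ((h.anc_of_later h1).trans ha) hb

end ElimTree

/-- If `y` has neighbours in two separate connected sets that both meet `L`, then a new vertex with
neighbourhood `L` can only keep the graph chordal if `y ∈ L`. -/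
theorem mem_of_isChordal_addVertex {V : Type*} {H : SimpleGraph V} {v y a b l l' : V}
    {L A B : Set V} (hc : IsChordal (addVertex H v L)) (hvA : v ∉ A) (hvB : v ∉ B)
    (hyv : y ≠ v) (hyA : y ∉ A) (hyB : y ∉ B) (hAB : Disjoint A B)
    (hadj : ∀ s ∈ A, ∀ t ∈ B, ¬ H.Adj s t) (hvH : ∀ x, ¬ H.Adj v x)
    (ha : a ∈ A) (hya : H.Adj y a) (hb : b ∈ B) (hyb : H.Adj y b)
    (hl : l ∈ L) (hal : Relation.ReflTransGen (fun s t => H.Adj s t ∧ t ∈ A) a l)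
    (hl' : l' ∈ L) (hbl : Relation.ReflTransGen (fun s t => H.Adj s t ∧ t ∈ B) b l') :
    y ∈ L := by
  by_contra hy
  have hKv : ∀ x, (addVertex H v L).Adj v x ↔ x ∈ L ∧ x ≠ v := fun x =>
    ⟨fun h => by
      rcases h with h | h | h
      · exact absurd h (hvH _)
      · exact h.2
      · exact absurd rfl h.2.2, fun h => .inr (.inl ⟨rfl, h⟩)⟩
  have hK : ∀ s t, s ≠ v → t ≠ v → ((addVertex H v L).Adj s t ↔ H.Adj s t) := fun s t hs ht =>
    ⟨fun h => by
      rcases h with h | h | h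
      · exact h
      · exact absurd h.1 hs
      · exact absurd h.1 ht, .inl⟩
  let S : Set V := {w | w ≠ y ∧ ¬ (addVertex H v L).Adj y w}
  have hvS : v ∈ S := ⟨hyv.symm, fun h => hy ((hKv y).1 h.symm).1⟩
  -- On the way from `a` to `l`, the start is moved to each new neighbour of `y`. From the last one,
  -- the path to `l` and on to `v` has no neighbour of `y` in its interior. Two such paths, one in
  -- `A` and one in `B`, meet in `v` and give a hole through `y`.
  have last : ∀ (A : Set V) (a l : V), v ∉ A → y ∉ A → a ∈ A → H.Adj y a → l ∈ L →
      Relation.ReflTransGen (fun s t => H.Adj s t ∧ t ∈ A) a l →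
      ∃ a' ∈ A, H.Adj y a' ∧ Through (addVertex H v L) S a' v := by
    intro A a l hvA hyA ha hya hl hal
    have : ∃ a' ∈ A, H.Adj y a' ∧ l ∈ A ∧ Relation.ReflTransGen
        (fun s t => (addVertex H v L).Adj s t ∧ t ∈ S) a' l := by
      clear hl
      induction hal with
      | refl => exact ⟨a, ha, hya, ha, .refl⟩
      | @tail b c _ hbc ih =>
        by_cases hyc : H.Adj y c
        · exact ⟨c, hbc.2, hyc, hbc.2, .refl⟩
        · obtain ⟨a', h1, h2, -, h3⟩ := ih
          refine ⟨a', h1, h2, hbc.2, .tail h3 ⟨.inl hbc.1, fun he => hyA (he ▸ hbc.2), fun hh => ?_⟩⟩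
          exact hyc ((hK _ _ hyv fun he => hvA (he ▸ hbc.2)).1 hh)
    obtain ⟨a', h1, h2, h3, h4⟩ := this
    exact ⟨a', h1, h2, l, h4, ((hKv l).2 ⟨hl, fun he => hvA (he ▸ h3)⟩).symm⟩
  obtain ⟨a', ha', hya', ta⟩ := last A a l hvA hyA ha hya hl hal
  obtain ⟨b', hb', hyb', tb⟩ := last B b l' hvB hyB hb hyb hl' hbl
  refine not_through_of_isChordal hc (v := y) (x := a') (y := b') (.inl hya') (.inl hyb')
    (fun he => hAB.le_bot ⟨ha', he ▸ hb'⟩) (fun hh => hadj a' ha' b' hb'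
      ((hK _ _ (fun he => hvA (he ▸ ha')) fun he => hvB (he ▸ hb')).1 hh)) ?_
  obtain ⟨z, hz, hzv⟩ := ta
  obtain ⟨w, hw, hwb⟩ := tb.symm
  exact ⟨w, (hz.tail ⟨hzv, hvS⟩).trans hw, hwb⟩

/-! ### The neighbourhood of an inserted vertex -/

/-- The quantities that describe the insertion of the vertex `v`.
`U` is the set of the ancestors of neighbours of `v`; `hv` is the child in `U` with the largest `d`,
`ua` the lowest ancestor in `U`, `dep` the depth, `lt` the top of the path of heavy children, and
`bot z` the lowest vertex of `U` that has `z` as a later neighbour. -/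
structure BotSpec (G : SimpleGraph ℕ) (O : Set ℕ) (none v : ℕ)
    (pos par d hv ua dep lt bot : ℕ → ℕ) (U l0 : ℕ → Prop) : Prop where
  v_not : v ∉ O
  U_mem : ∀ z, U z → z ∈ O
  U_iff : ∀ z ∈ O, U z ↔ G.Adj v z ∨ ∃ y ∈ O, U y ∧ par y = z
  hv_spec : ∀ y ∈ O, U y → par y ∈ O →
    U (hv (par y)) ∧ par (hv (par y)) = par y ∧ d y ≤ d (hv (par y))
  hv_none : hv none ∉ O
  ua_self : ∀ y, U y → ua y = y
  ua_par : ∀ y ∈ O, ¬ U y → ua y = ua (par y)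
  dep_eq : ∀ y, U y → dep y = dep (par y) + 1
  lt_eq : ∀ y, U y → lt y = if hv (par y) = y then lt (par y) else y
  l0_iff : ∀ z, U z → (l0 z ↔ G.Adj v z ∨
    ∃ w ∈ O, G.Adj z w ∧ pos w < pos z ∧ dep z < dep (lt (ua w)))
  bot_le : ∀ z, U z → ∀ w ∈ O, G.Adj z w → pos w < pos z → pos (bot z) ≤ pos (ua w)
  bot_mem : ∀ z, U z → bot z = z ∨ ∃ w ∈ O, G.Adj z w ∧ pos w < pos z ∧ bot z = ua w

/-- The rules that determine the neighbourhood `L` of the inserted vertex; `cnt t` is the number of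
vertices outside of `L` with `bot z = t`. -/
structure InsertSpec (G : SimpleGraph ℕ) (O : Set ℕ) (none v : ℕ)
    (pos par d hv ua dep lt bot gl cnt : ℕ → ℕ) (U l0 L : ℕ → Prop) : Prop
    extends BotSpec G O none v pos par d hv ua dep lt bot U l0 where
  gl_eq : ∀ t, U t → gl t =
    if lt t = t ∨ d t + cnt (par t) < d (par t) + 1 then dep t else gl (par t)
  L_iff : ∀ z, L z ↔ U z ∧ (l0 z ∨ dep z < gl (bot z))
  cnt_eq : ∀ t, U t → cnt t = {z | U z ∧ ¬ L z ∧ bot z = t}.ncard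

namespace BotSpec

variable {G H : SimpleGraph ℕ} {O : Set ℕ} {none v : ℕ}
  {pos par d hv ua dep lt bot : ℕ → ℕ} {U l0 : ℕ → Prop}

local notation "Spec" => BotSpec G O none v pos par d hv ua dep lt bot U l0
local notation "Tree" => ElimTree G H O none pos par d

theorem U_anc (s : Spec) {y z : ℕ} (hy : U y) (h : Anc O par y z) : U z := by
  induction h with
  | refl => exact hy
  | tail _ hbc ih => exact (s.U_iff _ hbc.2.1).2 (.inr ⟨_, hbc.1, ih, hbc.2.2⟩)

/-- Descending to children in `U` ends at a neighbour of `v`. So the subtree of each vertex of `U`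
is a connected set that meets every admissible neighbourhood of `v`. -/
theorem exists_nbr (s : Spec) (h : Tree) {z : ℕ} (hz : U z) :
    ∃ w ∈ O, G.Adj v w ∧ Anc O par w z := by
  generalize hk : pos z = k
  induction k using Nat.strong_induction_on generalizing z with
  | _ k ih =>
    rcases (s.U_iff z (s.U_mem z hz)).1 hz with hN | ⟨y, hy, hU, hp⟩
    · exact ⟨z, s.U_mem z hz, hN, .refl⟩
    · have hpO : par y ∈ O := hp ▸ s.U_mem z hz
      have := (h.par_later hy hpO).2
      obtain ⟨w, hw, hvw, hwy⟩ := ih (pos y) (by rw [← hk, ← hp]; exact this) hU rfl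
      exact ⟨w, hw, hvw, hwy.tail ⟨hy, s.U_mem z hz, hp⟩⟩

theorem ua_spec (s : Spec) {w z : ℕ} (hw : w ∈ O) (hwz : Anc O par w z)
    (hz : U z) : U (ua w) ∧ Anc O par w (ua w) ∧ Anc O par (ua w) z := by
  induction hwz using Relation.ReflTransGen.head_induction_on with
  | refl => rw [s.ua_self z hz]; exact ⟨hz, .refl, .refl⟩
  | @head a b hab hbz ih =>
    obtain ⟨h1, h2, rfl⟩ := hab
    by_cases ha : U a
    · rw [s.ua_self a ha]
      exact ⟨ha, .refl, .head ⟨h1, h2, rfl⟩ hbz⟩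
    · rw [s.ua_par a h1 ha]
      obtain ⟨h3, h4, h5⟩ := ih h2
      exact ⟨h3, .head ⟨h1, h2, rfl⟩ h4, h5⟩

theorem par_cases (s : Spec) (h : Tree) {y : ℕ} (hy : U y) :
    par y = none ∨ (par y ∈ O ∧ U (par y)) := by
  by_cases hp : par y = none
  · exact .inl hp
  · have hpO := (h.par_mem_iff (s.U_mem y hy)).2 hp
    exact .inr ⟨hpO, s.U_anc hy (.single ⟨s.U_mem y hy, hpO, rfl⟩)⟩

theorem dep_anc (s : Spec) {a b : ℕ} (ha : U a) (hab : Anc O par a b) :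
    a = b ∨ dep b < dep a := by
  induction hab with
  | refl => exact .inl rfl
  | tail hac hbc ih =>
    obtain ⟨h1, h2, rfl⟩ := hbc
    have := s.dep_eq _ (s.U_anc ha hac)
    rcases ih with rfl | ih <;> right <;> omega

theorem dep_le (s : Spec) {a b : ℕ} (ha : U a) (hab : Anc O par a b) :
    dep b ≤ dep a := by
  rcases s.dep_anc ha hab with rfl | h
  · rfl
  · exact h.le

theorem anc_of_dep_le (s : Spec) {y a b : ℕ} (hb : U b) (hya : Anc O par y a)
    (hyb : Anc O par y b) (hd : dep b ≤ dep a) : Anc O par a b := by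
  rcases ElimTree.anc_total hya hyb with h1 | h1
  · exact h1
  · rcases s.dep_anc hb h1 with rfl | h2
    · exact .refl
    · omega

/-- The top of the heavy path of `y`. -/
theorem lt_anc (s : Spec) (h : Tree) {y : ℕ} (hy : U y) :
    Anc O par y (lt y) ∧ lt (lt y) = lt y := by
  generalize hk : dep y = k
  induction k using Nat.strong_induction_on generalizing y with
  | _ k ih =>
    have he := s.lt_eq y hy
    split_ifs at he with hc
    · rcases s.par_cases h hy with hp | ⟨hpO, hpU⟩
      · rw [hp] at hc
        exact absurd (s.U_mem y hy) (hc ▸ s.hv_none)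
      · obtain ⟨h1, h2⟩ := ih (dep (par y)) (by rw [← hk, s.dep_eq y hy]; omega) hpU rfl
        rw [he]
        exact ⟨.head ⟨s.U_mem y hy, hpO, rfl⟩ h1, h2⟩
    · rw [he, he]
      exact ⟨.refl, rfl⟩

theorem lt_U (s : Spec) (h : Tree) {y : ℕ} (hy : U y) : U (lt y) := s.U_anc hy (s.lt_anc h hy).1

theorem heavy_of_lt_ne (s : Spec) (h : Tree) {y : ℕ} (hy : U y) (hl : lt y ≠ y) :
    U (par y) ∧ par y ∈ O ∧ lt y = lt (par y) ∧ hv (par y) = y := by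
  have he := s.lt_eq y hy
  split_ifs at he with hc
  · rcases s.par_cases h hy with hp | ⟨hpO, hpU⟩
    · rw [hp] at hc
      exact absurd (s.U_mem y hy) (hc ▸ s.hv_none)
    · exact ⟨hpU, hpO, he, hc⟩
  · exact absurd he hl

/-- Heavy paths have no gaps: below the top of the path of `y`, each ancestor of `y` is reached by
steps from heavy children only. -/
theorem lt_eq_of_between (s : Spec) (h : Tree) {y q : ℕ} (hy : U y) (h1 : Anc O par y q)
    (h2 : Anc O par q (lt y)) : lt q = lt y := by
  induction h1 using Relation.ReflTransGen.head_induction_on with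
  | refl => rfl
  | @head a b hab hbq ih =>
    obtain ⟨h3, h4, rfl⟩ := hab
    have hl : lt a ≠ a := by
      intro he
      rw [he] at h2
      have h5 := h.anc_le (hbq.trans h2)
      have h6 := (h.par_later h3 h4).2
      omega
    obtain ⟨h5, _, h6, _⟩ := s.heavy_of_lt_ne h hy hl
    rw [h6] at h2 ⊢
    exact ih h5 h2

/-- A vertex has only one heavy child, so a heavy path is a chain. On it, ancestry is decided by
comparing depths, which the program can do in constant time. -/
theorem anc_of_lt_eq (s : Spec) (h : Tree) {a b : ℕ} (ha : U a) (hb : U b) (hl : lt a = lt b)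
    (hd : dep a ≤ dep b) : Anc O par b a := by
  generalize hk : dep b = k
  induction k using Nat.strong_induction_on generalizing a b with
  | _ k ih =>
    by_cases hlb : lt b = b
    · have := (s.lt_anc h ha).1
      rw [hl, hlb] at this
      rcases s.dep_anc ha this with rfl | hlt
      · exact .refl
      · omega
    · obtain ⟨h1, h2, h3, h4⟩ := s.heavy_of_lt_ne h hb hlb
      have hdb := s.dep_eq b hb
      by_cases hla : lt a = a
      · rw [← hla, hl]
        exact (s.lt_anc h hb).1
      · by_cases hda : dep a = dep b
        · obtain ⟨h1', h2', h3', h4'⟩ := s.heavy_of_lt_ne h ha hla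
          have hda' := s.dep_eq a ha
          have h5 := ih (dep (par b)) (by omega) h1' h1 (by rw [← h3, ← h3', hl]) (by omega) rfl
          rcases s.dep_anc h1 h5 with h6 | h6
          · rw [← h4, h6, h4']; exact .refl
          · omega
        · exact .head ⟨s.U_mem b hb, h2, rfl⟩
            (ih (dep (par b)) (by omega) ha h1 (by rw [hl, h3]) (by omega) rfl)

theorem later_U (s : Spec) (h : Tree) {y z : ℕ} (hy : U y) (hz : z ∈ later H pos y) : U z :=
  s.U_anc hy (h.anc_of_later hz)

/-- If `z` is a later neighbour of `q`, and not for an obvious reason in `L`, then `q` lies on the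
heavy path of `z`. -/
theorem lt_eq_of_later (s : Spec) (h : Tree) {q z : ℕ} (hq : U q) (hz : z ∈ later H pos q)
    (hl : ¬ l0 z) : lt q = lt z ∧ lt (bot z) = lt z ∧ U (bot z) ∧ Anc O par (bot z) q ∧
      z ∈ later H pos (bot z) := by
  have hzU := s.later_U h hq hz
  -- If the top of the heavy path of `ua w` were strictly below `z`, then `l0 z` would hold. So `z`
  -- lies between `ua w` and that top, hence on the same heavy path.
  have key : ∀ w ∈ O, G.Adj z w → pos w < pos z → U (ua w) ∧ lt (ua w) = lt z ∧
      Anc O par w (ua w) ∧ Anc O par (ua w) z ∧ Anc O par z (lt (ua w)) := by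
    intro w hw hzw hwz
    have hzw' : z ∈ later H pos w := ⟨(h.adj_of_G (s.U_mem z hzU) hw hzw).symm, hwz⟩
    obtain ⟨h1, h2, h3⟩ := s.ua_spec hw (h.anc_of_later hzw') hzU
    have h4 : ¬ dep z < dep (lt (ua w)) := fun hd =>
      hl ((s.l0_iff z hzU).2 (.inr ⟨w, hw, hzw, hwz, hd⟩))
    have h5 := (s.lt_anc h h1).1
    have h6 : Anc O par z (lt (ua w)) := s.anc_of_dep_le (s.lt_U h h1) h3 h5 (by omega)
    exact ⟨h1, (s.lt_eq_of_between h h1 h3 h6).symm, h2, h3, h6⟩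
  -- The edge of `G` that minimality supplies ends in the subtree of `q`. Its end hangs on `ua w`,
  -- which is at or below `q`, so `q` lies between `ua w` and `z` on the path.
  obtain ⟨w, hw, hwq, hwz⟩ := h.exists_adj_of_later hz
  have hwz' : pos w < pos z := lt_of_le_of_lt (h.anc_le hwq) hz.2
  obtain ⟨k1, k2, k3, k4, k5⟩ := key w hw hwz.symm hwz'
  have hwq' : Anc O par (ua w) q := (s.ua_spec hw hwq hq).2.2
  have hbp := s.bot_le z hzU w hw hwz.symm hwz'
  have hbz : bot z ≠ z := by
    intro he
    rw [he] at hbp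
    have := h.anc_le hwq'
    have := hz.2
    omega
  rcases s.bot_mem z hzU with hb | ⟨w', hw', hzw', hwz'', hb⟩
  · exact absurd hb hbz
  obtain ⟨k1', k2', k3', k4', k5'⟩ := key w' hw' hzw' hwz''
  -- Both vertices lie on the same heavy path and are comparable; the lower position of `bot z`
  -- decides which is the descendant.
  have hba : Anc O par (bot z) (ua w) := by
    rw [hb] at hbp ⊢
    rcases le_total (dep (ua w)) (dep (ua w')) with hd | hd
    · exact s.anc_of_lt_eq h k1 k1' (k2.trans k2'.symm) hd
    · have := s.anc_of_lt_eq h k1' k1 (k2'.trans k2.symm) hd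
      rcases h.anc_pos this with h7 | h7
      · rw [h7]; exact .refl
      · omega
  have hlq : lt q = lt z := by
    rw [← k2]
    exact s.lt_eq_of_between h k1 hwq' ((h.anc_of_later hz).trans k5)
  refine ⟨hlq, by rw [hb]; exact k2', by rw [hb]; exact k1', hba.trans hwq', ?_⟩
  have hzw2 : z ∈ later H pos w' := ⟨(h.adj_of_G (s.U_mem z hzU) hw' hzw').symm, hwz''⟩
  refine h.later_of_anc hzw2 (by rw [hb]; exact k3') ?_
  exact lt_of_le_of_lt (h.anc_le (hba.trans hwq')) hz.2

/-- A vertex of `U` that is not in `L` has a `bot`. -/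
theorem bot_spec (s : Spec) (h : Tree) {z : ℕ} (hz : U z) (hl : ¬ l0 z) :
    lt (bot z) = lt z ∧ U (bot z) ∧ z ∈ later H pos (bot z) ∧
      ∀ q, U q → z ∈ later H pos q → Anc O par (bot z) q ∧ lt q = lt z := by
  rcases (s.U_iff z (s.U_mem z hz)).1 hz with hN | ⟨y, hy, hU, rfl⟩
  · exact absurd ((s.l0_iff z hz).2 (.inl hN)) hl
  · have := s.lt_eq_of_later h hU (h.par_later hy (s.U_mem _ hz)) hl
    refine ⟨this.2.1, this.2.2.1, this.2.2.2.2, fun q hq hzq => ?_⟩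
    have := s.lt_eq_of_later h hq hzq hl
    exact ⟨this.2.2.2.1, this.1⟩

end BotSpec

namespace InsertSpec

variable {G H : SimpleGraph ℕ} {O : Set ℕ} {none v : ℕ}
  {pos par d hv ua dep lt bot gl cnt : ℕ → ℕ} {U l0 L : ℕ → Prop}

local notation "Spec" => InsertSpec G O none v pos par d hv ua dep lt bot gl cnt U l0 L
local notation "Tree" => ElimTree G H O none pos par d

/-- The vertices `t` whose later neighbours are forced to be in `L`. -/
def Good (par d lt cnt : ℕ → ℕ) (t : ℕ) : Prop :=
  lt t = t ∨ d t + cnt (par t) < d (par t) + 1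

/-- The top of the heavy path is good, so the upward search along the path stops. The first good
vertex it meets is the deepest one, which is why only its depth has to be stored. -/
theorem gl_spec (s : Spec) (h : Tree) {t : ℕ} (ht : U t) :
    (∃ t', Anc O par t t' ∧ lt t' = lt t ∧ Good par d lt cnt t' ∧ gl t = dep t') ∧
    ∀ t', Anc O par t t' → lt t' = lt t → Good par d lt cnt t' → dep t' ≤ gl t := by
  generalize hk : dep t = k
  induction k using Nat.strong_induction_on generalizing t with
  | _ k ih =>
    have he := s.gl_eq t ht
    split_ifs at he with hc
    · refine ⟨⟨t, .refl, rfl, hc, he⟩, fun t' h1 _ _ => ?_⟩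
      rw [he]
      exact s.dep_le ht h1
    · push Not at hc
      obtain ⟨h1, h2, h3, h4⟩ := s.heavy_of_lt_ne h ht hc.1
      obtain ⟨⟨t', k1, k2, k3, k4⟩, k5⟩ :=
        ih (dep (par t)) (by rw [← hk, s.dep_eq t ht]; omega) h1 rfl
      refine ⟨⟨t', .head ⟨s.U_mem t ht, h2, rfl⟩ k1, k2.trans h3.symm, k3, he.trans k4⟩,
        fun t' m1 m2 m3 => ?_⟩
      rw [he]
      refine k5 t' (ElimTree.anc_par_of_ne m1 ?_) (m2.trans h3) m3
      rintro rfl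
      rcases m3 with m3 | m3
      · exact hc.1 m3
      · omega

/-- The later neighbours of a good vertex belong to `L`. -/
theorem L_of_good (s : Spec) (h : Tree) {t z : ℕ} (ht : U t) (hg : Good par d lt cnt t)
    (hz : z ∈ later H pos t) : L z := by
  have hzU := s.later_U h ht hz
  rw [s.L_iff]
  refine ⟨hzU, ?_⟩
  by_contra hn
  push Not at hn
  obtain ⟨h1, h2, h3, h4⟩ := s.bot_spec h hzU hn.1
  obtain ⟨h5, h6⟩ := h4 t ht hz
  have := (s.gl_spec h h2).2 t h5 (h6.trans h1.symm) hg
  rcases s.dep_anc ht (h.anc_of_later hz) with rfl | hd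
  · exact absurd hz.2 (lt_irrefl _)
  · omega

theorem not_l0 (s : Spec) {z : ℕ} (hz : U z) (hL : ¬ L z) : ¬ l0 z :=
  fun h => hL ((s.L_iff z).2 ⟨hz, .inl h⟩)

/-- `t` and its later neighbours. -/
def bag (H : SimpleGraph ℕ) (pos : ℕ → ℕ) (t : ℕ) : Set ℕ := insert t (later H pos t)

theorem bag_clique (h : Tree) {t a b : ℕ} (ha : a ∈ bag H pos t) (hb : b ∈ bag H pos t)
    (hab : a ≠ b) : H.Adj a b := by
  rcases ha with rfl | ha <;> rcases hb with rfl | hb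
  · exact absurd rfl hab
  · exact hb.1
  · exact ha.1.symm
  · exact h.clique t a b ha hb hab

theorem later_sub_bag_par (h : Tree) {t : ℕ} : later H pos t ⊆ bag H pos (par t) :=
  fun _ hz => h.later_par hz

theorem bag_finite (h : Tree) (t : ℕ) : (bag H pos t).Finite := (h.later_finite t).insert t

theorem bag_ncard (h : Tree) {t : ℕ} (ht : t ∈ O) : (bag H pos t).ncard = d t + 1 := by
  rw [bag, Set.ncard_insert_of_notMem (fun hm => lt_irrefl _ hm.2) (h.later_finite t), h.d_eq t ht]

theorem bag_U (s : Spec) (h : Tree) {t z : ℕ} (ht : U t) (hz : z ∈ bag H pos t) : U z := by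
  rcases hz with rfl | hz
  · exact ht
  · exact s.later_U h ht hz

/-- The vertices with `bot z = t` that are not in `L`. -/
def bucket (bot : ℕ → ℕ) (U L : ℕ → Prop) (t : ℕ) : Set ℕ := {z | U z ∧ ¬ L z ∧ bot z = t}

/-- On a heavy path, a vertex outside of `L` leaves the bags at its `bot`. -/
theorem mem_bucket_iff (s : Spec) (h : Tree) {t z : ℕ} (ht : U t) (hl : lt t ≠ t)
    (hz : z ∈ bag H pos (par t)) (hL : ¬ L z) :
    z ∈ bucket bot U L (par t) ↔ z ∉ later H pos t := by
  obtain ⟨h1, h2, h3, h4⟩ := s.heavy_of_lt_ne h ht hl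
  have hzU := s.bag_U h h1 hz
  obtain ⟨k1, k2, k3, k4⟩ := s.bot_spec h hzU (s.not_l0 hzU hL)
  constructor
  · rintro ⟨-, -, he⟩ hzt
    have := h.anc_le (k4 t ht hzt).1
    have := (h.par_later (s.U_mem t ht) h2).2
    rw [he] at *
    omega
  · intro hzt
    refine ⟨hzU, hL, ?_⟩
    have hbp : Anc O par (bot z) (par t) ∧ lt z = lt (par t) := by
      rcases hz with rfl | hz
      · exact ⟨h.anc_of_later k3, rfl⟩
      · obtain ⟨m1, m2⟩ := k4 _ h1 hz
        exact ⟨m1, m2.symm⟩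
    by_contra hne
    apply hzt
    -- A `bot` strictly below `par t` on this path is at `t` or below it, and then `z` would still
    -- be a later neighbour of `t`.
    have hd : dep t ≤ dep (bot z) := by
      rcases s.dep_anc k2 hbp.1 with h5 | h5
      · exact absurd h5 hne
      · rw [s.dep_eq t ht]; omega
    have hbt : Anc O par (bot z) t :=
      s.anc_of_lt_eq h ht k2 (by rw [h3, k1, hbp.2]) hd
    refine h.later_of_anc k3 hbt ?_
    have := (h.par_later (s.U_mem t ht) h2).2
    rcases hz with rfl | hz
    · exact this
    · exact this.trans hz.2

theorem bucket_sub (s : Spec) (h : Tree) {t : ℕ} : bucket bot U L t ⊆ bag H pos t := by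
  rintro z ⟨hz, hL, rfl⟩
  exact .inr (s.bot_spec h hz (s.not_l0 hz hL)).2.2.1

theorem bucket_finite (s : Spec) (h : Tree) (t : ℕ) : (bucket bot U L t).Finite :=
  h.fin.subset fun z hz => s.U_mem z hz.1

/-- If a vertex of `L` leaves the bags at `t`, then the later neighbours of `t` are in `L`. -/
theorem L_of_leave (s : Spec) (h : Tree) {t e z : ℕ} (ht : U t)
    (he : e ∈ bag H pos (par t)) (het : e ∉ later H pos t) (heL : L e)
    (hz : z ∈ later H pos t) : L z := by
  by_cases hl : lt t = t
  · exact s.L_of_good h ht (.inl hl) hz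
  · obtain ⟨h1, h2, h3, h4⟩ := s.heavy_of_lt_ne h ht hl
    refine s.L_of_good h ht (.inr ?_) hz
    have hfin := h.later_finite t
    -- The later neighbours of `t`, the vertex `e`, and the bucket of the parent are disjoint parts
    -- of the bag of the parent. Counting them yields the strict inequality that makes `t` good.
    have hsub : later H pos t ∪ insert e (bucket bot U L (par t)) ⊆ bag H pos (par t) := by
      rintro x (hx | rfl | hx)
      · exact later_sub_bag_par h hx
      · exact he
      · exact s.bucket_sub h hx
    have hle := Set.ncard_le_ncard hsub (bag_finite h _)
    have hdis : Disjoint (later H pos t) (insert e (bucket bot U L (par t))) := by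
      rw [Set.disjoint_left]
      rintro x hx (rfl | hx')
      · exact het hx
      · exact (s.mem_bucket_iff h ht hl (s.bucket_sub h hx') hx'.2.1).1 hx' hx
    rw [Set.ncard_union_eq hdis hfin ((s.bucket_finite h _).insert e), bag_ncard h h2,
      Set.ncard_insert_of_notMem (fun hm => hm.2.1 heL) (s.bucket_finite h _),
      ← h.d_eq t (s.U_mem t ht)] at hle
    have := s.cnt_eq (par t) h1
    unfold bucket at hle
    omega

/-- The set `L` is contained in every set that keeps the graph chordal. -/
theorem forced (s : Spec) (h : Tree) {M : Set ℕ} (hM : ∀ y ∈ O, G.Adj v y → y ∈ M)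
    (hc : IsChordal (addVertex H v M)) {z : ℕ} (hz : L z) : z ∈ M := by
  have hvO := s.v_not
  have hvH : ∀ x, ¬ H.Adj v x := fun x hx => hvO (h.supp _ _ hx)
  have sub_not : ∀ {q y}, Anc O par q y → y ∈ O → q ≠ v := by
    rintro q y hq hy rfl
    rcases h.anc_pos hq with rfl | hh
    · exact hvO hy
    · exact hvO hh.2.1
  -- the separator between the subtree of `t` and a vertex `e`
  have leave : ∀ t e z, U t → e ∈ bag H pos (par t) → e ∉ later H pos t → e ∈ M →
      z ∈ later H pos t → z ∈ M := by
    intro t e z ht he het heM hz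
    have hpz := later_sub_bag_par h hz
    have hze : z ≠ e := fun hh => het (hh ▸ hz)
    have htO := s.U_mem t ht
    have hpO := (h.later_mem (h.par_mem_of_later hz)).2
    have hpl := h.par_mem_of_later hz
    have heA : ¬ Anc O par e t := fun hh => by
      have h1 := h.anc_le hh
      have h2 := hpl.2
      rcases he with rfl | he
      · omega
      · have := he.2
        omega
    obtain ⟨w, hw, hvw, hwt⟩ := s.exists_nbr h ht
    refine mem_of_isChordal_addVertex (A := {x | Anc O par x t}) (B := {e}) (a := t) (b := e)
      (l := w) (l' := e) hc (fun hh => sub_not hh htO rfl) ?_ ?_ ?_ hze ?_ ?_ hvH .refl hz.1.symm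
      rfl (bag_clique h hpz he hze) (hM w hw hvw) (h.connected_subtree .refl hwt) heM .refl
    · rintro rfl
      exact hvO (h.later_mem (h.par_mem_of_later hz) |>.2 |> fun _ => by
        rcases he with he | he
        · exact he ▸ hpO
        · exact (h.later_mem he).2)
    · rintro rfl
      exact hvO (h.later_mem hz).2
    · intro hh
      have := h.anc_le hh
      have := hz.2
      omega
    · rw [Set.disjoint_left]
      rintro x hx rfl
      exact heA hx
    · rintro a ha b rfl hab
      exact het (h.later_of_adj_subtree ha hab heA)
  -- The top `t` of a heavy path has a heavy sibling `g`. The subtrees of `t` and `g` are disjoint,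
  -- not joined by edges, and both contain neighbours of `v`. If `z` is a later neighbour of both
  -- roots, these subtrees force it into `M`.
  have light : ∀ t z, U t → lt t = t → z ∈ later H pos t → z ∈ M := by
    intro t z ht hl hz
    have htO := s.U_mem t ht
    have hpl := h.par_mem_of_later hz
    have hpO := (h.later_mem hpl).2
    obtain ⟨hhU, hhp, hhd⟩ := s.hv_spec t htO ht hpO
    generalize hg : hv (par t) = g at hhU hhp hhd
    have hgO := s.U_mem g hhU
    have hgt : g ≠ t := by
      rintro rfl
      have h1 := s.lt_eq g ht
      rw [if_pos hg, hl] at h1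
      have h2 := h.anc_le (s.lt_anc h (s.later_U h ht hpl)).1
      rw [← h1] at h2
      have := hpl.2
      omega
    have hgl := h.par_later hgO (hhp ▸ hpO)
    rw [hhp] at hgl
    have hdisj : ∀ x, Anc O par x t → Anc O par x g → False := by
      intro x hx hx'
      rcases ElimTree.anc_total hx hx' with h1 | h1
      · have h2 := h.anc_le (ElimTree.anc_par_of_ne h1 (Ne.symm hgt))
        have := hgl.2
        omega
      · have h2 := ElimTree.anc_par_of_ne h1 hgt
        rw [hhp] at h2
        have := h.anc_le h2
        have := hpl.2
        omega
    have hnadj : ∀ a, Anc O par a t → ∀ b, Anc O par b g → ¬ H.Adj a b := by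
      intro a ha b hb hab
      rcases h.adj_cases hab with h1 | h1
      · exact hdisj a ha ((h.anc_of_later h1).trans hb)
      · exact hdisj b ((h.anc_of_later h1).trans ha) hb
    obtain ⟨w, hw, hvw, hwt⟩ := s.exists_nbr h ht
    obtain ⟨w', hw', hvw', hwg⟩ := s.exists_nbr h hhU
    have hzO := (h.later_mem hz).2
    have hzv : z ≠ v := fun he => hvO (he ▸ hzO)
    have hzt : ¬ Anc O par z t := fun hh => by
      have := h.anc_le hh
      have := hz.2
      omega
    have hpz : pos (par t) ≤ pos z := h.par_le t htO z hz
    have hzg : ¬ Anc O par z g := fun hh => by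
      have := h.anc_le hh
      have := hgl.2
      omega
    by_cases hcase : z ∈ later H pos g
    · exact mem_of_isChordal_addVertex (A := {x | Anc O par x t}) (B := {x | Anc O par x g})
        (a := t) (b := g) (l := w) (l' := w') hc (fun hh => sub_not hh htO rfl)
        (fun hh => sub_not hh hgO rfl) hzv hzt hzg (Set.disjoint_left.2 hdisj) hnadj hvH .refl
        hz.1.symm .refl hcase.1.symm (hM w hw hvw) (h.connected_subtree .refl hwt)
        (hM w' hw' hvw') (h.connected_subtree .refl hwg)
    · obtain ⟨e, heg, het⟩ : ∃ e ∈ later H pos g, e ∉ later H pos t := by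
        by_contra hn
        push Not at hn
        have h1 : (insert z (later H pos g)).ncard ≤ (later H pos t).ncard :=
          Set.ncard_le_ncard (Set.insert_subset hz hn) (h.later_finite t)
        rw [Set.ncard_insert_of_notMem hcase (h.later_finite g), ← h.d_eq t htO,
          ← h.d_eq g hgO] at h1
        omega
      have hep : e ∈ bag H pos (par t) := hhp ▸ later_sub_bag_par h heg
      have hzp : z ∈ bag H pos (par t) := later_sub_bag_par h hz
      have hze : z ≠ e := fun hh => hcase (hh ▸ heg)
      have heO := (h.later_mem heg).2
      have het' : ¬ Anc O par e t := fun hh => by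
        have h1 := h.anc_le hh
        have h2 := h.par_le g hgO e heg
        rw [hhp] at h2
        have := hpl.2
        omega
      have hrt : Relation.ReflTransGen
          (fun s t => H.Adj s t ∧ t ∈ insert e {x | Anc O par x g}) e w' := by
        refine .head ⟨heg.1.symm, .inr .refl⟩ ?_
        refine Relation.ReflTransGen.mono (fun a b hab => ?_) _ _ (h.connected_subtree .refl hwg)
        exact ⟨hab.1, .inr hab.2⟩
      refine mem_of_isChordal_addVertex (A := {x | Anc O par x t})
        (B := insert e {x | Anc O par x g})
        (a := t) (b := e) (l := w) (l' := w') hc (fun hh => sub_not hh htO rfl)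
        ?_ hzv hzt ?_ ?_ ?_ hvH .refl
        hz.1.symm (.inl rfl) (bag_clique h hzp hep hze) (hM w hw hvw)
        (h.connected_subtree .refl hwt) (hM w' hw' hvw') hrt
      · rintro (rfl | hh)
        · exact hvO heO
        · exact sub_not hh hgO rfl
      · rintro (hh | hh)
        · exact hze hh
        · exact hzg hh
      · rw [Set.disjoint_left]
        rintro x hx (rfl | hx')
        · exact het' hx
        · exact hdisj x hx hx'
      · rintro a ha b (rfl | hb) hab
        · exact het (h.later_of_adj_subtree ha hab het')
        · exact hnadj a ha b hb hab
  have l0M : ∀ z, U z → l0 z → z ∈ M := by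
    intro z hz hl
    rcases (s.l0_iff z hz).1 hl with hN | ⟨w, hw, hzw, hwz, hd⟩
    · exact hM z (s.U_mem z hz) hN
    · have hzw' : z ∈ later H pos w := ⟨(h.adj_of_G (s.U_mem z hz) hw hzw).symm, hwz⟩
      obtain ⟨h1, h2, h3⟩ := s.ua_spec hw (h.anc_of_later hzw') hz
      obtain ⟨h4, h5⟩ := s.lt_anc h h1
      have h6 : Anc O par (lt (ua w)) z := by
        rcases ElimTree.anc_total h3 h4 with h7 | h7
        · have := s.dep_le hz h7
          omega
        · exact h7
      refine light _ z (s.lt_U h h1) h5 (h.later_of_anc hzw' (h2.trans h4) ?_)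
      rcases h.anc_pos h6 with h7 | h7
      · rw [h7] at hd
        exact absurd hd (lt_irrefl _)
      · exact h7.1
  -- Induction on the depth: a vertex of `L` that leaves at `t` owes its membership to a recognition
  -- by `l0` or to a good vertex higher on the same path.
  have good : ∀ k t, dep t = k → U t → Good par d lt cnt t → ∀ z ∈ later H pos t, z ∈ M := by
    intro k
    induction k using Nat.strong_induction_on with
    | _ k ih =>
      intro t hk ht hg z hz
      by_cases hl : lt t = t
      · exact light t z ht hl hz
      obtain ⟨h1, h2, h3, h4⟩ := s.heavy_of_lt_ne h ht hl
      have hg' := hg.resolve_left hl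
      -- If every leaving vertex were in the bucket of the parent, the bag of the parent would have
      -- at most `d t + cnt (par t)` elements.
      have hex : ∃ e ∈ bag H pos (par t), e ∉ later H pos t ∧ e ∉ bucket bot U L (par t) := by
        by_contra hn
        push Not at hn
        have hsub : bag H pos (par t) ⊆ later H pos t ∪ bucket bot U L (par t) := fun e he => by
          by_cases hh : e ∈ later H pos t
          · exact .inl hh
          · exact .inr (hn e he hh)
        have h5 := (Set.ncard_le_ncard hsub ((h.later_finite t).union (s.bucket_finite h _))).trans
          (Set.ncard_union_le _ _)
        rw [bag_ncard h h2, ← h.d_eq t (s.U_mem t ht)] at h5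
        have h6 := s.cnt_eq (par t) h1
        unfold bucket at h5
        omega
      obtain ⟨e, he, het, heb⟩ := hex
      have heU := s.bag_U h h1 he
      have heL : L e := by
        by_contra hL
        exact heb ((s.mem_bucket_iff h ht hl he hL).2 het)
      refine leave t e z ht he het ?_ hz
      rcases ((s.L_iff e).1 heL).2 with h5 | h5
      · exact l0M e heU h5
      by_cases hl0 : l0 e
      · exact l0M e heU hl0
      obtain ⟨k1, k2, k3, k4⟩ := s.bot_spec h heU hl0
      obtain ⟨⟨t', m1, m2, m3, m4⟩, -⟩ := s.gl_spec h k2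
      have hlt : lt e = lt t := by
        rw [h3]
        rcases he with rfl | he
        · rfl
        · exact (k4 _ h1 he).2.symm
      have ht'U := s.U_anc k2 m1
      have he' : e ∈ later H pos t' := by
        have h6 : Anc O par t' e := s.anc_of_dep_le heU m1 (h.anc_of_later k3) (by omega)
        refine h.later_of_anc k3 m1 ?_
        rcases h.anc_pos h6 with h7 | h7
        · rw [m4, h7] at h5
          exact absurd h5 (lt_irrefl _)
        · exact h7.1
      -- The vertex `e` is a later neighbour of `t'` but no longer of `t`, so `t'` is strictly above
      -- `t` on the path.
      have hdt : dep t' < dep t := by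
        by_contra hd
        push Not at hd
        refine het (h.later_of_anc he' (s.anc_of_lt_eq h ht ht'U
          (by rw [m2, k1, hlt]) hd) ?_)
        have h6 := (h.par_later (s.U_mem t ht) h2).2
        rcases he with rfl | he
        · exact h6
        · exact h6.trans he.2
      exact ih (dep t') (hk ▸ hdt) t' rfl ht'U m3 e he'
  obtain ⟨hzU, hz'⟩ := (s.L_iff z).1 hz
  by_cases hl0 : l0 z
  · exact l0M z hzU hl0
  obtain ⟨k1, k2, k3, k4⟩ := s.bot_spec h hzU hl0
  obtain ⟨⟨t', m1, m2, m3, m4⟩, -⟩ := s.gl_spec h k2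
  have h5 := hz'.resolve_left hl0
  refine good _ t' rfl (s.U_anc k2 m1) m3 z ?_
  have h6 : Anc O par t' z := s.anc_of_dep_le hzU m1 (h.anc_of_later k3) (by omega)
  refine h.later_of_anc k3 m1 ?_
  rcases h.anc_pos h6 with h7 | h7
  · rw [m4, h7] at h5
    exact absurd h5 (lt_irrefl _)
  · exact h7.1

end InsertSpec

/-! ### The elimination tree after an insertion -/

/-- The new elimination order `nrk`: first the vertices outside of `U`, then those of `U` outside of
`L`, then `L`, and `v` last. -/
structure OrderSpec (O : Set ℕ) (v : ℕ) (pos bot nrk : ℕ → ℕ) (U L : ℕ → Prop) : Prop where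
  inj : Set.InjOn nrk (insert v O)
  lt_v : ∀ y ∈ O, nrk y < nrk v
  nonU_U : ∀ y ∈ O, ¬ U y → ∀ z, U z → nrk y < nrk z
  nonU : ∀ y ∈ O, ¬ U y → ∀ z ∈ O, ¬ U z → pos y < pos z → nrk y < nrk z
  nonL_L : ∀ y, U y → ¬ L y → ∀ z, L z → nrk y < nrk z
  mem_L : ∀ y z, L y → L z → pos y < pos z → nrk y < nrk z
  nonL : ∀ y, U y → ¬ L y → ∀ z, U z → ¬ L z → pos (bot z) < pos (bot y) → nrk y < nrk z

open Classical in
/-- The rules by which the elimination tree is updated. -/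
structure UpdateSpec (G : SimpleGraph ℕ) (O : Set ℕ) (none v : ℕ)
    (par d dep lt bot cnt nrk rt r la npar nd : ℕ → ℕ) (U L : ℕ → Prop) : Prop where
  par_nonU : ∀ y ∈ O, ¬ U y → ¬ U (par y) → npar y = par y
  d_nonU : ∀ y ∈ O, ¬ U y → nd y = d y
  rt_eq : ∀ y ∈ O, ¬ U y → rt y = if U (par y) then y else rt (par y)
  rt_none : rt none = none
  top_mem : ∀ y ∈ O, ¬ U y → U (par y) → npar y = none ∨
    ∃ x ∈ O, ¬ U x ∧ rt x = y ∧ G.Adj x (npar y) ∧ U (npar y)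
  top_le : ∀ y ∈ O, ¬ U y → U (par y) → ∀ x ∈ O, ¬ U x → rt x = y → ∀ z, U z → G.Adj x z →
    npar y ≠ none ∧ nrk (npar y) ≤ nrk z
  r_eq : ∀ t, U t → r t = if lt t = t then 0 else r (par t) + (if L (par t) then 0 else 1) -
    cnt (par t)
  la_eq : ∀ t, U t → la t = if par t = none then v else if L (par t) then par t else la (par t)
  par_L : ∀ y, L y → npar y = la y
  d_L : ∀ y, L y → nd y = d y + 1 - r y
  par_nonL : ∀ y, U y → ¬ L y →
    (U (npar y) ∧ ¬ L (npar y) ∧ lt (bot (npar y)) = lt (bot y) ∧ dep (npar y) ≤ dep (bot y) ∧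
      nrk y < nrk (npar y) ∧ ∀ z, U z → ¬ L z → lt (bot z) = lt (bot y) → dep z ≤ dep (bot y) →
      nrk y < nrk z → nrk (npar y) ≤ nrk z) ∨
    (npar y = bot y ∧ ∀ z, U z → ¬ L z → lt (bot z) = lt (bot y) → dep z ≤ dep (bot y) →
      ¬ nrk y < nrk z)
  d_nonL : ∀ y, U y → ¬ L y →
    nd y = d (bot y) + 1 - {z | U z ∧ ¬ L z ∧ bot z = bot y ∧ nrk z ≤ nrk y}.ncard
  par_v : npar v = none
  d_v : nd v = 0

namespace InsertSpec

variable {G H : SimpleGraph ℕ} {O : Set ℕ} {none v : ℕ}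
  {pos par d hv ua dep lt bot gl cnt nrk rt r la npar nd : ℕ → ℕ} {U l0 L : ℕ → Prop}

local notation "Spec" => InsertSpec G O none v pos par d hv ua dep lt bot gl cnt U l0 L
local notation "Tree" => ElimTree G H O none pos par d
local notation "Order" => OrderSpec O v pos bot nrk U L
local notation "Upd" => UpdateSpec G O none v par d dep lt bot cnt nrk rt r la npar nd U L

theorem L_U (s : Spec) {z : ℕ} (hz : L z) : U z := ((s.L_iff z).1 hz).1

/-- The vertices of `L` among the neighbours of `y` remain in the bags down to `bot y`. -/
theorem mem_bag_of_anc (s : Spec) (h : Tree) {t y q z : ℕ} (ht : U t) (hy : y ∈ later H pos t)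
    (hyL : ¬ L y) (hz : L z) (htq : Anc O par t q) (hzq : z ∈ bag H pos q)
    (hqy : pos q ≤ pos y) : z ∈ bag H pos t := by
  induction htq using Relation.ReflTransGen.head_induction_on with
  | refl => exact hzq
  | @head a b hab hbq ih =>
    obtain ⟨h1, h2, rfl⟩ := hab
    have hpU : U (par a) := s.U_anc ht (.single ⟨h1, h2, rfl⟩)
    have hzb : z ∈ bag H pos (par a) := by
      rcases h.later_par hy with rfl | hy'
      · rcases h.anc_pos hbq with he | hlt
        · rw [he]; exact hzq
        · omega
      · exact ih hpU hy'
    by_contra hn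
    exact hyL (s.L_of_leave h ht hzb (fun hh => hn (.inr hh)) hz hy)

theorem supp_addVertex (s : Spec) (h : Tree) {y z : ℕ}
    (hyz : (addVertex H v {z | L z}).Adj y z) : y ∈ insert v O := by
  rcases hyz with hh | hh | hh
  · exact .inr (h.supp _ _ hh)
  · exact .inl hh.1
  · exact .inr (s.U_mem _ (s.L_U hh.2.1))

theorem later_v (s : Spec) (h : Tree) (o : Order) :
    later (addVertex H v {z | L z}) nrk v = ∅ := by
  ext z
  refine ⟨fun hz => ?_, fun hz => absurd hz (Set.notMem_empty _)⟩
  rcases s.supp_addVertex h hz.1.symm with rfl | hh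
  · exact absurd hz.2 (lt_irrefl _)
  · exact absurd hz.2 (not_lt.2 (o.lt_v z hh).le)

/-- The set `U` is closed under passing to ancestors, so moving it behind all other vertices turns
no earlier neighbour of a vertex outside of `U` into a later one. -/
theorem later_nonU (s : Spec) (h : Tree) (o : Order) {y : ℕ} (hy : y ∈ O) (hyU : ¬ U y) :
    later (addVertex H v {z | L z}) nrk y = later H pos y := by
  ext z
  constructor
  · rintro ⟨hyz, hlt⟩
    have hyz' : H.Adj y z := by
      rcases hyz with hh | hh | hh
      · exact hh
      · exact absurd (hh.1 ▸ hy) s.v_not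
      · exact absurd (s.L_U hh.2.1) hyU
    have hzO := (h.supp' hyz').2
    rcases h.adj_cases hyz' with h1 | h1
    · exact h1
    · by_cases hzU : U z
      · exact absurd (s.later_U h hzU h1) hyU
      · have := o.nonU z hzO hzU y hy hyU h1.2
        omega
  · intro hz
    have hzO := (h.later_mem hz).2
    refine ⟨.inl hz.1, ?_⟩
    by_cases hzU : U z
    · exact o.nonU_U y hy hyU z hzU
    · exact o.nonU y hy hyU z hzO hzU hz.2

theorem later_L (s : Spec) (h : Tree) (o : Order) {y : ℕ} (hyL : L y) :
    later (addVertex H v {z | L z}) nrk y = insert v {z | z ∈ later H pos y ∧ L z} := by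
  have hy := s.U_mem y (s.L_U hyL)
  have hyv : y ≠ v := fun he => s.v_not (he ▸ hy)
  ext z
  constructor
  · rintro ⟨hyz, hlt⟩
    rcases hyz with hh | hh | hh
    · right
      have hzO := (h.supp' hh).2
      have hzL : L z := by
        by_contra hzL
        by_cases hzU : U z
        · have := o.nonL_L z hzU hzL y hyL
          omega
        · have := o.nonU_U z hzO hzU y (s.L_U hyL)
          omega
      refine ⟨?_, hzL⟩
      rcases h.adj_cases hh with h1 | h1
      · exact h1
      · have := o.mem_L z y hzL hyL h1.2
        omega
    · exact absurd hh.1 hyv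
    · exact .inl hh.1
  · rintro (rfl | ⟨hz, hzL⟩)
    · exact ⟨.inr (.inr ⟨rfl, hyL, hyv⟩), o.lt_v y hy⟩
    · exact ⟨.inl hz.1, o.mem_L y z hyL hzL hz.2⟩

/-- Everything that follows `y` in the new order and is adjacent to it is still in the bag of `bot
y`: elements of `L` because otherwise rule (b) would force `y` into `L`, the others because the
order is descending in `bot`. A bag is a clique, so it is allowed to eliminate `y` there. -/
theorem later_nonL (s : Spec) (h : Tree) (o : Order) {y : ℕ} (hyU : U y) (hyL : ¬ L y) :
    later (addVertex H v {z | L z}) nrk y =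
      {z | z ∈ bag H pos (bot y) ∧ (L z ∨ nrk y < nrk z)} := by
  have hy := s.U_mem y hyU
  obtain ⟨k1, k2, k3, k4⟩ := s.bot_spec h hyU (s.not_l0 hyU hyL)
  ext z
  constructor
  · rintro ⟨hyz, hlt⟩
    have hyz' : H.Adj y z := by
      rcases hyz with hh | hh | hh
      · exact hh
      · exact absurd (hh.1 ▸ hy) s.v_not
      · exact absurd hh.2.1 hyL
    have hzO := (h.supp' hyz').2
    have hzU : U z := by
      by_contra hzU
      have := o.nonU_U z hzO hzU y hyU
      omega
    refine ⟨?_, .inr hlt⟩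
    by_cases hzL : L z
    · rcases h.adj_cases hyz' with h1 | h1
      · exact s.mem_bag_of_anc h k2 k3 hyL hzL (h.anc_of_later k3) (.inr h1) le_rfl
      · exact s.mem_bag_of_anc h k2 k3 hyL hzL (k4 z hzU h1).1 (.inl rfl) h1.2.le
    · obtain ⟨m1, m2, m3, m4⟩ := s.bot_spec h hzU (s.not_l0 hzU hzL)
      have hltz : lt z = lt y := by
        rcases h.adj_cases hyz' with h1 | h1
        · exact (m4 y hyU h1).2.symm
        · exact (k4 z hzU h1).2
      -- With a higher `bot`, the vertex `z` would come before `y` in the new order.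
      have hbz : pos (bot z) ≤ pos (bot y) := by
        by_contra hh
        have := o.nonL z hzU hzL y hyU hyL (by omega)
        omega
      have hanc : Anc O par (bot z) (bot y) := by
        rcases le_total (dep (bot y)) (dep (bot z)) with hd | hd
        · exact s.anc_of_lt_eq h k2 m2 (by rw [k1, m1, hltz]) hd
        · have h1 := s.anc_of_lt_eq h m2 k2 (by rw [k1, m1, hltz]) hd
          rcases h.anc_pos h1 with h2 | h2
          · rw [h2]; exact .refl
          · omega
      by_cases hzb : z = bot y
      · exact .inl hzb
      · right
        refine h.later_of_anc m3 hanc ?_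
        rcases h.adj_cases hyz' with h1 | h1
        · exact k3.2.trans h1.2
        · rcases h.anc_pos (k4 z hzU h1).1 with h2 | h2
          · exact absurd h2.symm hzb
          · exact h2.1
  · rintro ⟨hz, hz'⟩
    have hlt : nrk y < nrk z := by
      rcases hz' with hzL | hlt
      · exact o.nonL_L y hyU hyL z hzL
      · exact hlt
    refine ⟨.inl (bag_clique h (.inr k3) hz ?_), hlt⟩
    rintro rfl
    exact lt_irrefl _ hlt

theorem later_clique (s : Spec) (h : Tree) (o : Order) (y a b : ℕ)
    (ha : a ∈ later (addVertex H v {z | L z}) nrk y)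
    (hb : b ∈ later (addVertex H v {z | L z}) nrk y) (hab : a ≠ b) :
    (addVertex H v {z | L z}).Adj a b := by
  rcases s.supp_addVertex h ha.1 with rfl | hy
  · rw [s.later_v h o] at ha
    exact ha.elim
  by_cases hyU : U y
  · by_cases hyL : L y
    · rw [s.later_L h o hyL] at ha hb
      have hv : ∀ z, z ∈ later H pos y → L z → z ≠ v := fun z hz _ he =>
        s.v_not (he ▸ (h.later_mem hz).2)
      rcases ha with rfl | ⟨ha, haL⟩ <;> rcases hb with rfl | ⟨hb, hbL⟩
      · exact absurd rfl hab
      · exact .inr (.inl ⟨rfl, hbL, hv _ hb hbL⟩)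
      · exact .inr (.inr ⟨rfl, haL, hv _ ha haL⟩)
      · exact .inl (h.clique y a b ha hb hab)
    · rw [s.later_nonL h o hyU hyL] at ha hb
      exact .inl (bag_clique h ha.1 hb.1 hab)
  · rw [s.later_nonU h o hy hyU] at ha hb
    exact .inl (h.clique y a b ha hb hab)

/-- Chordality is witnessed by the new elimination order, minimality by the fact that every element
of `L` is forced. -/
theorem isMinimalTriangulation_addVertex (s : Spec) (h : Tree) (o : Order) :
    IsMinimalTriangulation (restr G (insert v O)) (addVertex H v {z | L z}) := by
  refine h.min.insert s.v_not (fun y hy hvy => ?_) ?_ fun M _ hM hc z hz => ?_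
  · have hyU : U y := (s.U_iff y hy).2 (.inl hvy)
    exact (s.L_iff y).2 ⟨hyU, .inl ((s.l0_iff y hyU).2 (.inl hvy))⟩
  · exact isChordal_of_perfectElimination nrk
      (fun x y hxy he => hxy.ne (o.inj (s.supp_addVertex h hxy) (s.supp_addVertex h hxy.symm) he))
      fun y a b hya hyb ha hb hab => s.later_clique h o y a b ⟨hya, ha⟩ ⟨hyb, hb⟩ hab
  · exact s.forced h hM hc hz

/-- From the parent to `t`, the later neighbours outside of `L` gain the parent itself, if it is
outside of `L`, and lose exactly its bucket. At the top of a heavy path there are none, as all later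
neighbours are in `L`. -/
theorem r_spec (s : Spec) (h : Tree) (u : Upd) {t : ℕ} (ht : U t) :
    r t = {z | z ∈ later H pos t ∧ ¬ L z}.ncard := by
  generalize hk : dep t = k
  induction k using Nat.strong_induction_on generalizing t with
  | _ k ih =>
    rw [u.r_eq t ht]
    split_ifs with hl hpL
    · have : {z | z ∈ later H pos t ∧ ¬ L z} = ∅ := by
        ext z
        simp only [Set.mem_ofPred_eq, Set.mem_empty_iff_false, iff_false, not_and, not_not]
        exact fun hz => s.L_of_good h ht (.inl hl) hz
      rw [this, Set.ncard_empty]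
    all_goals
      obtain ⟨h1, h2, h3, h4⟩ := s.heavy_of_lt_ne h ht hl
      have hr := ih (dep (par t)) (by rw [← hk, s.dep_eq t ht]; omega) h1 rfl
      have hc := s.cnt_eq (par t) h1
      have hset : {z | z ∈ bag H pos (par t) ∧ ¬ L z} =
          {z | z ∈ later H pos t ∧ ¬ L z} ∪ bucket bot U L (par t) := by
        ext z
        constructor
        · rintro ⟨hz, hzL⟩
          by_cases hzt : z ∈ later H pos t
          · exact .inl ⟨hzt, hzL⟩
          · exact .inr ((s.mem_bucket_iff h ht hl hz hzL).2 hzt)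
        · rintro (⟨hz, hzL⟩ | hz)
          · exact ⟨later_sub_bag_par h hz, hzL⟩
          · exact ⟨s.bucket_sub h hz, hz.2.1⟩
      have hdis : Disjoint {z | z ∈ later H pos t ∧ ¬ L z} (bucket bot U L (par t)) := by
        rw [Set.disjoint_left]
        rintro z ⟨hz, hzL⟩ hzb
        exact (s.mem_bucket_iff h ht hl (later_sub_bag_par h hz) hzL).1 hzb hz
      have hcard := congrArg Set.ncard hset
      have hfin : {z | z ∈ later H pos t ∧ ¬ L z}.Finite :=
        (h.later_finite t).subset fun z hz => hz.1
      have hfin' : {z | z ∈ later H pos (par t) ∧ ¬ L z}.Finite :=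
        (h.later_finite _).subset fun z hz => hz.1
      rw [Set.ncard_union_eq hdis hfin (s.bucket_finite h _)] at hcard
      unfold bucket at hcard
      rw [← hc] at hcard
    · have : {z | z ∈ bag H pos (par t) ∧ ¬ L z} = {z | z ∈ later H pos (par t) ∧ ¬ L z} := by
        ext z
        constructor
        · rintro ⟨rfl | hz, hzL⟩
          · exact absurd hpL hzL
          · exact ⟨hz, hzL⟩
        · rintro ⟨hz, hzL⟩
          exact ⟨.inr hz, hzL⟩
      rw [this] at hcard
      omega
    · have : {z | z ∈ bag H pos (par t) ∧ ¬ L z} =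
          insert (par t) {z | z ∈ later H pos (par t) ∧ ¬ L z} := by
        ext z
        constructor
        · rintro ⟨rfl | hz, hzL⟩
          · exact .inl rfl
          · exact .inr ⟨hz, hzL⟩
        · rintro (rfl | ⟨hz, hzL⟩)
          · exact ⟨.inl rfl, hpL⟩
          · exact ⟨.inr hz, hzL⟩
      rw [this, Set.ncard_insert_of_notMem (fun hm => lt_irrefl _ hm.1.2) hfin'] at hcard
      omega

theorem la_spec (s : Spec) (h : Tree) (u : Upd) {t : ℕ} (ht : U t) :
    (la t = v ∧ ∀ z, Anc O par t z → z ≠ t → ¬ L z) ∨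
      (L (la t) ∧ Anc O par t (la t) ∧ la t ≠ t ∧
        ∀ z, Anc O par t z → z ≠ t → L z → pos (la t) ≤ pos z) := by
  generalize hk : dep t = k
  induction k using Nat.strong_induction_on generalizing t with
  | _ k ih =>
    have he := u.la_eq t ht
    have htO := s.U_mem t ht
    rcases s.par_cases h ht with hp | ⟨hpO, hpU⟩
    · left
      rw [if_pos hp] at he
      refine ⟨he, fun z hz hne => ?_⟩
      rcases Relation.ReflTransGen.cases_head hz with h1 | ⟨c, ⟨_, hc, rfl⟩, h1⟩
      · exact absurd h1.symm hne
      · exact absurd (hp ▸ hc) h.none_not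
    · have hpn : par t ≠ none := (h.par_mem_iff htO).1 hpO
      have hlt := (h.par_later htO hpO).2
      rw [if_neg hpn] at he
      split_ifs at he with hpL
      · right
        rw [he]
        exact ⟨hpL, .single ⟨htO, hpO, rfl⟩, fun hh => by rw [hh] at hlt; exact lt_irrefl _ hlt,
          fun z hz hne _ => h.anc_le (ElimTree.anc_par_of_ne hz (Ne.symm hne))⟩
      · have step : Anc O par t (par t) := .single ⟨htO, hpO, rfl⟩
        rcases ih (dep (par t)) (by rw [← hk, s.dep_eq t ht]; omega) hpU rfl with h1 | h1
        · left
          refine ⟨he.trans h1.1, fun z hz hne hzL => ?_⟩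
          have h2 := ElimTree.anc_par_of_ne hz (Ne.symm hne)
          exact h1.2 z h2 (fun hh => hpL (hh ▸ hzL)) hzL
        · right
          rw [he]
          refine ⟨h1.1, step.trans h1.2.1, ?_, fun z hz hne hzL => ?_⟩
          · intro hh
            have := h.anc_le h1.2.1
            rw [hh] at this
            omega
          · have h2 := ElimTree.anc_par_of_ne hz (Ne.symm hne)
            exact h1.2.2.2 z h2 (fun hh => hpL (hh ▸ hzL)) hzL

/-- The nearest ancestor in `L` of a vertex of `L` is a later neighbour of it. -/
theorem nearest_later (s : Spec) (h : Tree) {y z : ℕ} (hy : L y) (hz : L z)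
    (hyz : Anc O par y z) (hne : z ≠ y)
    (hmin : ∀ x, Anc O par y x → x ≠ y → L x → pos z ≤ pos x) : z ∈ later H pos y := by
  have key : ∀ q, Anc O par y q → Anc O par q z → q ≠ z → z ∈ later H pos q := by
    intro q hyq hqz hqz'
    clear hne
    induction hqz using Relation.ReflTransGen.head_induction_on with
    | refl => exact absurd rfl hqz'
    | @head a b hab hbz ih =>
      obtain ⟨h1, h2, rfl⟩ := hab
      have hpl := h.par_later h1 h2
      by_cases hpz : par a = z
      · exact hpz ▸ hpl
      have hyp : Anc O par y (par a) := hyq.tail ⟨h1, h2, rfl⟩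
      have h3 := ih hyp hpz
      have haU : U a := s.U_anc (s.L_U hy) hyq
      have hpL : ¬ L (par a) := fun hpL => by
        have h4 := hmin _ hyp (fun hh => by
          have := h.anc_le hyq
          have := hpl.2
          rw [hh] at this
          omega) hpL
        have := h3.2
        omega
      by_contra hn
      exact hpL (s.L_of_leave h haU (.inr h3) hn hz hpl)
  exact key y .refl hyz (Ne.symm hne)

theorem rt_spec (h : Tree) (u : Upd) {x : ℕ} (hx : x ∈ O) (hxU : ¬ U x) :
    rt x = none ∨ (rt x ∈ O ∧ ¬ U (rt x) ∧ U (par (rt x)) ∧ Anc O par x (rt x)) := by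
  -- The sum of all positions bounds every position, so its distance to `pos x` is a measure that
  -- decreases towards the root.
  have main : ∀ m x, x ∈ O → ¬ U x → (∑ y ∈ h.fin.toFinset, pos y) - pos x ≤ m →
      rt x = none ∨ (rt x ∈ O ∧ ¬ U (rt x) ∧ U (par (rt x)) ∧ Anc O par x (rt x)) := by
    intro m
    induction m with
    | zero =>
      intro x hx hxU hm
      have he := u.rt_eq x hx hxU
      split_ifs at he with hp
      · exact .inr (by rw [he]; exact ⟨hx, hxU, hp, .refl⟩)
      · by_cases hpn : par x = none
        · exact .inl (by rw [he, hpn, u.rt_none])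
        · exfalso
          have hl := h.par_mem x hx hpn
          have h1 := hl.2
          have h2 : pos (par x) ≤ ∑ y ∈ h.fin.toFinset, pos y :=
            Finset.single_le_sum (f := pos) (fun _ _ => Nat.zero_le _)
              (h.fin.mem_toFinset.2 (h.later_mem hl).2)
          omega
    | succ m ih =>
      intro x hx hxU hm
      have he := u.rt_eq x hx hxU
      split_ifs at he with hp
      · exact .inr (by rw [he]; exact ⟨hx, hxU, hp, .refl⟩)
      · by_cases hpn : par x = none
        · exact .inl (by rw [he, hpn, u.rt_none])
        · have hl := h.par_mem x hx hpn
          have h1 := hl.2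
          have h2 : pos (par x) ≤ ∑ y ∈ h.fin.toFinset, pos y :=
            Finset.single_le_sum (f := pos) (fun _ _ => Nat.zero_le _)
              (h.fin.mem_toFinset.2 (h.later_mem hl).2)
          rw [he]
          rcases ih (par x) (h.later_mem hl).2 hp (by omega) with h3 | ⟨h3, h4, h5, h6⟩
          · exact .inl h3
          · exact .inr ⟨h3, h4, h5, .head ⟨hx, (h.later_mem hl).2, rfl⟩ h6⟩
  exact main _ x hx hxU le_rfl

theorem rt_of_anc (s : Spec) (u : Upd) {x y : ℕ} (hxy : Anc O par x y) (hy : y ∈ O)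
    (hyU : ¬ U y) (hp : U (par y)) : rt x = y := by
  induction hxy using Relation.ReflTransGen.head_induction_on with
  | refl => rw [u.rt_eq y hy hyU, if_pos hp]
  | @head a b hab hby ih =>
    obtain ⟨h1, h2, rfl⟩ := hab
    have hpU : ¬ U (par a) := fun hh => hyU (s.U_anc hh hby)
    have haU : ¬ U a := fun hh => hpU (s.U_anc hh (.single ⟨h1, h2, rfl⟩))
    rw [u.rt_eq a h1 haU, if_neg hpU, ih]

/-- The least later neighbour. -/
structure IsFirst (S : Set ℕ) (none : ℕ) (pos : ℕ → ℕ) (p : ℕ) : Prop where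
  mem : p ≠ none → p ∈ S
  empty : p = none → S = ∅
  le : ∀ z ∈ S, pos p ≤ pos z

/-- The order inside `U` has changed, so the first later neighbour has to be recomputed where the
tree outside of `U` is attached to `U`. There, by minimality of `H`, the later neighbours are the
vertices of `U` that have a neighbour in `G` within the hanging subtree. Inside of that subtree the
old parents remain correct. -/
theorem isFirst_nonU (s : Spec) (h : Tree) (o : Order) (u : Upd) {y : ℕ} (hy : y ∈ O)
    (hyU : ¬ U y) : IsFirst (later H pos y) none nrk (npar y) := by
  by_cases hp : U (par y)
  · have hpO := s.U_mem _ hp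
    have hS : ∀ z, z ∈ later H pos y ↔ U z ∧ ∃ x ∈ O, ¬ U x ∧ rt x = y ∧ G.Adj x z := by
      intro z
      constructor
      · intro hz
        obtain ⟨w, hw, hwy, hwz⟩ := h.exists_adj_of_later hz
        exact ⟨s.U_anc hp (h.anc_par hz), w, hw, fun hh => hyU (s.U_anc hh hwy),
          s.rt_of_anc u hwy hy hyU hp, hwz⟩
      · rintro ⟨hzU, x, hx, hxU, hrt, hxz⟩
        have hanc : Anc O par x y := by
          rcases rt_spec h u hx hxU with h1 | h1
          · exact absurd (hrt ▸ hy) (h1 ▸ h.none_not)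
          · exact hrt ▸ h1.2.2.2
        have hxz' := h.adj_of_G hx (s.U_mem z hzU) hxz
        rcases h.adj_cases hxz' with h1 | h1
        · refine h.later_of_anc h1 hanc ?_
          by_contra hle
          exact hyU (s.U_anc hzU (h.anc_of_pos_le (h.anc_of_later h1) hanc (by omega)))
        · exact absurd (s.later_U h hzU h1) hxU
    refine ⟨fun hne => ?_, fun he => ?_, fun z hz => ?_⟩
    · rcases u.top_mem y hy hyU hp with h1 | ⟨x, hx, hxU, h1, h2, h3⟩
      · exact absurd h1 hne
      · exact (hS _).2 ⟨h3, x, hx, hxU, h1, h2⟩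
    · ext z
      refine ⟨fun hz => ?_, fun hz => hz.elim⟩
      obtain ⟨hzU, x, hx, hxU, hrt, hxz⟩ := (hS z).1 hz
      exact absurd he (u.top_le y hy hyU hp x hx hxU hrt z hzU hxz).1
    · obtain ⟨hzU, x, hx, hxU, hrt, hxz⟩ := (hS z).1 hz
      exact (u.top_le y hy hyU hp x hx hxU hrt z hzU hxz).2
  · rw [u.par_nonU y hy hyU hp]
    refine ⟨fun hne => h.par_mem y hy hne, fun he => h.par_none y hy he, fun z hz => ?_⟩
    have hzO := (h.later_mem hz).2
    have hpO := (h.later_mem (h.par_mem_of_later hz)).2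
    by_cases hzU : U z
    · exact (o.nonU_U _ hpO hp z hzU).le
    · rcases (h.par_le y hy z hz).eq_or_lt with he | hlt
      · rw [h.inj hpO hzO he]
      · exact (o.nonU _ hpO hp z hzO hzU hlt).le

theorem isFirst_L (s : Spec) (h : Tree) (o : Order) (u : Upd) (hvn : v ≠ none) {y : ℕ}
    (hyL : L y) : IsFirst (insert v {z | z ∈ later H pos y ∧ L z}) none nrk (npar y) := by
  rw [u.par_L y hyL]
  rcases s.la_spec h u (s.L_U hyL) with ⟨h1, h2⟩ | ⟨h1, h2, h3, h4⟩
  · rw [h1]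
    refine ⟨fun _ => .inl rfl, fun he => absurd he hvn, ?_⟩
    rintro z (rfl | ⟨hz, hzL⟩)
    · exact le_rfl
    · exact absurd hzL (h2 z (h.anc_of_later hz) hz.1.ne')
  · refine ⟨fun _ => .inr ⟨s.nearest_later h hyL h1 h2 h3 h4, h1⟩,
      fun he => absurd (he ▸ s.U_mem _ (s.L_U h1)) h.none_not, ?_⟩
    rintro z (rfl | ⟨hz, hzL⟩)
    · exact (o.lt_v _ (s.U_mem _ (s.L_U h1))).le
    · have := h4 z (h.anc_of_later hz) hz.1.ne' hzL
      rcases this.eq_or_lt with he | hlt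
      · rw [h.inj (s.U_mem _ (s.L_U h1)) (h.later_mem hz).2 he]
      · exact (o.mem_L _ z h1 hzL hlt).le

/-- Membership in a bag becomes a comparison of depths on one heavy path. In this form the first
later neighbour is a search for the next small enough entry in a list. -/
theorem mem_bag_bot_iff (s : Spec) (h : Tree) (o : Order) {y z : ℕ} (hyU : U y) (hyL : ¬ L y)
    (hzU : U z) (hzL : ¬ L z) (hlt : nrk y < nrk z) : z ∈ bag H pos (bot y) ↔
      lt (bot z) = lt (bot y) ∧ dep z ≤ dep (bot y) := by
  obtain ⟨k1, k2, k3, k4⟩ := s.bot_spec h hyU (s.not_l0 hyU hyL)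
  obtain ⟨m1, m2, m3, m4⟩ := s.bot_spec h hzU (s.not_l0 hzU hzL)
  constructor
  · rintro (rfl | hz)
    · exact ⟨m1, le_rfl⟩
    · exact ⟨by rw [m1, (m4 _ k2 hz).2], s.dep_le k2 (h.anc_of_later hz)⟩
  · rintro ⟨h1, h2⟩
    have hbz : pos (bot z) ≤ pos (bot y) := by
      by_contra hh
      have := o.nonL z hzU hzL y hyU hyL (by omega)
      omega
    have hanc : Anc O par (bot z) (bot y) := by
      rcases le_total (dep (bot y)) (dep (bot z)) with hd | hd
      · exact s.anc_of_lt_eq h k2 m2 h1.symm hd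
      · have h1 := s.anc_of_lt_eq h m2 k2 h1 hd
        rcases h.anc_pos h1 with h2 | h2
        · rw [h2]; exact .refl
        · omega
    have h3 : Anc O par (bot y) z := s.anc_of_dep_le hzU hanc (h.anc_of_later m3) h2
    rcases h.anc_pos h3 with h4 | h4
    · exact .inl h4.symm
    · exact .inr (h.later_of_anc m3 hanc h4.1)

theorem isFirst_nonL (s : Spec) (h : Tree) (o : Order) (u : Upd) {y : ℕ} (hyU : U y)
    (hyL : ¬ L y) :
    IsFirst {z | z ∈ bag H pos (bot y) ∧ (L z ∨ nrk y < nrk z)} none nrk (npar y) := by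
  obtain ⟨k1, k2, k3, k4⟩ := s.bot_spec h hyU (s.not_l0 hyU hyL)
  rcases u.par_nonL y hyU hyL with ⟨h1, h2, h3, h4, h5, h6⟩ | ⟨h1, h2⟩
  · refine ⟨fun _ => ⟨(s.mem_bag_bot_iff h o hyU hyL h1 h2 h5).2 ⟨h3, h4⟩, .inr h5⟩,
      fun he => absurd (s.U_mem _ (he ▸ h1)) h.none_not, ?_⟩
    rintro z ⟨hz, hz'⟩
    have hzU := s.bag_U h k2 hz
    by_cases hzL : L z
    · exact (o.nonL_L _ h1 h2 z hzL).le
    · have hlt := hz'.resolve_left hzL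
      obtain ⟨h7, h8⟩ := (s.mem_bag_bot_iff h o hyU hyL hzU hzL hlt).1 hz
      exact h6 z hzU hzL h7 h8 hlt
  · have hbL : L (bot y) := by
      by_contra hbL
      obtain ⟨m1, m2, m3, m4⟩ := s.bot_spec h k2 (s.not_l0 k2 hbL)
      exact h2 _ k2 hbL m1 le_rfl (o.nonL y hyU hyL _ k2 hbL m3.2)
    rw [h1]
    refine ⟨fun _ => ⟨.inl rfl, .inl hbL⟩, fun he => absurd (s.U_mem _ (he ▸ k2)) h.none_not, ?_⟩
    rintro z ⟨hz, hz'⟩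
    have hzU := s.bag_U h k2 hz
    by_cases hzL : L z
    · rcases hz with rfl | hz
      · exact le_rfl
      · exact (o.mem_L _ z hbL hzL hz.2).le
    · have hlt := hz'.resolve_left hzL
      obtain ⟨h7, h8⟩ := (s.mem_bag_bot_iff h o hyU hyL hzU hzL hlt).1 hz
      exact absurd hlt (h2 z hzU hzL h7 h8)

theorem d_L_spec (s : Spec) (h : Tree) (u : Upd) {y : ℕ} (hyL : L y) :
    nd y = (insert v {z | z ∈ later H pos y ∧ L z}).ncard := by
  have hyU := s.L_U hyL
  have hfin := h.later_finite y
  rw [u.d_L y hyL, s.r_spec h u hyU, h.d_eq y (s.U_mem y hyU),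
    Set.ncard_insert_of_notMem (fun hm => s.v_not (h.later_mem hm.1).2)
      (hfin.subset fun z hz => hz.1)]
  have : later H pos y = {z | z ∈ later H pos y ∧ L z} ∪ {z | z ∈ later H pos y ∧ ¬ L z} := by
    ext z
    simp only [Set.mem_union, Set.mem_ofPred_eq]
    tauto
  have hc := congrArg Set.ncard this
  rw [Set.ncard_union_eq (Set.disjoint_left.2 fun z h1 h2 => h2.2 h1.2)
    (hfin.subset fun z hz => hz.1) (hfin.subset fun z hz => hz.1)] at hc
  omega

theorem d_nonL_spec (s : Spec) (h : Tree) (o : Order) (u : Upd) {y : ℕ} (hyU : U y)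
    (hyL : ¬ L y) : nd y = {z | z ∈ bag H pos (bot y) ∧ (L z ∨ nrk y < nrk z)}.ncard := by
  obtain ⟨k1, k2, k3, k4⟩ := s.bot_spec h hyU (s.not_l0 hyU hyL)
  rw [u.d_nonL y hyU hyL, ← bag_ncard h (s.U_mem _ k2)]
  have hfin := bag_finite h (bot y)
  -- What does not come after `y` in this bag is outside of `L` and has the same `bot`, since a
  -- lower one would place it after `y`.
  have : bag H pos (bot y) = {z | z ∈ bag H pos (bot y) ∧ (L z ∨ nrk y < nrk z)} ∪
      {z | U z ∧ ¬ L z ∧ bot z = bot y ∧ nrk z ≤ nrk y} := by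
    ext z
    constructor
    · intro hz
      by_cases hc : L z ∨ nrk y < nrk z
      · exact .inl ⟨hz, hc⟩
      · push Not at hc
        have hzU := s.bag_U h k2 hz
        refine .inr ⟨hzU, hc.1, ?_, hc.2⟩
        obtain ⟨m1, m2, m3, m4⟩ := s.bot_spec h hzU (s.not_l0 hzU hc.1)
        have hanc : Anc O par (bot z) (bot y) := by
          rcases hz with rfl | hz
          · exact h.anc_of_later m3
          · exact (m4 _ k2 hz).1
        rcases h.anc_pos hanc with h1 | h1
        · exact h1
        · have := o.nonL y hyU hyL z hzU hc.1 h1.1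
          omega
    · rintro (hz | ⟨hzU, hzL, hb, -⟩)
      · exact hz.1
      · exact s.bucket_sub h ⟨hzU, hzL, hb⟩
  have hc := congrArg Set.ncard this
  rw [Set.ncard_union_eq ?_ (hfin.subset fun z hz => hz.1)
    (h.fin.subset fun z hz => s.U_mem z hz.1)] at hc
  · omega
  · rw [Set.disjoint_left]
    rintro z ⟨-, h1⟩ ⟨-, h2, -, h3⟩
    rcases h1 with h1 | h1
    · exact h2 h1
    · omega

/-- The elimination tree after the insertion of `v`. -/
theorem elimTree_addVertex (s : Spec) (h : Tree) (o : Order) (u : Upd) (hvn : v ≠ none) :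
    ElimTree G (addVertex H v {z | L z}) (insert v O) none nrk npar nd := by
  have hfirst : ∀ y ∈ insert v O,
      IsFirst (later (addVertex H v {z | L z}) nrk y) none nrk (npar y) ∧
      nd y = (later (addVertex H v {z | L z}) nrk y).ncard := by
    rintro y (rfl | hy)
    · rw [s.later_v h o, u.d_v, Set.ncard_empty]
      exact ⟨⟨fun hne => absurd u.par_v hne, fun _ => rfl, fun z hz => hz.elim⟩, rfl⟩
    · by_cases hyU : U y
      · by_cases hyL : L y
        · rw [s.later_L h o hyL]
          exact ⟨s.isFirst_L h o u hvn hyL, s.d_L_spec h u hyL⟩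
        · rw [s.later_nonL h o hyU hyL]
          exact ⟨s.isFirst_nonL h o u hyU hyL, s.d_nonL_spec h o u hyU hyL⟩
      · rw [s.later_nonU h o hy hyU, u.d_nonU y hy hyU]
        exact ⟨s.isFirst_nonU h o u hy hyU, h.d_eq y hy⟩
  exact
    { fin := h.fin.insert v
      supp := fun x y hxy => s.supp_addVertex h hxy
      inj := o.inj
      clique := s.later_clique h o
      par_mem := fun y hy => (hfirst y hy).1.mem
      par_none := fun y hy => (hfirst y hy).1.empty
      par_le := fun y hy => (hfirst y hy).1.le
      none_not := by
        rintro (he | hn)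
        · exact hvn he.symm
        · exact h.none_not hn
      d_eq := fun y hy => (hfirst y hy).2
      min := s.isMinimalTriangulation_addVertex h o }

end InsertSpec

theorem ElimTree.empty (G : SimpleGraph ℕ) (none : ℕ) (pos par d : ℕ → ℕ) :
    ElimTree G ⊥ ∅ none pos par d where
  fin := Set.finite_empty
  supp _ _ h := h.elim
  inj := Set.injOn_empty _
  clique _ _ _ h := h.1.elim
  par_mem _ h := h.elim
  par_none _ h := h.elim
  par_le _ h := h.elim
  none_not h := h.elim
  d_eq _ h := h.elim
  min := by
    have : restr G ∅ = ⊥ := by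
      ext
      simp [restr]
    rw [this]
    exact isMinimalTriangulation_bot

/-! ### Running programs safely

Registers and arrays are divided into those that hold indices, which are at most `n`, and those that
hold other numbers. In `t` units of time no number grows by more than `t`. -/

/-- The registers that hold indices. -/
def idxReg (r : ℕ) : Bool := r == 0 || r == 1 || (10 ≤ r && r < 20)
/-- The registers that hold other numbers. -/
def numReg (r : ℕ) : Bool := r == 3 || r == 4 || (20 ≤ r && r < 30)
/-- The arrays that hold indices. -/
def idxArr (a : ℕ) : Bool := 10 ≤ a && a < 30
/-- The arrays that hold other numbers. -/
def numArr (a : ℕ) : Bool := a == 0 || (30 ≤ a && a < 60)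

/-- All indices are at most `n`, and all other numbers at most `B`. -/
structure Safe (n B : ℕ) (σ : State) : Prop where
  size : σ.reg 0 = n
  idx_reg : ∀ r, idxReg r → σ.reg r ≤ n
  num_reg : ∀ r, numReg r → σ.reg r ≤ B
  idx_arr : ∀ a, idxArr a → ∀ i ≤ n, σ.arr a i ≤ n
  num_arr : ∀ a, numArr a → ∀ i ≤ n, σ.arr a i ≤ B

theorem Safe.mono {n B B' : ℕ} {σ : State} (h : Safe n B σ) (hB : B ≤ B') : Safe n B' σ :=
  ⟨h.size, h.idx_reg, fun r hr => (h.num_reg r hr).trans hB, h.idx_arr,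
    fun a ha i hi => (h.num_arr a ha i hi).trans hB⟩

theorem idxReg_not_numReg {r : ℕ} (h : idxReg r) : ¬ numReg r := by
  simp only [idxReg, numReg, Bool.or_eq_true, beq_iff_eq, Bool.and_eq_true,
    decide_eq_true_eq] at *
  omega

theorem idxArr_not_numArr {a : ℕ} (h : idxArr a) : ¬ numArr a := by
  simp only [idxArr, numArr, Bool.or_eq_true, beq_iff_eq, Bool.and_eq_true,
    decide_eq_true_eq] at *
  omega

theorem Safe.setReg_idx {n B : ℕ} {σ : State} (h : Safe n B σ) {r x : ℕ} (hr : idxReg r)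
    (hr0 : r ≠ 0) (hx : x ≤ n) : Safe n B (σ.setReg r x) where
  size := by rw [State.setReg]; simpa [Function.update_apply, Ne.symm hr0] using h.size
  idx_reg q hq := by
    simp only [State.setReg, Function.update_apply]
    split_ifs
    · exact hx
    · exact h.idx_reg q hq
  num_reg q hq := by
    simp only [State.setReg, Function.update_apply]
    split_ifs with hqr
    · exact absurd (hqr ▸ hq) (idxReg_not_numReg hr)
    · exact h.num_reg q hq
  idx_arr := h.idx_arr
  num_arr := h.num_arr

theorem Safe.setReg_num {n B : ℕ} {σ : State} (h : Safe n B σ) {r x : ℕ} (hr : numReg r)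
    (hx : x ≤ B) : Safe n B (σ.setReg r x) where
  size := by
    have : r ≠ 0 := by rintro rfl; simp [numReg] at hr
    rw [State.setReg]
    simpa [Function.update_apply, Ne.symm this] using h.size
  idx_reg q hq := by
    simp only [State.setReg, Function.update_apply]
    split_ifs with hqr
    · exact absurd hr (idxReg_not_numReg (hqr ▸ hq))
    · exact h.idx_reg q hq
  num_reg q hq := by
    simp only [State.setReg, Function.update_apply]
    split_ifs
    · exact hx
    · exact h.num_reg q hq
  idx_arr := h.idx_arr
  num_arr := h.num_arr

theorem Safe.setArr {n B : ℕ} {σ : State} (h : Safe n B σ) {a i x : ℕ}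
    (hx : idxArr a → x ≤ n) (hx' : numArr a → x ≤ B) : Safe n B (σ.setArr a i x) where
  size := h.size
  idx_reg := h.idx_reg
  num_reg := h.num_reg
  idx_arr b hb j hj := by
    simp only [State.setArr, Function.update_apply]
    split_ifs with hba
    · subst hba
      rw [Function.update_apply]
      split_ifs
      · exact hx hb
      · exact h.idx_arr b hb j hj
    · exact h.idx_arr b hb j hj
  num_arr b hb j hj := by
    simp only [State.setArr, Function.update_apply]
    split_ifs with hba
    · subst hba
      rw [Function.update_apply]
      split_ifs
      · exact hx' hb
      · exact h.num_arr b hb j hj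
    · exact h.num_arr b hb j hj

theorem mul_le_sq {a b c : ℕ} (ha : a ≤ c) (hb : b ≤ c) : a * b ≤ c ^ 2 := by
  rw [sq]
  exact Nat.mul_le_mul ha hb

theorem le_sq {a c : ℕ} (ha : a ≤ c) : a ≤ c ^ 2 := ha.trans (Nat.le_self_pow (by norm_num) c)

namespace Expr

/-- Expressions whose value is an index. -/
def isIdx : Expr → Bool
  | lit k => k == 0
  | var r => idxReg r
  | get a i => idxArr a && i.isIdx
  | sub e _ => e.isIdx
  | _ => false

/-- Expressions that read only from cells that hold small numbers. -/
def wf : Expr → Bool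
  | lit k => decide (k ≤ 1)
  | var r => idxReg r || numReg r
  | get a i => (idxArr a || numArr a) && i.isIdx && i.wf
  | add e f => e.wf && f.wf
  | sub e f => e.wf && f.wf
  | mul _ _ => false
  | lt e f => e.wf && f.wf
  | eq e f => e.wf && f.wf

/-- Expressions with values `0` and `1`. -/
def isBit : Expr → Bool
  | lit k => decide (k ≤ 1)
  | lt _ _ => true
  | eq _ _ => true
  | _ => false

/-- Expressions that contain no addition. -/
def isAtom : Expr → Bool
  | lit k => decide (k ≤ 1)
  | var _ => true
  | get _ _ => true
  | lt _ _ => true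
  | eq _ _ => true
  | sub e _ => e.isAtom
  | _ => false

/-- Expressions whose value exceeds the numbers in the memory by at most `1`. -/
def isSmall : Expr → Bool
  | add e f => e.isAtom && f.isBit
  | sub e _ => e.isSmall
  | e => e.isAtom

theorem cost_pos (e : Expr) : 1 ≤ e.cost := by
  cases e <;> simp [cost]

theorem eval_lt_ne_zero {e f : Expr} {σ : State} :
    (lt e f).eval σ ≠ 0 ↔ e.eval σ < f.eval σ := by
  simp only [eval]
  split_ifs with h <;> simp [h]

theorem eval_lt_eq_zero {e f : Expr} {σ : State} :
    (lt e f).eval σ = 0 ↔ f.eval σ ≤ e.eval σ := by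
  simp only [eval]
  split_ifs with h
  · simp [h]
  · simpa using h

theorem eval_eq_ne_zero {e f : Expr} {σ : State} :
    (eq e f).eval σ ≠ 0 ↔ e.eval σ = f.eval σ := by
  simp only [eval]
  split_ifs with h <;> simp [h]

theorem eval_le_of_isIdx {n B : ℕ} {σ : State} (h : Safe n B σ) :
    ∀ {e : Expr}, e.isIdx → e.eval σ ≤ n := by
  intro e
  induction e with
  | lit k => intro he; simp only [isIdx, beq_iff_eq] at he; simp [eval, he]
  | var r => intro he; exact h.idx_reg r he
  | get a i ih =>
    intro he
    simp only [isIdx, Bool.and_eq_true] at he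
    exact h.idx_arr a he.1 _ (ih he.2)
  | sub e f ihe _ =>
    intro he
    exact (Nat.sub_le _ _).trans (ihe he)
  | _ => intro he; simp [isIdx] at he

theorem eval_le_of_isBit {σ : State} : ∀ {e : Expr}, e.isBit → e.eval σ ≤ 1 := by
  intro e
  cases e with
  | lit k => intro he; simpa [isBit, eval] using he
  | lt e f => intro _; simp only [eval]; split_ifs <;> omega
  | eq e f => intro _; simp only [eval]; split_ifs <;> omega
  | _ => intro he; simp [isBit] at he

theorem eval_le_of_isAtom {n B : ℕ} {σ : State} (h : Safe n B σ) (hn : n ≤ B) (hB : 1 ≤ B) :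
    ∀ {e : Expr}, e.wf → e.isAtom → e.eval σ ≤ B := by
  intro e
  induction e with
  | lit k => intro _ he; exact (by simpa [isAtom] using he : k ≤ 1).trans hB
  | var r =>
    intro hw _
    simp only [wf, Bool.or_eq_true] at hw
    rcases hw with hw | hw
    · exact (h.idx_reg r hw).trans hn
    · exact h.num_reg r hw
  | get a i _ =>
    intro hw _
    simp only [wf, Bool.or_eq_true, Bool.and_eq_true] at hw
    have hi := eval_le_of_isIdx h hw.1.2
    rcases hw.1.1 with hw | hw
    · exact (h.idx_arr a hw _ hi).trans hn
    · exact h.num_arr a hw _ hi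
  | sub e f ihe _ =>
    intro hw he
    simp only [wf, Bool.and_eq_true] at hw
    exact (Nat.sub_le _ _).trans (ihe hw.1 he)
  | lt e f => intro _ _; exact (eval_le_of_isBit (σ := σ) (e := lt e f) rfl).trans hB
  | eq e f => intro _ _; exact (eval_le_of_isBit (σ := σ) (e := eq e f) rfl).trans hB
  | _ => intro _ he; simp [isAtom] at he

theorem eval_le_of_isSmall {n B : ℕ} {σ : State} (h : Safe n B σ) (hn : n ≤ B) (hB : 1 ≤ B) :
    ∀ {e : Expr}, e.wf → e.isSmall → e.eval σ ≤ B + 1 := by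
  intro e
  induction e with
  | add e f _ _ =>
    intro hw he
    simp only [wf, isSmall, Bool.and_eq_true] at hw he
    exact Nat.add_le_add (eval_le_of_isAtom h hn hB hw.1 he.1) (eval_le_of_isBit he.2)
  | sub e f ihe _ =>
    intro hw he
    simp only [wf, Bool.and_eq_true] at hw
    exact (Nat.sub_le _ _).trans (ihe hw.1 he)
  | _ => intro hw he; exact (eval_le_of_isAtom h hn hB hw he).trans (Nat.le_succ _)

/-- Multiplication is excluded by `wf`, so each node of the expression contributes at most `B + 1`
to the value, and intermediate results stay below the number of nodes times `B + 1`. -/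
theorem fits_of_wf {n B W : ℕ} {σ : State} (h : Safe n B σ) (hn : n ≤ B) (hB : 1 ≤ B) :
    ∀ {e : Expr}, e.wf → e.cost * (B + 1) < W → e.Fits W σ ∧ e.eval σ ≤ e.cost * (B + 1) := by
  have atom : ∀ e : Expr, e.wf → e.isAtom → e.eval σ ≤ e.cost * (B + 1) := fun e hw he =>
    (eval_le_of_isAtom h hn hB hw he).trans (by nlinarith [e.cost_pos])
  intro e
  induction e with
  | lit k =>
    intro hw hW
    have := atom _ hw hw
    exact ⟨lt_of_le_of_lt this hW, this⟩
  | var r =>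
    intro hw hW
    have := atom (var r) hw rfl
    exact ⟨lt_of_le_of_lt this hW, this⟩
  | get a i ih =>
    intro hw hW
    have := atom (get a i) hw rfl
    simp only [wf, Bool.and_eq_true] at hw
    refine ⟨⟨(ih hw.2 (lt_of_le_of_lt ?_ hW)).1, lt_of_le_of_lt this hW⟩, this⟩
    exact Nat.mul_le_mul_right _ (by simp [cost])
  | add e f ihe ihf =>
    intro hw hW
    simp only [wf, Bool.and_eq_true] at hw
    simp only [cost] at hW ⊢
    obtain ⟨h1, h2⟩ := ihe hw.1 (by nlinarith)
    obtain ⟨h3, h4⟩ := ihf hw.2 (by nlinarith)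
    have : e.eval σ + f.eval σ ≤ (e.cost + f.cost + 1) * (B + 1) := by nlinarith
    exact ⟨⟨h1, h3, lt_of_le_of_lt this hW⟩, this⟩
  | sub e f ihe ihf =>
    intro hw hW
    simp only [wf, Bool.and_eq_true] at hw
    simp only [cost] at hW ⊢
    obtain ⟨h1, h2⟩ := ihe hw.1 (by nlinarith)
    obtain ⟨h3, h4⟩ := ihf hw.2 (by nlinarith)
    exact ⟨⟨h1, h3⟩, (Nat.sub_le _ _).trans (by nlinarith)⟩
  | mul e f => intro hw; simp [wf] at hw
  | lt e f ihe ihf =>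
    intro hw hW
    have := atom (lt e f) hw rfl
    simp only [wf, Bool.and_eq_true] at hw
    simp only [cost] at hW
    exact ⟨⟨(ihe hw.1 (by nlinarith)).1, (ihf hw.2 (by nlinarith)).1, by nlinarith⟩, this⟩
  | eq e f ihe ihf =>
    intro hw hW
    have := atom (eq e f) hw rfl
    simp only [wf, Bool.and_eq_true] at hw
    simp only [cost] at hW
    exact ⟨⟨(ihe hw.1 (by nlinarith)).1, (ihf hw.2 (by nlinarith)).1, by nlinarith⟩, this⟩

end Expr

namespace Prog

/-- Programs without loops that respect the division into indices and other numbers. -/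
def wf : Prog → Bool
  | skip => true
  | set r e => e.wf && ((idxReg r && decide (3 ≤ r) && e.isIdx) || (numReg r && e.isSmall))
  | put a i e => i.wf && e.wf && (a == 3 || a == 4 || (idxArr a && e.isIdx) ||
      (numArr a && decide (1 ≤ a) && e.isSmall))
  | seq p q => p.wf && q.wf
  | ite e p q => e.wf && p.wf && q.wf
  | loop _ _ => false

/-- The effect of a program without loops. -/
def step : Prog → State → State
  | skip, σ => σ
  | set r e, σ => σ.setReg r (e.eval σ)
  | put a i e, σ => σ.setArr a (i.eval σ) (e.eval σ)
  | seq p q, σ => q.step (p.step σ)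
  | ite e p q, σ => if e.eval σ ≠ 0 then p.step σ else q.step σ
  | loop _ _, σ => σ

/-- A bound for the time that a program without loops needs. -/
def tb : Prog → ℕ
  | skip => 1
  | set _ e => e.cost + 1
  | put _ i e => i.cost + e.cost + 1
  | seq p q => p.tb + q.tb
  | ite e p q => e.cost + 1 + max p.tb q.tb
  | loop _ _ => 0

/-- The registers to which a program writes. -/
def wr : Prog → List ℕ
  | skip => []
  | set r _ => [r]
  | put _ _ _ => []
  | seq p q => p.wr ++ q.wr
  | ite _ p q => p.wr ++ q.wr
  | loop _ p => p.wr

/-- The arrays to which a program writes. -/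
def wa : Prog → List ℕ
  | skip => []
  | set _ _ => []
  | put a _ _ => [a]
  | seq p q => p.wa ++ q.wa
  | ite _ p q => p.wa ++ q.wa
  | loop _ p => p.wa

/-- Stored values exceed the numbers in the memory by at most `1` per assignment, while each
assignment costs at least one unit of time. Therefore the time bound also bounds the growth. -/
theorem exec_of_wf {n W : ℕ} : ∀ (p : Prog) {B : ℕ} {σ : State}, p.wf → Safe n B σ → n ≤ B →
    1 ≤ B → p.tb * (B + p.tb + 1) < W →
    ∃ t ≤ p.tb, Exec W p σ t (p.step σ) ∧ Safe n (B + p.tb) (p.step σ)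
  | skip, B, σ, _, hs, _, _, _ => ⟨1, le_rfl, .skip σ, hs.mono (by simp)⟩
  | set r e, B, σ, hw, hs, hn, hB, hW => by
    simp only [wf, Bool.and_eq_true, Bool.or_eq_true, decide_eq_true_eq] at hw
    simp only [tb] at hW ⊢
    refine ⟨_, le_rfl, .set r e σ (Expr.fits_of_wf hs hn hB hw.1 (by nlinarith)).1, ?_⟩
    rcases hw.2 with h | h
    · exact (hs.setReg_idx h.1.1 (by omega) (Expr.eval_le_of_isIdx hs h.2)).mono (by omega)
    · exact (hs.mono (by omega)).setReg_num h.1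
        ((Expr.eval_le_of_isSmall hs hn hB hw.1 h.2).trans (by omega))
  | put a i e, B, σ, hw, hs, hn, hB, hW => by
    simp only [wf, Bool.and_eq_true, Bool.or_eq_true, decide_eq_true_eq, beq_iff_eq] at hw
    simp only [tb] at hW ⊢
    refine ⟨_, le_rfl, .put a i e σ (Expr.fits_of_wf hs hn hB hw.1.1 (by nlinarith)).1
      (Expr.fits_of_wf hs hn hB hw.1.2 (by nlinarith)).1, ?_⟩
    refine (hs.mono (by omega)).setArr (fun ha => ?_) fun ha => ?_
    · rcases hw.2 with ((rfl | rfl) | h) | h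
      · simp [idxArr] at ha
      · simp [idxArr] at ha
      · exact Expr.eval_le_of_isIdx hs h.2
      · exact absurd h.1.1 (idxArr_not_numArr ha)
    · rcases hw.2 with ((rfl | rfl) | h) | h
      · simp [numArr] at ha
      · simp [numArr] at ha
      · exact absurd ha (idxArr_not_numArr h.1)
      · exact (Expr.eval_le_of_isSmall hs hn hB hw.1.2 h.2).trans (by omega)
  | seq p q, B, σ, hw, hs, hn, hB, hW => by
    simp only [wf, Bool.and_eq_true] at hw
    simp only [tb] at hW ⊢
    obtain ⟨t, ht, he, hs'⟩ := exec_of_wf p hw.1 hs hn hB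
      (lt_of_le_of_lt (Nat.mul_le_mul (by omega) (by omega)) hW)
    obtain ⟨t', ht', he', hs''⟩ := exec_of_wf q hw.2 hs' (by omega) (by omega)
      (lt_of_le_of_lt (Nat.mul_le_mul (by omega) (by omega)) hW)
    exact ⟨t + t', by omega, .seq he he', by rw [← add_assoc]; exact hs''⟩
  | ite e p q, B, σ, hw, hs, hn, hB, hW => by
    simp only [wf, Bool.and_eq_true] at hw
    simp only [tb] at hW ⊢
    have hp := le_max_left p.tb q.tb
    have hq := le_max_right p.tb q.tb
    have hf := (Expr.fits_of_wf (W := W) hs hn hB hw.1.1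
      (lt_of_le_of_lt (Nat.mul_le_mul (by omega) (by omega)) hW)).1
    by_cases hc : e.eval σ ≠ 0
    · obtain ⟨t, ht, he, hs'⟩ := exec_of_wf p hw.1.2 hs hn hB
        (lt_of_le_of_lt (Nat.mul_le_mul (by omega) (by omega)) hW)
      refine ⟨e.cost + 1 + t, by omega, ?_, ?_⟩
      · rw [step, if_pos hc]; exact .ite_true q hf hc he
      · rw [step, if_pos hc]; exact hs'.mono (by omega)
    · obtain ⟨t, ht, he, hs'⟩ := exec_of_wf q hw.2 hs hn hB
        (lt_of_le_of_lt (Nat.mul_le_mul (by omega) (by omega)) hW)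
      refine ⟨e.cost + 1 + t, by omega, ?_, ?_⟩
      · rw [step, if_neg hc]; exact .ite_false p hf (not_not.1 hc) he
      · rw [step, if_neg hc]; exact hs'.mono (by omega)
  | loop _ _, _, _, hw, _, _, _, _ => by simp [wf] at hw

end Prog

theorem Prog.step_frame (p : Prog) {σ : State} :
    (∀ r, r ∉ p.wr → (p.step σ).reg r = σ.reg r) ∧ ∀ a, a ∉ p.wa → (p.step σ).arr a = σ.arr a := by
  induction p generalizing σ with
  | skip => exact ⟨fun _ _ => rfl, fun _ _ => rfl⟩
  | set r e =>
    refine ⟨fun q hq => ?_, fun _ _ => rfl⟩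
    simp only [Prog.wr, List.mem_singleton] at hq
    simp [Prog.step, State.setReg, hq]
  | put a i e =>
    refine ⟨fun _ _ => rfl, fun b hb => ?_⟩
    simp only [Prog.wa, List.mem_singleton] at hb
    simp [Prog.step, State.setArr, hb]
  | seq p q ihp ihq =>
    simp only [Prog.wr, Prog.wa, List.mem_append, not_or]
    exact ⟨fun r hr => (ihq.1 r hr.2).trans (ihp.1 r hr.1),
      fun a ha => (ihq.2 a ha.2).trans (ihp.2 a ha.1)⟩
  | ite e p q ihp ihq =>
    simp only [Prog.wr, Prog.wa, List.mem_append, not_or, Prog.step]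
    split_ifs
    · exact ⟨fun r hr => ihp.1 r hr.1, fun a ha => ihp.2 a ha.1⟩
    · exact ⟨fun r hr => ihq.1 r hr.2, fun a ha => ihq.2 a ha.2⟩
  | loop e p => exact ⟨fun _ _ => rfl, fun _ _ => rfl⟩

theorem Exec.frame {W t : ℕ} {p : Prog} {σ σ' : State} (h : Exec W p σ t σ') :
    (∀ r, r ∉ p.wr → σ'.reg r = σ.reg r) ∧ ∀ a, a ∉ p.wa → σ'.arr a = σ.arr a := by
  induction h with
  | skip σ => exact ⟨fun _ _ => rfl, fun _ _ => rfl⟩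
  | set r e σ he =>
    refine ⟨fun q hq => ?_, fun _ _ => rfl⟩
    simp only [Prog.wr, List.mem_singleton] at hq
    simp [State.setReg, hq]
  | put a i e σ hi he =>
    refine ⟨fun _ _ => rfl, fun b hb => ?_⟩
    simp only [Prog.wa, List.mem_singleton] at hb
    simp [State.setArr, hb]
  | seq hp hq ihp ihq =>
    simp only [Prog.wr, Prog.wa, List.mem_append, not_or]
    exact ⟨fun r hr => (ihq.1 r hr.2).trans (ihp.1 r hr.1),
      fun a ha => (ihq.2 a ha.2).trans (ihp.2 a ha.1)⟩
  | ite_true q he h hp ih =>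
    simp only [Prog.wr, Prog.wa, List.mem_append, not_or]
    exact ⟨fun r hr => ih.1 r hr.1, fun a ha => ih.2 a ha.1⟩
  | ite_false p he h hq ih =>
    simp only [Prog.wr, Prog.wa, List.mem_append, not_or]
    exact ⟨fun r hr => ih.1 r hr.2, fun a ha => ih.2 a ha.2⟩
  | loop_done p he h => exact ⟨fun _ _ => rfl, fun _ _ => rfl⟩
  | loop_step he h hp hl ihp ihl =>
    exact ⟨fun r hr => (ihl.1 r hr).trans (ihp.1 r hr),
      fun a ha => (ihl.2 a ha).trans (ihp.2 a ha)⟩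

/-- Started in the state `σ`, the program `p` halts within `T` units of time in a state that
satisfies `Q`, provided that the words are large enough. -/
def Runs (n : ℕ) (p : Prog) (σ : State) (T : ℕ) (Q : State → Prop) : Prop :=
  ∀ W B, 1 ≤ B → n ≤ B → Safe n B σ → (B + T + 1) ^ 2 < W →
    ∃ t ≤ T, ∃ σ', Exec W p σ t σ' ∧ Safe n (B + T) σ' ∧ Q σ'

namespace Runs

variable {n : ℕ} {p q : Prog} {σ : State} {T T' : ℕ} {Q R : State → Prop}

theorem mono (h : Runs n p σ T Q) (hT : T ≤ T') (hQ : ∀ σ', Q σ' → R σ') : Runs n p σ T' R := by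
  intro W B hB hn hs hW
  obtain ⟨t, ht, σ', he, hs', hq⟩ := h W B hB hn hs (lt_of_le_of_lt (by gcongr) hW)
  exact ⟨t, ht.trans hT, σ', he, hs'.mono (by omega), hQ _ hq⟩

theorem imp (h : Runs n p σ T Q) (hQ : ∀ σ', Q σ' → R σ') : Runs n p σ T R := h.mono le_rfl hQ

theorem seq (hp : Runs n p σ T R) (hq : ∀ σ', R σ' → Runs n q σ' T' Q) :
    Runs n (p.seq q) σ (T + T') Q := by
  intro W B hB hn hs hW
  obtain ⟨t, ht, σ', he, hs', hr⟩ := hp W B hB hn hs (lt_of_le_of_lt (by gcongr; omega) hW)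
  obtain ⟨t', ht', σ'', he', hs'', hq'⟩ := hq σ' hr W (B + T) (by omega) (by omega) hs'
    (lt_of_le_of_lt (by gcongr ?_ ^ 2; omega) hW)
  exact ⟨t + t', by omega, σ'', .seq he he', by rw [← add_assoc]; exact hs'', hq'⟩

theorem frame (h : Runs n p σ T Q) : Runs n p σ T fun σ' => Q σ' ∧
    (∀ r, r ∉ p.wr → σ'.reg r = σ.reg r) ∧ ∀ a, a ∉ p.wa → σ'.arr a = σ.arr a := by
  intro W B hB hn hs hW
  obtain ⟨t, ht, σ', he, hs', hq⟩ := h W B hB hn hs hW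
  exact ⟨t, ht, σ', he, hs', hq, he.frame⟩

/-- The current state may be assumed to be safe. -/
theorem of_safe (h : (∃ B, Safe n B σ) → Runs n p σ T Q) : Runs n p σ T Q :=
  fun W B hB hn hs hW => h ⟨B, hs⟩ W B hB hn hs hW

theorem block (hp : p.wf) : Runs n p σ p.tb (fun σ' => σ' = p.step σ) := by
  intro W B hB hn hs hW
  obtain ⟨t, ht, he, hs'⟩ := p.exec_of_wf hp hs hn hB
    -- Cost and values are both at most `B + T + 1`; their product is the reason for the square in
    -- `Runs`.
    (lt_of_le_of_lt (mul_le_sq (by omega) (by omega)) hW)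
  exact ⟨t, ht, _, he, hs', rfl⟩

theorem ite {e : Expr} (hw : e.wf) (hp : e.eval σ ≠ 0 → Runs n p σ T Q)
    (hq : e.eval σ = 0 → Runs n q σ T Q) : Runs n (p.ite e q) σ (e.cost + 1 + T) Q := by
  intro W B hB hn hs hW
  have hf := (Expr.fits_of_wf (W := W) hs hn hB hw
    (lt_of_le_of_lt (mul_le_sq (by omega) (by omega)) hW)).1
  by_cases hc : e.eval σ = 0
  · obtain ⟨t, ht, σ', he, hs', hq'⟩ := hq hc W B hB hn hs
      (lt_of_le_of_lt (by gcongr; omega) hW)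
    exact ⟨e.cost + 1 + t, by omega, σ', .ite_false p hf hc he, hs'.mono (by omega), hq'⟩
  · obtain ⟨t, ht, σ', he, hs', hq'⟩ := hp hc W B hB hn hs
      (lt_of_le_of_lt (by gcongr; omega) hW)
    exact ⟨e.cost + 1 + t, by omega, σ', .ite_true q hf hc he, hs'.mono (by omega), hq'⟩

/-- Incrementing an index. -/
theorem incr {r : ℕ} (hr : idxReg r) (hr3 : 3 ≤ r) (h : σ.reg r < n) :
    Runs n (.set r (.add (.var r) (.lit 1))) σ 4 (fun σ' => σ' = σ.setReg r (σ.reg r + 1)) := by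
  intro W B hB hn hs hW
  have hw : (Expr.add (.var r) (.lit 1)).wf := by simp [Expr.wf, hr]
  exact ⟨4, le_rfl, _, .set r _ σ (Expr.fits_of_wf hs hn hB hw
    (lt_of_le_of_lt (by simp only [Expr.cost]; exact mul_le_sq (by omega) (by omega)) hW)).1,
    (hs.setReg_idx hr (by omega) h).mono (by omega), rfl⟩

end Runs

/-! ### Loop rules with time budgets -/

/-- Run `body` for all values of the register `rJ` below the value of `rB`. -/
def forLt (rJ rB : ℕ) (body : Prog) : Prog :=
  .seq (.set rJ (.lit 0))
    (.loop (.lt (.var rJ) (.var rB)) (.seq body (.set rJ (.add (.var rJ) (.lit 1)))))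

/-- The rule for `forLt`. The number `φ` is the remaining budget of time. -/
theorem Runs.forLt {n rJ rB : ℕ} {body : Prog} {σ : State}
    (Inv : ℕ → ℕ → (ℕ → ℕ → ℕ) → Prop) {φ₀ : ℕ} (hJ : idxReg rJ) (hJ3 : 3 ≤ rJ) (hB : idxReg rB)
    (hJB : rJ ≠ rB) (hJw : rJ ∉ body.wr) (hBw : rB ∉ body.wr) (h0 : Inv 0 φ₀ σ.arr)
    (hbody : ∀ (j φ : ℕ) (σ' : State), j < σ.reg rB → Inv j φ σ'.arr → σ'.reg rJ = j →
      (∀ r, r ∉ body.wr → r ≠ rJ → σ'.reg r = σ.reg r) →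
      (∀ a, a ∉ body.wa → σ'.arr a = σ.arr a) →
      ∃ T, Runs n body σ' T (fun σ'' => ∃ φ', Inv (j + 1) φ' σ''.arr ∧ T + φ' ≤ φ)) :
    Runs n (forLt rJ rB body) σ (φ₀ + 8 * σ.reg rB + 6)
      (fun σ' => σ'.reg rJ = σ.reg rB ∧ ∃ φ, Inv (σ.reg rB) φ σ'.arr) := by
  have key : ∀ (m j φ : ℕ) (σ' : State), j + m = σ.reg rB → Inv j φ σ'.arr → σ'.reg rJ = j →
      (∀ r, r ∉ body.wr → r ≠ rJ → σ'.reg r = σ.reg r) →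
      (∀ a, a ∉ body.wa → σ'.arr a = σ.arr a) →
      Runs n (.loop (.lt (.var rJ) (.var rB)) (.seq body (.set rJ (.add (.var rJ) (.lit 1)))))
        σ' (φ + 8 * m + 4) (fun σ' => σ'.reg rJ = σ.reg rB ∧ ∃ φ, Inv (σ.reg rB) φ σ'.arr) := by
    intro m
    induction m with
    | zero =>
      intro j φ σ' hj hI hJj hr _ W B h1 hn hs hW
      have hrB := hr rB hBw (Ne.symm hJB)
      have hw : (Expr.lt (.var rJ) (.var rB)).wf := by simp [Expr.wf, hJ, hB]
      have hf := (Expr.fits_of_wf (W := W) hs hn h1 hw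
        (lt_of_le_of_lt (by simp only [Expr.cost]; exact mul_le_sq (by omega) (by omega)) hW)).1
      refine ⟨4, by omega, σ', .loop_done _ hf ?_, hs.mono (by omega), by omega, φ, ?_⟩
      · exact Expr.eval_lt_eq_zero.2 (by simp only [Expr.eval]; omega)
      · rw [← hj]; exact hI
    | succ m ih =>
      intro j φ σ' hj hI hJj hr ha W B h1 hn hs hW
      have hrB := hr rB hBw (Ne.symm hJB)
      have hw : (Expr.lt (.var rJ) (.var rB)).wf := by simp [Expr.wf, hJ, hB]
      have hf := (Expr.fits_of_wf (W := W) hs hn h1 hw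
        (lt_of_le_of_lt (by simp only [Expr.cost]; exact mul_le_sq (by omega) (by omega)) hW)).1
      obtain ⟨T, hT⟩ := hbody j φ σ' (by omega) hI hJj hr ha
      -- The postcondition of the body contains the budget inequality. It becomes available by
      -- running the body once with some sufficiently large word bound.
      have hTφ : T ≤ φ := by
        by_contra hlt
        obtain ⟨_, _, _, _, _, φ', _, h⟩ := hT ((B + T + 1) ^ 2 + 1) B h1 hn hs (by omega)
        omega
      obtain ⟨t, ht, σ₁, he, hs₁, ⟨φ', hI', hφ⟩, hfr⟩ := hT.frame W B h1 hn hs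
        (lt_of_le_of_lt (by gcongr; omega) hW)
      have hJ₁ : σ₁.reg rJ = j := (hfr.1 rJ hJw).trans hJj
      have hkn : σ.reg rB ≤ n := by
        rw [← hrB]
        exact hs.idx_reg rB hB
      obtain ⟨t₂, ht₂, σ₂, he₂, hs₂, rfl⟩ := Runs.incr (σ := σ₁) hJ hJ3 (by omega) W (B + T)
        (by omega) (by omega) hs₁ (lt_of_le_of_lt (by gcongr ?_ ^ 2; omega) hW)
      obtain ⟨t₃, ht₃, σ₃, he₃, hs₃, hq⟩ := ih (j + 1) φ' (σ₁.setReg rJ (σ₁.reg rJ + 1)) (by omega)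
        hI' (by simp [State.setReg, hJ₁])
        (fun r hr1 hr2 => by
          simp only [State.setReg, Function.update_apply, hr2, if_false]
          exact (hfr.1 r hr1).trans (hr r hr1 hr2))
        (fun a ha1 => (hfr.2 a ha1).trans (ha a ha1)) W (B + T + 4) (by omega) (by omega) hs₂
        (lt_of_le_of_lt (by gcongr ?_ ^ 2; omega) hW)
      refine ⟨4 + (t + t₂) + t₃, by omega, σ₃, .loop_step hf ?_ (.seq he he₂) he₃,
        hs₃.mono (by omega), hq⟩
      exact Expr.eval_lt_ne_zero.2 (by simp only [Expr.eval]; omega)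
  intro W B h1 hn hs hW
  have hw : (Prog.set rJ (.lit 0)).wf := by simp [Prog.wf, Expr.wf, Expr.isIdx, hJ, hJ3]
  have h2 : (Prog.set rJ (.lit 0)).tb = 2 := rfl
  obtain ⟨t, ht, σ₁, he, hs₁, h3⟩ := Runs.block (n := n) (σ := σ) hw W B h1 hn hs
    (lt_of_le_of_lt (by gcongr; omega) hW)
  obtain rfl : σ₁ = σ.setReg rJ 0 := h3
  rw [h2] at ht hs₁
  obtain ⟨t₂, ht₂, σ₂, he₂, hs₂, hq⟩ := key (σ.reg rB) 0 φ₀ (σ.setReg rJ 0) (by omega)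
    h0 (by simp [State.setReg])
    (fun r _ hr => by simp [State.setReg, hr])
    (fun a _ => rfl) W (B + 2) (by omega) (by omega) hs₁
    (lt_of_le_of_lt (by gcongr ?_ ^ 2; omega) hW)
  exact ⟨t + t₂, by omega, σ₂, .seq he he₂, hs₂.mono (by omega), hq⟩

/-- The rule for `forLt` if the body has no loops. -/
theorem Runs.forLt_block {n rJ rB : ℕ} {body : Prog} {σ : State} (c : ℕ)
    (Inv : ℕ → (ℕ → ℕ → ℕ) → Prop) (hw : body.wf) (hc : body.tb ≤ c)
    (hJ : idxReg rJ) (hJ3 : 3 ≤ rJ) (hB : idxReg rB)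
    (hJB : rJ ≠ rB) (hJw : rJ ∉ body.wr) (hBw : rB ∉ body.wr) (h0 : Inv 0 σ.arr)
    (hbody : ∀ (j : ℕ) (σ' : State), j < σ.reg rB → Inv j σ'.arr → σ'.reg rJ = j →
      (∀ r, r ∉ body.wr → r ≠ rJ → σ'.reg r = σ.reg r) →
      (∀ a, a ∉ body.wa → σ'.arr a = σ.arr a) → (∃ B, Safe n B σ') →
      Inv (j + 1) (body.step σ').arr) :
    Runs n (AvoidableVertices.forLt rJ rB body) σ ((c + 8) * σ.reg rB + 6)
      (fun σ' => σ'.reg rJ = σ.reg rB ∧ Inv (σ.reg rB) σ'.arr) := by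
  have h := Runs.forLt (n := n) (σ := σ) (fun j φ A => Inv j A ∧ φ = c * (σ.reg rB - j))
    (φ₀ := c * σ.reg rB) hJ hJ3 hB hJB hJw hBw ⟨h0, by simp⟩ ?_
  · exact h.mono (by nlinarith) fun σ' h => ⟨h.1, h.2.choose_spec.1⟩
  · intro j φ σ' hj hI hJj hr ha
    refine ⟨c, Runs.of_safe fun hs => (Runs.block hw).mono hc ?_⟩
    rintro _ rfl
    refine ⟨_, ⟨hbody j σ' hj hI.1 hJj hr ha hs, rfl⟩, ?_⟩
    rw [hI.2, show σ.reg rB - j = (σ.reg rB - (j + 1)) + 1 by omega]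
    nlinarith

/-- A loop whose body has no loops. The number `k` bounds the number of the remaining rounds. -/
theorem Runs.while_block {n : ℕ} {e : Expr} {body : Prog} {σ₀ : State} (c : ℕ)
    (Inv : ℕ → State → Prop) (hew : e.wf) (hw : body.wf) (hc : e.cost + 1 + body.tb ≤ c) {k₀ : ℕ}
    (h0 : Inv k₀ σ₀)
    (hbody : ∀ k σ, Inv k σ → e.eval σ ≠ 0 → (∀ r, r ∉ body.wr → σ.reg r = σ₀.reg r) →
      (∀ a, a ∉ body.wa → σ.arr a = σ₀.arr a) → (∃ B, Safe n B σ) →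
      ∃ k' < k, Inv k' (body.step σ)) :
    ∃ T, Runs n (.loop e body) σ₀ T
      (fun σ' => ∃ k, Inv k σ' ∧ e.eval σ' = 0 ∧ T + c * k ≤ c * k₀ + c) := by
  have key : ∀ k σ, Inv k σ → (∀ r, r ∉ body.wr → σ.reg r = σ₀.reg r) →
      (∀ a, a ∉ body.wa → σ.arr a = σ₀.arr a) → ∃ T, Runs n (.loop e body) σ T
      (fun σ' => ∃ k', Inv k' σ' ∧ e.eval σ' = 0 ∧ T + c * k' ≤ c * k + c) := by
    intro k
    induction k using Nat.strong_induction_on with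
    | _ k ih =>
      intro σ hI hr ha
      -- The time is found by following the run itself, so that the final inequality can speak of
      -- the rounds that were not used. In an unsafe state `Runs` holds vacuously.
      by_cases hs0 : ∃ B, Safe n B σ
      · by_cases he : e.eval σ = 0
        · refine ⟨c, fun W B h1 hn hs hW => ?_⟩
          have hf := (Expr.fits_of_wf (W := W) hs hn h1 hew
            (lt_of_le_of_lt (mul_le_sq (by omega) (by omega)) hW)).1
          exact ⟨e.cost + 1, by omega, σ, .loop_done _ hf he, hs.mono (by omega), k, hI, he,
            by omega⟩
        · obtain ⟨k', hk, hI'⟩ := hbody k σ hI he hr ha hs0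
          obtain ⟨T, hT⟩ := ih k' hk (body.step σ) hI'
            (fun r h => (body.step_frame.1 r h).trans (hr r h))
            (fun a h => (body.step_frame.2 a h).trans (ha a h))
          refine ⟨c + T, fun W B h1 hn hs hW => ?_⟩
          have hf := (Expr.fits_of_wf (W := W) hs hn h1 hew
            (lt_of_le_of_lt (mul_le_sq (by omega) (by omega)) hW)).1
          obtain ⟨t, ht, _, h2, hs2, rfl⟩ := Runs.block (σ := σ) hw W B h1 hn hs
            (lt_of_le_of_lt (by gcongr; omega) hW)
          obtain ⟨t', ht', σ', h3, hs3, k2, h4, h5, h6⟩ := hT W (B + body.tb) (by omega) (by omega)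
            hs2 (lt_of_le_of_lt (by gcongr ?_ ^ 2; omega) hW)
          exact ⟨e.cost + 1 + t + t', by omega, σ', .loop_step hf he h2 h3, hs3.mono (by omega), k2,
            h4, h5, by nlinarith⟩
      · exact ⟨0, Runs.of_safe fun h => absurd h hs0⟩
  exact key _ σ₀ h0 (fun _ _ => rfl) fun _ _ => rfl

/-- Run `body` with the register `13` ranging over the adjacency list of the vertex `v`. -/
def forAdj (v : Expr) (body : Prog) : Prog :=
  .seq (.set 20 (.get arrPos v)) <|
  .seq (.set 21 (.get arrPos (.add v (.lit 1)))) <|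
  .loop (.lt (.var 20) (.var 21)) <|
    .seq (.set 13 (.get arrAdj (.var 20))) <|
    .seq body (.set 20 (.add (.var 20) (.lit 1)))

/-- Positions in the adjacency array may exceed `n` and its cells are not covered by `Safe`. Reading
a neighbour is therefore justified by `hadj`, and the rules for blocks apply only to the body. -/
theorem Runs.adjLoop {n : ℕ} {body : Prog} {σ : State} (c lo hi : ℕ)
    (Inv : ℕ → (ℕ → ℕ → ℕ) → Prop) (hadj : ∀ e, lo ≤ e → e < hi → σ.arr arrAdj e < n)
    (hw : body.wf) (hc : body.tb ≤ c) (hr20 : 20 ∉ body.wr) (hr21 : 21 ∉ body.wr)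
    (ha1 : arrAdj ∉ body.wa)
    (hbody : ∀ (e : ℕ) (σ' : State), lo ≤ e → e < hi → Inv e σ'.arr →
      σ'.reg 13 = σ.arr arrAdj e →
      (∀ r, r ∉ body.wr → r ≠ 13 → r ≠ 20 → r ≠ 21 → σ'.reg r = σ.reg r) →
      (∀ a, a ∉ body.wa → σ'.arr a = σ.arr a) → (∃ B, Safe n B σ') →
      Inv (e + 1) (body.step σ').arr) :
    ∀ (m e : ℕ) (σ' : State), lo ≤ e → e + m = hi → Inv e σ'.arr → σ'.reg 20 = e →
      σ'.reg 21 = hi →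
      (∀ r, r ∉ body.wr → r ≠ 13 → r ≠ 20 → r ≠ 21 → σ'.reg r = σ.reg r) →
      (∀ a, a ∉ body.wa → σ'.arr a = σ.arr a) →
      Runs n (.loop (.lt (.var 20) (.var 21)) (.seq (.set 13 (.get arrAdj (.var 20)))
        (.seq body (.set 20 (.add (.var 20) (.lit 1)))))) σ' ((c + 11) * m + 4)
        (fun σ' => Inv hi σ'.arr) := by
  intro m
  induction m with
  | zero =>
    intro e σ' _ he hI h20 h21 _ _ W B h1 hn hs hW
    have hw' : (Expr.lt (.var 20) (.var 21)).wf := rfl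
    have hf := (Expr.fits_of_wf (W := W) hs hn h1 hw'
      (lt_of_le_of_lt (by simp only [Expr.cost]; exact mul_le_sq (by omega) (by omega)) hW)).1
    refine ⟨4, by omega, σ', .loop_done _ hf ?_, hs.mono (by omega), ?_⟩
    · exact Expr.eval_lt_eq_zero.2 (by simp only [Expr.eval]; omega)
    · rw [← he]; exact hI
  | succ m ih =>
    intro e σ' hle he hI h20 h21 hr ha W B h1 hn hs hW
    have hw' : (Expr.lt (.var 20) (.var 21)).wf := rfl
    have hf := (Expr.fits_of_wf (W := W) hs hn h1 hw'
      (lt_of_le_of_lt (by simp only [Expr.cost]; exact mul_le_sq (by omega) (by omega)) hW)).1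
    have hxa : σ'.arr arrAdj e = σ.arr arrAdj e := by rw [ha _ ha1]
    have hx : σ'.arr arrAdj e < n := hxa ▸ hadj e hle (by omega)
    have heB : e ≤ B := by rw [← h20]; exact hs.num_reg 20 rfl
    have hBW : B < W := lt_of_le_of_lt (le_sq (by omega)) hW
    have e1 : Exec W (.set 13 (.get arrAdj (.var 20))) σ' 3 (σ'.setReg 13 (σ'.arr arrAdj e)) := by
      have := Exec.set (W := W) 13 (.get arrAdj (.var 20)) σ'
        ⟨by simp only [Expr.Fits]; omega, by simp only [Expr.eval, h20]; omega⟩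
      simpa only [Expr.eval, h20, Expr.cost] using this
    have s1 := hs.setReg_idx (r := 13) rfl (by norm_num) hx.le
    obtain ⟨t, ht, _, e2, s2, rfl⟩ := Runs.block (n := n) hw W B h1 hn s1
      (lt_of_le_of_lt (by gcongr; nlinarith) hW)
    have hfr := e2.frame
    have hI' := hbody e (σ'.setReg 13 (σ'.arr arrAdj e)) hle (by omega) hI
      (by simp [State.setReg, hxa])
      (fun r h2 h3 h4 h5 => by
        simp only [State.setReg, Function.update_apply, h3, if_false]
        exact hr r h2 h3 h4 h5)
      ha ⟨B, s1⟩
    have h20' : (body.step (σ'.setReg 13 (σ'.arr arrAdj e))).reg 20 = e := by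
      rw [hfr.1 20 hr20]
      simpa [State.setReg] using h20
    have h21' : (body.step (σ'.setReg 13 (σ'.arr arrAdj e))).reg 21 = hi := by
      rw [hfr.1 21 hr21]
      simpa [State.setReg] using h21
    generalize body.step (σ'.setReg 13 (σ'.arr arrAdj e)) = σ₂ at *
    obtain ⟨t3, ht3, σ₃, e3, s3, h6⟩ := Runs.block (n := n) (σ := σ₂)
      (p := .set 20 (.add (.var 20) (.lit 1))) rfl W (B + body.tb) (by omega) (by omega) s2
      (lt_of_le_of_lt (by gcongr ?_ ^ 2; simp only [Prog.tb, Expr.cost]; nlinarith) hW)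
    simp only [Prog.tb, Expr.cost] at ht3 s3
    obtain rfl : σ₃ = σ₂.setReg 20 (σ₂.reg 20 + 1) := h6
    obtain ⟨t4, ht4, σ4, e4, s4, hq⟩ := ih (e + 1) (σ₂.setReg 20 (σ₂.reg 20 + 1)) (by omega)
      (by omega) hI' (by simp [State.setReg, h20'])
      (by simp [State.setReg, h21'])
      (fun r h2 h3 h4 h5 => by
        simp only [State.setReg, Function.update_apply, h4, if_false]
        rw [← hr r h2 h3 h4 h5]
        have := hfr.1 r h2
        simpa [State.setReg, Function.update_apply, h3] using this)
      (fun a h2 => (hfr.2 a h2).trans (ha a h2)) W (B + body.tb + 4) (by omega) (by omega)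
      (s3.mono (by omega)) (lt_of_le_of_lt (by gcongr ?_ ^ 2; nlinarith) hW)
    refine ⟨4 + (3 + (t + t3)) + t4, by nlinarith, σ4,
      .loop_step hf ?_ (.seq e1 (.seq e2 e3)) e4, s4.mono (by nlinarith), hq⟩
    exact Expr.eval_lt_ne_zero.2 (by simp only [Expr.eval]; omega)

/-- The rule for `forAdj`. -/
theorem Runs.forAdj {n : ℕ} {v : Expr} {body : Prog} {σ : State} (c : ℕ)
    (Inv : ℕ → (ℕ → ℕ → ℕ) → Prop) (hv : v.wf) (hvc : v.cost ≤ c)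
    (hvn : v.eval σ < n) (hv' : ∀ x, v.eval (σ.setReg 20 x) = v.eval σ)
    (hmono : σ.arr arrPos (v.eval σ) ≤ σ.arr arrPos (v.eval σ + 1))
    (hadj : ∀ e, σ.arr arrPos (v.eval σ) ≤ e → e < σ.arr arrPos (v.eval σ + 1) →
      σ.arr arrAdj e < n)
    (hw : body.wf) (hc : body.tb ≤ c) (hr20 : 20 ∉ body.wr) (hr21 : 21 ∉ body.wr)
    (ha1 : arrAdj ∉ body.wa)
    (h0 : Inv (σ.arr arrPos (v.eval σ)) σ.arr)
    (hbody : ∀ (e : ℕ) (σ' : State), σ.arr arrPos (v.eval σ) ≤ e →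
      e < σ.arr arrPos (v.eval σ + 1) → Inv e σ'.arr → σ'.reg 13 = σ.arr arrAdj e →
      (∀ r, r ∉ body.wr → r ≠ 13 → r ≠ 20 → r ≠ 21 → σ'.reg r = σ.reg r) →
      (∀ a, a ∉ body.wa → σ'.arr a = σ.arr a) → (∃ B, Safe n B σ') →
      Inv (e + 1) (body.step σ').arr) :
    Runs n (forAdj v body) σ
      ((c + 11) * (σ.arr arrPos (v.eval σ + 1) - σ.arr arrPos (v.eval σ)) + 2 * c + 10)
      (fun σ' => Inv (σ.arr arrPos (v.eval σ + 1)) σ'.arr) := by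
  set lo := σ.arr arrPos (v.eval σ) with hlo
  set hi := σ.arr arrPos (v.eval σ + 1) with hhi
  intro W B h1 hn hs hW
  have hvc1 := v.cost_pos
  have hloB : lo ≤ B := hs.num_arr 0 rfl _ hvn.le
  have hhiB : hi ≤ B := hs.num_arr 0 rfl _ hvn
  have hBW : B < W := lt_of_le_of_lt (le_sq (by omega)) hW
  have hvW : v.cost * (B + 1) < W := lt_of_le_of_lt (mul_le_sq (by omega) (by omega)) hW
  have e1 : Exec W (.set 20 (.get arrPos v)) σ (v.cost + 1 + 1) (σ.setReg 20 lo) :=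
    Exec.set (W := W) 20 (.get arrPos v) σ
      ⟨(Expr.fits_of_wf hs hn h1 hv hvW).1, by change lo < W; omega⟩
  have s1 := hs.setReg_num (r := 20) rfl hloB
  have hv1 := hv' lo
  have e2 : Exec W (.set 21 (.get arrPos (.add v (.lit 1)))) (σ.setReg 20 lo)
      (v.cost + 1 + 1 + 1 + 1) ((σ.setReg 20 lo).setReg 21 hi) := by
    have := Exec.set (W := W) 21 (.get arrPos (.add v (.lit 1))) (σ.setReg 20 lo)
      ⟨⟨(Expr.fits_of_wf s1 hn h1 hv hvW).1, by simp only [Expr.Fits]; omega,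
        by simp only [Expr.eval, hv1]; omega⟩, by
        simp only [Expr.eval, hv1]
        change hi < W
        omega⟩
    simp only [Expr.eval, hv1, Expr.cost] at this
    exact this
  have s2 := s1.setReg_num (r := 21) rfl hhiB
  obtain ⟨t, ht, σ3, e3, s3, hq⟩ := Runs.adjLoop c lo hi Inv hadj hw hc hr20 hr21 ha1 hbody
    (hi - lo) lo ((σ.setReg 20 lo).setReg 21 hi) le_rfl
    (by omega) h0 (by simp [State.setReg]) (by simp [State.setReg])
    (fun r _ _ h4 h5 => by simp [State.setReg, h4, h5])
    (fun a _ => rfl) W B h1 hn s2 (lt_of_le_of_lt (by gcongr ?_ ^ 2; omega) hW)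
  exact ⟨_, by omega, σ3, .seq e1 (.seq e2 e3), s3.mono (by omega), hq⟩

/-! ### The program for the insertion of a vertex -/

section Step

variable {σ : State} {r q x a b i j : ℕ}

@[simp] theorem setReg_arr : (σ.setReg r x).arr = σ.arr := rfl
@[simp] theorem setReg_same : (σ.setReg r x).reg r = x := by simp [State.setReg]
@[simp] theorem setReg_ne (h : q ≠ r) : (σ.setReg r x).reg q = σ.reg q := by simp [State.setReg, h]
@[simp] theorem setArr_reg : (σ.setArr a i x).reg = σ.reg := rfl
@[simp] theorem setArr_same : (σ.setArr a i x).arr a j = if j = i then x else σ.arr a j := by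
  simp [State.setArr, Function.update_apply]
@[simp] theorem setArr_ne (h : b ≠ a) : (σ.setArr a i x).arr b = σ.arr b := by simp [State.setArr, h]

theorem setArr_of_ne (h : j ≠ i) : (σ.setArr b i x).arr a j = σ.arr a j := by
  by_cases hb : a = b
  · rw [hb, setArr_same, if_neg h]
  · rw [setArr_ne hb]

theorem step_skip : Prog.skip.step σ = σ := rfl
theorem step_set {e : Expr} : (Prog.set r e).step σ = σ.setReg r (e.eval σ) := rfl
theorem step_put {e f : Expr} :
    (Prog.put a e f).step σ = σ.setArr a (e.eval σ) (f.eval σ) := rfl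
theorem step_seq {p p' : Prog} : (p.seq p').step σ = p'.step (p.step σ) := rfl
theorem step_ite {e : Expr} {p p' : Prog} :
    (Prog.ite e p p').step σ = if e.eval σ = 0 then p'.step σ else p.step σ := by
  simp only [Prog.step, ne_eq, ite_not]
theorem eval_lit : (Expr.lit x).eval σ = x := rfl
theorem eval_var : (Expr.var r).eval σ = σ.reg r := rfl
theorem eval_get {e : Expr} : (Expr.get a e).eval σ = σ.arr a (e.eval σ) := rfl
theorem eval_add {e f : Expr} : (Expr.add e f).eval σ = e.eval σ + f.eval σ := rfl
theorem eval_sub {e f : Expr} : (Expr.sub e f).eval σ = e.eval σ - f.eval σ := rfl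
theorem eval_lt_zero {e f : Expr} : (Expr.lt e f).eval σ = 0 ↔ ¬ e.eval σ < f.eval σ := by
  rw [Expr.eval_lt_eq_zero, not_lt]
theorem eval_eq_zero {e f : Expr} : (Expr.eq e f).eval σ = 0 ↔ ¬ e.eval σ = f.eval σ := by
  rw [← Expr.eval_eq_ne_zero, not_not]

end Step

/-- The first `K` entries of `ord` list the elements of `O`, and `pos` contains their positions. -/
structure Listed (n K : ℕ) (O : Set ℕ) (ord pos : ℕ → ℕ) : Prop where
  mem : ∀ j < K, ord j ∈ O
  pos_ord : ∀ j < K, pos (ord j) = j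
  pos_lt : ∀ y ∈ O, pos y < K
  ord_pos : ∀ y ∈ O, ord (pos y) = y
  lt : ∀ y ∈ O, y < n

/-- The arrays hold the adjacency lists of `G`. -/
structure HoldsAdj (n : ℕ) (G : SimpleGraph ℕ) (A : ℕ → ℕ → ℕ) : Prop where
  start : A 0 0 = 0
  mono : ∀ v < n, A 0 v ≤ A 0 (v + 1)
  adj_iff : ∀ v < n, ∀ w, G.Adj v w ↔ ∃ e, A 0 v ≤ e ∧ e < A 0 (v + 1) ∧ A 1 e = w
  lt : ∀ v w, G.Adj v w → w < n

theorem HoldsAdj.adj_lt {n : ℕ} {G : SimpleGraph ℕ} {A : ℕ → ℕ → ℕ} (h : HoldsAdj n G A) {v e : ℕ}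
    (hv : v < n) (h1 : A 0 v ≤ e) (h2 : e < A 0 (v + 1)) : A 1 e < n :=
  h.lt v _ ((h.adj_iff v hv _).2 ⟨e, h1, h2, rfl⟩)

namespace Listed

variable {n K : ℕ} {O : Set ℕ} {ord pos : ℕ → ℕ}

theorem le (h : Listed n K O ord pos) : K ≤ n := by
  have : (Finset.range K).card ≤ (Finset.range n).card :=
    Finset.card_le_card_of_injOn ord (fun j hj => by
      simp only [Finset.coe_range, Set.mem_Iio] at hj ⊢
      exact h.lt _ (h.mem j hj)) (fun i hi j hj hij => by
      simp only [Finset.coe_range, Set.mem_Iio] at hi hj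
      rw [← h.pos_ord i hi, ← h.pos_ord j hj, hij])
  simpa using this

theorem eq_ord (h : Listed n K O ord pos) {y j : ℕ} (hy : y ∈ O) (hj : pos y = j) : y = ord j := by
  rw [← hj, h.ord_pos y hy]

end Listed

/-! ### Initialization, marking, and passes along the elimination order -/

/-- Initialization of the arrays at one index. -/
def initBody : Prog :=
  .seq (.put 33 (.var 10) (.lit 0)) <|
  .seq (.put 34 (.var 10) (.lit 0)) <|
  .seq (.put 13 (.var 10) (.var 0)) <|
  .seq (.put 14 (.var 10) (.var 0)) <|
  .seq (.put 35 (.var 10) (.lit 0)) <|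
  .seq (.put 16 (.var 10) (.var 0)) <|
  .seq (.put 36 (.var 10) (.lit 0)) <|
  .seq (.put 37 (.var 10) (.lit 0)) <|
  .seq (.put 21 (.var 10) (.var 0)) <|
  .seq (.put 22 (.var 10) (.var 14)) <|
  .seq (.put 24 (.var 10) (.var 0)) <|
  .put 25 (.var 10) (.var 0)

/-- Initialization of the arrays. -/
def initPass : Prog :=
  .seq (forLt 10 0 initBody) <| .seq initBody <|
  .seq (.put 41 (.lit 0) (.lit 0)) (.put 45 (.lit 0) (.lit 0))

/-- The initial values at the index `i`. -/
structure InitAt (n v : ℕ) (A : ℕ → ℕ → ℕ) (i : ℕ) : Prop where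
  isN : A 33 i = 0
  isU : A 34 i = 0
  hv : A 13 i = n
  ua : A 14 i = n
  dep : A 35 i = 0
  head : A 16 i = n
  isL : A 36 i = 0
  cnt : A 37 i = 0
  top : A 21 i = n
  la : A 22 i = v
  rt : A 24 i = n
  par : A 25 i = n

theorem initBody_step {n v : ℕ} {σ : State} (hn : σ.reg 0 = n) (hv : σ.reg 14 = v) :
    InitAt n v (initBody.step σ).arr (σ.reg 10) ∧
    ∀ i, InitAt n v σ.arr i → InitAt n v (initBody.step σ).arr i := by
  constructor
  · constructor <;>
    simp [initBody, step_seq, step_put, eval_var, eval_lit, setArr_same, setArr_ne, setArr_reg,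
      hn, hv]
  · intro i hi
    by_cases hij : i = σ.reg 10
    · constructor <;>
      simp [initBody, step_seq, step_put, eval_var, eval_lit, setArr_same, setArr_ne, setArr_reg,
        hn, hv, hij]
    · constructor <;>
      simp [initBody, step_seq, step_put, eval_var, eval_lit, setArr_same, setArr_ne, setArr_reg,
        hij, hi.isN, hi.isU, hi.hv, hi.ua, hi.dep, hi.head, hi.isL, hi.cnt, hi.top, hi.la, hi.rt,
        hi.par]

theorem runs_initPass {n : ℕ} {σ : State} (hn : σ.reg 0 = n) :
    Runs n initPass σ (100 * n + 100) (fun σ' => (∀ i ≤ n, InitAt n (σ.reg 14) σ'.arr i) ∧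
      σ'.arr 41 0 = 0 ∧ σ'.arr 45 0 = 0) := by
  have h1 := Runs.forLt_block (n := n) (σ := σ) (rJ := 10) (rB := 0) (body := initBody) 50
    (fun j A => ∀ i < j, InitAt n (σ.reg 14) A i) rfl (by decide) rfl (by decide) rfl (by decide)
    (by decide) (by decide) (fun i hi => absurd hi (Nat.not_lt_zero i)) (by
      intro j σ' hj hI hJ hr ha _ i hi
      have := initBody_step (n := n) (v := σ.reg 14) (σ := σ')
        (by rw [hr 0 (by decide) (by decide), hn]) (hr 14 (by decide) (by decide))
      by_cases hij : i = j
      · rw [hij, ← hJ]; exact this.1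
      · exact this.2 i (hI i (by omega)))
  refine (Runs.seq h1.frame fun σ1 h1 => ?_).mono (T := (50 + 8) * σ.reg 0 + 6 + 70)
    (by rw [hn]; omega) fun _ h => h
  refine ((Runs.block (p := .seq initBody <|
    .seq (.put 41 (.lit 0) (.lit 0)) (.put 45 (.lit 0) (.lit 0))) rfl)).mono (by decide) ?_
  rintro _ rfl
  obtain ⟨⟨hJ, hI⟩, hr, -⟩ := h1
  have := initBody_step (n := n) (v := σ.reg 14) (σ := σ1)
    (by rw [hr 0 (by decide), hn]) (hr 14 (by decide))
  refine ⟨fun i hi => ?_, ?_, ?_⟩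
  · have h2 : InitAt n (σ.reg 14) (initBody.step σ1).arr i := by
      -- After the loop, register `10` holds `n`. The extra run of the body treats the index `n`,
      -- which plays the role of `none` for parents.
      by_cases hin : i = σ1.reg 10
      · rw [hin]; exact this.1
      · exact this.2 i (hI i (by omega))
    constructor <;> simp [step_seq, step_put, setArr_ne, h2.isN, h2.isU, h2.hv, h2.ua, h2.dep,
      h2.head, h2.isL, h2.cnt, h2.top, h2.la, h2.rt, h2.par]
  · simp [step_seq, step_put, eval_lit, setArr_same]
  · simp [step_seq, step_put, eval_lit, setArr_same]

/-- Mark the neighbours of the new vertex. -/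
def markPass : Prog :=
  forAdj (.var 14) (.ite (.get 30 (.var 13))
    (.seq (.put 33 (.var 13) (.lit 1)) (.put 34 (.var 13) (.lit 1))) .skip)

theorem runs_markPass {n : ℕ} {G : SimpleGraph ℕ} {O : Set ℕ} {σ : State}
    (hG : HoldsAdj n G σ.arr) (hv : σ.reg 14 < n) (hins : ∀ y < n, σ.arr 30 y ≠ 0 ↔ y ∈ O)
    (h33 : ∀ i ≤ n, σ.arr 33 i = 0) (h34 : ∀ i ≤ n, σ.arr 34 i = 0) :
    Runs n markPass σ (30 * (σ.arr 0 (σ.reg 14 + 1) - σ.arr 0 (σ.reg 14)) + 50) (fun σ' =>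
      ∀ y ≤ n, (σ'.arr 33 y ≠ 0 ↔ y ∈ O ∧ G.Adj (σ.reg 14) y) ∧
        (σ'.arr 34 y ≠ 0 ↔ y ∈ O ∧ G.Adj (σ.reg 14) y)) := by
  refine (Runs.forAdj (n := n) (σ := σ) (v := .var 14) 15
    (fun e A => ∀ y ≤ n, (A 33 y ≠ 0 ↔ y ∈ O ∧ ∃ e', σ.arr 0 (σ.reg 14) ≤ e' ∧ e' < e ∧
      σ.arr 1 e' = y) ∧ (A 34 y ≠ 0 ↔ y ∈ O ∧ ∃ e', σ.arr 0 (σ.reg 14) ≤ e' ∧ e' < e ∧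
      σ.arr 1 e' = y)) rfl (by decide) hv (fun x => rfl) (hG.mono _ hv)
    (fun e h1 h2 => hG.adj_lt hv h1 h2) rfl (by decide) (by decide) (by decide) (by decide)
    ?_ ?_).mono ?_ ?_
  · intro y hy
    simp only [h33 y hy, h34 y hy, ne_eq, not_true_eq_false, false_iff, and_self]
    rintro ⟨-, e', h1, h2, -⟩
    exact absurd h2 (not_lt.2 h1)
  · intro e σ' h1 h2 hI h13 hr ha _ y hy
    have h30 : σ'.arr 30 = σ.arr 30 := ha 30 (by decide)
    have hen := hG.adj_lt hv h1 h2
    change σ'.reg 13 = σ.arr 1 e at h13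
    simp only [step_ite, step_seq, step_put, step_skip, eval_get, eval_var, eval_lit, h13, h30]
    have hex : (∃ e', σ.arr 0 (σ.reg 14) ≤ e' ∧ e' < e + 1 ∧ σ.arr 1 e' = y) ↔
        (∃ e', σ.arr 0 (σ.reg 14) ≤ e' ∧ e' < e ∧ σ.arr 1 e' = y) ∨ σ.arr 1 e = y := by
      constructor
      · rintro ⟨e', h3, h4, h5⟩
        by_cases he : e' = e
        · exact .inr (he ▸ h5)
        · exact .inl ⟨e', h3, by omega, h5⟩
      · rintro (⟨e', h3, h4, h5⟩ | h5)
        · exact ⟨e', h3, by omega, h5⟩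
        · exact ⟨e, h1, by omega, h5⟩
    rw [hex]
    have hIy := hI y hy
    have hen' := hins _ hen
    generalize (∃ e', σ.arr 0 (σ.reg 14) ≤ e' ∧ e' < e ∧ σ.arr 1 e' = y) = P at *
    by_cases hye : y = σ.arr 1 e
    · rw [← hye] at hen' ⊢
      split_ifs with hc
      · have : y ∉ O := fun hh => hen'.2 hh hc
        tauto
      · have : y ∈ O := hen'.1 hc
        simp [setArr_same, setArr_reg, h13, setArr_ne, ← hye, this]
    · have := Ne.symm hye
      split_ifs with hc
      · tauto
      · simp only [setArr_same, setArr_reg, h13, setArr_ne (show (33 : ℕ) ≠ 34 by decide),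
          setArr_ne (show (34 : ℕ) ≠ 33 by decide), if_neg hye]
        tauto
  · change (15 + 11) * (σ.arr 0 (σ.reg 14 + 1) - σ.arr 0 (σ.reg 14)) + 2 * 15 + 10 ≤ _
    omega
  · intro σ' hI y hy
    have := hI y hy
    rw [hG.adj_iff _ hv y]
    exact this

/-- Run `body` with the register `11` ranging over the listed vertices in ascending order. -/
def forAsc (body : Prog) : Prog := forLt 10 15 (.seq (.set 11 (.get 10 (.var 10))) body)

/-- Run `body` with the register `11` ranging over the listed vertices in descending order. -/
def forDesc (body : Prog) : Prog :=
  forLt 10 15 (.seq (.set 11 (.get 10 (.sub (.sub (.var 15) (.lit 1)) (.var 10)))) body)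

theorem Runs.forAsc {n K : ℕ} {O : Set ℕ} {body : Prog} {σ : State} (c : ℕ)
    (Inv : ℕ → (ℕ → ℕ → ℕ) → Prop) (hl : Listed n K O (σ.arr 10) (σ.arr 43)) (hK : σ.reg 15 = K)
    (hw : body.wf) (hc : body.tb ≤ c) (h10 : 10 ∉ body.wr) (h15 : 15 ∉ body.wr)
    (ha10 : 10 ∉ body.wa) (h0 : Inv 0 σ.arr)
    (hbody : ∀ (y : ℕ) (σ' : State), y ∈ O → Inv (σ.arr 43 y) σ'.arr → σ'.reg 11 = y →
      (∀ r, r ∉ body.wr → r ≠ 10 → r ≠ 11 → σ'.reg r = σ.reg r) →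
      (∀ a, a ∉ body.wa → σ'.arr a = σ.arr a) → (∃ B, Safe n B σ') →
      Inv (σ.arr 43 y + 1) (body.step σ').arr) :
    Runs n (forAsc body) σ ((c + 20) * n + 6) (fun σ' => Inv K σ'.arr) := by
  refine (Runs.forLt_block (n := n) (σ := σ) (c + 4) Inv (by rw [Prog.wf, hw]; rfl)
    (by simp only [Prog.tb, Expr.cost]; omega) rfl (by decide) rfl (by decide)
    (by simpa [Prog.wr] using h10) (by simpa [Prog.wr] using h15) h0 ?_).mono ?_ ?_
  · intro j σ' hj hI hJ hr ha hs
    rw [hK] at hj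
    have he : σ'.arr 10 (σ'.reg 10) = σ.arr 10 j := by rw [ha 10 (by simpa [Prog.wa]), hJ]
    have := hbody (σ.arr 10 j) (σ'.setReg 11 (σ.arr 10 j)) (hl.mem j hj)
      (by rw [hl.pos_ord j hj]; exact hI) setReg_same
      (fun r h1 h2 h3 => by rw [setReg_ne h3]; exact hr r (by simp [Prog.wr, h1, h3]) h2)
      (fun a h1 => ha a (by simpa [Prog.wa] using h1))
      (hs.imp fun B hs => hs.setReg_idx rfl (by decide) (hl.lt _ (hl.mem j hj)).le)
    rw [hl.pos_ord j hj] at this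
    rw [step_seq, step_set, eval_get, eval_var, he]
    exact this
  · rw [hK]
    have := Nat.mul_le_mul_left (c + 12) hl.le
    nlinarith
  · rw [hK]
    exact fun _ h => h.2

/-- In descending order a parent is treated before its children, so recursions along the tree read
final values. The hypothesis `hP` says that overwriting cells at `y` does not disturb what is known
about higher vertices. -/
theorem Runs.forDesc {n K : ℕ} {O : Set ℕ} {body : Prog} {σ : State} (c : ℕ)
    (P : ℕ → (ℕ → ℕ → ℕ) → Prop) (hl : Listed n K O (σ.arr 10) (σ.arr 43)) (hK : σ.reg 15 = K)
    (hw : body.wf) (hc : body.tb ≤ c) (h10 : 10 ∉ body.wr) (h15 : 15 ∉ body.wr)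
    (ha10 : 10 ∉ body.wa)
    (hbody : ∀ (y : ℕ) (σ' : State), y ∈ O →
      (∀ z ∈ O, σ.arr 43 y < σ.arr 43 z → P z σ'.arr) → σ'.reg 11 = y →
      (∀ a x, x ∉ O → σ'.arr a x = σ.arr a x) →
      (∀ r, r ∉ body.wr → r ≠ 10 → r ≠ 11 → σ'.reg r = σ.reg r) →
      (∀ a, a ∉ body.wa → σ'.arr a = σ.arr a) →
      P y (body.step σ').arr ∧ ∀ a x, x ≠ y → (body.step σ').arr a x = σ'.arr a x)
    (hP : ∀ y ∈ O, ∀ z ∈ O, σ.arr 43 y < σ.arr 43 z → ∀ A A' : ℕ → ℕ → ℕ,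
      (∀ a x, x ≠ y → A' a x = A a x) → P z A → P z A') :
    Runs n (forDesc body) σ ((c + 20) * n + 6) (fun σ' => (∀ z ∈ O, P z σ'.arr) ∧
      ∀ a x, x ∉ O → σ'.arr a x = σ.arr a x) := by
  refine (Runs.forLt_block (n := n) (σ := σ) (c + 10)
    (fun j A => (∀ z ∈ O, K ≤ σ.arr 43 z + j → P z A) ∧ ∀ a x, x ∉ O → A a x = σ.arr a x) (by rw [Prog.wf, hw]; rfl)
    (by simp only [Prog.tb, Expr.cost]; omega) rfl (by decide) rfl (by decide)
    (by simpa [Prog.wr] using h10) (by simpa [Prog.wr] using h15) ?_ ?_).mono ?_ ?_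
  · refine ⟨fun z hz h => ?_, fun _ _ _ => rfl⟩
    have := hl.pos_lt z hz
    omega
  · rintro j σ' hj ⟨hI, hI'⟩ hJ hr ha hs
    rw [hK] at hj
    have he : σ'.arr 10 (σ'.reg 15 - 1 - σ'.reg 10) = σ.arr 10 (K - 1 - j) := by
      rw [ha 10 (by simpa [Prog.wa]), hJ, hr 15 (by simpa [Prog.wr] using h15) (by decide), hK]
    have hm := hl.mem (K - 1 - j) (by omega)
    have hp := hl.pos_ord (K - 1 - j) (by omega)
    rw [step_seq, step_set, eval_get, eval_sub, eval_sub, eval_var, eval_var, eval_lit, he]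
    generalize hy : σ.arr 10 (K - 1 - j) = y at *
    obtain ⟨h1, h2⟩ := hbody y (σ'.setReg 11 y) hm
      (fun z hz hlt => hI z hz (by omega)) setReg_same hI'
      (fun r h1 h2 h3 => by rw [setReg_ne h3]; exact hr r (by simp [Prog.wr, h1, h3]) h2)
      (fun a h1 => ha a (by simpa [Prog.wa] using h1))
    refine ⟨fun z hz hzj => ?_, fun a x hx => (h2 a x fun he => hx (he ▸ hm)).trans (hI' a x hx)⟩
    by_cases hzy : z = y
    · rw [hzy]; exact h1
    · have : σ.arr 43 z ≠ K - 1 - j := fun h => hzy ((hl.eq_ord hz h).trans hy)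
      exact hP y hm z hz (by omega) _ _ h2 (hI z hz (by omega))
  · rw [hK]
    have := Nat.mul_le_mul_left (c + 18) hl.le
    nlinarith
  · rw [hK]
    exact fun _ h => ⟨fun z hz => h.2.1 z hz (by omega), h.2.2⟩

/-! ### Ancestors of the neighbours and heavy paths -/

/-- Compute the set `U` of the ancestors of the neighbours, and a child of maximal degree in it for
each of its elements. -/
def upPass : Prog :=
  forAsc (.ite (.get 34 (.var 11)) (.seq (.set 12 (.get 12 (.var 11)))
    (.ite (.lt (.var 12) (.var 0)) (.seq (.put 34 (.var 12) (.lit 1))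
      (.ite (.eq (.get 13 (.var 12)) (.var 0)) (.put 13 (.var 12) (.var 11))
        (.ite (.lt (.get 31 (.get 13 (.var 12))) (.get 31 (.var 11)))
          (.put 13 (.var 12) (.var 11)) .skip))) .skip)) .skip)

/-- Children precede their parents, so the membership of `y` in `U` is final when `y` is treated.
The entry of array `13` is a running maximum of `d` over the children in `U` seen so far. -/
theorem runs_upPass {n K : ℕ} {O : Set ℕ} {σ : State}
    (hl : Listed n K O (σ.arr 10) (σ.arr 43)) (hK : σ.reg 15 = K) (hn : σ.reg 0 = n)
    (hpar : ∀ y ∈ O, σ.arr 12 y = n ∨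
      σ.arr 12 y ∈ O ∧ σ.arr 43 y < σ.arr 43 (σ.arr 12 y)) (h13 : ∀ i ≤ n, σ.arr 13 i = n) :
    Runs n upPass σ (100 * n + 6) (fun σ' =>
      (∀ z ≤ n, σ'.arr 34 z ≠ 0 ↔ σ.arr 34 z ≠ 0 ∨
        z < n ∧ ∃ y ∈ O, σ'.arr 34 y ≠ 0 ∧ σ.arr 12 y = z) ∧
      (∀ y ∈ O, σ'.arr 34 y ≠ 0 → σ.arr 12 y ∈ O →
        σ'.arr 13 (σ.arr 12 y) ∈ O ∧ σ'.arr 34 (σ'.arr 13 (σ.arr 12 y)) ≠ 0 ∧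
        σ.arr 12 (σ'.arr 13 (σ.arr 12 y)) = σ.arr 12 y ∧
        σ.arr 31 y ≤ σ.arr 31 (σ'.arr 13 (σ.arr 12 y))) ∧ σ'.arr 13 n = n) := by
  have hnO : n ∉ O := fun h => lt_irrefl _ (hl.lt n h)
  refine (Runs.forAsc (n := n) (σ := σ) 50 (fun j A =>
    (∀ z ≤ n, A 34 z ≠ 0 ↔ σ.arr 34 z ≠ 0 ∨
        z < n ∧ ∃ y ∈ O, σ.arr 43 y < j ∧ A 34 y ≠ 0 ∧ σ.arr 12 y = z) ∧
    (∀ z < n, (A 13 z = n ∧ ∀ y ∈ O, σ.arr 43 y < j → A 34 y ≠ 0 → σ.arr 12 y ≠ z) ∨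
      (A 13 z ∈ O ∧ σ.arr 43 (A 13 z) < j ∧ A 34 (A 13 z) ≠ 0 ∧ σ.arr 12 (A 13 z) = z ∧
      ∀ y ∈ O, σ.arr 43 y < j → A 34 y ≠ 0 → σ.arr 12 y = z → σ.arr 31 y ≤ σ.arr 31 (A 13 z))) ∧
    A 13 n = n) hl hK rfl (by decide) (by decide) (by decide) (by decide) ?_ ?_).mono ?_ ?_
  · refine ⟨fun z hz => ?_, fun z hz => .inl ⟨h13 z hz.le, ?_⟩, h13 n le_rfl⟩
    · simp
    · simp
  · intro y σ' hy hI hy11 hr ha _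
    have e12 : σ'.arr 12 = σ.arr 12 := ha 12 (by decide)
    have e31 : σ'.arr 31 = σ.arr 31 := ha 31 (by decide)
    have e0 : σ'.reg 0 = n := (hr 0 (by decide) (by decide) (by decide)).trans hn
    have hlt : ∀ z ∈ O, σ.arr 43 z < σ.arr 43 y + 1 ↔ σ.arr 43 z < σ.arr 43 y ∨ z = y := by
      intro z hz
      constructor
      · intro h
        by_cases h' : σ.arr 43 z = σ.arr 43 y
        · exact .inr ((hl.eq_ord hz h').trans (hl.ord_pos y hy))
        · exact .inl (by omega)
      · rintro (h | rfl)
        · omega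
        · omega
    obtain ⟨hI1, hI2, hI3⟩ := hI
    simp only [step_ite, step_seq, step_put, step_set, step_skip, eval_get, eval_var, eval_lit,
      setReg_same, setReg_arr, hy11, e12, e31, setReg_ne (show (0 : ℕ) ≠ 12 by decide), e0,
      eval_lt_zero, eval_eq_zero, setArr_reg, setReg_ne (show (11 : ℕ) ≠ 12 by decide),
      setArr_ne (show (13 : ℕ) ≠ 34 by decide), setArr_ne (show (31 : ℕ) ≠ 34 by decide)]
    -- Vertices outside of `U` and roots change nothing; the invariant only has to be extended by
    -- one vacuous case.
    have hnot : (σ'.arr 34 y = 0 ∨ ¬ σ.arr 12 y < n) → 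
      (∀ z ≤ n, σ'.arr 34 z ≠ 0 ↔ σ.arr 34 z ≠ 0 ∨
        z < n ∧ ∃ x ∈ O, σ.arr 43 x < σ.arr 43 y + 1 ∧ σ'.arr 34 x ≠ 0 ∧ σ.arr 12 x = z) ∧
      (∀ z < n, (σ'.arr 13 z = n ∧ ∀ x ∈ O, σ.arr 43 x < σ.arr 43 y + 1 → σ'.arr 34 x ≠ 0 →
        σ.arr 12 x ≠ z) ∨
      (σ'.arr 13 z ∈ O ∧ σ.arr 43 (σ'.arr 13 z) < σ.arr 43 y + 1 ∧ σ'.arr 34 (σ'.arr 13 z) ≠ 0 ∧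
        σ.arr 12 (σ'.arr 13 z) = z ∧
      ∀ x ∈ O, σ.arr 43 x < σ.arr 43 y + 1 → σ'.arr 34 x ≠ 0 → σ.arr 12 x = z →
        σ.arr 31 x ≤ σ.arr 31 (σ'.arr 13 z))) ∧ σ'.arr 13 n = n := by
      intro h
      have key : ∀ x ∈ O, ∀ z < n, σ.arr 43 x < σ.arr 43 y + 1 → σ'.arr 34 x ≠ 0 →
          σ.arr 12 x = z → σ.arr 43 x < σ.arr 43 y := by
        intro x hx z hz h1 h2 h3
        rcases (hlt x hx).1 h1 with h1 | rfl
        · exact h1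
        · rcases h with h | h
          · exact absurd h h2
          · omega
      refine ⟨fun z hz => (hI1 z hz).trans (or_congr_right (and_congr_right fun hzn => ?_)),
        fun z hz => ?_, hI3⟩
      · exact ⟨fun ⟨x, h1, h2, h3⟩ => ⟨x, h1, by omega, h3⟩,
          fun ⟨x, h1, h2, h3, h4⟩ => ⟨x, h1, key x h1 z hzn h2 h3 h4, h3, h4⟩⟩
      · rcases hI2 z hz with ⟨h1, h2⟩ | ⟨h1, h2, h3, h4, h5⟩
        · exact .inl ⟨h1, fun x hx h3 h4 h5 => h2 x hx (key x hx z hz h3 h4 h5) h4 h5⟩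
        · exact .inr ⟨h1, by omega, h3, h4, fun x hx h6 h7 h8 =>
            h5 x hx (key x hx z hz h6 h7 h8) h7 h8⟩
    by_cases hU : σ'.arr 34 y = 0
    · rw [if_pos hU]; exact hnot (.inl hU)
    by_cases hp : ¬ σ.arr 12 y < n
    · rw [if_neg hU, if_pos hp]; exact hnot (.inr hp)
    rw [if_neg hU, if_neg hp]
    split_ifs with hv0 hvd
    all_goals
      rw [not_not] at hp
      obtain ⟨hpO, hpp⟩ := (hpar y hy).resolve_left hp.ne
      generalize hpe : σ.arr 12 y = p at *
      have hpy : y ≠ p := by rintro rfl; exact lt_irrefl _ hpp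
      -- The parent is higher than `y`, so marking it does not affect the statements about the
      -- vertices already treated.
      have hne : ∀ x ∈ O, σ.arr 43 x < σ.arr 43 y + 1 → x ≠ p := by
        rintro x hx h rfl
        omega
      have hUn : ∀ z ≤ n, (if z = p then 1 else σ'.arr 34 z) ≠ 0 ↔ σ.arr 34 z ≠ 0 ∨
          z < n ∧ ∃ x ∈ O, σ.arr 43 x < σ.arr 43 y + 1 ∧
            (if x = p then 1 else σ'.arr 34 x) ≠ 0 ∧ σ.arr 12 x = z := by
        intro z hz
        by_cases hzp : z = p
        · simp only [if_pos hzp, ne_eq, one_ne_zero, not_false_eq_true, true_iff]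
          exact .inr ⟨hzp ▸ hp, y, hy, by omega, by rw [if_neg hpy]; exact hU, hzp ▸ hpe⟩
        · rw [if_neg hzp, hI1 z hz]
          refine or_congr_right (and_congr_right fun hzn => ?_)
          constructor
          · rintro ⟨x, h1, h2, h3, h4⟩
            exact ⟨x, h1, by omega, by rw [if_neg (hne x h1 (by omega))]; exact h3, h4⟩
          · rintro ⟨x, h1, h2, h3, h4⟩
            rw [if_neg (hne x h1 h2)] at h3
            rcases (hlt x h1).1 h2 with h2 | rfl
            · exact ⟨x, h1, h2, h3, h4⟩
            · exact absurd (h4.symm.trans hpe) hzp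
      have hot : ∀ z < n, z ≠ p → (σ'.arr 13 z = n ∧ ∀ x ∈ O, σ.arr 43 x < σ.arr 43 y + 1 →
          (if x = p then 1 else σ'.arr 34 x) ≠ 0 → σ.arr 12 x ≠ z) ∨
          (σ'.arr 13 z ∈ O ∧ σ.arr 43 (σ'.arr 13 z) < σ.arr 43 y + 1 ∧
            (if σ'.arr 13 z = p then 1 else σ'.arr 34 (σ'.arr 13 z)) ≠ 0 ∧
            σ.arr 12 (σ'.arr 13 z) = z ∧
          ∀ x ∈ O, σ.arr 43 x < σ.arr 43 y + 1 → (if x = p then 1 else σ'.arr 34 x) ≠ 0 →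
            σ.arr 12 x = z → σ.arr 31 x ≤ σ.arr 31 (σ'.arr 13 z)) := by
        intro z hz hzp
        rcases hI2 z hz with ⟨h1, h2⟩ | ⟨h1, h2, h3, h4, h5⟩
        · refine .inl ⟨h1, fun x hx h3 h4 h5 => ?_⟩
          rw [if_neg (hne x hx h3)] at h4
          rcases (hlt x hx).1 h3 with h6 | rfl
          · exact h2 x hx h6 h4 h5
          · exact hzp (h5.symm.trans hpe)
        · refine .inr ⟨h1, by omega, by rw [if_neg (hne _ h1 (by omega))]; exact h3, h4,
            fun x hx h6 h7 h8 => ?_⟩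
          rw [if_neg (hne x hx h6)] at h7
          rcases (hlt x hx).1 h6 with h9 | rfl
          · exact h5 x hx h9 h7 h8
          · exact absurd (h8.symm.trans hpe) hzp
      simp only [setArr_same, setReg_arr, setArr_ne (show (34 : ℕ) ≠ 13 by decide),
        setArr_ne (show (13 : ℕ) ≠ 34 by decide)]
      refine ⟨hUn, fun z hz => ?_, ?_⟩
      rotate_left
      · try rw [if_neg hp.ne']
        exact hI3
      by_cases hzp : z = p
      rotate_left
      · try simp only [if_neg hzp]
        exact hot z hz hzp
      subst hzp
      try simp only [if_true]
    · refine .inr ⟨hy, by omega, by rw [if_neg hpy]; exact hU, hpe, fun x hx h1 h2 h3 => ?_⟩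
      rw [if_neg (hne x hx h1)] at h2
      rcases hI2 z hz with ⟨-, h4⟩ | ⟨h4, -⟩
      · rcases (hlt x hx).1 h1 with h5 | rfl
        · exact absurd h3 (h4 x hx h5 h2)
        · exact le_rfl
      · exact absurd (hv0 ▸ h4) hnO
    · refine .inr ⟨hy, by omega, by rw [if_neg hpy]; exact hU, hpe, fun x hx h1 h2 h3 => ?_⟩
      rw [if_neg (hne x hx h1)] at h2
      rcases hI2 z hz with ⟨h4, -⟩ | ⟨-, -, -, -, h4⟩
      · exact absurd h4 hv0
      · rcases (hlt x hx).1 h1 with h5 | rfl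
        · exact (h4 x hx h5 h2 h3).trans hvd.le
        · exact le_rfl
    · rcases hI2 z hz with ⟨h4, -⟩ | ⟨h1, h2, h3, h4, h5⟩
      · exact absurd h4 hv0
      · refine .inr ⟨h1, by omega, by rw [if_neg (hne _ h1 (by omega))]; exact h3, h4,
            fun x hx h6 h7 h8 => ?_⟩
        rw [if_neg (hne x hx h6)] at h7
        rcases (hlt x hx).1 h6 with h9 | rfl
        · exact h5 x hx h9 h7 h8
        · exact not_lt.1 hvd
  · omega
  · rintro σ' ⟨h1, h2, h3⟩
    refine ⟨fun z hz => (h1 z hz).trans (or_congr_right (and_congr_right fun _ => ?_)),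
      fun y hy hU hp => ?_, h3⟩
    · exact ⟨fun ⟨x, h1, h2, h3⟩ => ⟨x, h1, h3⟩, fun ⟨x, h1, h3⟩ => ⟨x, h1, hl.pos_lt x h1, h3⟩⟩
    · rcases h2 _ (hl.lt _ hp) with ⟨-, h4⟩ | ⟨h4, h5, h6, h7, h8⟩
      · exact absurd rfl (h4 y hy (hl.pos_lt y hy) hU)
      · exact ⟨h4, h6, h7, h8 y hy (hl.pos_lt y hy) hU rfl⟩

/-- Compute the nearest ancestor in `U`, and within `U` the depth and the top of the heavy path. -/
def pathPass : Prog :=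
  forDesc (.seq (.set 12 (.get 12 (.var 11))) <| .ite (.get 34 (.var 11))
    (.seq (.put 14 (.var 11) (.var 11)) <|
      .seq (.put 35 (.var 11) (.add (.get 35 (.var 12)) (.lit 1))) <|
      .ite (.eq (.get 13 (.var 12)) (.var 11)) (.put 15 (.var 11) (.get 15 (.var 12)))
        (.put 15 (.var 11) (.var 11)))
    (.put 14 (.var 11) (.get 14 (.var 12))))

theorem runs_pathPass {n K : ℕ} {O : Set ℕ} {σ : State}
    (hl : Listed n K O (σ.arr 10) (σ.arr 43)) (hK : σ.reg 15 = K)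
    (hpar : ∀ y ∈ O, σ.arr 12 y = n ∨
      σ.arr 12 y ∈ O ∧ σ.arr 43 y < σ.arr 43 (σ.arr 12 y)) :
    Runs n pathPass σ (100 * n + 6) (fun σ' =>
      (∀ y ∈ O, (σ.arr 34 y ≠ 0 → σ'.arr 14 y = y ∧
        σ'.arr 35 y = σ'.arr 35 (σ.arr 12 y) + 1 ∧ σ'.arr 15 y =
          if σ.arr 13 (σ.arr 12 y) = y then σ'.arr 15 (σ.arr 12 y) else y) ∧
        (σ.arr 34 y = 0 → σ'.arr 14 y = σ'.arr 14 (σ.arr 12 y))) ∧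
      ∀ a x, x ∉ O → σ'.arr a x = σ.arr a x) := by
  have hnO : n ∉ O := fun h => lt_irrefl _ (hl.lt n h)
  refine (Runs.forDesc (n := n) (σ := σ) 50 (fun y A => (σ.arr 34 y ≠ 0 → A 14 y = y ∧
        A 35 y = A 35 (σ.arr 12 y) + 1 ∧ A 15 y =
          if σ.arr 13 (σ.arr 12 y) = y then A 15 (σ.arr 12 y) else y) ∧
        (σ.arr 34 y = 0 → A 14 y = A 14 (σ.arr 12 y)))
    hl hK rfl (by decide) (by decide) (by decide) (by decide) ?_ ?_).mono (by omega) fun _ h => h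
  rotate_left
  · intro y hy z hz hlt A A' h hP
    have hzy : z ≠ y := by rintro rfl; exact lt_irrefl _ hlt
    have hpy : σ.arr 12 z ≠ y := by
      intro h
      rcases hpar z hz with h' | ⟨-, h'⟩
      · exact hnO ((h.symm.trans h') ▸ hy)
      · rw [h] at h'
        omega
    simpa only [h _ _ hzy, h _ _ hpy] using hP
  intro y σ' hy _ h11 _ hr ha
  have e12 : σ'.arr 12 = σ.arr 12 := ha 12 (by decide)
  have e13 : σ'.arr 13 = σ.arr 13 := ha 13 (by decide)
  have e34 : σ'.arr 34 = σ.arr 34 := ha 34 (by decide)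
  have hpy : σ.arr 12 y ≠ y := by
    intro h
    rcases hpar y hy with h' | ⟨-, h'⟩
    · exact hnO ((h.symm.trans h') ▸ hy)
    · rw [h] at h'
      exact lt_irrefl _ h'
  simp only [step_ite, step_seq, step_put, step_set, eval_get, eval_var, eval_lit, eval_add,
      setReg_same, setReg_arr, h11, e12, e13, e34, eval_eq_zero, setArr_reg,
      setReg_ne (show (11 : ℕ) ≠ 12 by decide), setArr_ne (show (13 : ℕ) ≠ 14 by decide),
      setArr_ne (show (13 : ℕ) ≠ 35 by decide), setArr_ne (show (15 : ℕ) ≠ 14 by decide),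
      setArr_ne (show (15 : ℕ) ≠ 35 by decide), setArr_ne (show (35 : ℕ) ≠ 14 by decide)]
  refine ⟨⟨fun hU => ?_, fun hU => ?_⟩, fun a x hx => ?_⟩
  · rw [if_neg hU]
    split_ifs with h1 <;> simp [hpy]
  · simp [if_pos hU, hpy]
  · split_ifs <;> simp only [setArr_of_ne hx, setReg_arr]

/-! ### Local recognition of elements of `L`, and the buckets -/

/-- For the vertices `z` that satisfy a condition, run `adj` on the adjacency list of `z`. -/
def forVertices (e : Expr) (pre adj post : Prog) : Prog :=
  forLt 10 0 (.ite e (.seq pre (.seq (forAdj (.var 10) adj) post)) .skip)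

theorem Runs.forVertices {n : ℕ} {e : Expr} {pre adj post : Prog} {σ : State} (c : ℕ)
    {G : SimpleGraph ℕ} (Inv : ℕ → (ℕ → ℕ → ℕ) → Prop) (J : ℕ → ℕ → (ℕ → ℕ → ℕ) → Prop)
    (hn : σ.reg 0 = n) (hG : HoldsAdj n G σ.arr) (hew : e.wf) (hpw : pre.wf) (haw : adj.wf)
    (hqw : post.wf) (hec : e.cost ≤ c) (hpc : pre.tb ≤ c) (hac : adj.tb ≤ c) (hqc : post.tb ≤ c)
    (hr10 : 10 ∉ pre.wr ++ adj.wr ++ post.wr) (hr0 : 0 ∉ pre.wr ++ adj.wr ++ post.wr)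
    (hr20 : 20 ∉ adj.wr) (hr21 : 21 ∉ adj.wr) (ha0 : 0 ∉ pre.wa ++ adj.wa ++ post.wa)
    (ha1 : 1 ∉ pre.wa ++ adj.wa ++ post.wa) (hc1 : 1 ≤ c)
    (h0 : Inv 0 σ.arr)
    (hskip : ∀ (j : ℕ) (σ' : State), j < n → Inv j σ'.arr → σ'.reg 10 = j → σ'.reg 0 = n →
      (∀ a, a ∉ pre.wa ++ adj.wa ++ post.wa → σ'.arr a = σ.arr a) → e.eval σ' = 0 →
      Inv (j + 1) σ'.arr)
    (hpre : ∀ (j : ℕ) (σ' : State), j < n → Inv j σ'.arr → σ'.reg 10 = j → σ'.reg 0 = n →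
      (∀ a, a ∉ pre.wa ++ adj.wa ++ post.wa → σ'.arr a = σ.arr a) → e.eval σ' ≠ 0 →
      J j (σ.arr 0 j) (pre.step σ').arr)
    (hadj : ∀ (j i : ℕ) (σ' : State), j < n → σ.arr 0 j ≤ i → i < σ.arr 0 (j + 1) →
      J j i σ'.arr → σ'.reg 10 = j → σ'.reg 0 = n → σ'.reg 13 = σ.arr 1 i →
      (∀ a, a ∉ pre.wa ++ adj.wa ++ post.wa → σ'.arr a = σ.arr a) →
      J j (i + 1) (adj.step σ').arr)
    (hpost : ∀ (j : ℕ) (σ' : State), j < n → J j (σ.arr 0 (j + 1)) σ'.arr → σ'.reg 10 = j → σ'.reg 0 = n →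
      (∀ a, a ∉ pre.wa ++ adj.wa ++ post.wa → σ'.arr a = σ.arr a) →
      Inv (j + 1) (post.step σ').arr) :
    Runs n (AvoidableVertices.forVertices e pre adj post) σ
      ((c + 11) * σ.arr 0 n + (5 * c + 20) * n + 6) (fun σ' => Inv n σ'.arr) := by
  simp only [List.mem_append, not_or] at hr10 hr0 ha0 ha1
  have hmono : ∀ k ≤ n, σ.arr 0 k ≤ σ.arr 0 n := by
    intro k hk
    induction hk using Nat.decreasingInduction with
    | self => exact le_rfl
    | of_succ k hk ih => exact (hG.mono k hk).trans ih
  have hframe : ∀ {σ' : State} (p : Prog), (∀ a, a ∈ p.wa → a ∈ pre.wa ++ adj.wa ++ post.wa) →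
      (∀ a, a ∉ pre.wa ++ adj.wa ++ post.wa → σ'.arr a = σ.arr a) → ∀ σ'' : State,
      (∀ a, a ∉ p.wa → σ''.arr a = σ'.arr a) →
      (∀ a, a ∉ pre.wa ++ adj.wa ++ post.wa → σ''.arr a = σ.arr a) :=
    fun p hp h σ'' h' a ha => (h' a fun hh => ha (hp a hh)).trans (h a ha)
  have hb10 : 10 ∉ (Prog.ite e
      (.seq pre (.seq (AvoidableVertices.forAdj (.var 10) adj) post)) .skip).wr := by
    simpa [Prog.wr, AvoidableVertices.forAdj] using ⟨hr10.1.1, hr10.1.2, hr10.2⟩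
  have hb0 : 0 ∉ (Prog.ite e (.seq pre (.seq (AvoidableVertices.forAdj (.var 10) adj) post)) .skip).wr := by
    simpa [Prog.wr, AvoidableVertices.forAdj] using ⟨hr0.1.1, hr0.1.2, hr0.2⟩
  have hba : ∀ a, a ∉ pre.wa ++ adj.wa ++ post.wa →
      a ∉ (Prog.ite e (.seq pre (.seq (AvoidableVertices.forAdj (.var 10) adj) post)) .skip).wa := by
    intro a ha
    simpa [Prog.wa, AvoidableVertices.forAdj, and_assoc] using ha
  -- The budget telescopes along the adjacency array: each entry and each vertex is paid for once.
  refine (Runs.forLt (n := n) (σ := σ) (fun j φ A => Inv j A ∧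
    φ = (c + 11) * (σ.arr 0 n - σ.arr 0 j) + (5 * c + 12) * (n - j)) rfl (by decide) rfl
    (by decide) hb10 hb0 ⟨h0, rfl⟩ ?_).mono ?_ ?_
  · rintro j φ σ' hj ⟨hI, rfl⟩ hJ hr ha
    rw [hn] at hj
    have ha' : ∀ a, a ∉ pre.wa ++ adj.wa ++ post.wa → σ'.arr a = σ.arr a :=
      fun a h => ha a (hba a h)
    have h00 : σ'.reg 0 = n := (hr 0 hb0 (by decide)).trans hn
    have hm1 := hG.mono j hj
    have hm2 := hmono (j + 1) hj
    have e0 : ∀ {σ' : State}, (∀ a, a ∉ pre.wa ++ adj.wa ++ post.wa → σ'.arr a = σ.arr a) →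
      σ'.arr 0 = σ.arr 0 := fun h => h 0 (by simpa using ⟨ha0.1.1, ha0.1.2, ha0.2⟩)
    have e1 : ∀ {σ' : State}, (∀ a, a ∉ pre.wa ++ adj.wa ++ post.wa → σ'.arr a = σ.arr a) →
      σ'.arr 1 = σ.arr 1 := fun h => h 1 (by simpa using ⟨ha1.1.1, ha1.1.2, ha1.2⟩)
    have hbig : Runs n (.ite e (.seq pre (.seq (AvoidableVertices.forAdj (.var 10) adj) post)) .skip) σ'
        (e.cost + 1 + (pre.tb + (((c + 11) * (σ.arr 0 (j + 1) - σ.arr 0 j) + 2 * c + 10) + post.tb)))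
        (fun σ'' => Inv (j + 1) σ''.arr) := by
      refine Runs.ite hew (fun he => ?_) (fun he => ?_)
      · refine Runs.seq (Runs.block hpw).frame ?_
        rintro σ1 ⟨rfl, h1, h2⟩
        have hJ1 := hpre j σ' hj hI hJ h00 ha' he
        have h10 : (pre.step σ').reg 10 = j := (h1 10 hr10.1.1).trans hJ
        have h00' : (pre.step σ').reg 0 = n := (h1 0 hr0.1.1).trans h00
        have ha1' := hframe pre (by simp +contextual) ha' _ h2
        generalize pre.step σ' = σ1 at *
        have hA := Runs.forAdj (n := n) (σ := σ1) (v := .var 10) c (J j) rfl hc1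
          (by rw [eval_var, h10]; exact hj) (fun x => rfl)
          (by rw [eval_var, h10, e0 ha1']; exact hm1)
          (by
            rw [eval_var, h10, e0 ha1', e1 ha1']
            exact fun i h1 h2 => hG.adj_lt hj h1 h2) haw hac hr20 hr21 ha1.1.2
          (by rw [eval_var, h10, e0 ha1']; exact hJ1) (by
            rw [eval_var, h10, e0 ha1', e1 ha1']
            intro i σ2 h3 h4 h5 h6 h7 h8 _
            exact hadj j i σ2 hj h3 h4 h5
              ((h7 10 hr10.1.2 (by decide) (by decide) (by decide)).trans h10)
              ((h7 0 hr0.1.2 (by decide) (by decide) (by decide)).trans h00') h6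
              (hframe adj (by simp +contextual) ha1' _ h8))
        rw [eval_var, h10, e0 ha1'] at hA
        refine Runs.seq hA.frame ?_
        rintro σ2 ⟨hJ2, h3, h4⟩
        have h10' : σ2.reg 10 = j :=
          (h3 10 (by simpa [Prog.wr, AvoidableVertices.forAdj] using hr10.1.2)).trans h10
        have h00'' : σ2.reg 0 = n :=
          (h3 0 (by simpa [Prog.wr, AvoidableVertices.forAdj] using hr0.1.2)).trans h00'
        have ha2 := hframe (AvoidableVertices.forAdj (.var 10) adj)
          (by simp +contextual [Prog.wa, AvoidableVertices.forAdj]) ha1' _ h4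
        refine (Runs.block hqw).imp ?_
        rintro _ rfl
        exact hpost j σ2 hj hJ2 h10' h00'' ha2
      · refine (Runs.block (p := .skip) rfl).mono (by simp only [Prog.tb]; omega) ?_
        intro σ'' h
        rw [h]
        exact hskip j σ' hj hI hJ h00 ha' he
    refine ⟨_, hbig.imp fun σ'' h => ⟨_, ⟨h, rfl⟩, ?_⟩⟩
    obtain ⟨x, hx⟩ := Nat.exists_eq_add_of_le hm1
    obtain ⟨y, hy⟩ := Nat.exists_eq_add_of_le hm2
    obtain ⟨k, hk⟩ := Nat.exists_eq_add_of_le (Nat.succ_le_of_lt hj)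
    rw [show σ.arr 0 n - σ.arr 0 j = x + y by omega, show σ.arr 0 n - σ.arr 0 (j + 1) = y by omega,
      show σ.arr 0 (j + 1) - σ.arr 0 j = x by omega, show n - j = k + 1 by omega,
      show n - (j + 1) = k by omega]
    nlinarith
  · rw [hn, hG.start]
    simp only [Nat.sub_zero]
    nlinarith
  · rw [hn]
    exact fun σ' h => h.2.choose_spec.1

/-- Starting from `h`, the links `nxt` run through the list `l` and end with `n`. -/
def Linked (nxt : ℕ → ℕ) (n : ℕ) : ℕ → List ℕ → Prop
  | h, [] => h = n
  | h, a :: l => h = a ∧ a < n ∧ Linked nxt n (nxt a) l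

theorem Linked.congr {nxt nxt' : ℕ → ℕ} {n h : ℕ} {l : List ℕ} (hl : Linked nxt n h l)
    (hc : ∀ x ∈ l, nxt' x = nxt x) : Linked nxt' n h l := by
  induction l generalizing h with
  | nil => exact hl
  | cons a l ih =>
    refine ⟨hl.1, hl.2.1, ?_⟩
    rw [hc a (by simp)]
    exact ih hl.2.2 fun x hx => hc x (by simp [hx])

/-- The lists that start at `head t` contain the vertices `z` with `P z` and `f z = t`. -/
def Buckets (n : ℕ) (head nxt f : ℕ → ℕ) (P : ℕ → Prop) : Prop :=
  ∀ t ≤ n, ∃ l : List ℕ, Linked nxt n (head t) l ∧ l.Nodup ∧ ∀ z, z ∈ l ↔ P z ∧ f z = t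

/-- Determine `bot` and the elements of `L` that are recognized locally, and put the other elements
of `U` into buckets. -/
def botPass : Prog :=
  forVertices (.get 34 (.var 10))
    (.seq (.put 42 (.var 10) (.get 33 (.var 10))) (.put 18 (.var 10) (.var 10)))
    (.ite (.get 30 (.var 13)) (.ite (.lt (.get 43 (.var 13)) (.get 43 (.var 10)))
      (.seq (.set 16 (.get 14 (.var 13))) <|
        .seq (.ite (.lt (.get 35 (.var 10)) (.get 35 (.get 15 (.var 16))))
          (.put 42 (.var 10) (.lit 1)) .skip)
          (.ite (.lt (.get 43 (.var 16)) (.get 43 (.get 18 (.var 10))))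
            (.put 18 (.var 10) (.var 16)) .skip)) .skip) .skip)
    (.ite (.get 42 (.var 10)) (.put 36 (.var 10) (.lit 1))
      (.seq (.put 17 (.var 10) (.get 16 (.get 18 (.var 10))))
        (.put 16 (.get 18 (.var 10)) (.var 10))))

theorem runs_botPass {n : ℕ} {G : SimpleGraph ℕ} {O : Set ℕ} {σ : State}
    (hn : σ.reg 0 = n) (hG : HoldsAdj n G σ.arr) (hins : ∀ y < n, σ.arr 30 y ≠ 0 ↔ y ∈ O)
    (h36 : ∀ i ≤ n, σ.arr 36 i = 0) (h16 : ∀ i ≤ n, σ.arr 16 i = n)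
    (h14 : ∀ i ≤ n, σ.arr 14 i ≤ n) :
    Runs n botPass σ (100 * σ.arr 0 n + 600 * n + 6) (fun σ' =>
      (∀ z < n, σ.arr 34 z ≠ 0 →
        (σ'.arr 42 z ≠ 0 ↔ σ.arr 33 z ≠ 0 ∨ ∃ w ∈ O, G.Adj z w ∧ σ.arr 43 w < σ.arr 43 z ∧
          σ.arr 35 z < σ.arr 35 (σ.arr 15 (σ.arr 14 w))) ∧
        (∀ w ∈ O, G.Adj z w → σ.arr 43 w < σ.arr 43 z →
          σ.arr 43 (σ'.arr 18 z) ≤ σ.arr 43 (σ.arr 14 w)) ∧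
        (σ'.arr 18 z = z ∨ ∃ w ∈ O, G.Adj z w ∧ σ.arr 43 w < σ.arr 43 z ∧
          σ'.arr 18 z = σ.arr 14 w)) ∧
      (∀ z ≤ n, σ'.arr 36 z ≠ 0 ↔ z < n ∧ σ.arr 34 z ≠ 0 ∧ σ'.arr 42 z ≠ 0) ∧
      Buckets n (σ'.arr 16) (σ'.arr 17) (σ'.arr 18)
        (fun z => z < n ∧ σ.arr 34 z ≠ 0 ∧ σ'.arr 42 z = 0)) := by
  -- `E z i w` says that `w` is an inserted neighbour of `z` before `z` that occurs in the list of
  -- `z` before the cell `i`. At the end of the list this is the quantifier in `BotSpec`.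
  set E : ℕ → ℕ → ℕ → Prop := fun z i w => ∃ i', σ.arr 0 z ≤ i' ∧ i' < i ∧ σ.arr 1 i' = w ∧
    w ∈ O ∧ σ.arr 43 w < σ.arr 43 z with hE
  set S : ℕ → ℕ → ℕ → ℕ → Prop := fun z i l0 b =>
    (l0 ≠ 0 ↔ σ.arr 33 z ≠ 0 ∨ ∃ w, E z i w ∧ σ.arr 35 z < σ.arr 35 (σ.arr 15 (σ.arr 14 w))) ∧
    (∀ w, E z i w → σ.arr 43 b ≤ σ.arr 43 (σ.arr 14 w)) ∧
    (b = z ∨ ∃ w, E z i w ∧ b = σ.arr 14 w) ∧ b ≤ n with hS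
  set I : ℕ → (ℕ → ℕ → ℕ) → Prop := fun j A =>
    (∀ z < j, σ.arr 34 z ≠ 0 → S z (σ.arr 0 (z + 1)) (A 42 z) (A 18 z)) ∧
    (∀ z ≤ n, A 36 z ≠ 0 ↔ z < j ∧ σ.arr 34 z ≠ 0 ∧ A 42 z ≠ 0) ∧
    Buckets n (A 16) (A 17) (A 18) (fun z => z < j ∧ σ.arr 34 z ≠ 0 ∧ A 42 z = 0) with hI
  have key := Runs.forVertices (n := n) (σ := σ) (e := .get 34 (.var 10))
    (pre := (.seq (.put 42 (.var 10) (.get 33 (.var 10))) (.put 18 (.var 10) (.var 10))))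
    (adj := (.ite (.get 30 (.var 13)) (.ite (.lt (.get 43 (.var 13)) (.get 43 (.var 10)))
      (.seq (.set 16 (.get 14 (.var 13))) <|
        .seq (.ite (.lt (.get 35 (.var 10)) (.get 35 (.get 15 (.var 16))))
          (.put 42 (.var 10) (.lit 1)) .skip)
          (.ite (.lt (.get 43 (.var 16)) (.get 43 (.get 18 (.var 10))))
            (.put 18 (.var 10) (.var 16)) .skip)) .skip) .skip))
    (post := (.ite (.get 42 (.var 10)) (.put 36 (.var 10) (.lit 1))
      (.seq (.put 17 (.var 10) (.get 16 (.get 18 (.var 10))))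
        (.put 16 (.get 18 (.var 10)) (.var 10))))) 60 I
    (fun j i A => σ.arr 34 j ≠ 0 ∧ S j i (A 42 j) (A 18 j) ∧ I j A) hn hG rfl rfl rfl rfl
    (by decide) (by decide) (by decide) (by decide) (by decide) (by decide) (by decide) (by decide)
    (by decide) (by decide) (by decide) ?_ ?_ ?_ ?_ ?_
  · refine key.mono (by omega) ?_
    rintro σ' ⟨h1, h2, h3⟩
    have hEO : ∀ z < n, ∀ w, E z (σ.arr 0 (z + 1)) w ↔ w ∈ O ∧ G.Adj z w ∧
        σ.arr 43 w < σ.arr 43 z := by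
      intro z hz w
      rw [hG.adj_iff z hz w]
      constructor
      · rintro ⟨i, h1, h2, h3, h4, h5⟩
        exact ⟨h4, ⟨i, h1, h2, h3⟩, h5⟩
      · rintro ⟨h4, ⟨i, h1, h2, h3⟩, h5⟩
        exact ⟨i, h1, h2, h3, h4, h5⟩
    refine ⟨fun z hz hU => ?_, h2, h3⟩
    obtain ⟨h4, h5, h6, -⟩ := h1 z hz hU
    simp only [hEO z hz] at h4 h5 h6
    refine ⟨h4.trans (or_congr_right ?_), fun w hw h7 h8 => h5 w ⟨hw, h7, h8⟩,
      h6.imp_right ?_⟩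
    · simp only [and_assoc]
    · simp only [and_assoc]; exact id
  · refine ⟨fun z hz => absurd hz (Nat.not_lt_zero z), fun z hz => ?_, fun t ht => ?_⟩
    · simp [h36 z hz]
    · exact ⟨[], h16 t ht, List.nodup_nil, by simp⟩
  · intro j σ' hj hI hJ _ ha he
    have e34 : σ'.arr 34 = σ.arr 34 := ha 34 (by decide)
    rw [eval_get, eval_var, hJ, e34] at he
    have hne : ∀ z, σ.arr 34 z ≠ 0 → z ≠ j := by rintro z h rfl; exact h he
    obtain ⟨h1, h2, h3⟩ := hI
    have hlt : ∀ z (P : Prop), (z < j + 1 ∧ σ.arr 34 z ≠ 0 ∧ P) ↔ (z < j ∧ σ.arr 34 z ≠ 0 ∧ P) :=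
      fun z P => ⟨fun h => ⟨by have := hne z h.2.1; omega, h.2⟩, fun h => ⟨by omega, h.2⟩⟩
    refine ⟨fun z hz hU => h1 z (by have := hne z hU; omega) hU, fun z hz => ?_, ?_⟩
    · rw [hlt]; exact h2 z hz
    · simpa only [hlt] using h3
  · intro j σ' hj hI hJ _ ha he
    have e33 : σ'.arr 33 = σ.arr 33 := ha 33 (by decide)
    rw [eval_get, eval_var, hJ, show σ'.arr 34 = σ.arr 34 from ha 34 (by decide)] at he
    obtain ⟨h1, h2, h3⟩ := hI
    have h0 : ∀ z i l b, z < j → (S z i (if z = j then l else σ'.arr 42 z)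
        (if z = j then b else σ'.arr 18 z) ↔ S z i (σ'.arr 42 z) (σ'.arr 18 z)) := by
      intro z i l b hz
      rw [if_neg hz.ne, if_neg hz.ne]
    simp only [step_seq, step_put, eval_get, eval_var, hJ, setArr_reg, setArr_same, e33,
      setArr_ne (show (18 : ℕ) ≠ 42 by decide), setArr_ne (show (42 : ℕ) ≠ 18 by decide), if_true]
    refine ⟨he, ⟨?_, ?_, .inl rfl, hj.le⟩, fun z hz hU => ?_, fun z hz => ?_, ?_⟩
    · refine ⟨.inl, fun h => h.resolve_right ?_⟩
      rintro ⟨w, ⟨i, h4, h5, -⟩, -⟩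
      omega
    · rintro w ⟨i, h4, h5, -⟩
      omega
    · simp only [setArr_ne, setArr_same, ne_eq, if_neg hz.ne,
        Nat.reduceEqDiff, not_false_eq_true]
      exact h1 z hz hU
    · simp only [setArr_ne, setArr_same, ne_eq, Nat.reduceEqDiff, not_false_eq_true]
      refine (h2 z hz).trans (and_congr_right fun hzj => ?_)
      rw [if_neg hzj.ne]
    · intro t ht
      obtain ⟨l, h4, h5, h6⟩ := h3 t ht
      refine ⟨l, ?_, h5, fun z => ?_⟩
      · simpa using h4
      · rw [h6]
        simp only [setArr_ne, setArr_same, ne_eq, Nat.reduceEqDiff, not_false_eq_true, and_assoc]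
        refine and_congr_right fun hzj => ?_
        rw [if_neg hzj.ne, if_neg hzj.ne]
  · rintro j i σ' hj hi1 hi2 ⟨hUj, hS1, h1, h2, h3⟩ hJ _ h13 ha
    have e30 : σ'.arr 30 = σ.arr 30 := ha 30 (by decide)
    have e43 : σ'.arr 43 = σ.arr 43 := ha 43 (by decide)
    have e14 : σ'.arr 14 = σ.arr 14 := ha 14 (by decide)
    have e15 : σ'.arr 15 = σ.arr 15 := ha 15 (by decide)
    have e35 : σ'.arr 35 = σ.arr 35 := ha 35 (by decide)
    have hw : σ.arr 1 i < n := hG.adj_lt hj hi1 hi2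
    have hEi : ∀ w, E j (i + 1) w ↔ E j i w ∨
        (w = σ.arr 1 i ∧ w ∈ O ∧ σ.arr 43 w < σ.arr 43 j) := by
      intro w
      constructor
      · rintro ⟨i', h4, h5, h6, h7⟩
        by_cases he : i' = i
        · exact .inr ⟨by rw [← h6, he], h7⟩
        · exact .inl ⟨i', h4, by omega, h6, h7⟩
      · rintro (⟨i', h4, h5, h6⟩ | ⟨h4, h5⟩)
        · exact ⟨i', h4, by omega, h6⟩
        · exact ⟨i, hi1, by omega, h4.symm, h5⟩
    simp only [step_ite, step_seq, step_put, step_set, step_skip, eval_get, eval_var, eval_lit,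
      hJ, h13, e30, e43, e14, e15, e35, eval_lt_zero, setReg_same,
      setReg_ne (show (10 : ℕ) ≠ 16 by decide), setReg_arr]
    have hno : (σ.arr 30 (σ.arr 1 i) = 0 ∨ ¬ σ.arr 43 (σ.arr 1 i) < σ.arr 43 j) →
        S j (i + 1) (σ'.arr 42 j) (σ'.arr 18 j) := by
      intro h
      have : ∀ w, E j (i + 1) w ↔ E j i w := by
        intro w
        rw [hEi]
        refine ⟨fun h' => h'.resolve_right ?_, .inl⟩
        rintro ⟨rfl, h4, h5⟩
        rcases h with h | h
        · exact (hins _ hw).2 h4 h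
        · exact h h5
      simpa only [hS, this] using hS1
    have hrest : ∀ X : State, (∀ a x, x ≠ j → X.arr a x = σ'.arr a x) → X.arr 16 = σ'.arr 16 →
        X.arr 17 = σ'.arr 17 → X.arr 36 = σ'.arr 36 → I j X.arr := by
      intro X hX h16 h17 h36
      refine ⟨fun z hz hU => ?_, fun z hz => ?_, fun t ht => ?_⟩
      · rw [hX _ _ hz.ne, hX _ _ hz.ne]; exact h1 z hz hU
      · rw [h36, h2 z hz]
        exact and_congr_right fun hzj => by rw [hX _ _ hzj.ne]
      · obtain ⟨l, h4, h5, h6⟩ := h3 t ht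
        refine ⟨l, by rw [h16, h17]; exact h4, h5, fun z => (h6 z).trans ?_⟩
        simp only [and_assoc]
        exact and_congr_right fun hzj => by rw [hX _ _ hzj.ne, hX _ _ hzj.ne]
    by_cases hc1 : σ.arr 30 (σ.arr 1 i) = 0
    · rw [if_pos hc1]
      exact ⟨hUj, hno (.inl hc1), h1, h2, h3⟩
    by_cases hc2 : ¬ σ.arr 43 (σ.arr 1 i) < σ.arr 43 j
    · rw [if_neg hc1, if_pos hc2]
      exact ⟨hUj, hno (.inr hc2), h1, h2, h3⟩
    rw [if_neg hc1, if_neg hc2]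
    have hwO := (hins _ hw).1 hc1
    rw [not_not] at hc2
    have hEw : E j (i + 1) (σ.arr 1 i) := (hEi _).2 (.inr ⟨rfl, hwO, hc2⟩)
    have hEm : ∀ w, E j i w → E j (i + 1) w := fun w h => (hEi w).2 (.inl h)
    obtain ⟨s1, s2, s3, s4⟩ := hS1
    have hL : ∀ b : Prop, [Decidable b] →
      (b ↔ σ.arr 35 j < σ.arr 35 (σ.arr 15 (σ.arr 14 (σ.arr 1 i)))) →
      ((if ¬ b then σ'.arr 42 j else 1) ≠ 0 ↔ σ.arr 33 j ≠ 0 ∨ ∃ w, E j (i + 1) w ∧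
        σ.arr 35 j < σ.arr 35 (σ.arr 15 (σ.arr 14 w))) := by
      intro b _ hb
      by_cases hbb : b
      · simp only [hbb, not_true_eq_false, if_false, ne_eq, one_ne_zero, not_false_eq_true,
          true_iff]
        exact .inr ⟨_, hEw, hb.1 hbb⟩
      · rw [if_pos hbb, s1]
        refine or_congr_right ⟨fun ⟨w, h4, h5⟩ => ⟨w, hEm w h4, h5⟩, fun ⟨w, h4, h5⟩ => ?_⟩
        rcases (hEi w).1 h4 with h4 | ⟨rfl, -⟩
        · exact ⟨w, h4, h5⟩
        · exact absurd (hb.2 h5) hbb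
    have hB : S j (i + 1) (if ¬ σ.arr 35 j < σ.arr 35 (σ.arr 15 (σ.arr 14 (σ.arr 1 i))) then
        σ'.arr 42 j else 1) (if ¬ σ.arr 43 (σ.arr 14 (σ.arr 1 i)) < σ.arr 43 (σ'.arr 18 j) then
        σ'.arr 18 j else σ.arr 14 (σ.arr 1 i)) := by
      refine ⟨hL _ Iff.rfl, fun w hEw' => ?_, ?_, ?_⟩
      · rcases (hEi w).1 hEw' with h4 | ⟨rfl, -⟩
        · have := s2 w h4
          split_ifs
          · omega
          · omega
        · split_ifs
          · exact le_rfl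
          · omega
      · split_ifs with h4
        · exact .inr ⟨_, hEw, rfl⟩
        · exact s3.imp_right fun ⟨w, h5, h6⟩ => ⟨w, hEm w h5, h6⟩
      · split_ifs with h4
        · exact h14 _ hw.le
        · exact s4
    by_cases hc3 : σ.arr 35 j < σ.arr 35 (σ.arr 15 (σ.arr 14 (σ.arr 1 i)))
    all_goals
      by_cases hc4 : σ.arr 43 (σ.arr 14 (σ.arr 1 i)) < σ.arr 43 (σ'.arr 18 j)
      all_goals
        simp only [hc3, hc4, not_true_eq_false, not_false_eq_true, if_true, if_false, setArr_reg,
          setReg_same, setReg_arr, setReg_ne (show (10 : ℕ) ≠ 16 by decide), hJ, e43,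
          setArr_ne (show (43 : ℕ) ≠ 42 by decide),
          setArr_ne (show (18 : ℕ) ≠ 42 by decide)] at hB ⊢
        refine ⟨hUj, by simpa using hB, hrest _ (fun a x hx => ?_) (by simp) (by simp) (by simp)⟩
        simp only [setArr_of_ne hx, setReg_arr]
  · rintro j σ' hj ⟨hUj, hS1, h1, h2, h3⟩ hJ _ ha
    have hlt : ∀ z, z < j + 1 ↔ z < j ∨ z = j := fun z => by omega
    have hSj : ∀ z < j + 1, σ.arr 34 z ≠ 0 → S z (σ.arr 0 (z + 1)) (σ'.arr 42 z) (σ'.arr 18 z) := by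
      intro z hz hU
      rcases (hlt z).1 hz with hz | rfl
      · exact h1 z hz hU
      · exact hS1
    simp only [step_ite, step_seq, step_put, eval_get, eval_var, eval_lit, hJ, setArr_reg,
      setArr_ne (show (18 : ℕ) ≠ 17 by decide)]
    split_ifs with hc
    · refine ⟨by simpa using hSj, fun z hz => ?_, fun t ht => ?_⟩
      · simp only [setArr_ne, ne_eq, Nat.reduceEqDiff, not_false_eq_true]
        rw [← ne_eq, h2 z hz, hlt, or_and_right]
        refine ⟨.inl, fun h => h.resolve_right ?_⟩
        rintro ⟨rfl, h'⟩
        exact h'.2 hc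
      · simp only [setArr_ne, setArr_same, ne_eq, Nat.reduceEqDiff, not_false_eq_true]
        obtain ⟨l, h4, h5, h6⟩ := h3 t ht
        have hjl : j ∉ l := fun h => lt_irrefl _ ((h6 j).1 h).1.1
        have h4' : ∀ h, Linked (σ'.arr 17) n h l →
            Linked (((σ'.setArr 17 j (σ'.arr 16 (σ'.arr 18 j))).setArr 16 (σ'.arr 18 j) j).arr 17)
              n h l := fun h hh => hh.congr fun x hx => by
          rw [setArr_ne (by decide), setArr_of_ne]
          rintro rfl
          exact hjl hx
        by_cases htj : t = σ'.arr 18 j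
        -- The new vertex is put in front of the list of its `bot`; the other links remain valid
        -- because it did not occur in any list.
        · refine ⟨j :: l, ⟨if_pos htj, hj, ?_⟩, List.nodup_cons.2 ⟨hjl, h5⟩, fun z => ?_⟩
          · refine h4' _ ?_
            rw [setArr_same, if_pos rfl, ← htj]
            exact h4
          · rw [List.mem_cons, h6, hlt]
            constructor
            · rintro (rfl | ⟨⟨h7, h8⟩, h9⟩)
              · exact ⟨⟨.inr rfl, hUj, hc⟩, htj.symm⟩
              · exact ⟨⟨.inl h7, h8⟩, h9⟩
            · rintro ⟨⟨h7 | h7, h8⟩, h9⟩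
              · exact .inr ⟨⟨h7, h8⟩, h9⟩
              · exact .inl h7
        · refine ⟨l, ?_, h5, fun z => ?_⟩
          · rw [if_neg htj]
            exact h4' _ h4
          · rw [h6, hlt]
            refine ⟨fun ⟨⟨h7, h8⟩, h9⟩ => ⟨⟨.inl h7, h8⟩, h9⟩, fun ⟨⟨h7, h8⟩, h9⟩ =>
              ⟨⟨h7.resolve_right ?_, h8⟩, h9⟩⟩
            rintro rfl
            exact htj h9.symm
    · refine ⟨by simpa using hSj, fun z hz => ?_, fun t ht => ?_⟩
      · simp only [setArr_ne, setArr_same, ne_eq, Nat.reduceEqDiff, not_false_eq_true]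
        split_ifs with hzj
        · simp [hzj, hUj, hc]
        · rw [← ne_eq, h2 z hz, hlt]
          simp [hzj]
      · simp only [setArr_ne, ne_eq, Nat.reduceEqDiff, not_false_eq_true]
        obtain ⟨l, h4, h5, h6⟩ := h3 t ht
        refine ⟨l, h4, h5, fun z => (h6 z).trans ?_⟩
        rw [hlt]
        refine ⟨fun ⟨⟨h7, h8⟩, h9⟩ => ⟨⟨.inl h7, h8⟩, h9⟩, fun ⟨⟨h7, h8⟩, h9⟩ =>
          ⟨⟨h7.resolve_right ?_, h8⟩, h9⟩⟩
        rintro rfl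
        exact hc h8.2

/-! ### Membership in `L`, bucket by bucket -/

/-- The number of indices below `k` with `f i = t`. -/
def countEq (f : ℕ → ℕ) (t k : ℕ) : ℕ := ((Finset.range k).filter fun i => f i = t).card

theorem countEq_succ (f : ℕ → ℕ) (t k : ℕ) :
    countEq f t (k + 1) = countEq f t k + if f k = t then 1 else 0 := by
  rw [countEq, Finset.range_add_one, Finset.filter_insert]
  split_ifs with h
  · rw [Finset.card_insert_of_notMem (by simp), countEq]
  · rw [countEq, add_zero]

theorem countEq_congr {f g : ℕ → ℕ} {t k : ℕ} (h : ∀ i < k, f i = g i) :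
    countEq f t k = countEq g t k := by
  rw [countEq, countEq, Finset.filter_congr fun i hi => by rw [h i (Finset.mem_range.1 hi)]]

/-- The elements of the buckets that satisfy `D` have been processed: each of them belongs to `L`
or to the list of the other vertices. -/
structure Filled (n : ℕ) (A₀ A : ℕ → ℕ → ℕ) (F D : ℕ → Prop) : Prop where
  sub : ∀ z, D z → F z
  isL : ∀ z, D z → (A 36 z ≠ 0 ↔ A₀ 35 z < A 38 (A₀ 18 z))
  other : ∀ z, ¬ D z → A 36 z = A₀ 36 z
  nl_mem : ∀ i < A 41 0, D (A 19 i) ∧ A 36 (A 19 i) = 0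
  exists_nl : ∀ z, D z → A 36 z = 0 → ∃ i < A 41 0, A 19 i = z
  inj : ∀ i < A 41 0, ∀ j < A 41 0, A 19 i = A 19 j → i = j
  anti : ∀ i j, i < j → j < A 41 0 → A₀ 43 (A₀ 18 (A 19 j)) ≤ A₀ 43 (A₀ 18 (A 19 i))
  cnt : ∀ t ≤ n, A 37 t = countEq (fun i => A₀ 18 (A 19 i)) t (A 41 0)
  deg : ∀ i < A 41 0, A 39 (A 19 i) = A₀ 31 (A₀ 18 (A 19 i)) + 1 -
    countEq (fun j => A₀ 18 (A 19 j)) (A₀ 18 (A 19 i)) (i + 1)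

/-- Process an element of a bucket. -/
def spillBody : Prog :=
  .seq (.ite (.lt (.get 35 (.var 17)) (.get 38 (.var 11))) (.put 36 (.var 17) (.lit 1))
    (.seq (.put 19 (.get 41 (.lit 0)) (.var 17)) <|
      .seq (.put 37 (.var 11) (.add (.get 37 (.var 11)) (.lit 1))) <|
      .seq (.put 39 (.var 17) (.sub (.add (.get 31 (.var 11)) (.lit 1)) (.get 37 (.var 11)))) <|
      .put 41 (.lit 0) (.add (.get 41 (.lit 0)) (.lit 1))))
    (.set 17 (.get 17 (.var 17)))

/-- The buckets are emptied from the top of the tree downwards, which makes the list of the vertices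
outside of `L` descending in `bot`. The counter of the bucket is increased before it is subtracted,
so it counts the new element itself, as `d_nonL` in `UpdateSpec` demands. -/
theorem Filled.step {n : ℕ} {A₀ : ℕ → ℕ → ℕ} {F D : ℕ → Prop} {σ : State} {z t : ℕ}
    (h : Filled n A₀ σ.arr F D) (h17 : σ.reg 17 = z) (h11 : σ.reg 11 = t) (hbt : A₀ 18 z = t)
    (e31 : σ.arr 31 = A₀ 31) (e35 : σ.arr 35 = A₀ 35) (hF : F z) (hD : ¬ D z)
    (h36 : A₀ 36 z = 0) (hmin : ∀ x, D x → A₀ 43 t ≤ A₀ 43 (A₀ 18 x)) (htn : t ≤ n) :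
    Filled n A₀ (spillBody.step σ).arr F (fun x => D x ∨ x = z) := by
  have hz36 : σ.arr 36 z = 0 := (h.other z hD).trans h36
  have hnz : ∀ i < σ.arr 41 0, σ.arr 19 i ≠ z := fun i hi he => hD (he ▸ (h.nl_mem i hi).1)
  simp only [spillBody, step_ite, step_seq, step_put, step_set, eval_get, eval_var, eval_lit,
    eval_add, eval_sub, eval_lt_zero, h17, h11, e31, e35, setArr_reg, setReg_arr,
    setArr_ne (show (31 : ℕ) ≠ 19 by decide), setArr_ne (show (31 : ℕ) ≠ 37 by decide),
    setArr_ne (show (37 : ℕ) ≠ 19 by decide), setArr_ne (show (41 : ℕ) ≠ 39 by decide),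
    setArr_ne (show (41 : ℕ) ≠ 37 by decide), setArr_ne (show (41 : ℕ) ≠ 19 by decide),
    setArr_same]
  split_ifs with hc
  · have hDz : ∀ x, D x → x ≠ z := by rintro x hx rfl; exact hD hx
    constructor
    · rintro x (hx | rfl)
      · exact h.sub x hx
      · exact hF
    · intro x hx
      simp only [ne_eq, Nat.reduceEqDiff, not_false_eq_true, setArr_ne, setArr_same]
      split_ifs with hxz
      · simp [hxz, hbt, hc]
      · exact h.isL x (hx.resolve_right hxz)
    · intro x hx
      rw [not_or] at hx
      simp [hx.2, h.other x hx.1]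
    · intro i hi
      simp only [ne_eq, Nat.reduceEqDiff, not_false_eq_true, setArr_ne] at hi
      simp [hnz i hi, h.nl_mem i hi]
    · intro x hx hx'
      by_cases hxz : x = z
      · simp [hxz] at hx'
      · simpa using h.exists_nl x (hx.resolve_right hxz) (by simpa [hxz] using hx')
    · simpa using h.inj
    · simpa using h.anti
    · simpa using h.cnt
    · simpa using h.deg
  · have hcq : ∀ (t k : ℕ), k ≤ σ.arr 41 0 →
        countEq (fun i => A₀ 18 (if i = σ.arr 41 0 then z else σ.arr 19 i)) t k =
        countEq (fun i => A₀ 18 (σ.arr 19 i)) t k := by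
      intro t k hk
      refine countEq_congr fun i hi => ?_
      rw [if_neg (by omega)]
    constructor
    · rintro x (hx | rfl)
      · exact h.sub x hx
      · exact hF
    · intro x hx
      simp only [ne_eq, Nat.reduceEqDiff, not_false_eq_true, setArr_ne]
      rcases hx with hx | rfl
      · exact h.isL x hx
      · simp [hz36, hbt, hc]
    · intro x hx
      rw [not_or] at hx
      simp [h.other x hx.1]
    · intro i hi
      simp only [ne_eq, Nat.reduceEqDiff, not_false_eq_true, setArr_ne, setArr_same,
        if_true] at hi ⊢
      split_ifs with hiM
      · exact ⟨.inr rfl, hz36⟩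
      · have := h.nl_mem i (by omega)
        exact ⟨.inl this.1, this.2⟩
    · intro x hx hx'
      simp only [ne_eq, Nat.reduceEqDiff, not_false_eq_true, setArr_ne, setArr_same,
        if_true] at hx' ⊢
      rcases hx with hx | rfl
      · obtain ⟨i, hi, he⟩ := h.exists_nl x hx hx'
        exact ⟨i, by omega, by rw [if_neg hi.ne, he]⟩
      · exact ⟨σ.arr 41 0, by omega, if_pos rfl⟩
    · intro i hi j hj
      simp only [ne_eq, Nat.reduceEqDiff, not_false_eq_true, setArr_ne, setArr_same,
        if_true] at hi hj ⊢
      split_ifs with h1 h2 h2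
      · omega
      · exact fun he => absurd he.symm (hnz j (by omega))
      · exact fun he => absurd he (hnz i (by omega))
      · exact h.inj i (by omega) j (by omega)
    · intro i j hij hj
      simp only [ne_eq, Nat.reduceEqDiff, not_false_eq_true, setArr_ne, setArr_same,
        if_true] at hj ⊢
      rw [if_neg (show i ≠ σ.arr 41 0 by omega)]
      split_ifs with h1
      · rw [hbt]
        exact hmin _ (h.nl_mem i (by omega)).1
      · exact h.anti i j hij (by omega)
    · intro s hs
      simp only [ne_eq, Nat.reduceEqDiff, not_false_eq_true, setArr_ne, setArr_same, if_true]
      rw [countEq_succ, hcq _ _ le_rfl, if_pos rfl, hbt, ← h.cnt s hs]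
      by_cases hst : s = t
      · simp [hst]
      · simp [hst, Ne.symm hst]
    · intro i hi
      simp only [ne_eq, Nat.reduceEqDiff, not_false_eq_true, setArr_ne, setArr_same,
        if_true] at hi ⊢
      split_ifs with h1 h2 h2
      · rw [countEq_succ, h1, hcq _ _ le_rfl, if_pos rfl, hbt, if_pos rfl, h.cnt t htn]
      · exact absurd rfl h2
      · exact absurd h2 (hnz i (by omega))
      · rw [hcq _ _ (by omega)]
        exact h.deg i (by omega)

theorem Filled.congr {n : ℕ} {A₀ A A' : ℕ → ℕ → ℕ} {F D D' : ℕ → Prop} (h : Filled n A₀ A F D)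
    (hD : ∀ z, D z ↔ D' z) (h38 : ∀ z, D z → A' 38 (A₀ 18 z) = A 38 (A₀ 18 z))
    (hA : ∀ a, a ≠ 38 → A' a = A a) : Filled n A₀ A' F D' := by
  obtain rfl : D = D' := funext fun z => propext (hD z)
  have e36 := hA 36 (by decide)
  have e41 := hA 41 (by decide)
  have e19 := hA 19 (by decide)
  have e37 := hA 37 (by decide)
  have e39 := hA 39 (by decide)
  constructor
  · exact h.sub
  · intro z hz
    rw [h38 z hz, e36]
    exact h.isL z hz
  · rw [e36]; exact h.other
  · rw [e36, e41, e19]; exact h.nl_mem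
  · rw [e36, e41, e19]; exact h.exists_nl
  · rw [e41, e19]; exact h.inj
  · rw [e41, e19]; exact h.anti
  · rw [e41, e19, e37]; exact h.cnt
  · rw [e41, e19, e39]; exact h.deg

/-- Prepare the processing of the bucket of a vertex. -/
def spillPre : Prog :=
  .seq (.set 12 (.get 12 (.var 11))) <|
  .seq (.ite (.eq (.get 15 (.var 11)) (.var 11)) (.put 38 (.var 11) (.get 35 (.var 11)))
    (.ite (.lt (.add (.get 31 (.var 11)) (.get 37 (.var 12))) (.add (.get 31 (.var 12)) (.lit 1)))
      (.put 38 (.var 11) (.get 35 (.var 11))) (.put 38 (.var 11) (.get 38 (.var 12)))))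
    (.set 17 (.get 16 (.var 11)))

theorem spillPre_step {n : ℕ} {σ : State} {y : ℕ} (hy : σ.reg 11 = y) (hn : σ.reg 0 = n) :
    (spillPre.step σ).reg 17 = σ.arr 16 y ∧ (spillPre.step σ).reg 11 = y ∧
    (spillPre.step σ).reg 0 = n ∧
    (∀ a, a ≠ 38 → (spillPre.step σ).arr a = σ.arr a) ∧
    (∀ x, x ≠ y → (spillPre.step σ).arr 38 x = σ.arr 38 x) ∧
    (spillPre.step σ).arr 38 y = if σ.arr 15 y = y ∨
      σ.arr 31 y + σ.arr 37 (σ.arr 12 y) < σ.arr 31 (σ.arr 12 y) + 1 then σ.arr 35 y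
      else σ.arr 38 (σ.arr 12 y) := by
  simp only [spillPre, step_ite, step_seq, step_put, step_set, eval_get, eval_var, eval_lit,
    eval_add, eval_lt_zero, eval_eq_zero, setReg_same, setReg_arr,
    setReg_ne (show (11 : ℕ) ≠ 12 by decide), hy]
  split_ifs with h1 h2 h3 h4 h5 <;> (simp_all; try omega)

/-- Decide which elements of the buckets belong to `L`, and list the others. -/
def spillPass : Prog :=
  forDesc (.ite (.get 34 (.var 11)) (.seq spillPre (.loop (.lt (.var 17) (.var 0)) spillBody)) .skip)

/-- The recursion for `gl` needs `cnt` and `gl` at the parent, whose bucket has already been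
emptied. Conversely, the elements of the bucket of `t` need only `gl t`. This resolves the mutual
dependence of `gl`, `L` and `cnt`. -/
theorem runs_spillPass {n K : ℕ} {O : Set ℕ} {F : ℕ → Prop} {σ : State}
    (hl : Listed n K O (σ.arr 10) (σ.arr 43)) (hK : σ.reg 15 = K) (hn : σ.reg 0 = n)
    (hpar : ∀ y ∈ O, σ.arr 12 y = n ∨
      σ.arr 12 y ∈ O ∧ σ.arr 43 y < σ.arr 43 (σ.arr 12 y))
    (hF : ∀ z, F z → z < n ∧ σ.arr 18 z ∈ O ∧ σ.arr 34 (σ.arr 18 z) ≠ 0)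
    (hb : Buckets n (σ.arr 16) (σ.arr 17) (σ.arr 18) F) (h36 : ∀ z, F z → σ.arr 36 z = 0)
    (h37 : ∀ t ≤ n, σ.arr 37 t = 0) (h41 : σ.arr 41 0 = 0) :
    Runs n spillPass σ (300 * n + 6) (fun σ' => Filled n σ.arr σ'.arr F F ∧
      ∀ t ∈ O, σ.arr 34 t ≠ 0 → σ'.arr 38 t = if σ.arr 15 t = t ∨
        σ.arr 31 t + σ'.arr 37 (σ.arr 12 t) < σ.arr 31 (σ.arr 12 t) + 1 then σ.arr 35 t
        else σ'.arr 38 (σ.arr 12 t)) := by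
  have hnO : n ∉ O := fun h => lt_irrefl _ (hl.lt n h)
  -- The vertices in buckets that are not yet emptied. Each vertex is in at most one bucket, so the
  -- rounds of all inner loops together are at most `n`.
  set R : ℕ → Set ℕ := fun j => {z | F z ∧ σ.arr 43 (σ.arr 18 z) + j < K} with hR
  have hRsub : ∀ j, R j ⊆ (Finset.range n : Set ℕ) := fun j z hz => by
    simpa using (hF z hz.1).1
  have hRfin : ∀ j, (R j).Finite := fun j => (Finset.finite_toSet _).subset (hRsub j)
  have hR0 : (R 0).ncard ≤ n := by
    have := Set.ncard_le_ncard (hRsub 0) (Finset.finite_toSet _)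
    rwa [Set.ncard_coe_finset, Finset.card_range] at this
  refine (Runs.forLt (n := n) (σ := σ) (fun j φ A =>
    Filled n σ.arr A F (fun z => F z ∧ K ≤ σ.arr 43 (σ.arr 18 z) + j) ∧
    (∀ t ∈ O, K ≤ σ.arr 43 t + j → σ.arr 34 t ≠ 0 → A 38 t = if σ.arr 15 t = t ∨
        σ.arr 31 t + A 37 (σ.arr 12 t) < σ.arr 31 (σ.arr 12 t) + 1 then σ.arr 35 t
        else A 38 (σ.arr 12 t)) ∧
    φ = 180 * (K - j) + 60 * (R j).ncard)
    rfl (by decide) rfl (by decide) (by decide) (by decide) ⟨?_, ?_, rfl⟩ ?_).mono ?_ ?_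
  · have hno : ∀ z, ¬ (F z ∧ K ≤ σ.arr 43 (σ.arr 18 z) + 0) := by
      rintro z ⟨h1, h2⟩
      have := hl.pos_lt _ (hF z h1).2.1
      omega
    constructor
    · exact fun z hz => absurd hz (hno z)
    · exact fun z hz => absurd hz (hno z)
    · exact fun _ _ => rfl
    · rw [h41]; exact fun i hi => absurd hi (Nat.not_lt_zero i)
    · exact fun z hz => absurd hz (hno z)
    · rw [h41]; exact fun i hi => absurd hi (Nat.not_lt_zero i)
    · rw [h41]; exact fun i j _ hj => absurd hj (Nat.not_lt_zero j)
    · intro t ht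
      rw [h37 t ht, h41]
      rfl
    · rw [h41]; exact fun i hi => absurd hi (Nat.not_lt_zero i)
  · intro t ht h
    have := hl.pos_lt t ht
    omega
  · rintro j φ σ' hj ⟨hI, hg, rfl⟩ hJ hr ha
    rw [hK] at hj
    have e10 := ha 10 (by decide)
    have e12 := ha 12 (by decide)
    have e15 := ha 15 (by decide)
    have e16 := ha 16 (by decide)
    have e17 := ha 17 (by decide)
    have e18 := ha 18 (by decide)
    have e31 := ha 31 (by decide)
    have e34 := ha 34 (by decide)
    have e35 := ha 35 (by decide)
    have e0 := (hr 0 (by decide) (by decide)).trans hn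
    have he : σ'.arr 10 (σ'.reg 15 - 1 - σ'.reg 10) = σ.arr 10 (K - 1 - j) := by
      rw [e10, hJ, hr 15 (by decide) (by decide), hK]
    clear hr ha
    have hm := hl.mem (K - 1 - j) (by omega)
    have hp := hl.pos_ord (K - 1 - j) (by omega)
    generalize hy : σ.arr 10 (K - 1 - j) = y at *
    have hyn := hl.lt y hm
    have hge : ∀ t ∈ O, K ≤ σ.arr 43 t + (j + 1) ↔ K ≤ σ.arr 43 t + j ∨ t = y := by
      intro t ht
      constructor
      · intro h
        by_cases h' : σ.arr 43 t = K - 1 - j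
        · exact .inr ((hl.eq_ord ht h').trans hy)
        · exact .inl (by omega)
      · rintro (h | rfl) <;> omega
    -- No parent of a vertex treated so far, `y` included, is `y`; so emptying the bucket of `y`
    -- leaves the values used in the recursion untouched.
    have hpne : ∀ t ∈ O, K ≤ σ.arr 43 t + (j + 1) → σ.arr 12 t ≠ y := by
      intro t ht h h'
      rcases hpar t ht with h2 | ⟨-, h2⟩
      · exact hnO (h2.symm.trans h' ▸ hm)
      · rw [h'] at h2
        omega
    obtain ⟨l, hl1, hl2, hl3⟩ := hb y hyn.le
    have hcard : (R j).ncard = (R (j + 1)).ncard + l.length := by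
      have h1 : R j = R (j + 1) ∪ (l.toFinset : Set ℕ) := by
        ext z
        simp only [hR, Set.mem_ofPred_eq, Set.mem_union, List.coe_toFinset, hl3]
        constructor
        · rintro ⟨h2, h3⟩
          by_cases h4 : σ.arr 18 z = y
          · exact .inr ⟨h2, h4⟩
          · have h5 := (hge _ (hF z h2).2.1).not.2 (by push Not; exact ⟨by omega, h4⟩)
            exact .inl ⟨h2, by omega⟩
        · rintro (⟨h2, h3⟩ | ⟨h2, h3⟩)
          · exact ⟨h2, by omega⟩
          · exact ⟨h2, by rw [h3, hp]; omega⟩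
      rw [h1, Set.ncard_union_eq _ (hRfin _) (Finset.finite_toSet _), Set.ncard_coe_finset,
        List.toFinset_card_of_nodup hl2]
      rw [Set.disjoint_left]
      rintro z ⟨-, h2⟩ h3
      simp only [List.coe_toFinset, hl3, Set.mem_ofPred_eq] at h3
      rw [h3.2, hp] at h2
      omega
    have hset : (Prog.set 11 (.get 10 (.sub (.sub (.var 15) (.lit 1)) (.var 10)))).step σ' =
        σ'.setReg 11 y := by
      rw [step_set, eval_get, eval_sub, eval_sub, eval_var, eval_var, eval_lit, he]
    suffices h : ∃ T, Runs n (.ite (.get 34 (.var 11))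
        (.seq spillPre (.loop (.lt (.var 17) (.var 0)) spillBody)) .skip) (σ'.setReg 11 y) T
        (fun σ'' => Filled n σ.arr σ''.arr F (fun z => F z ∧ K ≤ σ.arr 43 (σ.arr 18 z) + (j + 1)) ∧
          (∀ t ∈ O, K ≤ σ.arr 43 t + (j + 1) → σ.arr 34 t ≠ 0 → σ''.arr 38 t = if σ.arr 15 t = t ∨
            σ.arr 31 t + σ''.arr 37 (σ.arr 12 t) < σ.arr 31 (σ.arr 12 t) + 1 then σ.arr 35 t
            else σ''.arr 38 (σ.arr 12 t)) ∧ T ≤ 170 + 60 * l.length) by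
      obtain ⟨T, hT⟩ := h
      refine ⟨10 + T, Runs.imp (Runs.seq (R := fun σ1 => σ1 = σ'.setReg 11 y)
        ((Runs.block rfl).mono (by decide) fun σ1 h1 => by rw [h1, hset])
        fun σ1 h1 => h1 ▸ hT) fun σ'' h => ⟨_, ⟨h.1, h.2.1, rfl⟩, ?_⟩⟩
      have := h.2.2
      rw [show K - j = K - (j + 1) + 1 by omega, hcard]
      omega
    by_cases hU : σ.arr 34 y = 0
    · have hno : ∀ z, F z → σ.arr 18 z ≠ y := fun z hz h => (hF z hz).2.2 (h ▸ hU)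
      have hDD : ∀ z, F z ∧ K ≤ σ.arr 43 (σ.arr 18 z) + j ↔
          F z ∧ K ≤ σ.arr 43 (σ.arr 18 z) + (j + 1) := fun z => and_congr_right fun hz => by
        rw [hge _ (hF z hz).2.1, or_iff_left (hno z hz)]
      refine ⟨10, Runs.mono (Runs.ite (T := 1) rfl (fun h => ?_) fun _ => Runs.block rfl) (by decide) ?_⟩
      · exact absurd (by rw [eval_get, eval_var, setReg_same, setReg_arr, e34, hU]) h
      · rintro σ'' rfl
        refine ⟨hI.congr hDD (fun _ _ => rfl) fun _ _ => rfl, fun t ht h1 h2 => ?_, by omega⟩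
        rcases (hge t ht).1 h1 with h1 | rfl
        · exact hg t ht h1 h2
        · exact absurd hU h2
    · obtain ⟨p1, p2, p3, p4, p5, p6⟩ := spillPre_step (σ := σ'.setReg 11 y) (n := n) (y := y)
        setReg_same (by rw [setReg_ne (by decide)]; exact e0)
      rw [setReg_arr] at p1 p4 p5 p6
      generalize hσ1 : spillPre.step (σ'.setReg 11 y) = σ1 at p1 p2 p3 p4 p5 p6
      have q : ∀ a, a ≠ 38 → σ'.arr a = σ.arr a → σ1.arr a = σ.arr a :=
        fun a h1 h2 => (p4 a h1).trans h2
      have hF1 : Filled n σ.arr σ1.arr F (fun z => (F z ∧ K ≤ σ.arr 43 (σ.arr 18 z) + j) ∨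
          (F z ∧ σ.arr 18 z = y ∧ z ∉ l)) := by
        refine hI.congr (fun z => ?_) (fun z hz => p5 _ fun h => ?_) p4
        · refine ⟨.inl, fun h => h.resolve_right ?_⟩
          rintro ⟨h1, h2, h3⟩
          exact h3 ((hl3 z).2 ⟨h1, h2⟩)
        · have := hz.2
          rw [h, hp] at this
          omega
      obtain ⟨T, hT⟩ := Runs.while_block (n := n) (σ₀ := σ1) (e := .lt (.var 17) (.var 0))
        (body := spillBody) 60 (fun k σ2 => ∃ l' : List ℕ, l'.length = k ∧
          Linked (σ.arr 17) n (σ2.reg 17) l' ∧ l'.Nodup ∧ (∀ z ∈ l', F z ∧ σ.arr 18 z = y) ∧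
          Filled n σ.arr σ2.arr F (fun z => (F z ∧ K ≤ σ.arr 43 (σ.arr 18 z) + j) ∨
            (F z ∧ σ.arr 18 z = y ∧ z ∉ l')) ∧
          ∀ x, x ≠ y → σ2.arr 37 x = σ1.arr 37 x) rfl rfl (by decide) (k₀ := l.length)
          ⟨l, rfl, by rw [p1, e16]; exact hl1, hl2, fun z hz => (hl3 z).1 hz, hF1, fun _ _ => rfl⟩ (by
          rintro k σ2 ⟨l', h1, h2, h3, h4, h5, h6⟩ he hr ha _
          cases l' with
          | nil =>
            have h2' : σ2.reg 17 = n := h2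
            refine absurd ?_ he
            rw [eval_lt_zero, eval_var, eval_var, h2', hr 0 (by decide), p3]
            exact lt_irrefl _
          | cons z l' =>
            obtain ⟨h7, h8, h9⟩ := h2
            have h4z := h4 z (by simp)
            have hz' : z ∉ l' := (List.nodup_cons.1 h3).1
            have hkey := h5.step (z := z) (t := y) h7 ((hr 11 (by decide)).trans p2) h4z.2
              ((ha 31 (by decide)).trans (q 31 (by decide) e31))
              ((ha 35 (by decide)).trans (q 35 (by decide) e35)) h4z.1 (by
                rintro (⟨-, h⟩ | ⟨-, -, h⟩)
                · rw [h4z.2, hp] at h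
                  omega
                · exact h (by simp)) (h36 z h4z.1) (by
                rintro x (⟨-, h⟩ | ⟨-, h, -⟩)
                · omega
                · rw [h]) hyn.le
            refine ⟨l'.length, by rw [← h1]; simp, l', rfl, ?_, (List.nodup_cons.1 h3).2,
              fun x hx => h4 x (by simp [hx]), hkey.congr (fun x => ?_) (fun _ _ => rfl)
              (fun _ _ => rfl), fun x hx => ?_⟩
            · have e17' : σ2.arr 17 = σ.arr 17 := (ha 17 (by decide)).trans (q 17 (by decide) e17)
              rw [spillBody, step_seq, step_set, setReg_same, eval_get, eval_var]
              rw [(Prog.step_frame _).1 17 (by decide), (Prog.step_frame _).2 17 (by decide), h7,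
                e17']
              exact h9
            · rw [or_assoc]
              refine or_congr_right ?_
              constructor
              · rintro (⟨h10, h11, h12⟩ | rfl)
                · exact ⟨h10, h11, fun h => h12 (by simp [h])⟩
                · exact ⟨h4z.1, h4z.2, hz'⟩
              · rintro ⟨h10, h11, h12⟩
                by_cases hxz : x = z
                · exact .inr hxz
                · exact .inl ⟨h10, h11, by simp [hxz, h12]⟩
            · rw [← h6 x hx]
              have h11' : σ2.reg 11 = y := (hr 11 (by decide)).trans p2
              simp only [spillBody, step_ite, step_seq, step_put, step_set, eval_get, eval_var,
                setReg_arr, setArr_reg, h11']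
              split_ifs <;> simp [hx])
      refine ⟨4 + (70 + T), Runs.mono (Runs.ite (T := 70 + T) (Q := fun σ'' =>
          ∃ k, (∃ l' : List ℕ, l'.length = k ∧
          Linked (σ.arr 17) n (σ''.reg 17) l' ∧ l'.Nodup ∧ (∀ z ∈ l', F z ∧ σ.arr 18 z = y) ∧
          Filled n σ.arr σ''.arr F (fun z => (F z ∧ K ≤ σ.arr 43 (σ.arr 18 z) + j) ∨
            (F z ∧ σ.arr 18 z = y ∧ z ∉ l')) ∧
          ∀ x, x ≠ y → σ''.arr 37 x = σ1.arr 37 x) ∧ σ''.reg 0 = n ∧ σ''.arr 38 = σ1.arr 38 ∧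
          (Expr.lt (.var 17) (.var 0)).eval σ'' = 0 ∧ T + 60 * k ≤ 60 * l.length + 60)
          rfl (fun _ => ?_) fun h => ?_) (by simp only [Expr.cost]; omega) ?_⟩
      · refine Runs.seq ((Runs.block rfl).mono (T' := 70) (by decide) fun _ h => h) fun σ2 h2 => ?_
        rw [h2, hσ1]
        refine hT.frame.imp ?_
        rintro σ3 ⟨⟨k, h1, h2, h3⟩, h4, h5⟩
        exact ⟨k, h1, (h4 0 (by decide)).trans p3, h5 38 (by decide), h2, h3⟩
      · exact absurd (by rwa [eval_get, eval_var, setReg_same, setReg_arr, e34] at h) hU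
      · rintro σ'' ⟨k, ⟨l', h1, h2, h3, h4, h5, h6⟩, h7, h38, h8, h9⟩
        have hl' : l' = [] := by
          cases l' with
          | nil => rfl
          | cons z l' =>
            refine absurd h8 ?_
            rw [eval_lt_zero, eval_var, eval_var, h7, h2.1, not_not]
            exact h2.2.1
        subst hl'
        refine ⟨h5.congr (fun z => ?_) (fun _ _ => rfl) (fun _ _ => rfl), fun t ht h10 h11 => ?_,
          by omega⟩
        · rw [← and_or_left]
          refine and_congr_right fun hz => ?_
          rw [hge _ (hF z hz).2.1]
          simp
        · have h12 := hpne t ht h10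
          rw [h38, h6 _ h12, p4 37 (by decide), p5 _ h12]
          rcases (hge t ht).1 h10 with h13 | rfl
          · rw [p5 t (by rintro rfl; omega)]
            exact hg t ht h13 h11
          · rw [p6, e12, e15, e31, e35]
  · rw [hK]
    have := hl.le
    simp only [Nat.sub_zero]
    omega
  · rw [hK]
    rintro σ' ⟨-, φ, h1, h2, -⟩
    refine ⟨h1.congr (fun z => ?_) (fun _ _ => rfl) fun _ _ => rfl, fun t ht h => ?_⟩
    · exact and_iff_left (by omega)
    · exact h2 t ht (by omega) h

/-! ### New parents outside of `L` by monotone stacks -/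

/-- The stacks after the indices `e` with `E ≤ e < M` have been pushed in descending order, each of
them onto the stack `b e`, where the elements `x` with `r e < q x` have been popped before. -/
structure Stacks (M E : ℕ) (b q r : ℕ → ℕ) (S : ℕ → List ℕ) : Prop where
  mem : ∀ i, ∀ e ∈ S i, E ≤ e ∧ e < M ∧ b e = i
  sorted : ∀ i, (S i).Pairwise (· < ·)
  popped : ∀ e, E ≤ e → e < M → e ∉ S (b e) → ∃ x, E ≤ x ∧ x < e ∧ b x = b e ∧ r x < q e

/-- `x` is the first index after `e` that `e` sees. -/
def IsNext (M : ℕ) (b q r : ℕ → ℕ) (e x : ℕ) : Prop :=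
  e < x ∧ x < M ∧ b x = b e ∧ q x ≤ r e ∧ ∀ y, e < y → y < M → b y = b e → q y ≤ r e → x ≤ y

theorem Stacks.skip {M E : ℕ} {b q r : ℕ → ℕ} {S : ℕ → List ℕ} (h : Stacks M (E + 1) b q r S)
    (hE : M ≤ E) : Stacks M E b q r S where
  mem i e he := ⟨by have := h.mem i e he; omega, (h.mem i e he).2⟩
  sorted := h.sorted
  popped e h1 h2 := by omega

/-- An entry is popped only if its `q` exceeds the `r` of a treated index. As the indices descend,
`r` does not increase within a stack, so a popped entry is never seen again. What remains is sorted,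
hence its first element that is not popped is the next one. -/
theorem Stacks.push {M E : ℕ} {b q r : ℕ → ℕ} {S : ℕ → List ℕ} {p l : List ℕ}
    (h : Stacks M (E + 1) b q r S) (hE : E < M)
    (hmono : ∀ e x, e < x → x < M → b x = b e → r e ≤ r x)
    (hS : S (b E) = p ++ l) (hp : ∀ x ∈ p, r E < q x) :
    Stacks M E b q r (Function.update S (b E) (E :: l)) ∧
    (l = [] → ∀ y, E < y → y < M → b y = b E → r E < q y) ∧
    ∀ x l', l = x :: l' → q x ≤ r E → IsNext M b q r E x := by
  -- If `y` had been popped by `x`, then `r x < q y ≤ r E ≤ r x`.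
  have hcand : ∀ y, E < y → y < M → b y = b E → q y ≤ r E → y ∈ l := by
    intro y h1 h2 h3 h4
    by_cases hy : y ∈ S (b y)
    · rw [h3, hS, List.mem_append] at hy
      refine hy.resolve_left fun h' => ?_
      have := hp y h'
      omega
    · obtain ⟨x, h5, h6, h7, h8⟩ := h.popped y (by omega) h2 hy
      have := hmono E x (by omega) (by omega) (by rw [h7, h3])
      omega
  refine ⟨⟨fun i e he => ?_, fun i => ?_, fun e h1 h2 h3 => ?_⟩, fun hl y h1 h2 h3 => ?_,
    fun x l' hl hq => ?_⟩
  · by_cases hi : i = b E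
    · subst hi
      rw [Function.update_self, List.mem_cons] at he
      rcases he with rfl | he
      · exact ⟨le_rfl, hE, rfl⟩
      · have := h.mem (b E) e (by rw [hS]; simp [he])
        exact ⟨by omega, this.2⟩
    · rw [Function.update_of_ne hi] at he
      have := h.mem i e he
      exact ⟨by omega, this.2⟩
  · by_cases hi : i = b E
    · subst hi
      rw [Function.update_self, List.pairwise_cons]
      have h1 := h.sorted (b E)
      rw [hS, List.pairwise_append] at h1
      refine ⟨fun x hx => ?_, h1.2.1⟩
      have := h.mem (b E) x (by rw [hS]; simp [hx])
      omega
    · rw [Function.update_of_ne hi]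
      exact h.sorted i
  · by_cases hi : b e = b E
    · rw [hi, Function.update_self, List.mem_cons, not_or] at h3
      have h4 : E < e := by omega
      refine ⟨E, le_rfl, h4, hi.symm, ?_⟩
      by_contra h5
      exact h3.2 (hcand e h4 h2 hi (by omega))
    · rw [Function.update_of_ne hi] at h3
      have h4 : E ≠ e := by rintro rfl; exact hi rfl
      obtain ⟨x, h5, h6⟩ := h.popped e (by omega) h2 h3
      exact ⟨x, by omega, h6⟩
  · by_contra h4
    have := hcand y h1 h2 h3 (by omega)
    rw [hl] at this
    simp at this
  · have hx := h.mem (b E) x (by rw [hS, hl]; simp)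
    refine ⟨by omega, hx.2.1, hx.2.2, hq, fun y h1 h2 h3 h4 => ?_⟩
    have h5 := hcand y h1 h2 h3 h4
    rw [hl, List.mem_cons] at h5
    rcases h5 with rfl | h5
    · exact le_rfl
    · have h6 := h.sorted (b E)
      rw [hS, hl, List.pairwise_append, List.pairwise_cons] at h6
      exact (h6.2.1.1 y h5).le

/-- Pop from the stack. -/
def popBody : Prog :=
  .seq (.set 17 (.get 20 (.var 17))) (.ite (.get 36 (.var 17)) (.set 17 (.var 0)) .skip)

/-- Determine the new parents of the listed vertices. -/
def stackPass : Prog :=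
  forLt 10 0 (.ite (.lt (.sub (.sub (.var 0) (.lit 1)) (.var 10)) (.get 41 (.lit 0)))
    (.seq (.seq (.set 11 (.get 19 (.sub (.sub (.var 0) (.lit 1)) (.var 10)))) <|
      .seq (.set 16 (.get 18 (.var 11))) (.set 17 (.get 21 (.get 15 (.var 16))))) <|
    .seq (.loop (.lt (.get 35 (.var 16)) (.get 35 (.var 17))) popBody)
      (.seq (.ite (.lt (.var 17) (.var 0)) (.put 20 (.var 11) (.var 17))
        (.put 20 (.var 11) (.var 16))) (.put 21 (.get 15 (.var 16)) (.var 11)))) .skip)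

/-- The new parent of a vertex is the entry below it on its stack, so array `20` serves both as
parent and as link. A vertex without successor has its `bot` as parent, which lies in `L` by `hL`;
this is how the bottom of a stack is recognized. -/
theorem runs_stackPass {n M : ℕ} {nl b q r : ℕ → ℕ} {σ : State} (hn : σ.reg 0 = n)
    (hnl : ∀ e, σ.arr 19 e = nl e) (hM : σ.arr 41 0 = M) (hMn : M ≤ n)
    (hb : ∀ e < M, b e = σ.arr 15 (σ.arr 18 (nl e)) ∧ b e ≤ n)
    (hq : ∀ e < M, q e = σ.arr 35 (nl e)) (hr : ∀ e < M, r e = σ.arr 35 (σ.arr 18 (nl e)))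
    (hmono : ∀ e x, e < x → x < M → b x = b e → r e ≤ r x)
    (hnln : ∀ e < M, nl e < n ∧ σ.arr 36 (nl e) = 0)
    (hinj : ∀ i < M, ∀ j < M, nl i = nl j → i = j)
    (hL : ∀ e < M, (∀ y, e < y → y < M → b y = b e → r e < q y) → σ.arr 36 (σ.arr 18 (nl e)) ≠ 0)
    (h21 : ∀ i ≤ n, σ.arr 21 i = n) (h35 : σ.arr 35 n = 0) :
    Runs n stackPass σ (200 * n + 6) (fun σ' => ∀ e < M,
      (∃ x, IsNext M b q r e x ∧ σ'.arr 20 (nl e) = nl x) ∨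
      ((∀ y, e < y → y < M → b y = b e → r e < q y) ∧ σ'.arr 20 (nl e) = σ.arr 18 (nl e))) := by
  set nx : (ℕ → ℕ → ℕ) → ℕ → ℕ := fun A x => if σ.arr 36 (A 20 x) = 0 then A 20 x else n with hnx
  -- The total length of the stacks is part of the budget: a push deposits the time for the pop that
  -- may remove the entry later.
  refine (Runs.forLt (n := n) (σ := σ) (fun j φ A => ∃ S : ℕ → List ℕ, Stacks M (n - j) b q r S ∧
    (∀ i ≤ n, Linked (nx A) n (A 21 i) ((S i).map nl)) ∧
    (∀ e < M, n - j ≤ e → (∃ x, IsNext M b q r e x ∧ A 20 (nl e) = nl x) ∨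
      ((∀ y, e < y → y < M → b y = b e → r e < q y) ∧ A 20 (nl e) = σ.arr 18 (nl e))) ∧
    φ = 160 * (n - j) + 20 * ∑ i ∈ Finset.range (n + 1), (S i).length)
    rfl (by decide) rfl (by decide) (by decide) (by decide)
    ⟨fun _ => [], ⟨by simp, by simp, fun e h1 h2 => by omega⟩, fun i hi => h21 i hi,
      fun e h1 h2 => by omega, rfl⟩ ?_).mono ?_ ?_
  · rintro j φ σ' hj ⟨S, hS, hc, hs, rfl⟩ hJ hr' ha
    rw [hn] at hj
    have e15 := ha 15 (by decide)
    have e18 := ha 18 (by decide)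
    have e19 := ha 19 (by decide)
    have e35 := ha 35 (by decide)
    have e36 := ha 36 (by decide)
    have e41 := ha 41 (by decide)
    have e0 := (hr' 0 (by decide) (by decide)).trans hn
    clear hr' ha
    have hE : n - j = (n - (j + 1)) + 1 := by omega
    have hval : n - 1 - j = n - (j + 1) := by omega
    set E := n - (j + 1) with hEdef
    rw [hE] at hS hs ⊢
    by_cases hEM : E < M
    · obtain ⟨hyn, hyL⟩ := hnln E hEM
      obtain ⟨hbE, hbn⟩ := hb E hEM
      set y := nl E with hy
      set t := σ.arr 18 y with ht
      set pre : Prog := (.seq (.set 11 (.get 19 (.sub (.sub (.var 0) (.lit 1)) (.var 10)))) <|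
        .seq (.set 16 (.get 18 (.var 11))) (.set 17 (.get 21 (.get 15 (.var 16))))) with hpre
      have hpr : (pre.step σ').reg 11 = y ∧ (pre.step σ').reg 16 = t ∧
          (pre.step σ').reg 17 = σ'.arr 21 (b E) ∧ (pre.step σ').reg 0 = n ∧
          (pre.step σ').arr = σ'.arr := by
        simp [hpre, step_seq, step_set, eval_get, eval_sub, eval_var, eval_lit, e0, hJ, hval, e19,
          hnl, e18, e15, hbE, ← hy, ← ht]
      obtain ⟨p1, p2, p3, p4, p5⟩ := hpr
      generalize hσ1 : pre.step σ' = σ1 at p1 p2 p3 p4 p5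
      have hw := Runs.while_block (n := n) (σ₀ := σ1)
        (e := .lt (.get 35 (.var 16)) (.get 35 (.var 17))) (body := popBody) 20
        (fun k σ2 => ∃ p l, S (b E) = p ++ l ∧ l.length = k ∧ (∀ x ∈ p, r E < q x) ∧
          Linked (nx σ'.arr) n (σ2.reg 17) (l.map nl)) rfl rfl (by decide)
        (k₀ := (S (b E)).length)
        ⟨[], S (b E), rfl, rfl, by simp, by rw [p3]; exact hc _ hbn⟩ (by
          rintro k σ2 ⟨p, l, h1, h2, h3, h4⟩ he hr2 ha2 _
          have f16 : σ2.reg 16 = t := (hr2 16 (by decide)).trans p2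
          have f0 : σ2.reg 0 = n := (hr2 0 (by decide)).trans p4
          have f35 : σ2.arr 35 = σ.arr 35 := by rw [ha2 35 (by decide), p5, e35]
          have f36 : σ2.arr 36 = σ.arr 36 := by rw [ha2 36 (by decide), p5, e36]
          have f20 : σ2.arr 20 = σ'.arr 20 := by rw [ha2 20 (by decide), p5]
          rw [ne_eq, eval_lt_zero, not_not, eval_get, eval_get, eval_var, eval_var, f16, f35] at he
          cases l with
          | nil =>
            have h4' : σ2.reg 17 = n := h4
            -- An empty stack shows the index `n`, whose depth is `0`, so the loop condition fails
            -- there without a separate test.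
            rw [h4', h35] at he
            omega
          | cons x l =>
            obtain ⟨h5, h6, h7⟩ := h4
            refine ⟨l.length, by rw [← h2]; simp, p ++ [x], l, by rw [h1]; simp, rfl, ?_, ?_⟩
            · intro z hz
              rw [List.mem_append, List.mem_singleton] at hz
              rcases hz with hz | rfl
              · exact h3 z hz
              · have hx := hS.mem (b E) z (by rw [h1]; simp)
                rw [hq z hx.2.1, hr E hEM, ← h5]
                exact he
            · have : (popBody.step σ2).reg 17 = nx σ'.arr (nl x) := by
                simp only [popBody, step_seq, step_set, step_ite, step_skip, eval_get, eval_var,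
                  setReg_same, setReg_arr, f36, f20, h5, hnx]
                split_ifs <;> simp [f0]
              rw [this]
              exact h7)
      obtain ⟨T, hT⟩ := hw
      refine ⟨20 + (20 + (T + 40)), Runs.imp (Runs.mono (Runs.ite (T := 20 + (T + 40)) (Q :=
          fun σ'' => ∃ p l, S (b E) = p ++ l ∧ (∀ x ∈ p, r E < q x) ∧
          (∀ x l', l = x :: l' → q x ≤ r E) ∧ T + 20 * l.length ≤ 20 * (S (b E)).length + 20 ∧
          (∀ i, σ''.arr 21 i = if i = b E then y else σ'.arr 21 i) ∧
          (∀ x, σ''.arr 20 x = if x = y then (l.map nl).headD t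
            else σ'.arr 20 x) ∧
          ∀ i, i = b E → Linked (nx σ'.arr) n ((l.map nl).headD n) (l.map nl)) rfl
        (fun _ => ?_) fun h => ?_) (by simp only [Expr.cost]; omega) fun _ h => h) ?_⟩
      · refine Runs.seq ((Runs.block (p := pre) rfl).mono (T' := 20) (by decide) fun _ h => h)
          fun σ2 h2 => ?_
        rw [h2, hσ1]
        refine Runs.seq hT.frame ?_
        rintro σ3 ⟨⟨k, ⟨p, l, h1, h3, h4, h5⟩, h6, h7⟩, h8, h9⟩
        refine (Runs.block rfl).mono (by decide) ?_
        rintro _ rfl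
        have f16 : σ3.reg 16 = t := (h8 16 (by decide)).trans p2
        have f11 : σ3.reg 11 = y := (h8 11 (by decide)).trans p1
        have f0 : σ3.reg 0 = n := (h8 0 (by decide)).trans p4
        have fa : ∀ a, σ3.arr a = σ'.arr a := fun a => by rw [h9 a (by simp [popBody, Prog.wa]), p5]
        rw [eval_lt_zero, eval_get, eval_get, eval_var, eval_var, f16, fa, e35] at h6
        refine ⟨p, l, h1, h4, ?_, by rw [h3]; exact h7, fun i => ?_, fun x => ?_, ?_⟩
        · rintro x l' rfl
          have hx := hS.mem (b E) x (by rw [h1]; simp)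
          rw [hq x hx.2.1, hr E hEM, ← h5.1]
          exact not_lt.1 h6
        · have : σ'.arr 15 t = b E := by rw [e15, hbE]
          simp only [step_seq, step_put, step_ite, eval_get, eval_var, f16, f11]
          have key : ∀ τ : State, τ.reg 16 = t → τ.reg 11 = y → τ.arr 15 = σ'.arr 15 →
              τ.arr 21 = σ'.arr 21 → (τ.setArr 21 (τ.arr 15 (τ.reg 16)) (τ.reg 11)).arr 21 i =
                if i = b E then y else σ'.arr 21 i := by
            intro τ h1 h2 h3 h4
            rw [h1, h2, h3, this, ← h4]
            split_ifs with hi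
            · rw [hi, setArr_same, if_pos rfl]
            · exact setArr_of_ne hi
          apply key <;> split_ifs <;> simp [f16, f11, fa]
        · simp only [step_seq, step_put, step_ite, eval_get, eval_var, f16, f11, eval_lt_zero, f0,
            setArr_ne (show (20 : ℕ) ≠ 21 by decide)]
          cases l with
          | nil =>
            have h5' : σ3.reg 17 = n := h5
            rw [if_pos (by omega), setArr_same, fa]; rfl
          | cons x l =>
            obtain ⟨h10, h11, -⟩ := h5
            rw [if_neg (by omega), setArr_same, fa, h10]; rfl
        · intro i hi
          cases l with
          | nil => rfl
          | cons x l => exact ⟨rfl, h5.2⟩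
      · exact absurd h (by
          rw [eval_lt_zero, not_not, eval_sub, eval_sub, eval_get, eval_var, eval_var, eval_lit, eval_lit,
            e41, hM, e0, hJ, hval]
          exact hEM)
      · rintro σ'' ⟨p, l, h1, h2, h3, h4, h5, h6, h7⟩
        obtain ⟨g1, g2, g3⟩ := hS.push hEM hmono h1 h2
        have hnext : (∃ x, IsNext M b q r E x ∧ σ''.arr 20 y = nl x ∧ ∃ l', l = x :: l') ∨
            ((∀ x, E < x → x < M → b x = b E → r E < q x) ∧ σ''.arr 20 y = t ∧ l = []) := by
          rw [h6, if_pos rfl]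
          cases l with
          | nil => exact .inr ⟨g2 rfl, rfl, rfl⟩
          | cons x l => exact .inl ⟨x, g3 x l rfl (h3 x l rfl), rfl, l, rfl⟩
        refine ⟨_, ⟨_, g1, fun i hi => ?_, fun e h8 h9 => ?_, rfl⟩, ?_⟩
        · have hne : ∀ i, ∀ x ∈ (S i).map nl, nx σ''.arr x = nx σ'.arr x := by
            intro i x hx
            obtain ⟨e, he, rfl⟩ := List.mem_map.1 hx
            have hm := hS.mem i e he
            have : nl e ≠ y := fun h => by
              have := hinj e hm.2.1 E hEM h
              omega
            simp only [hnx, h6, if_neg this]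
          by_cases hib : i = b E
          · subst hib
            rw [Function.update_self, h5, if_pos rfl]
            refine ⟨rfl, hyn, ?_⟩
            have hh := (h7 _ rfl).congr fun x hx => hne (b E) x (by
              rw [h1, List.map_append, List.mem_append]; exact .inr hx)
            have hnxy : nx σ''.arr y = ((l.map nl).headD n) := by
              rcases hnext with ⟨x, h8, h9, l', rfl⟩ | ⟨h8, h9, rfl⟩
              · simp only [hnx, h9]
                rw [if_pos (hnln x h8.2.1).2]; rfl
              · simp only [hnx, h9]
                rw [if_neg (hL E hEM h8)]; rfl
            rw [hnxy]
            exact hh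
          · rw [Function.update_of_ne hib, h5, if_neg hib]
            exact (hc i hi).congr (hne i)
        · rcases eq_or_lt_of_le h9 with rfl | h9
          · rcases hnext with ⟨x, h10, h11, -⟩ | ⟨h10, h11, -⟩
            · exact .inl ⟨x, h10, h11⟩
            · exact .inr ⟨h10, h11⟩
          · have : nl e ≠ y := fun h => by
              have := hinj e h8 E hEM h
              omega
            rw [h6, if_neg this]
            exact hs e h8 h9
        · have hsum : ∀ S' : ℕ → List ℕ, ∑ i ∈ Finset.range (n + 1), (S' i).length =
              (S' (b E)).length + ∑ i ∈ (Finset.range (n + 1)).erase (b E), (S' i).length :=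
            fun S' => (Finset.add_sum_erase _ (fun i => (S' i).length) (by simp; omega)).symm
          rw [hsum S, hsum (Function.update S (b E) (E :: l)), Function.update_self,
            List.length_cons, Finset.sum_congr rfl fun i hi => by
              rw [Function.update_of_ne (Finset.ne_of_mem_erase hi)]]
          omega
    · refine ⟨30, Runs.mono (Runs.ite (T := 1) rfl (fun h => ?_) fun _ => Runs.block rfl) (by decide)
        ?_⟩
      · rw [ne_eq, eval_lt_zero, not_not, eval_sub, eval_sub, eval_get, eval_var, eval_var,
          eval_lit, eval_lit, e41, hM, e0, hJ, hval] at h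
        exact absurd h hEM
      · rintro σ'' rfl
        exact ⟨_, ⟨S, hS.skip (by omega), hc, fun e h1 h2 => hs e h1 (by omega), rfl⟩, by omega⟩
  · rw [hn]
    simp
    omega
  · rw [hn]
    rintro σ' ⟨-, φ, S, -, -, h, -⟩ e he
    exact h e he (by omega)

/-! ### New data inside `L` and outside of `U` -/

/-- Compute the degrees that the elements of `L` lose, and their new parents. -/
def losePass : Prog :=
  forDesc (.ite (.get 34 (.var 11)) (.seq (.set 12 (.get 12 (.var 11))) <|
    .seq (.ite (.eq (.get 15 (.var 11)) (.var 11)) (.put 40 (.var 11) (.lit 0))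
      (.put 40 (.var 11) (.sub (.add (.get 40 (.var 12)) (.eq (.get 36 (.var 12)) (.lit 0)))
        (.get 37 (.var 12)))))
      (.ite (.get 36 (.var 12)) (.put 22 (.var 11) (.var 12))
        (.put 22 (.var 11) (.get 22 (.var 12))))) .skip)

theorem runs_losePass {n K : ℕ} {O : Set ℕ} {σ : State}
    (hl : Listed n K O (σ.arr 10) (σ.arr 43)) (hK : σ.reg 15 = K)
    (hpar : ∀ y ∈ O, σ.arr 12 y = n ∨
      σ.arr 12 y ∈ O ∧ σ.arr 43 y < σ.arr 43 (σ.arr 12 y)) :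
    Runs n losePass σ (100 * n + 6) (fun σ' =>
      (∀ y ∈ O, σ.arr 34 y ≠ 0 → σ'.arr 40 y = (if σ.arr 15 y = y then 0 else
          σ'.arr 40 (σ.arr 12 y) + (if σ.arr 36 (σ.arr 12 y) = 0 then 1 else 0) -
            σ.arr 37 (σ.arr 12 y)) ∧
        σ'.arr 22 y = if σ.arr 36 (σ.arr 12 y) = 0 then σ'.arr 22 (σ.arr 12 y) else σ.arr 12 y) ∧
      ∀ a x, x ∉ O → σ'.arr a x = σ.arr a x) := by
  have hnO : n ∉ O := fun h => lt_irrefl _ (hl.lt n h)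
  refine (Runs.forDesc (n := n) (σ := σ) 70 (fun y A => σ.arr 34 y ≠ 0 →
        A 40 y = (if σ.arr 15 y = y then 0 else
          A 40 (σ.arr 12 y) + (if σ.arr 36 (σ.arr 12 y) = 0 then 1 else 0) -
            σ.arr 37 (σ.arr 12 y)) ∧
        A 22 y = if σ.arr 36 (σ.arr 12 y) = 0 then A 22 (σ.arr 12 y) else σ.arr 12 y)
    hl hK rfl (by decide) (by decide) (by decide) (by decide) ?_ ?_).mono (by omega) fun _ h => h
  rotate_left
  · intro y hy z hz hlt A A' h hP
    have hzy : z ≠ y := by rintro rfl; exact lt_irrefl _ hlt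
    have hpy : σ.arr 12 z ≠ y := by
      intro h
      rcases hpar z hz with h' | ⟨-, h'⟩
      · exact hnO ((h.symm.trans h') ▸ hy)
      · rw [h] at h'
        omega
    simpa only [h _ _ hzy, h _ _ hpy] using hP
  intro y σ' hy _ h11 _ hr ha
  have e12 : σ'.arr 12 = σ.arr 12 := ha 12 (by decide)
  have e15 : σ'.arr 15 = σ.arr 15 := ha 15 (by decide)
  have e34 : σ'.arr 34 = σ.arr 34 := ha 34 (by decide)
  have e36 : σ'.arr 36 = σ.arr 36 := ha 36 (by decide)
  have e37 : σ'.arr 37 = σ.arr 37 := ha 37 (by decide)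
  clear hr ha
  have hpy : σ.arr 12 y ≠ y := by
    intro h
    rcases hpar y hy with h' | ⟨-, h'⟩
    · exact hnO ((h.symm.trans h') ▸ hy)
    · rw [h] at h'
      exact lt_irrefl _ h'
  simp only [step_ite, step_seq, step_put, step_set, eval_get, eval_var, eval_lit, eval_add,
      eval_sub, setReg_same, setReg_arr, h11, e12, e15, e34, e37, eval_eq_zero, step_skip, setReg_ne (show (11 : ℕ) ≠ 12 by decide)]
  refine ⟨fun hU => ?_, fun a x hx => ?_⟩
  · rw [if_neg hU]
    have hb : ∀ τ : State, τ.reg 12 = σ.arr 12 y → τ.arr 36 = σ.arr 36 →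
        (Expr.eq (.get 36 (.var 12)) (.lit 0)).eval τ =
          if σ.arr 36 (σ.arr 12 y) = 0 then 1 else 0 := by
      intro τ h1 h2
      rw [Expr.eval, eval_get, eval_var, h1, h2, eval_lit]
    rw [hb _ (by simp) (by simp [e36])]
    split_ifs with h1 h2 <;> simp_all
  · split_ifs <;> simp [setArr_of_ne, h11, hx]

/-- For the vertices outside of `U`, determine the highest ancestor outside of `U` if its parent
belongs to `U`. -/
def rootPass : Prog :=
  forDesc (.seq (.set 12 (.get 12 (.var 11))) <|
    .ite (.get 34 (.var 11)) (.put 24 (.var 11) (.var 0))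
    (.ite (.get 34 (.var 12)) (.put 24 (.var 11) (.var 11))
      (.put 24 (.var 11) (.get 24 (.var 12)))))

/-- Vertices of `U` receive the value `n`, which excludes them from the next scan of the adjacency
lists. Outside of `U` the value is inherited from the parent, or is `n` if the root is reached
without meeting `U`. -/
theorem runs_rootPass {n K : ℕ} {O : Set ℕ} {σ : State}
    (hl : Listed n K O (σ.arr 10) (σ.arr 43)) (hK : σ.reg 15 = K) (hn : σ.reg 0 = n)
    (hpar : ∀ y ∈ O, σ.arr 12 y = n ∨
      σ.arr 12 y ∈ O ∧ σ.arr 43 y < σ.arr 43 (σ.arr 12 y)) :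
    Runs n rootPass σ (100 * n + 6) (fun σ' =>
      (∀ y ∈ O, σ'.arr 24 y = if σ.arr 34 y = 0 then if σ.arr 34 (σ.arr 12 y) = 0 then
        σ'.arr 24 (σ.arr 12 y) else y else n) ∧
      ∀ a x, x ∉ O → σ'.arr a x = σ.arr a x) := by
  have hnO : n ∉ O := fun h => lt_irrefl _ (hl.lt n h)
  refine (Runs.forDesc (n := n) (σ := σ) 70 (fun y A =>
      A 24 y = if σ.arr 34 y = 0 then if σ.arr 34 (σ.arr 12 y) = 0 then
        A 24 (σ.arr 12 y) else y else n)
    hl hK rfl (by decide) (by decide) (by decide) (by decide) ?_ ?_).mono (by omega) fun _ h => h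
  rotate_left
  · intro y hy z hz hlt A A' h hP
    have hzy : z ≠ y := by rintro rfl; exact lt_irrefl _ hlt
    have hpy : σ.arr 12 z ≠ y := by
      intro h
      rcases hpar z hz with h' | ⟨-, h'⟩
      · exact hnO ((h.symm.trans h') ▸ hy)
      · rw [h] at h'
        omega
    simpa only [h _ _ hzy, h _ _ hpy] using hP
  intro y σ' hy _ h11 _ hr ha
  have e12 : σ'.arr 12 = σ.arr 12 := ha 12 (by decide)
  have e34 : σ'.arr 34 = σ.arr 34 := ha 34 (by decide)
  have e0 : σ'.reg 0 = n := (hr 0 (by decide) (by decide) (by decide)).trans hn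
  clear hr ha
  have hpy : σ.arr 12 y ≠ y := by
    intro h
    rcases hpar y hy with h' | ⟨-, h'⟩
    · exact hnO ((h.symm.trans h') ▸ hy)
    · rw [h] at h'
      exact lt_irrefl _ h'
  simp only [step_ite, step_seq, step_put, step_set, eval_get, eval_var, setReg_same, setReg_arr,
    h11, e12, e34, setReg_ne (show (11 : ℕ) ≠ 12 by decide),
    setReg_ne (show (0 : ℕ) ≠ 12 by decide), e0]
  refine ⟨?_, fun a x hx => ?_⟩
  · split_ifs <;> simp [hpy]
  · split_ifs <;> simp [setArr_of_ne hx]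

/-- For the highest vertices outside of `U`, determine their first neighbour in `U`. -/
def topPass : Prog :=
  forVertices (.lt (.get 24 (.var 10)) (.var 0)) .skip
    (.ite (.get 34 (.var 13)) (.ite (.eq (.get 25 (.get 24 (.var 10))) (.var 0))
      (.put 25 (.get 24 (.var 10)) (.var 13))
      (.ite (.lt (.get 44 (.var 13)) (.get 44 (.get 25 (.get 24 (.var 10)))))
        (.put 25 (.get 24 (.var 10)) (.var 13)) .skip)) .skip) .skip

/-- Each `f q` is a vertex `w` of least rank with `D z w` for some `z` with `rt z = q`, or `n` if
there is none. -/
def Tops (n : ℕ) (rt nrk f : ℕ → ℕ) (D : ℕ → ℕ → Prop) : Prop :=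
  ∀ q, (f q = n ∨ ∃ z, D z (f q) ∧ rt z = q) ∧
    ∀ z w, D z w → rt z = q → f q ≠ n ∧ nrk (f q) ≤ nrk w

theorem Tops.congr {n : ℕ} {rt nrk f : ℕ → ℕ} {D D' : ℕ → ℕ → Prop} (h : Tops n rt nrk f D)
    (hD : ∀ z w, D' z w ↔ D z w) : Tops n rt nrk f D' := by
  have : D' = D := funext fun z => funext fun w => propext (hD z w)
  rwa [this]

theorem Tops.update {n z w : ℕ} {rt nrk f g : ℕ → ℕ} {D : ℕ → ℕ → Prop} (h : Tops n rt nrk f D)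
    (hw : w ≠ n) (hg : ∀ q, q ≠ rt z → g q = f q)
    (hz : g (rt z) = w ∧ (f (rt z) ≠ n → nrk w ≤ nrk (f (rt z))) ∨
      g (rt z) = f (rt z) ∧ f (rt z) ≠ n ∧ nrk (f (rt z)) ≤ nrk w) :
    Tops n rt nrk g (fun x y => D x y ∨ x = z ∧ y = w) := by
  intro q
  obtain ⟨h1, h2⟩ := h q
  by_cases hq : q = rt z
  · subst hq
    rcases hz with ⟨hz, hz'⟩ | ⟨hz, hz1, hz2⟩
    · rw [hz]
      refine ⟨.inr ⟨z, .inr ⟨rfl, rfl⟩, rfl⟩, ?_⟩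
      rintro x y (hx | ⟨rfl, rfl⟩) hr
      · obtain ⟨h3, h4⟩ := h2 x y hx hr
        exact ⟨hw, (hz' h3).trans h4⟩
      · exact ⟨hw, le_rfl⟩
    · rw [hz]
      refine ⟨h1.imp_right fun ⟨x, hx, hr⟩ => ⟨x, .inl hx, hr⟩, ?_⟩
      rintro x y (hx | ⟨rfl, rfl⟩) hr
      · exact h2 x y hx hr
      · exact ⟨hz1, hz2⟩
  · rw [hg q hq]
    refine ⟨h1.imp_right fun ⟨x, hx, hr⟩ => ⟨x, .inl hx, hr⟩, ?_⟩
    rintro x y (hx | ⟨rfl, rfl⟩) hr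
    · exact h2 x y hx hr
    · exact absurd hr.symm hq

theorem runs_topPass {n : ℕ} {G : SimpleGraph ℕ} {σ : State}
    (hn : σ.reg 0 = n) (hG : HoldsAdj n G σ.arr) (h25 : ∀ i ≤ n, σ.arr 25 i = n) :
    Runs n topPass σ (100 * σ.arr 0 n + 600 * n + 6) (fun σ' =>
      ∀ q < n, (σ'.arr 25 q = n ∨ ∃ z < n, G.Adj z (σ'.arr 25 q) ∧ σ.arr 34 (σ'.arr 25 q) ≠ 0 ∧
        σ.arr 24 z = q) ∧ ∀ z < n, ∀ w, G.Adj z w → σ.arr 34 w ≠ 0 → σ.arr 24 z = q →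
          σ'.arr 25 q ≠ n ∧ σ.arr 44 (σ'.arr 25 q) ≤ σ.arr 44 w) := by
  set E : ℕ → ℕ → ℕ → Prop := fun i z w => σ.arr 24 z < n ∧ ∃ i', σ.arr 0 z ≤ i' ∧ i' < i ∧
    σ.arr 1 i' = w ∧ σ.arr 34 w ≠ 0 with hE
  -- Only indices below `n` occur as highest vertices outside of `U`; extending by `n` makes the
  -- invariant uniform in `q`.
  set f : (ℕ → ℕ → ℕ) → ℕ → ℕ := fun A q => if q < n then A 25 q else n with hf
  refine (Runs.forVertices (n := n) (σ := σ) (G := G) 60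
    (fun j A => Tops n (σ.arr 24) (σ.arr 44) (f A) (fun z w => z < j ∧ E (σ.arr 0 (z + 1)) z w))
    (fun j i A => σ.arr 24 j < n ∧ Tops n (σ.arr 24) (σ.arr 44) (f A)
      (fun z w => z < j ∧ E (σ.arr 0 (z + 1)) z w ∨ z = j ∧ E i z w))
    hn hG rfl rfl rfl rfl (by decide) (by decide) (by decide) (by decide) (by decide) (by decide)
    (by decide) (by decide) (by decide) (by decide) (by decide) ?_ ?_ ?_ ?_ ?_).mono
    (by omega) ?_
  · intro q
    refine ⟨.inl ?_, fun z w h => absurd h.1 (Nat.not_lt_zero z)⟩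
    simp only [hf]
    split_ifs with hq
    · exact h25 q hq.le
    · rfl
  · intro j σ' hj hI hJ h0 ha he
    refine hI.congr fun z w => ⟨fun ⟨h1, h2⟩ => ⟨?_, h2⟩, fun ⟨h1, h2⟩ => ⟨by omega, h2⟩⟩
    rw [eval_lt_zero, eval_get, eval_var, eval_var, hJ, h0, ha 24 (by decide)] at he
    rcases Nat.lt_succ_iff_lt_or_eq.1 h1 with h3 | rfl
    · exact h3
    · exact absurd h2.1 he
  · intro j σ' hj hI hJ h0 ha he
    rw [ne_eq, eval_lt_zero, not_not, eval_get, eval_var, eval_var, hJ, h0, ha 24 (by decide)] at he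
    refine ⟨he, hI.congr fun z w => ⟨?_, .inl⟩⟩
    rintro (h1 | ⟨rfl, -, i', h1, h2, -⟩)
    · exact h1
    · omega
  · rintro j i σ' hj h1 h2 ⟨hj24, hI⟩ hJ h0 h13 ha
    have e24 : σ'.arr 24 = σ.arr 24 := ha 24 (by decide)
    have e34 : σ'.arr 34 = σ.arr 34 := ha 34 (by decide)
    have e44 : σ'.arr 44 = σ.arr 44 := ha 44 (by decide)
    clear ha
    refine ⟨hj24, ?_⟩
    have hw : σ.arr 1 i < n := hG.adj_lt hj h1 h2
    generalize hwe : σ.arr 1 i = w at *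
    simp only [step_ite, step_put, step_skip, eval_get, eval_var, hJ, h13, e24, e34, e44,
      eval_lt_zero, eval_eq_zero, h0]
    have hEi : ∀ y, E (i + 1) j y ↔ E i j y ∨ y = w ∧ σ.arr 34 w ≠ 0 := by
      intro y
      constructor
      · rintro ⟨h3, i', h4, h5, h6, h7⟩
        by_cases hi : i' = i
        · subst hi
          have : y = w := h6.symm.trans hwe
          exact .inr ⟨this, this ▸ h7⟩
        · exact .inl ⟨h3, i', h4, by omega, h6, h7⟩
      · rintro (⟨h3, i', h4, h5, h6, h7⟩ | ⟨rfl, h7⟩)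
        · exact ⟨h3, i', h4, by omega, h6, h7⟩
        · exact ⟨hj24, i, h1, by omega, hwe, h7⟩
    have hfj : ∀ A, f A (σ.arr 24 j) = A 25 (σ.arr 24 j) := fun A => if_pos hj24
    have hfq : ∀ A q, A 25 q = σ'.arr 25 q → f A q = f σ'.arr q := fun A q h => by
      simp only [hf, h]
    clear_value E f
    by_cases hU : σ.arr 34 w = 0
    · rw [if_pos hU]
      refine hI.congr fun x y => or_congr_right (and_congr_right ?_)
      rintro rfl
      rw [hEi]
      exact or_iff_left fun h => h.2 hU
    · rw [if_neg hU]
      have hgoal : ∀ g, Tops n (σ.arr 24) (σ.arr 44) g (fun x y =>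
          (x < j ∧ E (σ.arr 0 (x + 1)) x y ∨ x = j ∧ E i x y) ∨ x = j ∧ y = w) →
          Tops n (σ.arr 24) (σ.arr 44) g (fun x y =>
          (x < j ∧ E (σ.arr 0 (x + 1)) x y ∨ x = j ∧ E (i + 1) x y)) := by
        intro g hg
        refine hg.congr fun x y => ?_
        rw [or_assoc, ← and_or_left]
        refine or_congr_right (and_congr_right ?_)
        rintro rfl
        rw [hEi]
        exact or_congr_right (and_iff_left hU)
      split_ifs with h3 h4
      · refine hgoal _ (hI.update hw.ne (fun q hq => hfq _ _ ?_) (.inl ⟨?_, fun h => ?_⟩))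
        · rw [setArr_same, if_neg hq]
        · rw [hfj, setArr_same, if_pos rfl]
        · rw [hfj] at h; exact absurd h3 h
      · refine hgoal _ (hI.update hw.ne (fun q hq => hfq _ _ ?_) (.inl ⟨?_, fun _ => ?_⟩))
        · rw [setArr_same, if_neg hq]
        · rw [hfj, setArr_same, if_pos rfl]
        · rw [hfj]; exact h4.le
      · exact hgoal _ (hI.update hw.ne (fun q hq => rfl)
          (.inr ⟨rfl, by rwa [hfj], by rw [hfj]; exact not_lt.1 h4⟩))
  · rintro j σ' hj ⟨h1, hI⟩ hJ h0 ha
    refine hI.congr fun z w => ⟨fun ⟨h1, h2⟩ => ?_, ?_⟩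
    · rcases Nat.lt_succ_iff_lt_or_eq.1 h1 with h3 | rfl
      · exact .inl ⟨h3, h2⟩
      · exact .inr ⟨rfl, h2⟩
    · rintro (⟨h3, h4⟩ | ⟨rfl, h4⟩)
      · exact ⟨by omega, h4⟩
      · exact ⟨by omega, h4⟩
  · intro σ' h q hq
    obtain ⟨h1, h2⟩ := h q
    simp only [hf, if_pos hq] at h1 h2
    refine ⟨h1.imp_right ?_, fun z hz w hzw hw hzq => ?_⟩
    · rintro ⟨z, ⟨h3, h4, i', h5, h6, h7, h8⟩, h9⟩
      exact ⟨z, h3, (hG.adj_iff z h3 _).2 ⟨i', h5, h6, h7⟩, h8, h9⟩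
    · obtain ⟨i', h5, h6, h7⟩ := (hG.adj_iff z hz _).1 hzw
      exact h2 z w ⟨hz, by omega, i', h5, h6, h7, hw⟩ hzq

/-! ### The new elimination order -/

/-- The list `l` has been written to the arrays of the new order. -/
def Appended (A : ℕ → ℕ → ℕ) (l : List ℕ) : Prop :=
  A 45 0 = l.length ∧ ∀ (i y : ℕ), l[i]? = some y → A 23 i = y ∧ A 44 y = i

/-- Append the vertex in the register `11` to the new order. -/
def append : Prog :=
  .seq (.put 23 (.get 45 (.lit 0)) (.var 11)) <|
  .seq (.put 44 (.var 11) (.get 45 (.lit 0))) (.put 45 (.lit 0) (.add (.get 45 (.lit 0)) (.lit 1)))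

theorem Appended.congr {A A' : ℕ → ℕ → ℕ} {l : List ℕ} (h : Appended A l) (h1 : A' 23 = A 23)
    (h2 : A' 44 = A 44) (h3 : A' 45 = A 45) : Appended A' l := by
  rw [Appended, h1, h2, h3]
  exact h

theorem Appended.append_step {σ : State} {l : List ℕ} {y : ℕ} (h : Appended σ.arr l)
    (hy : σ.reg 11 = y) (hyl : y ∉ l) : Appended (append.step σ).arr (l ++ [y]) := by
  obtain ⟨h1, h2⟩ := h
  have h23 : ∀ i, (append.step σ).arr 23 i = if i = l.length then y else σ.arr 23 i := by
    intro i
    simp [append, step_seq, step_put, eval_get, eval_lit, eval_var, h1, hy]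
  have h44 : ∀ i, (append.step σ).arr 44 i = if i = y then l.length else σ.arr 44 i := by
    intro i
    simp [append, step_seq, step_put, eval_get, eval_lit, eval_var, h1, hy]
  have h45 : (append.step σ).arr 45 0 = l.length + 1 := by
    simp [append, step_seq, step_put, eval_get, eval_lit, eval_var, eval_add, h1]
  refine ⟨by rw [h45]; simp, fun i x hx => ?_⟩
  rw [h23, h44]
  by_cases hi : i < l.length
  · rw [List.getElem?_append_left hi] at hx
    have hxl : x ∈ l := List.mem_of_getElem? hx
    rw [if_neg hi.ne, if_neg fun he : x = y => hyl (he ▸ hxl)]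
    exact h2 i x hx
  · rw [List.getElem?_append_right (by omega)] at hx
    have hi' : i = l.length := by
      by_contra hne
      rw [List.getElem?_eq_none (by simp; omega)] at hx
      simp at hx
    subst hi'
    simp at hx
    simp [hx]

theorem Appended.pairwise {A : ℕ → ℕ → ℕ} {l : List ℕ} (h : Appended A l) :
    l.Pairwise fun a b => A 44 a < A 44 b := by
  rw [List.pairwise_iff_getElem]
  intro i j hi hj hij
  rw [(h.2 i _ (List.getElem?_eq_getElem hi)).2, (h.2 j _ (List.getElem?_eq_getElem hj)).2]
  exact hij

theorem Appended.listed {n : ℕ} {A : ℕ → ℕ → ℕ} {l : List ℕ} (h : Appended A l)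
    (hl : ∀ y ∈ l, y < n) : Listed n l.length {y | y ∈ l} (A 23) (A 44) where
  mem j hj := by
    rw [(h.2 j _ (List.getElem?_eq_getElem hj)).1]
    exact List.getElem_mem hj
  pos_ord j hj := by
    have := h.2 j _ (List.getElem?_eq_getElem hj)
    rw [this.1, this.2]
  pos_lt y hy := by
    obtain ⟨j, hj, rfl⟩ := List.getElem_of_mem hy
    rw [(h.2 j _ (List.getElem?_eq_getElem hj)).2]
    exact hj
  ord_pos y hy := by
    obtain ⟨j, hj, rfl⟩ := List.getElem_of_mem hy
    have := h.2 j _ (List.getElem?_eq_getElem hj)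
    rw [this.2, this.1]
  lt := hl

/-- The listed vertices. -/
def ordList (ord : ℕ → ℕ) (K : ℕ) : List ℕ := (List.range K).map ord

theorem Listed.mem_ordList {n K : ℕ} {O : Set ℕ} {ord pos : ℕ → ℕ} (h : Listed n K O ord pos)
    {y : ℕ} : y ∈ ordList ord K ↔ y ∈ O := by
  rw [ordList, List.mem_map]
  constructor
  · rintro ⟨j, hj, rfl⟩
    exact h.mem j (List.mem_range.1 hj)
  · exact fun hy => ⟨pos y, List.mem_range.2 (h.pos_lt y hy), h.ord_pos y hy⟩

theorem Listed.pairwise {n K : ℕ} {O : Set ℕ} {ord pos : ℕ → ℕ} (h : Listed n K O ord pos) :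
    (ordList ord K).Pairwise fun a b => pos a < pos b := by
  rw [ordList, List.pairwise_map]
  refine List.pairwise_lt_range.imp_of_mem fun {a b} ha hb hab => ?_
  rw [h.pos_ord a (List.mem_range.1 ha), h.pos_ord b (List.mem_range.1 hb)]
  exact hab

theorem runs_forAsc_append {n K : ℕ} {O : Set ℕ} {σ : State} {l : List ℕ} (e : Expr)
    (P : ℕ → Prop) [DecidablePred P] (hl : Listed n K O (σ.arr 10) (σ.arr 43)) (hK : σ.reg 15 = K)
    (hw : e.wf) (hc : e.cost ≤ 10) (h0 : Appended σ.arr l)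
    (he : ∀ y ∈ O, ∀ τ : State, τ.reg 11 = y → (∀ a, a ∉ [23, 44, 45] → τ.arr a = σ.arr a) →
      (e.eval τ = 0 ↔ ¬ P y)) (hlP : ∀ y ∈ O, P y → y ∉ l) :
    Runs n (forAsc (.ite e append .skip)) σ (100 * n + 6)
      (fun σ' => Appended σ'.arr (l ++ (ordList (σ.arr 10) K).filter P)) := by
  refine (Runs.forAsc (n := n) (σ := σ) 40
    (fun j A => Appended A (l ++ (ordList (σ.arr 10) j).filter P)) hl hK
    (by rw [Prog.wf, hw]; rfl) ?_ (by simp [Prog.wr, append])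
    (by simp [Prog.wr, append]) (by simp [Prog.wa, append]) (by simpa [ordList] using h0)
    ?_).mono (by omega) fun _ h => h
  · have : append.tb = 14 := rfl
    simp only [Prog.tb, this]
    omega
  · intro y σ' hy hI hy11 _ ha _
    have hsucc : ordList (σ.arr 10) (σ.arr 43 y + 1) = ordList (σ.arr 10) (σ.arr 43 y) ++ [y] := by
      simp [ordList, List.range_succ, hl.ord_pos y hy]
    rw [hsucc, List.filter_append, step_ite]
    by_cases hP : P y
    · rw [if_neg (mt (he y hy σ' hy11 ha).1 (not_not.2 hP)), ← List.append_assoc]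
      have : List.filter (fun y => decide (P y)) [y] = [y] := by simp [hP]
      rw [this]
      refine hI.append_step hy11 ?_
      rw [List.mem_append, not_or]
      refine ⟨hlP y hy hP, fun h => ?_⟩
      obtain ⟨j, hj, hjy⟩ := List.mem_map.1 (List.mem_filter.1 h).1
      rw [List.mem_range] at hj
      have := hl.pos_ord j (hj.trans (hl.pos_lt y hy))
      rw [hjy] at this
      omega
    · rw [if_pos ((he y hy σ' hy11 ha).2 hP)]
      have : List.filter (fun y => decide (P y)) [y] = [] := by simp [hP]
      rw [this, List.append_nil]
      exact hI

/-- Write down the new elimination order. -/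
def orderPass : Prog :=
  .seq (forAsc (.ite (.eq (.get 34 (.var 11)) (.lit 0)) append .skip)) <|
  .seq (forLt 10 0 (.ite (.lt (.var 10) (.get 41 (.lit 0)))
    (.seq (.set 11 (.get 19 (.var 10))) append) .skip)) <|
  .seq (forAsc (.ite (.get 36 (.var 11)) append .skip)) <|
  .seq (.set 11 (.var 14)) append

theorem runs_orderPass {n K M v : ℕ} {nl : ℕ → ℕ} {O : Set ℕ} {σ : State}
    (hn : σ.reg 0 = n) (hl : Listed n K O (σ.arr 10) (σ.arr 43)) (hK : σ.reg 15 = K)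
    (hv : σ.reg 14 = v) (hvO : v ∉ O) (h45 : σ.arr 45 0 = 0) (hM : σ.arr 41 0 = M) (hMn : M ≤ n)
    (hnl : ∀ e, σ.arr 19 e = nl e) (hinj : ∀ i < M, ∀ j < M, nl i = nl j → i = j)
    (hnlO : ∀ e < M, nl e ∈ O ∧ σ.arr 34 (nl e) ≠ 0 ∧ σ.arr 36 (nl e) = 0)
    (hLU : ∀ y ∈ O, σ.arr 36 y ≠ 0 → σ.arr 34 y ≠ 0) :
    Runs n orderPass σ (400 * n + 60) (fun σ' => Appended σ'.arr
      ((ordList (σ.arr 10) K).filter (fun y => σ.arr 34 y = 0) ++ (List.range M).map nl ++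
        (ordList (σ.arr 10) K).filter (fun y => σ.arr 36 y ≠ 0) ++ [v])) := by
  have h1 := runs_forAsc_append (n := n) (σ := σ) (l := []) (.eq (.get 34 (.var 11)) (.lit 0))
    (fun y => σ.arr 34 y = 0) hl hK rfl (by decide) ⟨h45, by simp⟩ (by
      intro y hy τ h1 h2
      rw [eval_eq_zero, eval_get, eval_var, h1, h2 34 (by decide), eval_lit]) (by simp)
  rw [List.nil_append] at h1
  set l1 := (ordList (σ.arr 10) K).filter (fun y => σ.arr 34 y = 0) with hl1
  have hm1 : ∀ y, y ∈ l1 ↔ y ∈ O ∧ σ.arr 34 y = 0 := fun y => by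
    rw [hl1, List.mem_filter, hl.mem_ordList]; simp
  refine (Runs.seq h1.frame (T' := 300 * n + 54) ?_).mono (by omega) fun _ h => h
  rintro σ1 ⟨g1, g2, g3⟩
  have h2 := Runs.forLt_block (n := n) (σ := σ1) (rJ := 10) (rB := 0)
    (body := .ite (.lt (.var 10) (.get 41 (.lit 0))) (.seq (.set 11 (.get 19 (.var 10))) append)
      .skip) 40 (fun j A => Appended A (l1 ++ (List.range (min j M)).map nl)) rfl (by decide) rfl
      (by decide) rfl (by decide) (by decide) (by decide) (by simpa using g1) (by
        intro j σ' hj hI hJ hr ha _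
        have e19 : σ'.arr 19 = σ.arr 19 := (ha 19 (by decide)).trans (g3 19 (by decide))
        have e41 : σ'.arr 41 = σ.arr 41 := (ha 41 (by decide)).trans (g3 41 (by decide))
        simp only [step_ite, step_seq, step_set, step_skip, eval_lt_zero, eval_get, eval_var,
          eval_lit, e19, e41, hJ, hM, hnl]
        by_cases hjM : j < M
        · rw [if_neg (not_not.2 hjM), show min (j + 1) M = min j M + 1 by omega, List.range_succ,
            List.map_append, ← List.append_assoc]
          have hj' : min j M = j := by omega
          rw [hj'] at hI ⊢
          refine Appended.append_step (σ := σ'.setReg 11 (nl j)) hI setReg_same ?_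
          rw [List.mem_append, not_or, hm1]
          refine ⟨fun h => (hnlO j hjM).2.1 h.2, fun h => ?_⟩
          obtain ⟨i, hi, hij⟩ := List.mem_map.1 h
          rw [List.mem_range] at hi
          have := hinj i (by omega) j hjM hij
          omega
        · rw [if_pos hjM, show min (j + 1) M = min j M by omega]
          exact hI)
  have g0 : σ1.reg 0 = n := (g2 0 (by decide)).trans hn
  rw [g0, min_eq_right hMn] at h2
  refine (Runs.seq h2.frame (T' := 200 * n + 48) ?_).mono (by omega) fun _ h => h
  rintro σ2 ⟨⟨-, g4⟩, g5, g6⟩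
  have e : ∀ a, a ∉ [23, 44, 45] → σ2.arr a = σ.arr a := fun a ha =>
    (g6 a ha).trans (g3 a ha)
  have h3 := runs_forAsc_append (n := n) (σ := σ2) (K := K) (O := O) (.get 36 (.var 11))
    (fun y => σ.arr 36 y ≠ 0) (by rw [e 10 (by decide), e 43 (by decide)]; exact hl)
    ((g5 15 (by decide)).trans ((g2 15 (by decide)).trans hK)) rfl (by decide) g4 (by
      intro y hy τ h1 h2
      rw [eval_get, eval_var, h1, h2 36 (by decide), e 36 (by decide), not_not]) (by
      intro y hy hyL h
      rw [List.mem_append, hm1] at h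
      rcases h with h | h
      · exact hLU y hy hyL h.2
      · obtain ⟨i, hi, rfl⟩ := List.mem_map.1 h
        exact hyL (hnlO i (List.mem_range.1 hi)).2.2)
  rw [e 10 (by decide)] at h3
  refine (Runs.seq h3.frame (T' := 100 * n + 42) ?_).mono (by omega) fun _ h => h
  rintro σ3 ⟨g7, g8, g9⟩
  refine (Runs.block rfl).mono (T' := 100 * n + 42) (Nat.le_add_left_of_le (by decide)) ?_
  rintro _ rfl
  have e14 : σ3.reg 14 = v :=
    (g8 14 (by decide)).trans ((g5 14 (by decide)).trans ((g2 14 (by decide)).trans hv))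
  rw [step_seq, step_set, eval_var, e14]
  refine Appended.append_step (σ := σ3.setReg 11 v) g7 setReg_same ?_
  simp only [List.mem_append, not_or, hm1, List.mem_map, List.mem_range, List.mem_filter,
    hl.mem_ordList]
  refine ⟨⟨fun h => hvO h.1, ?_⟩, fun h => hvO h.1⟩
  rintro ⟨i, hi, rfl⟩
  exact hvO (hnlO i hi).1

/-! ### Combining the passes: from the memory to the specifications -/

/-- The memory holds the elimination tree of the minimal triangulation `H` of `G[O]`. -/
structure HoldsTree (n K : ℕ) (G H : SimpleGraph ℕ) (O : Set ℕ) (A : ℕ → ℕ → ℕ) : Prop where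
  listed : Listed n K O (A 10) (A 43)
  adj : HoldsAdj n G A
  ins : ∀ y < n, A 30 y ≠ 0 ↔ y ∈ O
  tree : ElimTree G H O n (A 43) (A 12) (A 31)

theorem HoldsTree.par_cases {n K : ℕ} {G H : SimpleGraph ℕ} {O : Set ℕ} {A : ℕ → ℕ → ℕ}
    (h : HoldsTree n K G H O A) : ∀ y ∈ O, A 12 y = n ∨ A 12 y ∈ O ∧ A 43 y < A 43 (A 12 y) := by
  intro y hy
  by_cases hp : A 12 y = n
  · exact .inl hp
  · have := h.tree.par_mem y hy hp
    exact .inr ⟨(h.tree.later_mem this).2, this.2⟩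

/-- Determine the ancestors of the neighbours of the new vertex, and their heavy paths. -/
def scanPass : Prog := .seq initPass <| .seq markPass <| .seq upPass pathPass

/-- The result of `scanPass`. -/
structure Scanned (n v : ℕ) (G : SimpleGraph ℕ) (O : Set ℕ) (A : ℕ → ℕ → ℕ) : Prop where
  isN : ∀ z ≤ n, A 33 z ≠ 0 ↔ z ∈ O ∧ G.Adj v z
  U_iff : ∀ z ≤ n, A 34 z ≠ 0 ↔ (z ∈ O ∧ G.Adj v z) ∨ z < n ∧ ∃ y ∈ O, A 34 y ≠ 0 ∧ A 12 y = z
  hv : ∀ y ∈ O, A 34 y ≠ 0 → A 12 y ∈ O →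
    A 13 (A 12 y) ∈ O ∧ A 34 (A 13 (A 12 y)) ≠ 0 ∧
    A 12 (A 13 (A 12 y)) = A 12 y ∧ A 31 y ≤ A 31 (A 13 (A 12 y))
  hv_none : A 13 n = n
  path_U : ∀ y ∈ O, A 34 y ≠ 0 → A 14 y = y ∧ A 35 y = A 35 (A 12 y) + 1 ∧
    A 15 y = if A 13 (A 12 y) = y then A 15 (A 12 y) else y
  ua_par : ∀ y ∈ O, A 34 y = 0 → A 14 y = A 14 (A 12 y)
  ua_le : ∀ i ≤ n, A 14 i ≤ n
  dep_none : A 35 n = 0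
  head : ∀ i ≤ n, A 16 i = n
  isL : ∀ i ≤ n, A 36 i = 0
  cnt : ∀ i ≤ n, A 37 i = 0
  top : ∀ i ≤ n, A 21 i = n
  la : A 22 n = v
  rt : ∀ i ≤ n, A 24 i = n
  par : ∀ i ≤ n, A 25 i = n
  count : A 41 0 = 0
  next : A 45 0 = 0

theorem runs_scanPass {n K v : ℕ} {G H : SimpleGraph ℕ} {O : Set ℕ} {σ : State}
    (hn : σ.reg 0 = n) (hK : σ.reg 15 = K) (hv : σ.reg 14 = v) (hvn : v < n)
    (h : HoldsTree n K G H O σ.arr) :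
    Runs n scanPass σ (30 * σ.arr 0 n + 300 * n + 170)
      (fun σ' => Scanned n v G O σ'.arr) := by
  have hnO : n ∉ O := fun hh => lt_irrefl _ (h.listed.lt n hh)
  refine (Runs.seq (runs_initPass hn).frame
    (T' := 30 * σ.arr 0 n + 200 * n + 70) ?_).mono (by omega) fun _ h => h
  rintro σ1 ⟨⟨i1, i2, i3⟩, r1, f1⟩
  rw [hv] at i1
  have e1 : ∀ a, a ∉ initPass.wa → σ1.arr a = σ.arr a := f1
  have v1 : σ1.reg 14 = v := (r1 14 (by decide)).trans hv
  have hm := runs_markPass (n := n) (G := G) (O := O) (σ := σ1)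
    ⟨by rw [e1 0 (by decide)]; exact h.adj.start, by rw [e1 0 (by decide)]; exact h.adj.mono,
      by rw [e1 0 (by decide), e1 1 (by decide)]; exact h.adj.adj_iff, h.adj.lt⟩
    (by rw [v1]; exact hvn) (by rw [e1 30 (by decide)]; exact h.ins)
    (fun i hi => (i1 i hi).isN) (fun i hi => (i1 i hi).isU)
  rw [v1, e1 0 (by decide)] at hm
  have hdeg : σ.arr 0 (v + 1) ≤ σ.arr 0 n := by
    have : ∀ k, v + 1 ≤ k → k ≤ n → σ.arr 0 (v + 1) ≤ σ.arr 0 k := by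
      intro k hk
      induction k, hk using Nat.le_induction with
      | base => exact fun _ => le_rfl
      | succ k hk ih => exact fun hkn => (ih (by omega)).trans (h.adj.mono k (by omega))
    exact this n hvn le_rfl
  refine (Runs.seq hm.frame (T' := 200 * n + 20) ?_).mono (by omega) fun _ h => h
  rintro σ2 ⟨m1, r2, f2⟩
  have e2 : ∀ a, a ∉ initPass.wa ++ markPass.wa → σ2.arr a = σ.arr a := fun a ha =>
    (f2 a fun hh => ha (List.mem_append_right _ hh)).trans
      (f1 a fun hh => ha (List.mem_append_left _ hh))
  have hu := runs_upPass (n := n) (K := K) (O := O) (σ := σ2)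
    (by rw [e2 10 (by decide), e2 43 (by decide)]; exact h.listed)
    ((r2 15 (by decide)).trans ((r1 15 (by decide)).trans hK))
    ((r2 0 (by decide)).trans ((r1 0 (by decide)).trans hn))
    (by rw [e2 12 (by decide), e2 43 (by decide)]; exact h.par_cases)
    (by rw [f2 13 (by decide)]; exact fun i hi => (i1 i hi).hv)
  refine (Runs.seq hu.frame (T' := 100 * n + 6) ?_).mono (by omega) fun _ h => h
  rintro σ3 ⟨⟨u1, u2, u3⟩, r3, f3⟩
  rw [e2 12 (by decide)] at u1 u2
  rw [e2 31 (by decide)] at u2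
  have e3 : ∀ a, a ∉ initPass.wa ++ markPass.wa ++ upPass.wa → σ3.arr a = σ.arr a := fun a ha =>
    (f3 a fun hh => ha (List.mem_append_right _ hh)).trans
      (e2 a fun hh => ha (List.mem_append_left _ hh))
  have hp := runs_pathPass (n := n) (K := K) (O := O) (σ := σ3)
    (by rw [e3 10 (by decide), e3 43 (by decide)]; exact h.listed)
    ((r3 15 (by decide)).trans ((r2 15 (by decide)).trans ((r1 15 (by decide)).trans hK)))
    (by rw [e3 12 (by decide), e3 43 (by decide)]; exact h.par_cases)
  intro W B hB hnB hs hW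
  obtain ⟨t, ht, σ4, h1, h2, ⟨⟨p1, p2⟩, -, f4⟩⟩ := hp.frame W B hB hnB hs hW
  refine ⟨t, ht, σ4, h1, h2, ?_⟩
  rw [e3 12 (by decide)] at p1
  have e4 : ∀ a, a ∉ markPass.wa ++ upPass.wa ++ pathPass.wa → σ4.arr a = σ1.arr a := by
    intro a ha
    simp only [List.mem_append, not_or] at ha
    exact (f4 a ha.2).trans ((f3 a ha.1.2).trans (f2 a ha.1.1))
  have e34 : σ4.arr 34 = σ3.arr 34 := f4 34 (by decide)
  have e13 : σ4.arr 13 = σ3.arr 13 := f4 13 (by decide)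
  have e33 : σ4.arr 33 = σ2.arr 33 := (f4 33 (by decide)).trans (f3 33 (by decide))
  have e12 : σ4.arr 12 = σ.arr 12 := (f4 12 (by decide)).trans (e3 12 (by decide))
  have e31 : σ4.arr 31 = σ.arr 31 := (f4 31 (by decide)).trans (e3 31 (by decide))
  constructor
  · rw [e33]
    exact fun z hz => (m1 z hz).1
  · rw [e34, e12]
    intro z hz
    rw [u1 z hz, (m1 z hz).2]
  · rw [e34, e13, e12, e31]
    exact u2
  · rw [e13]
    exact u3
  · rw [e34, e13, e12]
    exact fun y hy => (p1 y hy).1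
  · rw [e34, e12]
    exact fun y hy => (p1 y hy).2
  · exact fun i hi => h2.idx_arr 14 rfl i hi
  · rw [p2 35 n hnO, f3 35 (by decide), f2 35 (by decide)]
    exact (i1 n le_rfl).dep
  · rw [e4 16 (by decide)]
    exact fun i hi => (i1 i hi).head
  · rw [e4 36 (by decide)]
    exact fun i hi => (i1 i hi).isL
  · rw [e4 37 (by decide)]
    exact fun i hi => (i1 i hi).cnt
  · rw [e4 21 (by decide)]
    exact fun i hi => (i1 i hi).top
  · rw [e4 22 (by decide)]
    exact (i1 n le_rfl).la
  · rw [e4 24 (by decide)]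
    exact fun i hi => (i1 i hi).rt
  · rw [e4 25 (by decide)]
    exact fun i hi => (i1 i hi).par
  · rw [e4 41 (by decide)]
    exact i2
  · rw [e4 45 (by decide)]
    exact i3

theorem Scanned.U_mem {n K v : ℕ} {G H : SimpleGraph ℕ} {O : Set ℕ} {A : ℕ → ℕ → ℕ}
    (hS : Scanned n v G O A) (h : HoldsTree n K G H O A) : ∀ z ≤ n, A 34 z ≠ 0 → z ∈ O := by
  intro z hz hU
  rcases (hS.U_iff z hz).1 hU with h1 | ⟨h1, y, hy, -, h2⟩
  · exact h1.1
  · rcases h.par_cases y hy with h3 | h3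
    · omega
    · rw [← h2]; exact h3.1

theorem countEq_eq_ncard {M t : ℕ} {f nl : ℕ → ℕ} {S : Set ℕ}
    (hinj : ∀ i < M, ∀ j < M, nl i = nl j → i = j)
    (hS : ∀ z, z ∈ S ↔ ∃ i < M, nl i = z ∧ f i = t) : countEq f t M = S.ncard := by
  have : S = nl '' ((Finset.range M).filter fun i => f i = t : Finset ℕ) := by
    ext z
    rw [hS]
    simp only [Finset.coe_filter, Finset.mem_range, Set.mem_image, Set.mem_ofPred_eq]
    exact ⟨fun ⟨i, h1, h2, h3⟩ => ⟨i, ⟨h1, h3⟩, h2⟩, fun ⟨i, ⟨h1, h3⟩, h2⟩ => ⟨i, h1, h2, h3⟩⟩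
  rw [this, Set.InjOn.ncard_image, Set.ncard_coe_finset, countEq]
  intro i hi j hj hij
  simp only [Finset.coe_filter, Finset.mem_range, Set.mem_ofPred_eq] at hi hj
  exact hinj i hi.1 j hj.1 hij

/-- Determine the neighbourhood of the new vertex, and the order and the parents of the other
vertices of `U`. -/
def choosePass : Prog := .seq botPass <| .seq spillPass stackPass

/-- The result of `choosePass`. -/
structure Chosen (n v : ℕ) (G : SimpleGraph ℕ) (O : Set ℕ) (A : ℕ → ℕ → ℕ) : Prop where
  spec : InsertSpec G O n v (A 43) (A 12) (A 31) (A 13) (A 14) (A 35) (A 15) (A 18) (A 38) (A 37)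
    (fun z => z ∈ O ∧ A 34 z ≠ 0) (fun z => A 42 z ≠ 0)
    (fun z => (z ∈ O ∧ A 34 z ≠ 0) ∧ A 36 z ≠ 0)
  L_U : ∀ z ≤ n, A 36 z ≠ 0 → A 34 z ≠ 0
  nl_mem : ∀ e < A 41 0, (A 19 e ∈ O ∧ A 34 (A 19 e) ≠ 0) ∧ A 36 (A 19 e) = 0
  exists_nl : ∀ z ∈ O, A 34 z ≠ 0 → A 36 z = 0 → ∃ e < A 41 0, A 19 e = z
  inj : ∀ i < A 41 0, ∀ j < A 41 0, A 19 i = A 19 j → i = j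
  anti : ∀ i j, i < j → j < A 41 0 → A 43 (A 18 (A 19 j)) ≤ A 43 (A 18 (A 19 i))
  deg : ∀ e < A 41 0, A 39 (A 19 e) = A 31 (A 18 (A 19 e)) + 1 -
    countEq (fun j => A 18 (A 19 j)) (A 18 (A 19 e)) (e + 1)
  par : ∀ e < A 41 0, (∃ x, IsNext (A 41 0) (fun e => A 15 (A 18 (A 19 e)))
      (fun e => A 35 (A 19 e)) (fun e => A 35 (A 18 (A 19 e))) e x ∧
      A 20 (A 19 e) = A 19 x) ∨
    ((∀ y, e < y → y < A 41 0 → A 15 (A 18 (A 19 y)) = A 15 (A 18 (A 19 e)) →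
      A 35 (A 18 (A 19 e)) < A 35 (A 19 y)) ∧ A 20 (A 19 e) = A 18 (A 19 e))
  count_le : A 41 0 ≤ n

/-- The facts about `bot` are proved before `L` is known, as the bucket pass needs that every `bot`
is a vertex of `U`. Only after that pass is the full `InsertSpec` available, and it in turn supplies
the monotonicity that the stacks need. -/
theorem runs_choosePass {n K v : ℕ} {G H : SimpleGraph ℕ} {O : Set ℕ} {σ : State}
    (hn : σ.reg 0 = n) (hK : σ.reg 15 = K) (hvO : v ∉ O)
    (h : HoldsTree n K G H O σ.arr) (hS : Scanned n v G O σ.arr) :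
    Runs n choosePass σ (100 * σ.arr 0 n + 1100 * n + 18)
      (fun σ' => Chosen n v G O σ'.arr) := by
  have hnO : n ∉ O := fun hh => lt_irrefl _ (h.listed.lt n hh)
  refine (Runs.seq (runs_botPass hn h.adj h.ins hS.isL hS.head hS.ua_le).frame
    (T' := 500 * n + 12) ?_).mono (by omega) fun _ h => h
  rintro σ1 ⟨⟨b1, b2, b3⟩, r1, f1⟩
  have hUO := hS.U_mem h
  have hb : BotSpec G O n v (σ.arr 43) (σ.arr 12) (σ.arr 31) (σ.arr 13) (σ.arr 14) (σ.arr 35)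
      (σ.arr 15) (σ1.arr 18) (fun z => z ∈ O ∧ σ.arr 34 z ≠ 0) (fun z => σ1.arr 42 z ≠ 0) := by
    constructor
    · exact hvO
    · exact fun z hz => hz.1
    · intro z hz
      have hzn := h.listed.lt z hz
      simp only [hz, true_and]
      rw [hS.U_iff z hzn.le]
      constructor
      · rintro (h1 | ⟨-, y, h2, h3, h4⟩)
        · exact .inl h1.2
        · exact .inr ⟨y, h2, ⟨h2, h3⟩, h4⟩
      · rintro (h1 | ⟨y, h2, h3, h4⟩)
        · exact .inl ⟨hz, h1⟩
        · exact .inr ⟨hzn, y, h2, h3.2, h4⟩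
    · intro y hy hU hp
      obtain ⟨h1, h2, h3, h4⟩ := hS.hv y hy hU.2 hp
      exact ⟨⟨h1, h2⟩, h3, h4⟩
    · rw [hS.hv_none]; exact hnO
    · exact fun y hy => (hS.path_U y hy.1 hy.2).1
    · exact fun y hy hU => hS.ua_par y hy (by_contra fun hh => hU ⟨hy, hh⟩)
    · exact fun y hy => (hS.path_U y hy.1 hy.2).2.1
    · exact fun y hy => (hS.path_U y hy.1 hy.2).2.2
    · intro z hz
      rw [(b1 z (h.listed.lt z hz.1) hz.2).1, hS.isN z (h.listed.lt z hz.1).le]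
      simp only [hz.1, true_and]
    · exact fun z hz => (b1 z (h.listed.lt z hz.1) hz.2).2.1
    · exact fun z hz => (b1 z (h.listed.lt z hz.1) hz.2).2.2
  have ht := h.tree
  have hFU : ∀ z, (z < n ∧ σ.arr 34 z ≠ 0 ∧ σ1.arr 42 z = 0) →
      (z ∈ O ∧ σ.arr 34 z ≠ 0) ∧ ¬ σ1.arr 42 z ≠ 0 := fun z hz =>
    ⟨⟨hUO z hz.1.le hz.2.1, hz.2.1⟩, not_not.2 hz.2.2⟩
  have hsp := runs_spillPass (n := n) (K := K) (O := O)
    (F := fun z => z < n ∧ σ.arr 34 z ≠ 0 ∧ σ1.arr 42 z = 0) (σ := σ1)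
    (by rw [f1 10 (by decide), f1 43 (by decide)]; exact h.listed)
    ((r1 15 (by decide)).trans hK) ((r1 0 (by decide)).trans hn)
    (by rw [f1 12 (by decide), f1 43 (by decide)]; exact h.par_cases)
    (fun z hz => by
      rw [f1 34 (by decide)]
      exact ⟨hz.1, (hb.bot_spec ht (hFU z hz).1 (hFU z hz).2).2.1⟩) b3
    (fun z hz => by
      by_contra hne
      exact ((b2 z hz.1.le).1 hne).2.2 hz.2.2)
    (by rw [f1 37 (by decide)]; exact hS.cnt) (by rw [f1 41 (by decide)]; exact hS.count)
  refine (Runs.seq hsp.frame (T' := 200 * n + 6) ?_).mono (by omega) fun _ h => h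
  rintro σ2 ⟨⟨s1, s2⟩, r2, f2⟩
  have e2 : ∀ a, a ∉ botPass.wa ++ spillPass.wa → σ2.arr a = σ.arr a := fun a ha =>
    (f2 a fun hh => ha (List.mem_append_right _ hh)).trans
      (f1 a fun hh => ha (List.mem_append_left _ hh))
  obtain ⟨s_sub, s_isL, s_other, s_mem, s_ex, s_inj, s_anti, s_cnt, s_deg⟩ := s1
  simp only [f1 34 (by decide), f1 15 (by decide), f1 31 (by decide), f1 12 (by decide),
    f1 35 (by decide), f1 43 (by decide)] at s_isL s_anti s_deg s2
  have e18 : σ2.arr 18 = σ1.arr 18 := f2 18 (by decide)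
  have e42 : σ2.arr 42 = σ1.arr 42 := f2 42 (by decide)
  rw [← e18] at s_isL s_anti s_cnt s_deg hb
  rw [← e42] at s_isL s_mem s_ex s_other b2 hFU hb
  have hLU : ∀ z ≤ n, σ2.arr 36 z ≠ 0 → σ.arr 34 z ≠ 0 := by
    intro z hz hL
    by_cases hF : z < n ∧ σ.arr 34 z ≠ 0 ∧ σ2.arr 42 z = 0
    · exact hF.2.1
    · rw [s_other z hF] at hL
      exact ((b2 z hz).1 hL).2.1
  have hnl : ∀ e < σ2.arr 41 0, (σ2.arr 19 e ∈ O ∧ σ.arr 34 (σ2.arr 19 e) ≠ 0) ∧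
      σ2.arr 36 (σ2.arr 19 e) = 0 := fun e he =>
    ⟨(hFU _ (s_mem e he).1).1, (s_mem e he).2⟩
  have hex : ∀ z ∈ O, σ.arr 34 z ≠ 0 → σ2.arr 36 z = 0 → ∃ e < σ2.arr 41 0, σ2.arr 19 e = z := by
    intro z hz hU hL
    refine s_ex z ⟨h.listed.lt z hz, hU, ?_⟩ hL
    by_contra h42
    rw [s_other z fun hF => h42 hF.2.2] at hL
    exact (b2 z (h.listed.lt z hz).le).2 ⟨h.listed.lt z hz, hU, h42⟩ hL
  have hI : InsertSpec G O n v (σ.arr 43) (σ.arr 12) (σ.arr 31) (σ.arr 13) (σ.arr 14) (σ.arr 35)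
      (σ.arr 15) (σ2.arr 18) (σ2.arr 38) (σ2.arr 37) (fun z => z ∈ O ∧ σ.arr 34 z ≠ 0)
      (fun z => σ2.arr 42 z ≠ 0) (fun z => (z ∈ O ∧ σ.arr 34 z ≠ 0) ∧ σ2.arr 36 z ≠ 0) := by
    refine ⟨hb, fun t ht => s2 t ht.1 ht.2, fun z => and_congr_right fun hz => ?_, fun t ht => ?_⟩
    · have hzn := h.listed.lt z hz.1
      by_cases h42 : σ2.arr 42 z = 0
      · rw [s_isL z ⟨hzn, hz.2, h42⟩]
        simp [h42]
      · rw [s_other z fun hF => h42 hF.2.2, b2 z hzn.le]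
        simp [h42, hzn, hz.2]
    · rw [s_cnt t (h.listed.lt t ht.1).le]
      refine countEq_eq_ncard s_inj fun z => ⟨fun ⟨h1, h2, h3⟩ => ?_, ?_⟩
      · obtain ⟨e, he, rfl⟩ := hex z h1.1 h1.2 (by_contra fun hh => h2 ⟨h1, hh⟩)
        exact ⟨e, he, rfl, h3⟩
      · rintro ⟨i, hi, rfl, h3⟩
        exact ⟨(hnl i hi).1, fun hh => hh.2 (hnl i hi).2, h3⟩
  have hbot : ∀ e < σ2.arr 41 0, _ := fun e he => hb.bot_spec ht (hnl e he).1
    (hI.not_l0 (hnl e he).1 fun hh => hh.2 (hnl e he).2)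
  have hMn : σ2.arr 41 0 ≤ n := by
    have := Finset.card_le_card_of_injOn (s := Finset.range (σ2.arr 41 0)) (t := Finset.range n)
      (σ2.arr 19) (fun e he => by
        simp only [Finset.coe_range, Set.mem_Iio] at he ⊢
        exact h.listed.lt _ (hnl e he).1.1) (fun i hi j hj hij => by
        simp only [Finset.coe_range, Set.mem_Iio] at hi hj
        exact s_inj i hi j hj hij)
    simpa using this
  have hst := runs_stackPass (n := n) (M := σ2.arr 41 0) (nl := σ2.arr 19)
    (b := fun e => σ.arr 15 (σ2.arr 18 (σ2.arr 19 e))) (q := fun e => σ.arr 35 (σ2.arr 19 e))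
    (r := fun e => σ.arr 35 (σ2.arr 18 (σ2.arr 19 e))) (σ := σ2)
    ((r2 0 (by decide)).trans ((r1 0 (by decide)).trans hn)) (fun _ => rfl) rfl hMn
    (fun e he => by
      rw [e2 15 (by decide)]
      exact ⟨rfl, (h.listed.lt _ (hb.lt_U ht (hbot e he).2.1).1).le⟩)
    (fun e he => by rw [e2 35 (by decide)]) (fun e he => by rw [e2 35 (by decide)])
    -- On one heavy path a smaller depth of the second `bot` would mean a higher position, against
    -- the descending order of the list.
    (fun e x hex hx hbx => by
      obtain ⟨-, k2, -, -⟩ := hbot e (by omega)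
      obtain ⟨-, m2, -, -⟩ := hbot x hx
      by_contra hlt
      have h1 := ht.anc_pos (hb.anc_of_lt_eq ht m2 k2 hbx (not_le.1 hlt).le)
      have h2 := s_anti e x hex hx
      rcases h1 with h1 | h1
      · rw [h1] at hlt
        exact hlt le_rfl
      · omega)
    (fun e he => ⟨h.listed.lt _ (hnl e he).1.1, (hnl e he).2⟩) s_inj
    -- If the `bot` were outside of `L`, it would occur in the list. It has a lower `bot` of its
    -- own, so it occurs after `e`, on the same path and at a depth that `e` sees.
    (fun e he hno hL => by
      obtain ⟨k1, k2, k3, -⟩ := hbot e he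
      obtain ⟨x, hx, hxe⟩ := hex _ k2.1 k2.2 hL
      obtain ⟨m1, m2, m3, -⟩ := hbot x hx
      rw [hxe] at m1 m2 m3
      have hex' : e < x := by
        by_contra hle
        rcases eq_or_lt_of_le (not_lt.1 hle) with rfl | hlt
        · have h9 := k3.2
          rw [← hxe] at h9
          exact lt_irrefl _ h9
        · have := s_anti x e hlt he
          rw [hxe] at this
          have := m3.2
          omega
      have := hno x hex' hx (by simp only [hxe]; exact m1)
      simp only [hxe] at this
      exact lt_irrefl _ this)
    (by rw [e2 21 (by decide)]; exact hS.top) (by rw [e2 35 (by decide)]; exact hS.dep_none)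
  refine hst.frame.imp ?_
  rintro σ3 ⟨t1, -, f3⟩
  have e18' : σ3.arr 18 = σ2.arr 18 := f3 18 (by decide)
  have e19 : σ3.arr 19 = σ2.arr 19 := f3 19 (by decide)
  have e36 : σ3.arr 36 = σ2.arr 36 := f3 36 (by decide)
  have e37 : σ3.arr 37 = σ2.arr 37 := f3 37 (by decide)
  have e38 : σ3.arr 38 = σ2.arr 38 := f3 38 (by decide)
  have e39 : σ3.arr 39 = σ2.arr 39 := f3 39 (by decide)
  have e41 : σ3.arr 41 = σ2.arr 41 := f3 41 (by decide)
  have e42' : σ3.arr 42 = σ2.arr 42 := f3 42 (by decide)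
  have g : ∀ a, a ∉ botPass.wa ++ spillPass.wa ++ stackPass.wa → σ3.arr a = σ.arr a := fun a ha =>
    (f3 a fun hh => ha (List.mem_append_right _ hh)).trans
      (e2 a fun hh => ha (List.mem_append_left _ hh))
  have g12 := g 12 (by decide)
  have g13 := g 13 (by decide)
  have g14 := g 14 (by decide)
  have g15 := g 15 (by decide)
  have g31 := g 31 (by decide)
  have g34 := g 34 (by decide)
  have g35 := g 35 (by decide)
  have g43 := g 43 (by decide)
  constructor
  · rw [e18', e36, e37, e38, e42', g12, g13, g14, g15, g31, g34, g35, g43]; exact hI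
  · rw [e36, g34]; exact hLU
  · rw [e19, e36, e41, g34]; exact hnl
  · rw [e19, e36, e41, g34]; exact hex
  · rw [e19, e41]; exact s_inj
  · rw [e19, e18', e41, g43]; exact s_anti
  · rw [e19, e18', e39, e41, g31]; exact s_deg
  · rw [e19, e18', e41, g15, g35]; exact t1
  · rw [e41]; exact hMn

/-- Since `pos` increases along the list, comparing `pos` is comparing indices. -/
theorem _root_.List.Pairwise.rel_of_lt {l : List ℕ} {pos : ℕ → ℕ} {R : ℕ → ℕ → Prop}
    (h1 : l.Pairwise fun a b => pos a < pos b) (h2 : l.Pairwise R) {y z : ℕ} (hy : y ∈ l)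
    (hz : z ∈ l) (hlt : pos y < pos z) : R y z := by
  obtain ⟨i, hi, rfl⟩ := List.getElem_of_mem hy
  obtain ⟨j, hj, rfl⟩ := List.getElem_of_mem hz
  rw [List.pairwise_iff_getElem] at h1 h2
  rcases lt_trichotomy i j with hij | rfl | hij
  · exact h2 i j hi hj hij
  · exact absurd hlt (lt_irrefl _)
  · have := h1 j i hj hi hij
    omega

/-- The new parent of `y`. -/
def newPar (n v : ℕ) (A : ℕ → ℕ → ℕ) (y : ℕ) : ℕ :=
  if y = v then n else if A 34 y = 0 then if A 34 (A 12 y) = 0 then A 12 y else A 25 y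
  else if A 36 y = 0 then A 20 y else A 22 y

/-- The new number of later neighbours of `y`. -/
def newDeg (v : ℕ) (A : ℕ → ℕ → ℕ) (y : ℕ) : ℕ :=
  if y = v then 0 else if A 34 y = 0 then A 31 y
  else if A 36 y = 0 then A 39 y else A 31 y + 1 - A 40 y

/-- Determine the new elimination tree. -/
def rankPass : Prog := .seq losePass <| .seq orderPass <| .seq rootPass topPass

theorem runs_rankPass {n K v : ℕ} {G H : SimpleGraph ℕ} {O : Set ℕ} {σ : State}
    (hn : σ.reg 0 = n) (hK : σ.reg 15 = K) (hv : σ.reg 14 = v) (hvn : v < n)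
    (h : HoldsTree n K G H O σ.arr) (hC : Chosen n v G O σ.arr)
    (hUO : ∀ z ≤ n, σ.arr 34 z ≠ 0 → z ∈ O) (h22 : σ.arr 22 n = v) (h24 : ∀ i ≤ n, σ.arr 24 i = n)
    (h25 : ∀ i ≤ n, σ.arr 25 i = n) (h45 : σ.arr 45 0 = 0) :
    Runs n rankPass σ (100 * σ.arr 0 n + 1200 * n + 78) (fun σ' =>
      Listed n (K + 1) (insert v O) (σ'.arr 23) (σ'.arr 44) ∧
      ElimTree G (addVertex H v {z | z ∈ O ∧ σ'.arr 36 z ≠ 0}) (insert v O) n (σ'.arr 44)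
        (newPar n v σ'.arr) (newDeg v σ'.arr)) := by
  have hnO : n ∉ O := fun hh => lt_irrefl _ (h.listed.lt n hh)
  have hvO := hC.spec.v_not
  refine (Runs.seq (runs_losePass h.listed hK h.par_cases).frame
    (T' := 100 * σ.arr 0 n + 1100 * n + 72) ?_).mono (by omega) fun _ h => h
  rintro σ1 ⟨⟨l1, l2⟩, r1, f1⟩
  have hor := runs_orderPass (n := n) (K := K) (M := σ.arr 41 0) (v := v) (nl := σ.arr 19) (O := O)
    (σ := σ1) ((r1 0 (by decide)).trans hn)
    (by rw [f1 10 (by decide), f1 43 (by decide)]; exact h.listed)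
    ((r1 15 (by decide)).trans hK) ((r1 14 (by decide)).trans hv) hvO
    (by rw [f1 45 (by decide)]; exact h45) (by rw [f1 41 (by decide)]) hC.count_le
    (fun e => by rw [f1 19 (by decide)]) hC.inj
    (fun e he => by
      rw [f1 34 (by decide), f1 36 (by decide)]
      exact ⟨(hC.nl_mem e he).1.1, (hC.nl_mem e he).1.2, (hC.nl_mem e he).2⟩)
    (fun y hy => by
      rw [f1 34 (by decide), f1 36 (by decide)]
      exact hC.L_U y (h.listed.lt y hy).le)
  rw [f1 10 (by decide), f1 34 (by decide), f1 36 (by decide)] at hor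
  refine (Runs.seq hor.frame (T' := 100 * σ.arr 0 n + 700 * n + 12) ?_).mono (by omega) fun _ h => h
  rintro σ2 ⟨o1, r2, f2⟩
  have e2 : ∀ a, a ∉ losePass.wa ++ orderPass.wa → σ2.arr a = σ.arr a := fun a ha =>
    (f2 a fun hh => ha (List.mem_append_right _ hh)).trans
      (f1 a fun hh => ha (List.mem_append_left _ hh))
  have hro := runs_rootPass (n := n) (K := K) (O := O) (σ := σ2)
    (by rw [e2 10 (by decide), e2 43 (by decide)]; exact h.listed)
    ((r2 15 (by decide)).trans ((r1 15 (by decide)).trans hK))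
    ((r2 0 (by decide)).trans ((r1 0 (by decide)).trans hn))
    (by rw [e2 12 (by decide), e2 43 (by decide)]; exact h.par_cases)
  rw [e2 34 (by decide), e2 12 (by decide)] at hro
  refine (Runs.seq hro.frame (T' := 100 * σ.arr 0 n + 600 * n + 6) ?_).mono (by omega) fun _ h => h
  rintro σ3 ⟨⟨t1, t2⟩, r3, f3⟩
  have e3 : ∀ a, a ∉ losePass.wa ++ orderPass.wa ++ rootPass.wa → σ3.arr a = σ.arr a := fun a ha =>
    (f3 a fun hh => ha (List.mem_append_right _ hh)).trans
      (e2 a fun hh => ha (List.mem_append_left _ hh))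
  have hto := runs_topPass (n := n) (G := G) (σ := σ3)
    ((r3 0 (by decide)).trans ((r2 0 (by decide)).trans ((r1 0 (by decide)).trans hn)))
    ⟨by rw [e3 0 (by decide)]; exact h.adj.start, by rw [e3 0 (by decide)]; exact h.adj.mono,
      by rw [e3 0 (by decide), e3 1 (by decide)]; exact h.adj.adj_iff, h.adj.lt⟩
    (by rw [e3 25 (by decide)]; exact h25)
  rw [e3 0 (by decide), e3 34 (by decide)] at hto
  refine hto.frame.imp ?_
  rintro σ4 ⟨q1, -, f4⟩
  have e4 : ∀ a, a ∉ losePass.wa ++ orderPass.wa ++ rootPass.wa ++ topPass.wa →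
      σ4.arr a = σ.arr a := fun a ha =>
    (f4 a fun hh => ha (List.mem_append_right _ hh)).trans
      (e3 a fun hh => ha (List.mem_append_left _ hh))
  have g12 := e4 12 (by decide)
  have g20 := e4 20 (by decide)
  have g31 := e4 31 (by decide)
  have g34 := e4 34 (by decide)
  have g36 := e4 36 (by decide)
  have g39 := e4 39 (by decide)
  have g44 : σ4.arr 44 = σ3.arr 44 := f4 44 (by decide)
  have g24 : σ4.arr 24 = σ3.arr 24 := f4 24 (by decide)
  have g40 : σ1.arr 40 = σ4.arr 40 := by
    rw [f4 40 (by decide), f3 40 (by decide), f2 40 (by decide)]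
  have g22 : σ1.arr 22 = σ4.arr 22 := by
    rw [f4 22 (by decide), f3 22 (by decide), f2 22 (by decide)]
  have g24' : σ2.arr 24 = σ.arr 24 := e2 24 (by decide)
  rw [g40, g22] at l1
  rw [← g24] at t1 q1
  rw [← g44] at q1
  have t2' : ∀ x ≤ n, x ∉ O → σ4.arr 24 x = n := fun x hxn hx => by
    rw [g24, t2 24 x hx, g24', h24 x hxn]
  have l2' : σ4.arr 22 n = v := by rw [← g22, l2 22 n hnO, h22]
  have o1' := o1.congr (A' := σ4.arr) (by rw [f4 23 (by decide), f3 23 (by decide)])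
    (by rw [f4 44 (by decide), f3 44 (by decide)]) (by rw [f4 45 (by decide), f3 45 (by decide)])
  clear o1 f1 f2 f3 f4 r1 r2 r3 e2 e3 e4 hor hro hto g40 g22 g44 g24 l2 t2 g24'
  have hml : ∀ y, y ∈ ((ordList (σ.arr 10) K).filter (fun y => σ.arr 34 y = 0) ++
      (List.range (σ.arr 41 0)).map (σ.arr 19) ++
      (ordList (σ.arr 10) K).filter (fun y => σ.arr 36 y ≠ 0) ++ [v]) ↔ y ∈ insert v O := by
    intro y
    simp only [List.mem_append, List.mem_filter, h.listed.mem_ordList, List.mem_map, List.mem_range,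
      List.mem_singleton, decide_eq_true_eq, Set.mem_insert_iff]
    constructor
    · rintro (((h1 | ⟨i, hi, rfl⟩) | h1) | h1)
      · exact .inr h1.1
      · exact .inr (hC.nl_mem i hi).1.1
      · exact .inr h1.1
      · exact .inl h1
    · rintro (h1 | h1)
      · exact .inr h1
      · by_cases hU : σ.arr 34 y = 0
        · exact .inl (.inl (.inl ⟨h1, hU⟩))
        · by_cases hL : σ.arr 36 y = 0
          · exact .inl (.inl (.inr (hC.exists_nl y h1 hU hL)))
          · exact .inl (.inr ⟨h1, hL⟩)
  have hpw := o1'.pairwise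
  have hlt : ∀ y ∈ insert v O, y < n := by
    rintro y (rfl | hy)
    · exact hvn
    · exact h.listed.lt y hy
  have hli := o1'.listed (n := n) fun y hy => hlt y ((hml y).1 hy)
  -- Both lists are free of repetitions and have the same elements, so the new order is a
  -- permutation of the old one together with `v`.
  have hlen : ((ordList (σ.arr 10) K).filter (fun y => σ.arr 34 y = 0) ++
      (List.range (σ.arr 41 0)).map (σ.arr 19) ++
      (ordList (σ.arr 10) K).filter (fun y => σ.arr 36 y ≠ 0) ++ [v]).length = K + 1 := by
    have hnd : (v :: ordList (σ.arr 10) K).Nodup :=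
      List.nodup_cons.2 ⟨by rwa [h.listed.mem_ordList], h.listed.pairwise.imp fun hab he =>
        (he ▸ hab).ne rfl⟩
    have hperm := (List.perm_ext_iff_of_nodup (hpw.imp fun {a b} hab (he : a = b) =>
      (he ▸ hab).ne rfl) hnd).2 fun y => by
        rw [hml, List.mem_cons, h.listed.mem_ordList, Set.mem_insert_iff]
    rw [hperm.length_eq]
    simp [ordList]
  rw [hlen, show {y | y ∈ ((ordList (σ.arr 10) K).filter (fun y => σ.arr 34 y = 0) ++
      (List.range (σ.arr 41 0)).map (σ.arr 19) ++
      (ordList (σ.arr 10) K).filter (fun y => σ.arr 36 y ≠ 0) ++ [v])} = insert v O from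
      Set.ext hml] at hli
  refine ⟨hli, ?_⟩
  simp only [List.pairwise_append, List.pairwise_map, List.mem_append, List.mem_filter,
    h.listed.mem_ordList, List.mem_map, List.mem_range, List.mem_singleton,
    decide_eq_true_eq] at hpw
  obtain ⟨⟨⟨w1, w2, w3⟩, w4, w5⟩, -, w6⟩ := hpw
  have w1' : ∀ y ∈ O, σ.arr 34 y = 0 → ∀ z ∈ O, σ.arr 34 z = 0 → σ.arr 43 y < σ.arr 43 z →
      σ4.arr 44 y < σ4.arr 44 z := fun y hy hyU z hz hzU hlt =>
    (h.listed.pairwise.filter _).rel_of_lt w1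
      (by simpa [h.listed.mem_ordList] using ⟨hy, hyU⟩)
      (by simpa [h.listed.mem_ordList] using ⟨hz, hzU⟩) hlt
  have w4' : ∀ y ∈ O, σ.arr 36 y ≠ 0 → ∀ z ∈ O, σ.arr 36 z ≠ 0 → σ.arr 43 y < σ.arr 43 z →
      σ4.arr 44 y < σ4.arr 44 z := fun y hy hyL z hz hzL hlt =>
    (h.listed.pairwise.filter _).rel_of_lt w4
      (by simpa [h.listed.mem_ordList] using ⟨hy, hyL⟩)
      (by simpa [h.listed.mem_ordList] using ⟨hz, hzL⟩) hlt
  have w2' : ∀ i < σ.arr 41 0, ∀ j < σ.arr 41 0,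
      (σ4.arr 44 (σ.arr 19 i) < σ4.arr 44 (σ.arr 19 j) ↔ i < j) := by
    have key : ∀ i < σ.arr 41 0, ∀ j < σ.arr 41 0, i < j →
        σ4.arr 44 (σ.arr 19 i) < σ4.arr 44 (σ.arr 19 j) := fun i hi j hj hij =>
      List.Pairwise.rel_of_lt (pos := id) List.pairwise_lt_range w2 (List.mem_range.2 hi)
        (List.mem_range.2 hj) hij
    intro i hi j hj
    refine ⟨fun hlt => ?_, key i hi j hj⟩
    by_contra hij
    rcases eq_or_lt_of_le (not_lt.1 hij) with rfl | hji
    · exact lt_irrefl _ hlt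
    · exact lt_asymm hlt (key j hj i hi hji)
  have hnl : ∀ y, (y ∈ O ∧ σ.arr 34 y ≠ 0) → ¬ ((y ∈ O ∧ σ.arr 34 y ≠ 0) ∧ σ.arr 36 y ≠ 0) →
      ∃ e < σ.arr 41 0, σ.arr 19 e = y := fun y hU hL =>
    hC.exists_nl y hU.1 hU.2 (by_contra fun hh => hL ⟨hU, hh⟩)
  have hLn : ∀ e < σ.arr 41 0, ¬ ((σ.arr 19 e ∈ O ∧ σ.arr 34 (σ.arr 19 e) ≠ 0) ∧
      σ.arr 36 (σ.arr 19 e) ≠ 0) := fun e he hh => hh.2 (hC.nl_mem e he).2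
  have hord : OrderSpec O v (σ.arr 43) (σ.arr 18) (σ4.arr 44) (fun z => z ∈ O ∧ σ.arr 34 z ≠ 0)
      (fun z => (z ∈ O ∧ σ.arr 34 z ≠ 0) ∧ σ.arr 36 z ≠ 0) := by
    constructor
    · intro a ha b hb hab
      rw [← hli.ord_pos a ha, hab, hli.ord_pos b hb]
    · intro y hy
      have := (hml y).2 (.inr hy)
      simp only [List.mem_append, List.mem_filter, h.listed.mem_ordList, List.mem_map,
        List.mem_range, List.mem_singleton, decide_eq_true_eq] at this
      rcases this with hh | rfl
      · exact w6 y hh v rfl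
      · exact absurd hy hvO
    · intro y hy hyU z hz
      have hy0 : σ.arr 34 y = 0 := by_contra fun hh => hyU ⟨hy, hh⟩
      by_cases hL : σ.arr 36 z = 0
      · exact w3 y ⟨hy, hy0⟩ z (hC.exists_nl z hz.1 hz.2 hL)
      · exact w5 y (.inl ⟨hy, hy0⟩) z ⟨hz.1, hL⟩
    · exact fun y hy hyU z hz hzU => w1' y hy (by_contra fun hh => hyU ⟨hy, hh⟩) z hz
        (by_contra fun hh => hzU ⟨hz, hh⟩)
    · exact fun y hU hL z hz => w5 y (.inr (hnl y hU hL)) z ⟨hz.1.1, hz.2⟩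
    · exact fun y z hy hz => w4' y hy.1.1 hy.2 z hz.1.1 hz.2
    · intro y hyU hyL z hzU hzL hpos
      obtain ⟨i, hi, rfl⟩ := hnl y hyU hyL
      obtain ⟨j, hj, rfl⟩ := hnl z hzU hzL
      rw [w2' i hi j hj]
      by_contra hij
      rcases eq_or_lt_of_le (not_lt.1 hij) with rfl | hlt
      · exact lt_irrefl _ hpos
      · have := hC.anti j i hlt hi
        omega
  have hLp : ∀ t ∈ O, ((σ.arr 12 t ∈ O ∧ σ.arr 34 (σ.arr 12 t) ≠ 0) ∧ σ.arr 36 (σ.arr 12 t) ≠ 0) ↔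
      σ.arr 36 (σ.arr 12 t) ≠ 0 := fun t ht => by
    refine ⟨fun hh => hh.2, fun hh => ?_⟩
    have hle : σ.arr 12 t ≤ n := by
      rcases h.par_cases t ht with h1 | h1
      · exact h1.le
      · exact (h.listed.lt _ h1.1).le
    have := hC.L_U _ hle hh
    exact ⟨⟨hUO _ hle this, this⟩, hh⟩
  have hUp : ∀ t ∈ O, (σ.arr 12 t ∈ O ∧ σ.arr 34 (σ.arr 12 t) ≠ 0) ↔
      σ.arr 34 (σ.arr 12 t) ≠ 0 := fun t ht => by
    refine ⟨fun hh => hh.2, fun hh => ⟨hUO _ ?_ hh, hh⟩⟩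
    rcases h.par_cases t ht with h1 | h1
    · exact h1.le
    · exact (h.listed.lt _ h1.1).le
  have hvne : ∀ y ∈ O, y ≠ v := fun y hy he => hvO (he ▸ hy)
  have hupd : UpdateSpec G O n v (σ.arr 12) (σ.arr 31) (σ.arr 35) (σ.arr 15) (σ.arr 18) (σ.arr 37)
      (σ4.arr 44) (σ4.arr 24) (σ4.arr 40) (σ4.arr 22) (newPar n v σ4.arr) (newDeg v σ4.arr)
      (fun z => z ∈ O ∧ σ.arr 34 z ≠ 0) (fun z => (z ∈ O ∧ σ.arr 34 z ≠ 0) ∧ σ.arr 36 z ≠ 0) := by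
    have hnp : ∀ y ∈ O, newPar n v σ4.arr y = if σ.arr 34 y = 0 then if σ.arr 34 (σ.arr 12 y) = 0
        then σ.arr 12 y else σ4.arr 25 y else if σ.arr 36 y = 0 then σ.arr 20 y
        else σ4.arr 22 y := fun y hy => by
      rw [newPar, if_neg (hvne y hy), g34, g12, g36, g20]
    have hnd : ∀ y ∈ O, newDeg v σ4.arr y = if σ.arr 34 y = 0 then σ.arr 31 y
        else if σ.arr 36 y = 0 then σ.arr 39 y else σ.arr 31 y + 1 - σ4.arr 40 y := fun y hy => by
      rw [newDeg, if_neg (hvne y hy), g34, g31, g36, g39]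
    constructor
    · intro y hy hyU hpU
      rw [hUp y hy, not_not] at hpU
      rw [hnp y hy, if_pos (by_contra fun hh => hyU ⟨hy, hh⟩), if_pos hpU]
    · intro y hy hyU
      rw [hnd y hy, if_pos (by_contra fun hh => hyU ⟨hy, hh⟩)]
    · intro y hy hyU
      rw [t1 y hy, if_pos (by_contra fun hh => hyU ⟨hy, hh⟩)]
      by_cases hp : σ.arr 34 (σ.arr 12 y) = 0
      · rw [if_pos hp, if_neg (by rw [hUp y hy]; exact not_not.2 hp)]
      · rw [if_neg hp, if_pos ((hUp y hy).2 hp)]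
    -- Array `24` was initialized with `n` everywhere and the pass writes only at inserted vertices;
    -- this gives `rt none = none`.
    · exact t2' n le_rfl hnO
    · intro y hy hyU hpU
      rw [hnp y hy, if_pos (by_contra fun hh => hyU ⟨hy, hh⟩), if_neg hpU.2]
      rcases (q1 y (h.listed.lt y hy)).1 with h1 | ⟨z, hz, h1, h2, h3⟩
      · exact .inl h1
      · right
        have hzO : z ∈ O := by
          by_contra hzO
          rw [t2' z hz.le hzO] at h3
          exact hnO (h3 ▸ hy)
        refine ⟨z, hzO, fun hzU => ?_, h3, h1, hUO _ (h.adj.lt _ _ h1).le h2, h2⟩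
        rw [t1 z hzO, if_neg hzU.2] at h3
        exact hnO (h3 ▸ hy)
    · intro y hy hyU hpU x hx hxU hxy z hz hxz
      rw [hnp y hy, if_pos (by_contra fun hh => hyU ⟨hy, hh⟩), if_neg hpU.2]
      exact (q1 y (h.listed.lt y hy)).2 x (h.listed.lt x hx) z hxz hz.2 hxy
    · intro t ht
      rw [(l1 t ht.1 ht.2).1]
      simp only [hLp t ht.1, ite_not]
    · intro t ht
      rw [(l1 t ht.1 ht.2).2]
      simp only [hLp t ht.1, ite_not]
      by_cases hp : σ.arr 12 t = n
      · have : σ.arr 36 n = 0 := by_contra fun hh => hnO (hUO n le_rfl (hC.L_U n le_rfl hh))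
        rw [if_pos hp, hp, if_pos this, l2']
      · rw [if_neg hp]
    · intro y hy
      rw [hnp y hy.1.1, if_neg hy.1.2, if_neg hy.2]
    · intro y hy
      rw [hnd y hy.1.1, if_neg hy.1.2, if_neg hy.2]
    · intro y hyU hyL
      obtain ⟨e, he, rfl⟩ := hnl y hyU hyL
      rw [hnp _ hyU.1, if_neg hyU.2, if_pos (hC.nl_mem e he).2]
      rcases hC.par e he with ⟨x, ⟨h1, h2, h3, h4, h5⟩, h6⟩ | ⟨h1, h2⟩
      · left
        rw [h6]
        refine ⟨(hC.nl_mem x h2).1, hLn x h2, h3, h4, (w2' e he x h2).2 h1, ?_⟩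
        intro z hzU hzL hz1 hz2 hz3
        obtain ⟨i, hi, rfl⟩ := hnl z hzU hzL
        rw [w2' e he i hi] at hz3
        have := h5 i hz3 hi hz1 hz2
        rw [← not_lt, w2' i hi x h2]
        omega
      · right
        refine ⟨h2, ?_⟩
        intro z hzU hzL hz1 hz2 hz3
        obtain ⟨i, hi, rfl⟩ := hnl z hzU hzL
        rw [w2' e he i hi] at hz3
        have := h1 i hz3 hi hz1
        omega
    · intro y hyU hyL
      obtain ⟨e, he, rfl⟩ := hnl y hyU hyL
      rw [hnd _ hyU.1, if_neg hyU.2, if_pos (hC.nl_mem e he).2, hC.deg e he]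
      congr 1
      refine countEq_eq_ncard (nl := σ.arr 19)
        (fun i hi j hj => hC.inj i (by omega) j (by omega)) fun z => ⟨?_, ?_⟩
      · rintro ⟨hzU, hzL, h1, h2⟩
        obtain ⟨i, hi, rfl⟩ := hnl z hzU hzL
        rw [← not_lt, w2' e he i hi] at h2
        exact ⟨i, by omega, rfl, h1⟩
      · rintro ⟨i, hi, rfl, h1⟩
        refine ⟨(hC.nl_mem i (by omega)).1, hLn i (by omega), h1, ?_⟩
        rw [← not_lt, w2' e he i (by omega)]
        omega
    · rw [newPar, if_pos rfl]
    · rw [newDeg, if_pos rfl]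
  have hfin := hC.spec.elimTree_addVertex h.tree hord hupd hvn.ne
  have hset : {z | (z ∈ O ∧ σ.arr 34 z ≠ 0) ∧ σ.arr 36 z ≠ 0} = {z | z ∈ O ∧ σ4.arr 36 z ≠ 0} := by
    rw [g36]
    ext z
    exact ⟨fun hz => ⟨hz.1.1, hz.2⟩, fun hz => ⟨⟨hz.1, hC.L_U z (h.listed.lt z hz.1).le hz.2⟩, hz.2⟩⟩
  rw [hset] at hfin
  exact hfin

/-! ### The edge list and the running answer -/

/-- Write down an edge from the new vertex. -/
def emit : Prog :=
  .seq (.put 3 (.get 46 (.lit 0)) (.var 14)) <|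
  .seq (.put 4 (.get 46 (.lit 0)) (.var 11)) (.put 46 (.lit 0) (.add (.get 46 (.lit 0)) (.lit 1)))

/-- The memory holds a list of the elements of `E`. -/
def HoldsEdges (A : ℕ → ℕ → ℕ) (E : Set (Sym2 ℕ)) : Prop :=
  Set.BijOn (fun j => s(A 3 j, A 4 j)) (Set.Iio (A 46 0)) E

theorem HoldsEdges.emit_step {σ : State} {E E' : Set (Sym2 ℕ)} {v y : ℕ} (h : HoldsEdges σ.arr E)
    (hv : σ.reg 14 = v) (hy : σ.reg 11 = y) (hE : s(v, y) ∉ E)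
    (hE' : ∀ e, e ∈ E' ↔ e = s(v, y) ∨ e ∈ E) : HoldsEdges (emit.step σ).arr E' := by
  have h3 : ∀ i, (emit.step σ).arr 3 i = if i = σ.arr 46 0 then v else σ.arr 3 i := by
    intro i
    simp [emit, step_seq, step_put, eval_get, eval_lit, eval_var, hv]
  have h4 : ∀ i, (emit.step σ).arr 4 i = if i = σ.arr 46 0 then y else σ.arr 4 i := by
    intro i
    simp [emit, step_seq, step_put, eval_get, eval_lit, eval_var, hy]
  have h46 : (emit.step σ).arr 46 0 = σ.arr 46 0 + 1 := by
    simp [emit, step_seq, step_put, eval_get, eval_lit, eval_var, eval_add]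
  have hf : ∀ i, i < σ.arr 46 0 →
      s((emit.step σ).arr 3 i, (emit.step σ).arr 4 i) = s(σ.arr 3 i, σ.arr 4 i) := by
    intro i hi
    rw [h3, h4, if_neg hi.ne, if_neg hi.ne]
  have hf' : s((emit.step σ).arr 3 (σ.arr 46 0), (emit.step σ).arr 4 (σ.arr 46 0)) = s(v, y) := by
    rw [h3, h4, if_pos rfl, if_pos rfl]
  rw [HoldsEdges, h46]
  obtain ⟨g1, g2, g3⟩ := h
  refine ⟨fun i hi => ?_, fun i hi j hj hij => ?_, fun e he => ?_⟩
  · rcases Nat.lt_succ_iff_lt_or_eq.1 hi with hi | rfl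
    · simp only [hE', hf i hi]
      exact .inr (g1 hi)
    · simp only [hE', hf']
      exact .inl trivial
  · rcases Nat.lt_succ_iff_lt_or_eq.1 hi with hi | rfl <;>
      rcases Nat.lt_succ_iff_lt_or_eq.1 hj with hj | rfl
    · simp only [hf i hi, hf j hj] at hij
      exact g2 hi hj hij
    · simp only [hf i hi, hf'] at hij
      exact absurd (hij ▸ g1 hi) hE
    · simp only [hf j hj, hf'] at hij
      exact absurd (hij ▸ g1 hj) hE
    · rfl
  · rcases (hE' e).1 he with rfl | he
    · exact ⟨_, Nat.lt_succ_self _, hf'⟩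
    · obtain ⟨i, hi, rfl⟩ := g3 he
      exact ⟨i, Nat.lt_succ_of_lt hi, hf i hi⟩

/-- Write down the edges from the new vertex, and check whether the marked vertices form a clique. -/
def emitPass : Prog :=
  forAsc (.ite (.get 36 (.var 11)) emit (.ite (.get 32 (.var 14)) (.ite (.get 32 (.var 11))
    (.put 47 (.lit 0) (.lit 0)) .skip) .skip))

/-- The answer says whether `P` holds. -/
def Answers (A : ℕ → ℕ → ℕ) (P : Prop) : Prop := A 47 0 ≤ 1 ∧ (A 47 0 ≠ 0 ↔ P)

/-- Whether the marked vertices form a clique is maintained incrementally: an insertion adds edges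
only at `v`, so the answer can only be spoiled by a marked vertex outside of `L` when `v` is marked.
-/
theorem runs_emitPass {n K v : ℕ} {O : Set ℕ} {E : Set (Sym2 ℕ)} {P : Prop} {σ : State}
    (hl : Listed n K O (σ.arr 10) (σ.arr 43)) (hK : σ.reg 15 = K) (hv : σ.reg 14 = v)
    (hE : HoldsEdges σ.arr E) (hvE : ∀ y, s(v, y) ∉ E) (hP : Answers σ.arr P) (hvO : v ∉ O) :
    Runs n emitPass σ (100 * n + 6) (fun σ' =>
      HoldsEdges σ'.arr (E ∪ {e | ∃ y ∈ O, σ.arr 36 y ≠ 0 ∧ e = s(v, y)}) ∧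
      Answers σ'.arr (P ∧ ∀ y ∈ O, σ.arr 32 v ≠ 0 → σ.arr 32 y ≠ 0 → σ.arr 36 y ≠ 0)) := by
  refine (Runs.forAsc (n := n) (σ := σ) 40 (fun j A =>
    HoldsEdges A (E ∪ {e | ∃ y ∈ O, σ.arr 43 y < j ∧ σ.arr 36 y ≠ 0 ∧ e = s(v, y)}) ∧
    Answers A (P ∧ ∀ y ∈ O, σ.arr 43 y < j → σ.arr 32 v ≠ 0 → σ.arr 32 y ≠ 0 → σ.arr 36 y ≠ 0))
    hl hK rfl (by decide) (by decide) (by decide) (by decide) ⟨?_, ?_⟩ ?_).mono (by omega) ?_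
  · simpa using hE
  · simpa using hP
  · rintro y σ' hy ⟨hI, hA⟩ h11 hr ha -
    have e32 : σ'.arr 32 = σ.arr 32 := ha 32 (by decide)
    have e36 : σ'.arr 36 = σ.arr 36 := ha 36 (by decide)
    have h14 : σ'.reg 14 = v := (hr 14 (by decide) (by decide) (by decide)).trans hv
    clear hr ha
    have hlt : ∀ z ∈ O, σ.arr 43 z < σ.arr 43 y + 1 ↔ z = y ∨ σ.arr 43 z < σ.arr 43 y := by
      intro z hz
      constructor
      · intro h
        by_cases h' : σ.arr 43 z = σ.arr 43 y
        · exact .inl ((hl.eq_ord hz h').trans (hl.ord_pos y hy))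
        · exact .inr (by omega)
      · rintro (rfl | h) <;> omega
    have hyv : y ≠ v := fun he => hvO (he ▸ hy)
    have hsame : (σ.arr 36 y = 0 → ∀ A, HoldsEdges A
        (E ∪ {e | ∃ z ∈ O, σ.arr 43 z < σ.arr 43 y ∧ σ.arr 36 z ≠ 0 ∧ e = s(v, z)}) →
        HoldsEdges A
        (E ∪ {e | ∃ z ∈ O, σ.arr 43 z < σ.arr 43 y + 1 ∧ σ.arr 36 z ≠ 0 ∧ e = s(v, z)})) := by
      intro h0 A hA
      have : {e | ∃ z ∈ O, σ.arr 43 z < σ.arr 43 y + 1 ∧ σ.arr 36 z ≠ 0 ∧ e = s(v, z)} =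
          {e | ∃ z ∈ O, σ.arr 43 z < σ.arr 43 y ∧ σ.arr 36 z ≠ 0 ∧ e = s(v, z)} := by
        ext e
        refine exists_congr fun z => and_congr_right fun hz => ?_
        rw [hlt z hz]
        refine and_congr_left fun h1 => or_iff_right ?_
        rintro rfl
        exact h1.1 h0
      rwa [this]
    have hans : (∀ z ∈ O, σ.arr 43 z < σ.arr 43 y + 1 → σ.arr 32 v ≠ 0 → σ.arr 32 z ≠ 0 →
        σ.arr 36 z ≠ 0) ↔ (σ.arr 32 v ≠ 0 → σ.arr 32 y ≠ 0 → σ.arr 36 y ≠ 0) ∧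
        ∀ z ∈ O, σ.arr 43 z < σ.arr 43 y → σ.arr 32 v ≠ 0 → σ.arr 32 z ≠ 0 → σ.arr 36 z ≠ 0 := by
      constructor
      · exact fun h => ⟨h y hy (by omega), fun z hz hlt => h z hz (by omega)⟩
      · rintro ⟨h1, h2⟩ z hz hzy
        rcases (hlt z hz).1 hzy with rfl | hzy
        · exact h1
        · exact h2 z hz hzy
    rw [hans, step_ite, step_ite, step_ite]
    simp only [eval_get, eval_var, h11, h14, e32, e36, step_skip, step_put, eval_lit]
    by_cases h36 : σ.arr 36 y = 0
    · rw [if_pos h36]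
      split_ifs with h1 h2
      · exact ⟨hsame h36 _ hI, hA.1, hA.2.trans (and_congr_right fun _ =>
          (and_iff_right fun h => absurd h1 h).symm)⟩
      · exact ⟨hsame h36 _ hI, hA.1, hA.2.trans (and_congr_right fun _ =>
          (and_iff_right fun _ h => absurd h2 h).symm)⟩
      · refine ⟨hsame h36 _ (by rw [HoldsEdges, setArr_ne (by decide), setArr_ne (by decide),
          setArr_ne (by decide)]; exact hI), ?_, ?_⟩
        · simp
        · simp only [setArr_same, if_true, ne_eq, not_true_eq_false, false_iff]
          exact fun h => h.2.1 h1 h2 h36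
    · rw [if_neg h36]
      refine ⟨hI.emit_step h14 h11 ?_ ?_, ?_⟩
      · rintro (h | ⟨z, hz, h1, -, h2⟩)
        · exact hvE y h
        · rw [Sym2.eq_iff] at h2
          rcases h2 with ⟨-, rfl⟩ | ⟨-, h2⟩
          · exact lt_irrefl _ h1
          · exact hyv h2
      · intro e
        constructor
        · rintro (h | ⟨z, hz, h1, h2, h3⟩)
          · exact .inr (.inl h)
          · rcases (hlt z hz).1 h1 with rfl | h1
            · exact .inl h3
            · exact .inr (.inr ⟨z, hz, h1, h2, h3⟩)
        · rintro (rfl | h | ⟨z, hz, h1, h2, h3⟩)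
          · exact .inr ⟨y, hy, by omega, h36, rfl⟩
          · exact .inl h
          · exact .inr ⟨z, hz, by omega, h2, h3⟩
      · have e47 : (emit.step σ').arr 47 = σ'.arr 47 := emit.step_frame.2 47 (by decide)
        rw [Answers, e47]
        exact ⟨hA.1, hA.2.trans (and_congr_right fun _ =>
          (and_iff_right fun _ _ => h36).symm)⟩
  · rintro σ' ⟨h1, h2⟩
    have hs : {e | ∃ y ∈ O, σ.arr 43 y < K ∧ σ.arr 36 y ≠ 0 ∧ e = s(v, y)} =
        {e | ∃ y ∈ O, σ.arr 36 y ≠ 0 ∧ e = s(v, y)} := by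
      ext e
      exact exists_congr fun y => and_congr_right fun hy => and_iff_right (hl.pos_lt y hy)
    rw [hs] at h1
    refine ⟨h1, h2.1, h2.2.trans (and_congr_right fun _ => ?_)⟩
    exact forall_congr' fun y => forall_congr' fun hy => imp_iff_right (hl.pos_lt y hy)

/-- Update the entries at one index. -/
def commitBody : Prog :=
  .seq (.ite (.eq (.var 10) (.var 14))
    (.seq (.put 12 (.var 10) (.var 0)) (.put 31 (.var 10) (.lit 0)))
    (.ite (.get 34 (.var 10))
      (.ite (.get 36 (.var 10))
        (.seq (.put 12 (.var 10) (.get 22 (.var 10))) (.put 31 (.var 10)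
          (.sub (.add (.get 31 (.var 10)) (.lit 1)) (.get 40 (.var 10)))))
        (.seq (.put 12 (.var 10) (.get 20 (.var 10))) (.put 31 (.var 10) (.get 39 (.var 10)))))
      (.ite (.get 34 (.get 12 (.var 10))) (.put 12 (.var 10) (.get 25 (.var 10))) .skip))) <|
  .seq (.put 10 (.var 10) (.get 23 (.var 10))) (.put 43 (.var 10) (.get 44 (.var 10)))

/-- Update the elimination tree. -/
def commitPass : Prog := .seq (.put 30 (.var 14) (.lit 1)) (forLt 10 0 commitBody)

/-- The update is in place. It is correct because the entries at an index depend on the old parent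
and number at the same index only, and otherwise on arrays that the loop does not write. -/
theorem commitBody_step {n v j : ℕ} {σ : State} {A : ℕ → ℕ → ℕ} (h0 : σ.reg 0 = n)
    (hv : σ.reg 14 = v) (hj : σ.reg 10 = j) (hA : ∀ a, a ∉ commitBody.wa → σ.arr a = A a)
    (h12 : σ.arr 12 j = A 12 j) (h31 : σ.arr 31 j = A 31 j) :
    (commitBody.step σ).arr 12 j = newPar n v A j ∧ (commitBody.step σ).arr 31 j = newDeg v A j ∧
    (commitBody.step σ).arr 10 j = A 23 j ∧ (commitBody.step σ).arr 43 j = A 44 j ∧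
    ∀ a x, x ≠ j → (commitBody.step σ).arr a x = σ.arr a x := by
  have e20 := hA 20 (by decide)
  have e22 := hA 22 (by decide)
  have e23 := hA 23 (by decide)
  have e25 := hA 25 (by decide)
  have e34 := hA 34 (by decide)
  have e36 := hA 36 (by decide)
  have e39 := hA 39 (by decide)
  have e40 := hA 40 (by decide)
  have e44 := hA 44 (by decide)
  simp only [commitBody, step_seq, step_put, step_ite, step_skip, eval_eq_zero, eval_get, eval_var,
    eval_lit, eval_sub, eval_add, h0, hv, hj, h12, e34, e36, newPar, newDeg]
  refine ⟨?_, ?_, ?_, ?_, fun a x hx => ?_⟩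
  rotate_right
  · split_ifs <;> simp only [setArr_of_ne, setArr_reg, hj, hx, ne_eq, not_false_eq_true]
  all_goals split_ifs <;> simp [*]

theorem runs_commitLoop {n v : ℕ} {σ : State} (hn : σ.reg 0 = n) (hv : σ.reg 14 = v) :
    Runs n (forLt 10 0 commitBody) σ (88 * n + 6) (fun σ' => ∀ e < n,
      σ'.arr 12 e = newPar n v σ.arr e ∧ σ'.arr 31 e = newDeg v σ.arr e ∧
      σ'.arr 10 e = σ.arr 23 e ∧ σ'.arr 43 e = σ.arr 44 e) := by
  have h := Runs.forLt_block (n := n) (σ := σ) (rJ := 10) (rB := 0)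
    (body := commitBody) 80 (fun j A => ∀ e < n, (e < j → A 12 e = newPar n v σ.arr e ∧
      A 31 e = newDeg v σ.arr e ∧ A 10 e = σ.arr 23 e ∧ A 43 e = σ.arr 44 e) ∧
      (j ≤ e → A 12 e = σ.arr 12 e ∧ A 31 e = σ.arr 31 e))
    rfl (by decide) rfl (by decide) rfl (by decide) (by decide) (by decide)
    (fun e he => ⟨fun h => absurd h (Nat.not_lt_zero e), fun _ => ⟨rfl, rfl⟩⟩) (by
      intro j σ' hj hI hJ hr ha _
      rw [hn] at hj
      obtain ⟨h1, h2⟩ := (hI j hj).2 le_rfl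
      obtain ⟨s1, s2, s3, s4, s5⟩ := commitBody_step
        ((hr 0 (by decide) (by decide)).trans hn) ((hr 14 (by decide) (by decide)).trans hv) hJ ha
        h1 h2
      intro e he
      by_cases hej : e = j
      · subst hej
        exact ⟨fun _ => ⟨s1, s2, s3, s4⟩, fun h => by omega⟩
      · rw [s5 12 e hej, s5 31 e hej, s5 10 e hej, s5 43 e hej]
        exact ⟨fun h => (hI e he).1 (by omega), fun h => (hI e he).2 (by omega)⟩)
  rw [hn] at h
  exact h.imp fun σ' h e he => (h.2 e he).1 he

theorem runs_commitPass {n v : ℕ} {σ : State} (hn : σ.reg 0 = n) (hv : σ.reg 14 = v) :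
    Runs n commitPass σ (100 * n + 20) (fun σ' => (∀ e < n, σ'.arr 12 e = newPar n v σ.arr e ∧
      σ'.arr 31 e = newDeg v σ.arr e ∧ σ'.arr 10 e = σ.arr 23 e ∧ σ'.arr 43 e = σ.arr 44 e) ∧
      ∀ e, σ'.arr 30 e = if e = v then 1 else σ.arr 30 e) := by
  have hput : (Prog.put 30 (.var 14) (.lit 1)).step σ = σ.setArr 30 v 1 := by
    rw [step_put, eval_var, eval_lit, hv]
  have hb := Runs.block (n := n) (σ := σ) (p := .put 30 (.var 14) (.lit 1)) rfl
  rw [hput] at hb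
  refine (Runs.seq (T' := 88 * n + 6) hb fun τ hτ => ?_).mono
    (by simp only [Prog.tb, Expr.cost]; omega) fun _ h => h
  have hl := (runs_commitLoop (n := n) (v := v) (σ := τ) (by rw [hτ]; exact hn)
    (by rw [hτ]; exact hv)).frame
  refine hl.imp ?_
  rintro σ' ⟨h1, -, h2⟩
  rw [hτ] at h1 h2
  refine ⟨fun e he => ?_, fun e => by rw [h2 30 (by decide), setArr_same]⟩
  simpa [newPar, newDeg] using h1 e he

theorem ElimTree.congr {G H : SimpleGraph ℕ} {O : Set ℕ} {none : ℕ} {pos par d pos' par' d' : ℕ → ℕ}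
    (h : ElimTree G H O none pos par d) (hpos : ∀ y ∈ O, pos' y = pos y)
    (hpar : ∀ y ∈ O, par' y = par y) (hd : ∀ y ∈ O, d' y = d y) :
    ElimTree G H O none pos' par' d' := by
  have hl : ∀ y, later H pos' y = later H pos y := by
    intro y
    ext z
    refine and_congr_right fun hyz => ?_
    rw [hpos y (h.supp' hyz).1, hpos z (h.supp' hyz).2]
  refine ⟨h.fin, h.supp, fun a ha b hb hab => h.inj ha hb ?_, ?_, ?_, ?_, ?_, h.none_not, ?_, h.min⟩
  · rwa [hpos a ha, hpos b hb] at hab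
  · intro y a b
    rw [hl]
    exact h.clique y a b
  · intro y hy
    rw [hl, hpar y hy]
    exact h.par_mem y hy
  · intro y hy
    rw [hl, hpar y hy]
    exact h.par_none y hy
  · intro y hy z
    rw [hl]
    intro hz
    have hz' := h.later_mem hz
    have hp : par y ∈ O := (h.later_mem (h.par_mem y hy fun hp => by
      rw [h.par_none y hy hp] at hz
      exact hz)).2
    rw [hpar y hy, hpos _ hp, hpos z hz'.2]
    exact h.par_le y hy z hz
  · intro y hy
    rw [hl, hd y hy]
    exact h.d_eq y hy

theorem Listed.congr {n K : ℕ} {O : Set ℕ} {ord pos ord' pos' : ℕ → ℕ}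
    (h : Listed n K O ord pos) (ho : ∀ j < n, ord' j = ord j) (hp : ∀ j < n, pos' j = pos j) :
    Listed n K O ord' pos' := by
  have hK := h.le
  refine ⟨fun j hj => ?_, fun j hj => ?_, fun y hy => ?_, fun y hy => ?_, h.lt⟩
  · rw [ho j (by omega)]
    exact h.mem j hj
  · rw [ho j (by omega), hp _ (h.lt _ (h.mem j hj))]
    exact h.pos_ord j hj
  · rw [hp y (h.lt y hy)]
    exact h.pos_lt y hy
  · rw [hp y (h.lt y hy), ho _ ((h.pos_lt y hy).trans_le hK)]
    exact h.ord_pos y hy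

theorem HoldsTree.congr {n K : ℕ} {G H : SimpleGraph ℕ} {O : Set ℕ} {A A' : ℕ → ℕ → ℕ}
    (h : HoldsTree n K G H O A) (hA : ∀ a ∈ [0, 1, 10, 12, 30, 31, 43], A' a = A a) :
    HoldsTree n K G H O A' := by
  refine ⟨?_, ⟨?_, ?_, ?_, h.adj.lt⟩, ?_, ?_⟩
  · rw [hA 10 (by decide), hA 43 (by decide)]
    exact h.listed
  · rw [hA 0 (by decide)]
    exact h.adj.start
  · rw [hA 0 (by decide)]
    exact h.adj.mono
  · rw [hA 0 (by decide), hA 1 (by decide)]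
    exact h.adj.adj_iff
  · rw [hA 30 (by decide)]
    exact h.ins
  · rw [hA 43 (by decide), hA 12 (by decide), hA 31 (by decide)]
    exact h.tree

/-- The marked vertices in `O` are pairwise adjacent. -/
def MarkedClique (H : SimpleGraph ℕ) (X O : Set ℕ) : Prop :=
  ∀ a ∈ O, ∀ b ∈ O, a ∈ X → b ∈ X → a ≠ b → H.Adj a b

/-- The memory holds the triangulation `H` with its elimination tree and the list of its edges, and
the answer to the question whether the elements of `X` in `O` are pairwise adjacent. -/
structure Built (n K : ℕ) (G H : SimpleGraph ℕ) (X O : Set ℕ) (A : ℕ → ℕ → ℕ) : Prop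
    extends HoldsTree n K G H O A where
  edges : HoldsEdges A H.edgeSet
  marked : ∀ y < n, A 32 y ≠ 0 ↔ y ∈ X
  answers : Answers A (MarkedClique H X O)

/-- Add the vertex in the register `14` to the triangulation. -/
def insertPass : Prog :=
  .seq scanPass <| .seq choosePass <| .seq rankPass <| .seq emitPass commitPass

theorem edgeSet_addVertex {H : SimpleGraph ℕ} {v : ℕ} {O : Set ℕ} {P : ℕ → Prop} (hv : v ∉ O) :
    (addVertex H v {z | z ∈ O ∧ P z}).edgeSet =
      H.edgeSet ∪ {e | ∃ y ∈ O, P y ∧ e = s(v, y)} := by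
  ext e
  induction e with
  | _ a b =>
    simp only [SimpleGraph.mem_edgeSet, addVertex, Set.mem_union, Set.mem_ofPred_eq]
    refine or_congr_right ⟨?_, ?_⟩
    · rintro (⟨rfl, hb, -⟩ | ⟨rfl, ha, -⟩)
      · exact ⟨b, hb.1, hb.2, rfl⟩
      · exact ⟨a, ha.1, ha.2, Sym2.eq_swap⟩
    · rintro ⟨y, hy, hP, he⟩
      have hyv : y ≠ v := fun h => hv (h ▸ hy)
      rcases Sym2.eq_iff.1 he with ⟨rfl, rfl⟩ | ⟨rfl, rfl⟩
      · exact .inl ⟨rfl, ⟨hy, hP⟩, hyv⟩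
      · exact .inr ⟨rfl, ⟨hy, hP⟩, hyv⟩

theorem markedClique_addVertex {H : SimpleGraph ℕ} {v : ℕ} {O X : Set ℕ} {P : ℕ → Prop}
    (hH : ∀ x y, H.Adj x y → x ∈ O) (hv : v ∉ O) :
    MarkedClique (addVertex H v {z | z ∈ O ∧ P z}) X (insert v O) ↔
      MarkedClique H X O ∧ ∀ y ∈ O, v ∈ X → y ∈ X → P y := by
  have hne : ∀ y ∈ O, y ≠ v := fun y hy h => hv (h ▸ hy)
  constructor
  · refine fun h => ⟨fun a ha b hb haX hbX hab => ?_, fun y hy hvX hyX => ?_⟩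
    · rcases h a (.inr ha) b (.inr hb) haX hbX hab with h | h | h
      · exact h
      · exact absurd h.1 (hne a ha)
      · exact absurd h.1 (hne b hb)
    · rcases h v (.inl rfl) y (.inr hy) hvX hyX (hne y hy).symm with h | h | h
      · exact absurd (hH _ _ h) hv
      · exact h.2.1.2
      · exact absurd h.1 (hne y hy)
  · rintro ⟨h1, h2⟩ a (rfl | ha) b (rfl | hb) haX hbX hab
    · exact absurd rfl hab
    · exact .inr (.inl ⟨rfl, ⟨hb, h2 b hb haX hbX⟩, hab.symm⟩)
    · exact .inr (.inr ⟨rfl, ⟨ha, h2 a ha hbX haX⟩, hab⟩)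
    · exact .inl (h1 a ha b hb haX hbX hab)

/-- Each pass is linear in the number of vertices and adjacency entries, so a whole insertion is;
`H` is never read, and the written edges are those at `v`. The inequality `K < n` is recorded for
incrementing the counter as an index. -/
theorem runs_insertPass {n K v : ℕ} {G H : SimpleGraph ℕ} {X O : Set ℕ} {σ : State}
    (hn : σ.reg 0 = n) (hK : σ.reg 15 = K) (hv : σ.reg 14 = v) (hvn : v < n) (hvO : v ∉ O)
    (h : Built n K G H X O σ.arr) :
    Runs n insertPass σ (300 * σ.arr 0 n + 3000 * n + 300) (fun σ' => K < n ∧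
      ∃ L, Built n (K + 1) G (addVertex H v L) X (insert v O) σ'.arr) := by
  refine (Runs.seq (runs_scanPass hn hK hv hvn h.toHoldsTree).frame
    (T' := 230 * σ.arr 0 n + 2700 * n + 122) ?_).mono (by omega) fun _ h => h
  rintro σ1 ⟨hS, r1, f1⟩
  have h1 : HoldsTree n K G H O σ1.arr := h.congr fun a ha => f1 a (by
    revert a; decide)
  have e0 : σ1.arr 0 = σ.arr 0 := f1 0 (by decide)
  have hch := runs_choosePass (σ := σ1) ((r1 0 (by decide)).trans hn)
    ((r1 15 (by decide)).trans hK) hvO h1 hS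
  rw [e0] at hch
  refine (Runs.seq hch.frame (T' := 130 * σ.arr 0 n + 1600 * n + 104) ?_).mono (by omega)
    fun _ h => h
  rintro σ2 ⟨hC, r2, f2⟩
  have h2 : HoldsTree n K G H O σ2.arr := h1.congr fun a ha => f2 a (by revert a; decide)
  have q0 : σ2.reg 0 = n := (r2 0 (by decide)).trans ((r1 0 (by decide)).trans hn)
  have q14 : σ2.reg 14 = v := (r2 14 (by decide)).trans ((r1 14 (by decide)).trans hv)
  have q15 : σ2.reg 15 = K := (r2 15 (by decide)).trans ((r1 15 (by decide)).trans hK)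
  have hrk := runs_rankPass (σ := σ2) q0 q15 q14 hvn h2 hC
    (by rw [f2 34 (by decide)]; exact hS.U_mem h1)
    (by rw [f2 22 (by decide)]; exact hS.la)
    (by rw [f2 24 (by decide)]; exact hS.rt)
    (by rw [f2 25 (by decide)]; exact hS.par)
    (by rw [f2 45 (by decide)]; exact hS.next)
  rw [f2 0 (by decide), e0] at hrk
  refine (Runs.seq hrk.frame (T' := 30 * σ.arr 0 n + 400 * n + 26) ?_).mono (by omega)
    fun _ h => h
  rintro σ3 ⟨⟨hL, hT⟩, r3, f3⟩
  have h3 : HoldsTree n K G H O σ3.arr := h2.congr fun a ha => f3 a (by revert a; decide)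
  have e3 : ∀ a ∈ [3, 4, 46, 47, 32], σ3.arr a = σ.arr a := fun a ha =>
    (f3 a (by revert a; decide)).trans ((f2 a (by revert a; decide)).trans
      (f1 a (by revert a; decide)))
  have hem := runs_emitPass (n := n) (σ := σ3) (v := v) (E := H.edgeSet) (P := MarkedClique H X O)
    h3.listed ((r3 15 (by decide)).trans q15) ((r3 14 (by decide)).trans q14)
    (by rw [HoldsEdges, e3 3 (by decide), e3 4 (by decide), e3 46 (by decide)]; exact h.edges)
    (fun y hy => hvO (h.tree.supp _ _ hy))
    (by rw [Answers, e3 47 (by decide)]; exact h.answers) hvO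
  refine (Runs.seq hem.frame (T' := 100 * n + 20) ?_).mono (by omega) fun _ h => h
  rintro σ4 ⟨⟨hE, hA⟩, r4, f4⟩
  refine (runs_commitPass (n := n) (v := v) (σ := σ4)
    ((r4 0 (by decide)).trans ((r3 0 (by decide)).trans q0))
    ((r4 14 (by decide)).trans ((r3 14 (by decide)).trans q14))).frame.imp ?_
  rintro σ5 ⟨⟨hU, hI⟩, -, f5⟩
  have hnp : ∀ y, newPar n v σ4.arr y = newPar n v σ3.arr y := fun y => by
    simp only [newPar, f4 34 (by decide), f4 12 (by decide), f4 25 (by decide), f4 36 (by decide),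
      f4 20 (by decide), f4 22 (by decide)]
  have hnd : ∀ y, newDeg v σ4.arr y = newDeg v σ3.arr y := fun y => by
    simp only [newDeg, f4 34 (by decide), f4 31 (by decide), f4 36 (by decide), f4 39 (by decide),
      f4 40 (by decide)]
  have hlt : ∀ y ∈ insert v O, y < n := hL.lt
  have h5 : ∀ a ∈ [0, 1], σ5.arr a = σ3.arr a := fun a ha =>
    (f5 a (by revert a; decide)).trans (f4 a (by revert a; decide))
  refine ⟨hL.le, {z | z ∈ O ∧ σ3.arr 36 z ≠ 0}, ⟨?_, ⟨?_, ?_, ?_, h.adj.lt⟩, ?_, ?_⟩, ?_, ?_, ?_⟩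
  · exact hL.congr (fun j hj => ((hU j hj).2.2.1).trans (by rw [f4 23 (by decide)]))
      fun j hj => ((hU j hj).2.2.2).trans (by rw [f4 44 (by decide)])
  · rw [h5 0 (by decide)]
    exact h3.adj.start
  · rw [h5 0 (by decide)]
    exact h3.adj.mono
  · rw [h5 0 (by decide), h5 1 (by decide)]
    exact h3.adj.adj_iff
  · intro y hy
    rw [hI, f4 30 (by decide)]
    by_cases hyv : y = v
    · simp [hyv]
    · rw [if_neg hyv, h3.ins y hy, Set.mem_insert_iff, or_iff_right hyv]
  · refine hT.congr (fun y hy => ?_) (fun y hy => ?_) fun y hy => ?_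
    · rw [(hU y (hlt y hy)).2.2.2, f4 44 (by decide)]
    · rw [(hU y (hlt y hy)).1, hnp]
    · rw [(hU y (hlt y hy)).2.1, hnd]
  · rw [edgeSet_addVertex hvO, HoldsEdges, f5 3 (by decide), f5 4 (by decide), f5 46 (by decide)]
    exact hE
  · intro y hy
    rw [f5 32 (by decide), f4 32 (by decide), e3 32 (by decide)]
    exact h.marked y hy
  · rw [Answers, f5 47 (by decide)]
    refine ⟨hA.1, hA.2.trans ?_⟩
    rw [markedClique_addVertex h.tree.supp hvO, e3 32 (by decide)]
    refine and_congr_right fun _ => forall₂_congr fun y hy => ?_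
    rw [h.marked v hvn, h.marked y (hlt y (.inr hy))]

/-! ### All insertions, and their total time -/

/-- Add the vertex in the register `14`, and update the number of vertices. -/
def insertVertex : Prog :=
  .seq (.set 15 (.get 27 (.lit 0))) <| .seq insertPass <|
  .seq (.set 15 (.add (.var 15) (.lit 1))) (.put 27 (.lit 0) (.var 15))

/-- The memory holds a vertex-incremental minimal triangulation for the list `l`. Isolated vertices
may be ignored. -/
def Inserted (n : ℕ) (G : SimpleGraph ℕ) (X : Set ℕ) (l : List ℕ) (A : ℕ → ℕ → ℕ) : Prop :=
  ∃ (O : Set ℕ) (H : SimpleGraph ℕ), (∀ y ∈ O, y ∈ l) ∧ (∀ y ∈ l, ∀ w, G.Adj y w → y ∈ O) ∧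
    IsVertexIncremental G l H ∧ Built n (A 27 0) G H X O A

theorem restr_eq_restr {V : Type*} {G : SimpleGraph V} {P Q : Set V} (h : ∀ y ∈ P, y ∈ Q)
    (hQ : ∀ y ∈ Q, ∀ w, G.Adj y w → y ∈ P) : restr G Q = restr G P := by
  ext a b
  exact ⟨fun ⟨hab, ha, hb⟩ => ⟨hab, hQ a ha b hab, hQ b hb a hab.symm⟩,
    fun ⟨hab, ha, hb⟩ => ⟨hab, h a ha, h b hb⟩⟩

theorem addVertex_empty {V : Type*} (H : SimpleGraph V) (v : V) : addVertex H v ∅ = H := by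
  ext a b
  simp [addVertex]

/-- A vertex without neighbours in `G` gets the empty neighbourhood, so the memory need not change.
Skipping such vertices reduces the number of expensive insertions to at most the number of adjacency
entries. -/
theorem Inserted.concat_isolated {n v : ℕ} {G : SimpleGraph ℕ} {X : Set ℕ} {l : List ℕ}
    {A : ℕ → ℕ → ℕ} (h : Inserted n G X l A) (hvl : v ∉ l) (hv : ∀ w, ¬ G.Adj v w) :
    Inserted n G X (l ++ [v]) A := by
  obtain ⟨O, H, h1, h2, h3, h4⟩ := h
  refine ⟨O, H, fun y hy => List.mem_append_left _ (h1 y hy), fun y hy w hyw => ?_, ?_, h4⟩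
  · rcases List.mem_append.1 hy with hy | hy
    · exact h2 y hy w hyw
    · rw [List.mem_singleton.1 hy] at hyw
      exact absurd hyw (hv w)
  · rw [← addVertex_empty H v]
    refine h3.concat hvl ?_
    rw [addVertex_empty, restr_eq_restr (P := O) (fun y hy => .inr (h1 y hy))]
    · exact h4.tree.min
    · rintro y (rfl | hy) w hyw
      · exact absurd hyw (hv w)
      · exact h2 y hy w hyw

theorem runs_insertVertex {n v : ℕ} {G : SimpleGraph ℕ} {X : Set ℕ} {l : List ℕ} {σ : State}
    (hn : σ.reg 0 = n) (hv : σ.reg 14 = v) (hvn : v < n) (hvl : v ∉ l)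
    (h : Inserted n G X l σ.arr) :
    Runs n insertVertex σ (300 * σ.arr 0 n + 3000 * n + 310)
      (fun σ' => Inserted n G X (l ++ [v]) σ'.arr) := by
  obtain ⟨O, H, h1, h2, h3, h4⟩ := h
  have hvO : v ∉ O := fun hh => hvl (h1 v hh)
  refine (Runs.seq (T := 3) (T' := 300 * σ.arr 0 n + 3000 * n + 307)
    (Runs.block (n := n) (σ := σ) rfl) ?_).mono (by omega) fun _ h => h
  intro σ1 hσ1
  rw [step_set, eval_get, eval_lit] at hσ1
  have a1 : σ1.arr = σ.arr := by rw [hσ1]; rfl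
  have hi := runs_insertPass (n := n) (K := σ.arr 27 0) (σ := σ1) (v := v)
    (by rw [hσ1]; simpa using hn) (by rw [hσ1]; simp) (by rw [hσ1]; simpa using hv) hvn hvO
    (by rw [a1]; exact h4)
  rw [a1] at hi
  refine (Runs.seq hi.frame (T' := 7) ?_).mono (by omega) fun _ h => h
  rintro σ2 ⟨⟨hK, L, hB⟩, r2, -⟩
  have h15 : σ2.reg 15 = σ.arr 27 0 := (r2 15 (by decide)).trans (by rw [hσ1]; simp)
  refine (Runs.seq (Runs.incr (n := n) (r := 15) rfl (by norm_num) (by omega)) (T' := 3) ?_)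
  rintro σ3 hσ3
  refine (Runs.block (n := n) (σ := σ3) rfl).imp ?_
  rintro _ rfl
  rw [step_put, eval_lit, eval_var]
  have h15' : σ3.reg 15 = σ.arr 27 0 + 1 := by rw [hσ3]; simp [h15]
  have a3 : σ3.arr = σ2.arr := by rw [hσ3]; rfl
  rw [h15']
  refine ⟨insert v O, addVertex H v L, ?_, ?_, ?_, ?_⟩
  · rintro y (rfl | hy)
    · simp
    · exact List.mem_append_left _ (h1 y hy)
  · intro y hy w hyw
    rcases List.mem_append.1 hy with hy | hy
    · exact .inr (h2 y hy w hyw)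
    · exact .inl (List.mem_singleton.1 hy)
  · refine h3.concat hvl ?_
    rw [restr_eq_restr (P := insert v O)]
    · exact hB.tree.min
    · rintro y (rfl | hy)
      · exact .inl rfl
      · exact .inr (h1 y hy)
    · rintro y (rfl | hy) w hyw
      · exact .inl rfl
      · exact .inr (h2 y hy w hyw)
  · have hf : ∀ a, a ≠ 27 → (σ3.setArr 27 0 (σ.arr 27 0 + 1)).arr a = σ2.arr a := fun a ha => by
      rw [setArr_ne ha, a3]
    have h27 : (σ3.setArr 27 0 (σ.arr 27 0 + 1)).arr 27 0 = σ.arr 27 0 + 1 := by simp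
    rw [h27]
    refine ⟨hB.toHoldsTree.congr fun a ha => hf a (by revert a; decide), ?_, ?_, ?_⟩
    · rw [HoldsEdges, hf 3 (by decide), hf 4 (by decide), hf 46 (by decide)]
      exact hB.edges
    · rw [hf 32 (by decide)]
      exact hB.marked
    · rw [Answers, hf 47 (by decide)]
      exact hB.answers

/-- Add the vertex in the register `18` if it is not isolated and `e` is nonzero. -/
def insertIf (e : Expr) : Prog :=
  .seq (.set 19 (.var 18)) <| .seq (.set 19 (.add (.var 19) (.lit 1))) <|
  .ite (.lt (.get 0 (.var 18)) (.get 0 (.var 19)))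
    (.ite e (.seq (.set 14 (.var 18)) insertVertex) .skip) .skip

theorem runs_skip {n : ℕ} {σ : State} : Runs n .skip σ 1 (fun σ' => σ' = σ) :=
  Runs.block (p := .skip) rfl

theorem runs_insertIf {n j T : ℕ} {e : Expr} {G : SimpleGraph ℕ} {X S : Set ℕ} {l l' : List ℕ}
    {σ : State} (hn : σ.reg 0 = n) (hj : σ.reg 18 = j) (hjn : j < n) (he : e.wf)
    (hec : e.cost ≤ 6) (hjl : j ∈ S → j ∉ l) (h : Inserted n G X l σ.arr)
    (hS : ∀ σ', σ'.reg 18 = j → σ'.reg 1 = σ.reg 1 → σ'.arr 32 = σ.arr 32 → (e.eval σ' ≠ 0 ↔ j ∈ S))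
    (hl : j ∈ S → l' = l ++ [j]) (hl' : j ∉ S → l' = l) (hT0 : 30 ≤ T)
    (hT : σ.arr 0 j < σ.arr 0 (j + 1) → 300 * σ.arr 0 n + 3000 * n + 340 ≤ T) :
    Runs n (insertIf e) σ T (fun σ' => Inserted n G X l' σ'.arr) := by
  have hadj : HoldsAdj n G σ.arr := by
    obtain ⟨O, H, -, -, -, h⟩ := h
    exact h.adj
  refine (Runs.seq (T := 2) (T' := T - 2)
    (Runs.block (n := n) (σ := σ) rfl) ?_).mono (by omega) fun _ h => h
  intro σ1 hσ1
  rw [step_set, eval_var, hj] at hσ1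
  have h19 : σ1.reg 19 = j := by rw [hσ1]; simp
  refine (Runs.seq (Runs.incr (n := n) (r := 19) rfl (by norm_num) (by omega))
    (T' := T - 6) ?_).mono (by omega) fun _ h => h
  intro σ2 hσ2
  rw [h19] at hσ2
  have a2 : σ2.arr = σ.arr := by rw [hσ2, hσ1]; rfl
  have q2 : ∀ r, r ≠ 19 → σ2.reg r = σ.reg r := fun r hr => by
    rw [hσ2, hσ1, setReg_ne hr, setReg_ne hr]
  have q19 : σ2.reg 19 = j + 1 := by rw [hσ2]; simp
  have q18 : σ2.reg 18 = j := (q2 18 (by norm_num)).trans hj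
  have hev : (Expr.lt (.get 0 (.var 18)) (.get 0 (.var 19))).eval σ2 = 0 ↔
      ¬ σ.arr 0 j < σ.arr 0 (j + 1) := by
    rw [eval_lt_zero, eval_get, eval_get, eval_var, eval_var, q18, q19, a2]
  have hSj := hS σ2 q18 (q2 1 (by norm_num)) (by rw [a2])
  refine (Runs.ite (n := n) (T := T - 12) (by rfl) (fun h1 => ?_) fun h1 => ?_).mono
    (by simp only [Expr.cost]; omega) fun _ h => h
  -- A nonempty adjacency list; only here is the large part of the time bound available and needed.
  · have h1' := not_not.1 ((not_congr hev).1 h1)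
    have hT' : 2 + (300 * σ.arr 0 n + 3000 * n + 310) ≤ T - 20 := by
      have := hT h1'
      exact Nat.le_sub_of_add_le (by linarith)
    have hc : e.cost + 1 + (T - 20) ≤ T - 12 := by
      clear hev hSj h1 h1' hσ1 hσ2 hS
      omega
    refine Runs.mono (Runs.ite (n := n) (T := T - 20) he (fun h2 => ?_) fun h2 => ?_) hc
      fun _ h => h
    · obtain rfl := hl (hSj.1 h2)
      have hb : Runs n (.set 14 (.var 18)) σ2 2 _ := Runs.block rfl
      refine Runs.mono (Runs.seq (T' := 300 * σ.arr 0 n + 3000 * n + 310) hb ?_) hT' fun _ h => h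
      intro σ3 hσ3
      rw [step_set, eval_var, q18] at hσ3
      have a3 : σ3.arr = σ.arr := by rw [hσ3, ← a2]; rfl
      have hi := runs_insertVertex (n := n) (v := j) (σ := σ3) (G := G) (X := X)
        (by rw [hσ3, setReg_ne (by norm_num), q2 0 (by norm_num)]; exact hn)
        (by rw [hσ3]; simp) hjn (hjl (hSj.1 h2)) (by rw [a3]; exact h)
      rwa [a3] at hi
    · rw [hl' fun hj => hSj.2 hj h2]
      refine runs_skip.mono (by omega) ?_
      rintro _ rfl
      rw [a2]
      exact h
  · refine runs_skip.mono (by omega) ?_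
    rintro _ rfl
    rw [a2]
    have hiso : ∀ w, ¬ G.Adj j w := fun w hw => by
      obtain ⟨e, he1, he2, -⟩ := (hadj.adj_iff j hjn w).1 hw
      exact hev.1 h1 (by omega)
    by_cases hjS : j ∈ S
    · rw [hl hjS]
      exact h.concat_isolated (hjl hjS) hiso
    · rw [hl' hjS]
      exact h

/-- Add all vertices for which `e` is nonzero. -/
def insertAll (e : Expr) : Prog := forLt 18 0 (insertIf e)

open Classical in
/-- The elements of `S` below `n`. -/
noncomputable def listOf (S : Set ℕ) (n : ℕ) : List ℕ := (List.range n).filter (· ∈ S)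

theorem mem_listOf {S : Set ℕ} {n y : ℕ} : y ∈ listOf S n ↔ y < n ∧ y ∈ S := by
  simp [listOf]

theorem listOf_succ_of_mem {S : Set ℕ} {n : ℕ} (h : n ∈ S) :
    listOf S (n + 1) = listOf S n ++ [n] := by
  simp [listOf, List.range_succ, h]

theorem listOf_succ_of_notMem {S : Set ℕ} {n : ℕ} (h : n ∉ S) :
    listOf S (n + 1) = listOf S n := by
  simp [listOf, List.range_succ, h]

theorem HoldsAdj.start_le {n : ℕ} {G : SimpleGraph ℕ} {A : ℕ → ℕ → ℕ} (h : HoldsAdj n G A)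
    {i : ℕ} (hi : i ≤ n) : A 0 i ≤ A 0 n := by
  refine Nat.le_induction (P := fun k _ => k ≤ n → A 0 i ≤ A 0 k) (fun _ => le_rfl)
    (fun k _ ih hk => (ih (by omega)).trans (h.mono k hk)) n hi le_rfl

/-- An insertion costs `O(n)` plus the number `D` of adjacency entries. A non-isolated vertex
charges the first part to one of its own entries and the second to itself; in total this is `O(n * D
+ n)`, where a bound by the number of vertices alone would give `n * n`. -/
theorem runs_insertAll {n : ℕ} {e : Expr} {G : SimpleGraph ℕ} {X S : Set ℕ} {l : List ℕ}
    {σ : State} (hn : σ.reg 0 = n) (he : e.wf) (hec : e.cost ≤ 6) (hadj : HoldsAdj n G σ.arr)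
    (hSl : ∀ y ∈ S, y ∉ l) (h : Inserted n G X l σ.arr)
    (hS : ∀ j < n, ∀ σ', σ'.reg 18 = j → σ'.reg 1 = σ.reg 1 → σ'.arr 32 = σ.arr 32 →
      (e.eval σ' ≠ 0 ↔ j ∈ S)) :
    Runs n (insertAll e) σ
      ((3000 * n + 340) * σ.arr 0 n + (300 * σ.arr 0 n + 30) * n + 8 * n + 6)
      (fun σ' => Inserted n G X (l ++ listOf S n) σ'.arr) := by
  have hwr : (insertIf e).wr = (insertIf (.lit 0)).wr := rfl
  have hwa : (insertIf e).wa = (insertIf (.lit 0)).wa := rfl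
  have key := Runs.forLt (n := n) (σ := σ) (rJ := 18) (rB := 0) (body := insertIf e)
    (fun j φ A => Inserted n G X (l ++ listOf S j) A ∧
      φ = (3000 * n + 340) * (σ.arr 0 n - σ.arr 0 j) + (300 * σ.arr 0 n + 30) * (n - j))
    (φ₀ := (3000 * n + 340) * σ.arr 0 n + (300 * σ.arr 0 n + 30) * n) rfl (by decide) rfl
    (by decide) (by rw [hwr]; decide) (by rw [hwr]; decide)
    ⟨by simpa [listOf] using h, by rw [hadj.start]; simp⟩ ?_
  · rw [hn] at key
    exact key.imp fun σ' h => h.2.choose_spec.1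
  · rintro j φ σ' hj ⟨hI, rfl⟩ h18 hr ha
    rw [hn] at hj
    rw [hwr] at hr
    rw [hwa] at ha
    have e0 := ha 0 (by decide)
    have e32 := ha 32 (by decide)
    have q0 := hr 0 (by decide) (by decide)
    have q1 := hr 1 (by decide) (by decide)
    clear hr ha
    have hmono := hadj.mono j hj
    have hle := hadj.start_le (i := j + 1) hj
    have hjl : j ∈ S → j ∉ l ++ listOf S j := fun hjS hm => by
      rcases List.mem_append.1 hm with hm | hm
      · exact hSl j hjS hm
      · exact lt_irrefl _ (mem_listOf.1 hm).1
    have hT : ∃ T, 30 ≤ T ∧ (σ.arr 0 j < σ.arr 0 (j + 1) → 300 * σ.arr 0 n + 3000 * n + 340 ≤ T) ∧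
        T + ((3000 * n + 340) * (σ.arr 0 n - σ.arr 0 (j + 1)) +
          (300 * σ.arr 0 n + 30) * (n - (j + 1))) ≤
        (3000 * n + 340) * (σ.arr 0 n - σ.arr 0 j) + (300 * σ.arr 0 n + 30) * (n - j) := by
      rw [show n - j = n - (j + 1) + 1 by omega, mul_add _ _ 1, mul_one]
      by_cases hlt : σ.arr 0 j < σ.arr 0 (j + 1)
      · refine ⟨300 * σ.arr 0 n + 3000 * n + 340, by omega, fun _ => le_rfl, ?_⟩
        have := Nat.mul_le_mul_left (3000 * n + 340)
          (show σ.arr 0 n - σ.arr 0 (j + 1) + 1 ≤ σ.arr 0 n - σ.arr 0 j by omega)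
        rw [mul_add, mul_one] at this
        omega
      · refine ⟨30, le_rfl, fun h => absurd h hlt, ?_⟩
        rw [show σ.arr 0 (j + 1) = σ.arr 0 j by omega]
        omega
    obtain ⟨T, hT1, hT2, hT3⟩ := hT
    refine ⟨T, (runs_insertIf (S := S) (l' := l ++ listOf S (j + 1)) (q0.trans hn) h18 hj he hec hjl
      hI (fun σ'' g1 g2 g3 => hS j hj σ'' g1 (g2.trans q1) (g3.trans e32))
      (fun hjS => by rw [listOf_succ_of_mem hjS, List.append_assoc])
      (fun hjS => by rw [listOf_succ_of_notMem hjS]) hT1 (by rwa [e0])).imp fun σ'' h => ?_⟩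
    exact ⟨_, ⟨h, rfl⟩, hT3⟩

/-! ### Clearing the memory and the whole construction -/

/-- Set the registers in `L` to zero. -/
def zeroRegs (L : List ℕ) : Prog := L.foldr (fun r p => .seq (.set r (.lit 0)) p) .skip

theorem exec_zeroRegs {W : ℕ} (hW : 0 < W) (L : List ℕ) (σ : State) :
    ∃ σ', Exec W (zeroRegs L) σ (2 * L.length + 1) σ' ∧ σ'.arr = σ.arr ∧
      ∀ r, σ'.reg r = if r ∈ L then 0 else σ.reg r := by
  induction L generalizing σ with
  | nil => exact ⟨σ, .skip σ, rfl, fun r => by simp⟩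
  | cons q L ih =>
    obtain ⟨σ', h1, h2, h3⟩ := ih (σ.setReg q 0)
    refine ⟨σ', ?_, h2, fun r => ?_⟩
    · rw [List.length_cons, show 2 * (L.length + 1) + 1 = 2 + (2 * L.length + 1) by ring]
      exact .seq (.set q (.lit 0) σ hW) h1
    · rw [h3]
      by_cases hr : r = q
      · simp [hr]
      · simp [hr]

/-- Set the cells of the arrays in `L` at the index in the register `10` to zero. -/
def zeroCells (L : List ℕ) : Prog := L.foldr (fun a p => .seq (.put a (.var 10) (.lit 0)) p) .skip

theorem exec_zeroCells {W : ℕ} (L : List ℕ) (σ : State) (hW : σ.reg 10 < W) :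
    ∃ σ', Exec W (zeroCells L) σ (3 * L.length + 1) σ' ∧ σ'.reg = σ.reg ∧
      ∀ a j, σ'.arr a j = if a ∈ L ∧ j = σ.reg 10 then 0 else σ.arr a j := by
  induction L generalizing σ with
  | nil => exact ⟨σ, .skip σ, rfl, fun a j => by simp⟩
  | cons b L ih =>
    obtain ⟨σ', h1, h2, h3⟩ := ih (σ.setArr b (σ.reg 10) 0) hW
    refine ⟨σ', ?_, h2, fun a j => ?_⟩
    · rw [List.length_cons, show 3 * (L.length + 1) + 1 = 3 + (3 * L.length + 1) by ring]
      exact .seq (.put b (.var 10) (.lit 0) σ hW (Nat.zero_lt_of_lt hW)) h1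
    · rw [h3, setArr_reg]
      by_cases ha : a = b
      · subst ha
        by_cases hj : j = σ.reg 10 <;> simp [hj]
      · rw [setArr_ne ha]
        simp [ha]

/-- Set the cells of the arrays in `L` to zero. -/
def zeroLoop (L : List ℕ) : Prog :=
  .loop (.lt (.var 10) (.add (.var 0) (.lit 1)))
    (.seq (zeroCells L) (.set 10 (.add (.var 10) (.lit 1))))

theorem exec_zeroLoop {n W : ℕ} (L : List ℕ) (hW : n + 2 ≤ W) (m : ℕ) (σ : State)
    (hn : σ.reg 0 = n) (hm : σ.reg 10 + m = n + 1) :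
    ∃ σ', Exec W (zeroLoop L) σ ((3 * L.length + 11) * m + 6) σ' ∧
      (∀ r, r ≠ 10 → σ'.reg r = σ.reg r) ∧
      ∀ a j, σ'.arr a j = if a ∈ L ∧ σ.reg 10 ≤ j ∧ j ≤ n then 0 else σ.arr a j := by
  -- The loop has to reach the index `n`, so register `10` takes the value `n + 1`, which is not an
  -- index in the sense of `Safe`; hence the direct verification and the bound `n + 2 ≤ W`.
  have hfits : ∀ τ : State, τ.reg 0 = n → τ.reg 10 ≤ n + 1 →
      (Expr.lt (.var 10) (.add (.var 0) (.lit 1))).Fits W τ := by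
    intro τ h0 h10
    simp only [Expr.Fits, Expr.eval]
    omega
  induction m generalizing σ with
  | zero =>
    refine ⟨σ, .loop_done _ (hfits σ hn (by omega)) ?_, fun _ _ => rfl, fun a j => ?_⟩
    · exact Expr.eval_lt_eq_zero.2 (by simp only [Expr.eval]; omega)
    · rw [if_neg (by omega)]
  | succ m ih =>
    obtain ⟨σ1, h1, h2, h3⟩ := exec_zeroCells (W := W) L σ (by omega)
    obtain ⟨σ2, h4, h5, h6⟩ := ih (σ1.setReg 10 (σ1.reg 10 + 1)) (by simp [h2, hn])
      (by rw [setReg_same, h2]; omega)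
    refine ⟨σ2, ?_, fun r hr => ?_, fun a j => ?_⟩
    · have hset : Exec W (.set 10 (.add (.var 10) (.lit 1))) σ1 4
          (σ1.setReg 10 (σ1.reg 10 + 1)) :=
        .set 10 (.add (.var 10) (.lit 1)) σ1 (by simp only [Expr.Fits, Expr.eval, h2]; omega)
      have := Exec.loop_step (hfits σ hn (by omega)) (Expr.eval_lt_ne_zero.2 (by
        simp only [Expr.eval]
        omega)) (.seq h1 hset) h4
      simp only [Expr.cost] at this
      rw [show (3 * L.length + 11) * (m + 1) + 6 = 1 + (1 + 1 + 1) + 1 + 1 +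
        (3 * L.length + 1 + 4) + ((3 * L.length + 11) * m + 6) by ring]
      exact this
    · rw [h5 r hr, setReg_ne hr, h2]
    · rw [h6, setReg_same, setReg_arr, h2, h3]
      by_cases ha : a ∈ L
      · simp only [ha, true_and]
        split_ifs <;> first | rfl | omega
      · simp [ha]

/-- Initialize the memory. -/
def clearPass : Prog :=
  .seq (zeroRegs ([3, 4] ++ List.range' 10 20)) <|
  .seq (zeroLoop (List.range' 10 50)) (.set 10 (.lit 0))

/-- Nothing is assumed about the initial memory, so `Safe` and the rules for `Runs` are not
available before this pass. Its writes are literals and its only growing number is the loop index.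
-/
theorem exec_clearPass {n W : ℕ} {σ : State} (hn : σ.reg 0 = n) (hW : n + 2 ≤ W) :
    ∃ t ≤ 200 * n + 300, ∃ σ', Exec W clearPass σ t σ' ∧ (∀ r ≤ 2, σ'.reg r = σ.reg r) ∧
      (∀ r, 3 ≤ r → r < 5 → σ'.reg r = 0) ∧ (∀ r, 10 ≤ r → r < 30 → σ'.reg r = 0) ∧
      (∀ a < 10, σ'.arr a = σ.arr a) ∧
      ∀ a, 10 ≤ a → a < 60 → ∀ j ≤ n, σ'.arr a j = 0 := by
  obtain ⟨σ1, h1, h2, h3⟩ := exec_zeroRegs (W := W) (by omega) ([3, 4] ++ List.range' 10 20) σ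
  have hm : ∀ r, r ∈ [3, 4] ++ List.range' 10 20 ↔ r = 3 ∨ r = 4 ∨ 10 ≤ r ∧ r < 30 := by
    intro r
    simp [List.mem_range'_1]
  simp only [hm] at h3
  have h10 : σ1.reg 10 = 0 := by rw [h3, if_pos (by omega)]
  obtain ⟨σ2, h4, h5, h6⟩ := exec_zeroLoop (n := n) (W := W) (List.range' 10 50) hW (n + 1) σ1
    (by rw [h3, if_neg (by omega)]; exact hn) (by omega)
  rw [h10] at h6
  refine ⟨_, ?_, σ2.setReg 10 0, .seq h1 (.seq h4 (.set 10 (.lit 0) σ2 (by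
    simp only [Expr.Fits]; omega))), fun r hr => ?_, fun r hr hr' => ?_, fun r hr hr' => ?_,
    fun a ha => ?_, fun a ha ha' j hj => ?_⟩
  · simp only [List.length_append, List.length_range', List.length_cons, List.length_nil, Expr.cost]
    omega
  · rw [setReg_ne (by omega), h5 r (by omega), h3, if_neg (by omega)]
  · rw [setReg_ne (by omega), h5 r (by omega), h3, if_pos (by omega)]
  · by_cases h : r = 10
    · rw [h, setReg_same]
    · rw [setReg_ne h, h5 r h, h3, if_pos (by omega)]
  · ext j
    rw [setReg_arr, h6, if_neg (by simp only [List.mem_range'_1]; omega), h2]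
  · rw [setReg_arr, h6, if_pos (by simp only [List.mem_range'_1]; omega)]

/-- Mark the neighbours of the vertex in the register `1`. -/
def startPass : Prog :=
  .seq (.put 47 (.lit 0) (.lit 1)) (forAdj (.var 1) (.put 32 (.var 13) (.lit 1)))

theorem runs_startPass {n u : ℕ} {G : SimpleGraph ℕ} {σ : State} (hu : σ.reg 1 = u) (hun : u < n)
    (hadj : HoldsAdj n G σ.arr) (h0 : ∀ a, 10 ≤ a → a < 60 → ∀ j ≤ n, σ.arr a j = 0) :
    Runs n startPass σ (20 * σ.arr 0 n + 30)
      (fun σ' => Inserted n G {y | G.Adj u y} [] σ'.arr) := by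
  refine (Runs.seq (T := 3) (T' := 20 * σ.arr 0 n + 27) (Runs.block rfl) ?_).mono (by omega)
    fun _ h => h
  intro σ1 hσ1
  rw [step_put, eval_lit, eval_lit] at hσ1
  have f1 : ∀ a, a ≠ 47 → σ1.arr a = σ.arr a := fun a ha => by rw [hσ1, setArr_ne ha]
  have h47 : σ1.arr 47 0 = 1 := by rw [hσ1]; simp
  have hu1 : σ1.reg 1 = u := by rw [hσ1]; exact hu
  clear hσ1
  have e0 := f1 0 (by norm_num)
  have e1 := f1 1 (by norm_num)
  have hle := hadj.start_le (i := u + 1) hun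
  have key := Runs.forAdj (n := n) (σ := σ1) (v := .var 1) (body := .put 32 (.var 13) (.lit 1)) 3
    (fun e A => ∀ y ≤ n, A 32 y ≠ 0 ↔ ∃ i, σ.arr 0 u ≤ i ∧ i < e ∧ σ.arr 1 i = y)
    rfl (by decide) (by rwa [eval_var, hu1]) (fun x => rfl)
    (by rw [eval_var, hu1, e0]; exact hadj.mono u hun)
    (by
      rw [eval_var, hu1, e0, e1]
      exact fun e h1 h2 => hadj.adj_lt hun h1 h2) rfl (by decide) (by decide) (by decide) (by decide)
    (by
      rw [eval_var, hu1, e0, f1 32 (by norm_num)]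
      intro y hy
      rw [h0 32 (by norm_num) (by norm_num) y hy]
      simp only [ne_eq, not_true_eq_false, false_iff, not_exists]
      omega)
    (by
      rw [eval_var, hu1, e0, e1]
      intro e σ' h1 h2 hI h13 _ _ _ y hy
      rw [step_put, eval_var, h13, eval_lit, setArr_same]
      split_ifs with hye
      · simp only [ne_eq, one_ne_zero, not_false_eq_true, true_iff]
        exact ⟨e, h1, by omega, hye.symm⟩
      · rw [hI y hy]
        refine exists_congr fun i => and_congr_right fun _ => ⟨fun h => ⟨by omega, h.2⟩, fun h => ?_⟩
        refine ⟨lt_of_le_of_ne (by omega) ?_, h.2⟩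
        rintro rfl
        exact hye h.2.symm)
  rw [eval_var, hu1, e0] at key
  refine key.frame.mono (by omega) ?_
  rintro σ2 ⟨hX, -, f2⟩
  have f : ∀ a, a ≠ 47 → a ≠ 32 → σ2.arr a = σ.arr a := fun a ha ha' =>
    (f2 a (by simpa [forAdj, Prog.wa] using ha')).trans (f1 a ha)
  have g : ∀ a, a ≠ 47 → a ≠ 32 → 10 ≤ a → a < 60 → ∀ j ≤ n, σ2.arr a j = 0 :=
    fun a ha ha' h1 h2 j hj => by rw [f a ha ha', h0 a h1 h2 j hj]
  have h47' : σ2.arr 47 0 = 1 := by rw [f2 47 (by decide), h47]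
  refine ⟨∅, ⊥, fun y hy => hy.elim, fun y hy => by simp at hy,
    isVertexIncremental_iff.2 fun i _ => ?_, ⟨⟨?_, ⟨?_, ?_, ?_, hadj.lt⟩, ?_, ?_⟩, ?_, ?_, ?_⟩⟩
  · have hb : ∀ K : SimpleGraph ℕ, restr K {v | v ∈ ([] : List ℕ).take i} = ⊥ := fun K => by
      ext a b
      simp [restr]
    rw [hb, hb]
    exact isMinimalTriangulation_bot
  · rw [g 27 (by norm_num) (by norm_num) (by norm_num) (by norm_num) 0 (by omega)]
    exact ⟨fun j hj => by omega, fun j hj => by omega, fun y hy => hy.elim, fun y hy => hy.elim,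
      fun y hy => hy.elim⟩
  · rw [f 0 (by norm_num) (by norm_num)]
    exact hadj.start
  · rw [f 0 (by norm_num) (by norm_num)]
    exact hadj.mono
  · rw [f 0 (by norm_num) (by norm_num), f 1 (by norm_num) (by norm_num)]
    exact hadj.adj_iff
  · intro y hy
    rw [g 30 (by norm_num) (by norm_num) (by norm_num) (by norm_num) y hy.le]
    simp
  · exact ElimTree.empty G n _ _ _
  · rw [HoldsEdges, g 46 (by norm_num) (by norm_num) (by norm_num) (by norm_num) 0 (by omega)]
    simp
  · intro y hy
    rw [hX y hy.le, Set.mem_ofPred_eq, hadj.adj_iff u hun]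
  · rw [Answers, h47']
    exact ⟨le_rfl, iff_of_true one_ne_zero fun a ha => ha.elim⟩

/-- Construct the triangulation, and test the vertex in the register `1`. -/
def buildPass : Prog :=
  .seq startPass <| .seq (insertAll (.eq (.get 32 (.var 18)) (.eq (.var 18) (.var 1)))) <|
  .seq (.seq (.set 14 (.var 1)) insertVertex) <| .seq (insertAll (.get 32 (.var 18))) <|
  .seq (.set 4 (.get 46 (.lit 0))) (.set 3 (.get 47 (.lit 0)))

theorem Inserted.marked {n : ℕ} {G : SimpleGraph ℕ} {X : Set ℕ} {l : List ℕ} {A : ℕ → ℕ → ℕ}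
    (h : Inserted n G X l A) : ∀ y < n, A 32 y ≠ 0 ↔ y ∈ X := by
  obtain ⟨O, H, -, -, -, h⟩ := h
  exact h.marked

theorem Inserted.adj {n : ℕ} {G : SimpleGraph ℕ} {X : Set ℕ} {l : List ℕ} {A : ℕ → ℕ → ℕ}
    (h : Inserted n G X l A) : HoldsAdj n G A := by
  obtain ⟨O, H, -, -, -, h⟩ := h
  exact h.adj

theorem runs_buildPass {n u : ℕ} {G : SimpleGraph ℕ} {σ : State} (hn : σ.reg 0 = n)
    (hu : σ.reg 1 = u) (hun : u < n) (hadj : HoldsAdj n G σ.arr)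
    (h0 : ∀ a, 10 ≤ a → a < 60 → ∀ j ≤ n, σ.arr a j = 0) :
    Runs n buildPass σ (6600 * (n * σ.arr 0 n) + 1000 * σ.arr 0 n + 3100 * n + 400)
      (fun σ' => ∃ H : SimpleGraph ℕ, IsVertexIncremental G
        (listOf {y | y ≠ u ∧ ¬ G.Adj u y} n ++ u :: listOf {y | G.Adj u y} n) H ∧
        (∀ x y, H.Adj x y → x < n) ∧
        Set.BijOn (fun j => s(σ'.arr 3 j, σ'.arr 4 j)) (Set.Iio (σ'.reg 4)) H.edgeSet ∧
        σ'.reg 3 ≤ 1 ∧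
        (σ'.reg 3 ≠ 0 ↔ ∀ a b, G.Adj u a → G.Adj u b → a ≠ b → H.Adj a b)) := by
  refine (Runs.seq (runs_startPass hu hun hadj h0).frame (T' := 6600 * (n * σ.arr 0 n) +
    980 * σ.arr 0 n + 3100 * n + 370) ?_).mono (by omega) fun _ h => h
  rintro σ1 ⟨h1, r1, f1⟩
  have n1 : σ1.reg 0 = n := (r1 0 (by decide)).trans hn
  have u1 : σ1.reg 1 = u := (r1 1 (by decide)).trans hu
  have e1 : σ1.arr 0 = σ.arr 0 := f1 0 (by decide)
  clear r1 f1
  have hi1 := runs_insertAll (S := {y | y ≠ u ∧ ¬ G.Adj u y}) (σ := σ1) (l := [])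
    (e := .eq (.get 32 (.var 18)) (.eq (.var 18) (.var 1))) n1 rfl (by decide) h1.adj
    (by simp) h1 (by
      intro j hj σ' g18 g1 g32
      -- The vertex `u` is unmarked, so the mark of `j` equals the truth value of `j = u` only if
      -- both are zero: `j` is then neither `u` nor a neighbour of `u`.
      rw [Expr.eval_eq_ne_zero]
      simp only [Expr.eval, g18, g1, g32, u1, Set.mem_ofPred_eq]
      have hm := h1.marked j hj
      rw [Set.mem_ofPred_eq] at hm
      rw [← not_iff_not.2 hm]
      by_cases hju : j = u
      · rw [if_pos hju]
        have : σ1.arr 32 j = 0 := by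
          by_contra hne
          exact G.ne_of_adj (hm.1 hne) hju.symm
        omega
      · rw [if_neg hju]
        omega)
  rw [e1, List.nil_append] at hi1
  refine (Runs.seq hi1.frame (T' := (3000 * n + 340) * σ.arr 0 n + (300 * σ.arr 0 n + 30) * n +
    8 * n + 6 + (300 * σ.arr 0 n + 3000 * n + 318)) ?_).mono (by
      have := Nat.zero_le (n * σ.arr 0 n)
      nlinarith) fun _ h => h
  rintro σ2 ⟨h2, r2, f2⟩
  have n2 : σ2.reg 0 = n := (r2 0 (by decide)).trans n1
  have u2 : σ2.reg 1 = u := (r2 1 (by decide)).trans u1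
  have e2 : σ2.arr 0 = σ.arr 0 := (f2 0 (by decide)).trans e1
  clear r2 f2
  have hset : Runs n (.set 14 (.var 1)) σ2 2 (fun σ' => σ' = σ2.setReg 14 u) := by
    have hb := Runs.block (n := n) (p := .set 14 (.var 1)) (σ := σ2) rfl
    rwa [step_set, eval_var, u2] at hb
  have hiu : Runs n (.seq (.set 14 (.var 1)) insertVertex) σ2
      (2 + (300 * σ.arr 0 n + 3000 * n + 310)) (fun σ' => Inserted n G {y | G.Adj u y}
        (listOf {y | y ≠ u ∧ ¬ G.Adj u y} n ++ [u]) σ'.arr) := by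
    refine Runs.seq hset ?_
    rintro τ hτ
    have aτ : τ.arr = σ2.arr := by rw [hτ]; rfl
    have := runs_insertVertex (n := n) (v := u) (σ := τ) (by rw [hτ, setReg_ne (by decide), n2])
      (by rw [hτ, setReg_same]) hun (fun hm =>
        (mem_listOf (S := {y | y ≠ u ∧ ¬ G.Adj u y}).1 hm).2.1 rfl) (by rw [aτ]; exact h2)
    rwa [aτ, e2] at this
  refine (Runs.seq hiu.frame (T' := (3000 * n + 340) * σ.arr 0 n + (300 * σ.arr 0 n + 30) * n +
    8 * n + 6 + 6) ?_).mono (by omega) fun _ h => h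
  rintro σ3 ⟨h3, r3, f3⟩
  have n3 : σ3.reg 0 = n := (r3 0 (by decide)).trans n2
  have e3 : σ3.arr 0 = σ.arr 0 := (f3 0 (by decide)).trans e2
  clear r3 f3
  have hi3 := runs_insertAll (S := {y | G.Adj u y}) (σ := σ3)
    (e := .get 32 (.var 18)) n3 rfl (by decide) h3.adj
    (by
      intro y hy hm
      rcases List.mem_append.1 hm with hm | hm
      · exact (mem_listOf.1 hm).2.2 hy
      · exact G.ne_of_adj hy (List.mem_singleton.1 hm).symm) h3 (by
      intro j hj σ' g18 g1 g32
      rw [eval_get, eval_var, g18, g32]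
      exact h3.marked j hj)
  rw [e3] at hi3
  refine Runs.seq hi3 ?_
  rintro σ4 ⟨O, H, hO, hO', hinc, hB⟩
  refine (Runs.block (n := n) (σ := σ4) rfl).mono (by decide) ?_
  rintro _ rfl
  rw [List.append_assoc, List.singleton_append] at hinc hO hO'
  have hr : ((Prog.seq (.set 4 (.get 46 (.lit 0))) (.set 3 (.get 47 (.lit 0)))).step σ4).reg 4 =
      σ4.arr 46 0 := by
    simp [step_seq, step_set, eval_get, eval_lit]
  have hr' : ((Prog.seq (.set 4 (.get 46 (.lit 0))) (.set 3 (.get 47 (.lit 0)))).step σ4).reg 3 =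
      σ4.arr 47 0 := by
    simp [step_seq, step_set, eval_get, eval_lit]
  rw [hr, hr']
  refine ⟨H, hinc, fun x y hxy => hB.listed.lt x (hB.tree.supp x y hxy), hB.edges, hB.answers.1,
    hB.answers.2.trans ⟨fun h a b ha hb hab => ?_, fun h a _ b _ ha hb hab => h a b ha hb hab⟩⟩
  -- Neighbours of `u` are not isolated, so none of them was skipped, and the answer about the
  -- inserted marked vertices concerns all of them.
  have hX : ∀ a, G.Adj u a → a ∈ O := fun a ha => hO' a (List.mem_append_right _ (.tail _
    (mem_listOf.2 ⟨hB.adj.lt u a ha, ha⟩))) u ha.symm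
  exact h a (hX a ha) b (hX b hb) ha hb hab

/-! ### From the memory to the graph -/

/-- A smaller chordal graph on `V` can be mapped forward. The additional vertices of `W` are
isolated there, so it remains chordal and contradicts minimality. -/
theorem IsMinimalTriangulation.comap {V W : Type*} [Nonempty V] {G H : SimpleGraph W} (f : V ↪ W)
    (h : IsMinimalTriangulation G H) (hH : ∀ x y, H.Adj x y → x ∈ Set.range f) :
    IsMinimalTriangulation (G.comap f) (H.comap f) := by
  refine ⟨SimpleGraph.comap_monotone f h.1, h.2.1.of_embedding (SimpleGraph.Embedding.comap f H),
    fun K hGK hKH hK => h.2.2 (K.map f) (fun x y hxy => ?_) (lt_of_le_of_ne ?_ ?_) ?_⟩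
  · obtain ⟨a, rfl⟩ := hH x y (h.1 hxy)
    obtain ⟨b, rfl⟩ := hH y _ (h.1 hxy).symm
    exact (SimpleGraph.map_adj_apply).2 (hGK hxy)
  · intro x y hxy
    obtain ⟨a, b, hab, rfl, rfl⟩ := (SimpleGraph.map_adj f K x y).1 hxy
    exact hKH.le hab
  · intro he
    refine hKH.ne ?_
    rw [← he, SimpleGraph.comap_map_eq]
  · have hinv : ∀ a, Function.invFun f (f a) = a := Function.leftInverse_invFun f.injective
    refine hK.of_cycles (Set.range f) (Function.invFun f) ?_ ?_ ?_
    · intro x y hxy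
      obtain ⟨a, b, -, rfl, -⟩ := (SimpleGraph.map_adj f K x y).1 hxy
      exact ⟨a, rfl⟩
    · rintro _ ⟨a, rfl⟩ _ ⟨b, rfl⟩ hab
      rw [hinv, hinv] at hab
      rw [hab]
    · rintro _ ⟨a, rfl⟩ _ ⟨b, rfl⟩
      rw [hinv, hinv, SimpleGraph.map_adj_apply]

theorem IsVertexIncremental.comap {V W : Type*} [Nonempty V] {G H : SimpleGraph W} (f : V ↪ W)
    {l : List V} (h : IsVertexIncremental G (l.map f) H) :
    IsVertexIncremental (G.comap f) l (H.comap f) := by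
  rw [isVertexIncremental_iff] at h ⊢
  intro i hi
  have hmem : ∀ a, f a ∈ (l.map f).take i ↔ a ∈ l.take i := fun a => by
    rw [← List.map_take, List.mem_map_of_injective f.injective]
  have hr : ∀ K : SimpleGraph W, restr (K.comap f) {v | v ∈ l.take i} =
      (restr K {v | v ∈ (l.map f).take i}).comap f := by
    intro K
    ext a b
    simp only [restr, SimpleGraph.comap_adj, Set.mem_ofPred_eq, hmem]
  rw [hr, hr]
  refine (h i (by simpa using hi)).comap f fun x y hxy => ?_
  have hx : x ∈ l.map f := List.mem_of_mem_take hxy.2.1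
  obtain ⟨a, -, rfl⟩ := List.mem_map.1 hx
  exact ⟨a, rfl⟩

theorem HoldsGraph.holdsAdj {n : ℕ} {G : SimpleGraph (Fin n)} {σ : State} (h : HoldsGraph G σ) :
    HoldsAdj n (G.map Fin.valEmbedding) σ.arr := by
  refine ⟨h.start, fun v hv => h.mono ⟨v, hv⟩, fun v hv w => ?_, fun v w hvw => ?_⟩
  · have hl := h.lists ⟨v, hv⟩
    constructor
    · intro hvw
      obtain ⟨a, b, hab, rfl, rfl⟩ := (SimpleGraph.map_adj _ _ _ _).1 hvw
      obtain ⟨e, he, heb⟩ := hl.surjOn ⟨b, hab, rfl⟩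
      exact ⟨e, he.1, he.2, heb⟩
    · rintro ⟨e, he1, he2, rfl⟩
      obtain ⟨b, hb, hbe⟩ := hl.mapsTo ⟨he1, he2⟩
      rw [← hbe]
      exact (SimpleGraph.map_adj _ _ _ _).2 ⟨⟨v, hv⟩, b, hb, rfl, rfl⟩
  · obtain ⟨a, b, -, -, rfl⟩ := (SimpleGraph.map_adj _ _ _ _).1 hvw
    exact b.isLt

/-- The length of the adjacency array is the sum of the degrees, so the time bounds in terms of its
last position become bounds in terms of the number of edges. -/
theorem HoldsGraph.arrPos_eq {n : ℕ} {G : SimpleGraph (Fin n)} {σ : State} (h : HoldsGraph G σ) :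
    σ.arr 0 n = 2 * G.edgeSet.ncard ∧ σ.arr 0 n ≤ n * n := by
  classical
  have hdeg : ∀ v : Fin n, G.degree v = σ.arr 0 (v.val + 1) - σ.arr 0 v := by
    intro v
    have h1 := (h.lists v).injOn.ncard_image
    rw [(h.lists v).image_eq, Set.ncard_image_of_injective _ Fin.val_injective,
      Set.ncard_eq_toFinset_card', Set.ncard_eq_toFinset_card'] at h1
    rw [Set.toFinset_Ico, Nat.card_Ico] at h1
    exact h1
  have hsum : ∀ k ≤ n, ∑ i ∈ Finset.range k, (σ.arr 0 (i + 1) - σ.arr 0 i) = σ.arr 0 k := by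
    intro k
    induction k with
    | zero => exact fun _ => h.start.symm
    | succ k ih =>
      intro hk
      rw [Finset.sum_range_succ, ih (by omega)]
      have : σ.arr 0 k ≤ σ.arr 0 (k + 1) := h.mono ⟨k, hk⟩
      omega
  have htot : ∑ v, G.degree v = σ.arr 0 n := by
    rw [Finset.sum_congr rfl fun v _ => hdeg v,
      Fin.sum_univ_eq_sum_range (fun i => σ.arr 0 (i + 1) - σ.arr 0 i) n, hsum n le_rfl]
  constructor
  · rw [← htot, G.sum_degrees_eq_twice_card_edges, Set.ncard_eq_toFinset_card']
    rfl
  · rw [← htot]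
    calc ∑ v, G.degree v ≤ ∑ _v : Fin n, n :=
          Finset.sum_le_sum fun v _ => (G.degree_lt_card_verts v).le.trans (by simp)
      _ = n * n := by simp

/-- Construct a vertex-incremental minimal triangulation, and test the vertex in the register `1`. -/
def testProg : Prog :=
  .ite (.get 0 (.var 0)) (.seq clearPass buildPass) (.seq (.set 4 (.lit 0)) (.set 3 (.lit 1)))

/-- Without edges the bound `O(n * m + 1)` does not even allow clearing the memory. The graph is its
own triangulation, with an empty edge list and only simplicial vertices. -/
theorem testsByTriangulation_of_edgeless {n W T : ℕ} {G : SimpleGraph (Fin n)} {u : Fin n}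
    {σ : State} (h : HoldsGraph G σ) (hm : G.edgeSet.ncard = 0) (hW : n + 2 ≤ W) (hT : 7 ≤ T) :
    ∃ (t : ℕ) (σ' : State), Exec W testProg σ t σ' ∧ t ≤ T ∧
      (∀ r ≤ 2, σ'.reg r = σ.reg r) ∧ (∀ a ≤ 2, σ'.arr a = σ.arr a) ∧
      ∃ (l : List (Fin n)) (H : SimpleGraph (Fin n)),
        IsOrderingAt G u l ∧ IsVertexIncremental G l H ∧ HoldsTriangulation H σ' ∧
        (IsSimplicial H u → σ'.reg 3 = 1) ∧ (¬ IsSimplicial H u → σ'.reg 3 = 0) := by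
  have hD : σ.arr 0 n = 0 := by rw [h.arrPos_eq.1, hm]
  have hn : σ.reg 0 = n := h.size
  obtain rfl : G = ⊥ := by
    rw [← SimpleGraph.edgeSet_eq_empty]
    exact (Set.ncard_eq_zero (Set.toFinite _)).1 hm
  obtain ⟨l, hl⟩ := exists_isOrderingAt (⊥ : SimpleGraph (Fin n)) u
  have hs : IsSimplicial (⊥ : SimpleGraph (Fin n)) u := fun a ha => ha.elim
  have h2 : (Expr.get 0 (.var 0)).eval σ = 0 := by rw [eval_get, eval_var, hn, hD]
  refine ⟨3 + (2 + 2), _, .ite_false _ ⟨?_, ?_⟩ h2 (.seq (.set 4 (.lit 0) σ ?_)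
    (.set 3 (.lit 1) _ ?_)), hT, ?_, fun _ _ => rfl, l, ⊥, hl, ?_, ?_, fun _ => ?_,
    fun hh => absurd hs hh⟩
  · simp only [Expr.Fits]
    omega
  · simp only [Expr.eval]
    rw [hn, hD]
    omega
  · simp only [Expr.Fits]
    omega
  · simp only [Expr.Fits]
    omega
  · intro r hr
    rw [setReg_ne (by omega), setReg_ne (by omega)]
  · rw [isVertexIncremental_iff]
    intro i _
    have hb : ∀ P : Set (Fin n), restr (⊥ : SimpleGraph (Fin n)) P = ⊥ := fun P => by
      ext a b
      simp [restr]
    rw [hb]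
    exact isMinimalTriangulation_bot
  · rw [HoldsTriangulation, setReg_ne (by decide), setReg_same, eval_lit]
    simp
  · rw [setReg_same, eval_lit]

theorem isOrderingAt_of_map {n : ℕ} {G : SimpleGraph (Fin n)} {u : Fin n} :
    ∃ l : List (Fin n), IsOrderingAt G u l ∧ l.map Fin.valEmbedding =
      listOf {y | y ≠ u ∧ ¬ (G.map Fin.valEmbedding).Adj u y} n ++
        u.val :: listOf {y | (G.map Fin.valEmbedding).Adj u y} n := by
  have hlift : ∀ S : Set ℕ, ∃ l : List (Fin n), l.map Fin.valEmbedding = listOf S n := fun S =>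
    ⟨(listOf S n).pmap Fin.mk fun a ha => (mem_listOf.1 ha).1, by simp [List.map_pmap]⟩
  have hnd : ∀ S : Set ℕ, (listOf S n).Nodup := fun S => List.nodup_range.filter _
  obtain ⟨a, ha⟩ := hlift {y | y ≠ u ∧ ¬ (G.map Fin.valEmbedding).Adj u y}
  obtain ⟨x, hx⟩ := hlift {y | (G.map Fin.valEmbedding).Adj u y}
  have hadj : ∀ v : Fin n, (G.map Fin.valEmbedding).Adj u v ↔ G.Adj u v := fun v =>
    SimpleGraph.map_adj_apply (f := Fin.valEmbedding)
  have hma : ∀ v, v ∈ a ↔ v ≠ u ∧ ¬ G.Adj u v := fun v => by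
    rw [← List.mem_map_of_injective Fin.valEmbedding.injective, ha, mem_listOf, Set.mem_ofPred_eq,
      ← hadj]
    simp [Fin.val_inj]
  have hmx : ∀ v, v ∈ x ↔ G.Adj u v := fun v => by
    rw [← List.mem_map_of_injective Fin.valEmbedding.injective, hx, mem_listOf, Set.mem_ofPred_eq,
      ← hadj]
    simp
  have hmap : (a ++ u :: x).map Fin.valEmbedding =
      listOf {y | y ≠ u ∧ ¬ (G.map Fin.valEmbedding).Adj u y} n ++
        u.val :: listOf {y | (G.map Fin.valEmbedding).Adj u y} n := by
    rw [List.map_append, List.map_cons, ha, hx]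
    rfl
  refine ⟨a ++ u :: x, ⟨?_, fun v => ?_, a, x, rfl, fun v hv => ((hma v).1 hv).2,
    fun v hv => (hmx v).1 hv⟩, hmap⟩
  · have hna : a.Nodup := List.Nodup.of_map _ (ha ▸ hnd _)
    have hnx : x.Nodup := List.Nodup.of_map _ (hx ▸ hnd _)
    refine List.nodup_append.2 ⟨hna, List.nodup_cons.2 ⟨fun h => G.irrefl ((hmx u).1 h), hnx⟩, ?_⟩
    rintro v hv w hw rfl
    rcases List.mem_cons.1 hw with rfl | hw
    · exact ((hma v).1 hv).1 rfl
    · exact ((hma v).1 hv).2 ((hmx v).1 hw)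
  · rw [List.mem_append, List.mem_cons, hma, hmx]
    tauto

theorem testsByTriangulation_testProg {n : ℕ} (G : SimpleGraph (Fin n)) (u : Fin n) :
    TestsByTriangulation testProg ((n + 2) ^ 36) (20000 * (n * G.edgeSet.ncard + 1)) G u := by
  intro σ h hu
  have hW : n + 2 ≤ (n + 2) ^ 36 := Nat.le_self_pow (by norm_num) _
  by_cases hm : G.edgeSet.ncard = 0
  · exact testsByTriangulation_of_edgeless h hm hW (by omega)
  obtain ⟨hD, hDn⟩ := h.arrPos_eq
  have hn : σ.reg 0 = n := h.size
  have : Nonempty (Fin n) := ⟨u⟩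
  have hn0 := u.pos
  set m := G.edgeSet.ncard
  have hmn : m ≤ n * m := Nat.le_mul_of_pos_left m hn0
  have hnm : n ≤ n * m := Nat.le_mul_of_pos_right n (Nat.pos_of_ne_zero hm)
  -- The initial numbers and the time together are below `2 ^ 15 * (n * m + 1)`, hence below `(n +
  -- 2) ^ 18`; the square demanded by `Runs` doubles the exponent to `36`.
  have hbig : (σ.arr 0 n + n + 1) + (13200 * (n * m) + 2000 * m + 3100 * n + 400) + 1 <
      (n + 2) ^ 18 := by
    have h15 : 2 ^ 15 ≤ (n + 2) ^ 15 := Nat.pow_le_pow_left (by omega) 15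
    have h3 : n * m + 1 ≤ (n + 2) ^ 3 := by nlinarith
    calc _ < 2 ^ 15 * (n * m + 1) := by omega
      _ ≤ (n + 2) ^ 15 * (n + 2) ^ 3 := Nat.mul_le_mul h15 h3
      _ = (n + 2) ^ 18 := by ring
  have hsq : ((σ.arr 0 n + n + 1) + (13200 * (n * m) + 2000 * m + 3100 * n + 400) + 1) ^ 2 <
      (n + 2) ^ 36 := by
    calc _ < ((n + 2) ^ 18) ^ 2 := Nat.pow_lt_pow_left hbig (by norm_num)
      _ = (n + 2) ^ 36 := by ring
  have hDW : σ.arr 0 n < (n + 2) ^ 36 := lt_of_le_of_lt (le_sq (by omega)) hsq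
  obtain ⟨t1, ht1, σ1, hex1, c1, c2, c3, c4, c5⟩ := exec_clearPass hn hW
  have hadj : HoldsAdj n (G.map Fin.valEmbedding) σ1.arr := by
    refine ⟨?_, ?_, ?_, h.holdsAdj.lt⟩
    · rw [c4 0 (by norm_num)]
      exact h.holdsAdj.start
    · rw [c4 0 (by norm_num)]
      exact h.holdsAdj.mono
    · rw [c4 0 (by norm_num), c4 1 (by norm_num)]
      exact h.holdsAdj.adj_iff
  have hsafe : Safe n (σ.arr 0 n + n + 1) σ1 := by
    refine ⟨(c1 0 (by norm_num)).trans hn, fun r hr => ?_, fun r hr => ?_, fun a ha i hi => ?_,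
      fun a ha i hi => ?_⟩
    · simp only [idxReg, Bool.or_eq_true, beq_iff_eq, Bool.and_eq_true, decide_eq_true_eq] at hr
      rcases hr with (rfl | rfl) | hr
      · exact ((c1 0 (by norm_num)).trans hn).le
      · rw [c1 1 (by norm_num), hu]
        exact u.isLt.le
      · rw [c3 r hr.1 (by omega)]
        exact Nat.zero_le _
    · simp only [numReg, Bool.or_eq_true, beq_iff_eq, Bool.and_eq_true, decide_eq_true_eq] at hr
      by_cases hr5 : r < 5
      · rw [c2 r (by omega) hr5]
        exact Nat.zero_le _
      · rw [c3 r (by omega) (by omega)]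
        exact Nat.zero_le _
    · simp only [idxArr, Bool.and_eq_true, decide_eq_true_eq] at ha
      rw [c5 a ha.1 (by omega) i hi]
      exact Nat.zero_le _
    · simp only [numArr, Bool.or_eq_true, beq_iff_eq, Bool.and_eq_true, decide_eq_true_eq] at ha
      by_cases ha0 : a = 0
      · rw [ha0]
        have := hadj.start_le hi
        rw [c4 0 (by norm_num)] at this ⊢
        omega
      · rw [c5 a (by omega) (by omega) i hi]
        exact Nat.zero_le _
  have hrun := runs_buildPass (n := n) (u := u.val) (σ := σ1) ((c1 0 (by norm_num)).trans hn)
    ((c1 1 (by norm_num)).trans hu) u.isLt hadj c5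
  rw [c4 0 (by norm_num), hD] at hrun
  obtain ⟨t2, ht2, σ2, hex2, -, ⟨H, hinc, hlt, hE, hle, hans⟩, r2, f2⟩ :=
    (hrun.mono (T' := 13200 * (n * m) + 2000 * m + 3100 * n + 400)
      (by rw [mul_left_comm n 2 m]; omega) fun _ h => h).frame
      ((n + 2) ^ 36) _ (by omega) (by omega) hsafe hsq
  obtain ⟨l, hl, hlm⟩ := isOrderingAt_of_map (G := G) (u := u)
  have hcm : (G.map Fin.valEmbedding).comap Fin.valEmbedding = G :=
    SimpleGraph.comap_map_eq Fin.valEmbedding G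
  rw [← hlm] at hinc
  have hinc' : IsVertexIncremental G l (H.comap Fin.valEmbedding) := by
    have := hinc.comap Fin.valEmbedding
    rwa [hcm] at this
  have hN : ∀ v, (H.comap Fin.valEmbedding).Adj u v → G.Adj u v := fun v hv => by
    by_contra hG
    exact hl.not_fill hinc' v ⟨hv, hG⟩
  -- The program has tested the neighbours of `u` in `G`. They are its neighbours in the
  -- triangulation, as there is no fill at `u`.
  have hsimp : IsSimplicial (H.comap Fin.valEmbedding) u ↔ σ2.reg 3 ≠ 0 := by
    rw [hans]
    constructor
    · intro hs a b ha hb hab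
      obtain ⟨x, y, hxy, hx, rfl⟩ := (SimpleGraph.map_adj _ _ _ _).1 ha
      obtain ⟨x', y', hxy', hx', rfl⟩ := (SimpleGraph.map_adj _ _ _ _).1 hb
      obtain rfl : x = u := Fin.val_injective hx
      obtain rfl : x' = x := Fin.val_injective hx'
      exact hs ((hl.isMinimalTriangulation hinc').1 hxy)
        ((hl.isMinimalTriangulation hinc').1 hxy') fun he => hab (by rw [he])
    · intro hs a ha b hb hab
      exact hs a b ((SimpleGraph.map_adj _ _ _ _).2 ⟨u, a, hN a ha, rfl, rfl⟩)
        ((SimpleGraph.map_adj _ _ _ _).2 ⟨u, b, hN b hb, rfl, rfl⟩) fun he =>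
          hab (Fin.val_injective he)
  refine ⟨3 + (t1 + t2), σ2, .ite_true _ ⟨?_, ?_⟩ ?_ (.seq hex1 hex2), ?_, fun r hr => ?_,
    fun a ha => ?_, l, H.comap Fin.valEmbedding, hl, hinc', ?_, fun hs => ?_, fun hs => ?_⟩
  · simp only [Expr.Fits]
    omega
  · simpa only [Expr.eval, hn] using hDW
  · rw [eval_get, eval_var, hn, hD]
    omega
  · omega
  · rw [← c1 r hr]
    exact r2 r (by
      have : ∀ r ≤ 2, r ∉ buildPass.wr := by decide
      exact this r hr)
  · rw [← c4 a (lt_of_le_of_lt ha (by decide))]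
    exact f2 a (by
      have : ∀ a ≤ 2, a ∉ buildPass.wa := by decide
      exact this a ha)
  · have : Sym2.map Fin.val '' (H.comap (Fin.valEmbedding (n := n))).edgeSet = H.edgeSet := by
      ext e
      constructor
      · rintro ⟨e, he, rfl⟩
        induction e with
        | _ a b => exact he
      · intro he
        induction e with
        | _ a b =>
          exact ⟨s(⟨a, hlt a b he⟩, ⟨b, hlt b a he.symm⟩), he, rfl⟩
    rw [HoldsTriangulation, this]
    exact hE
  · have := hsimp.1 hs
    change σ2.reg 3 = 1
    omega
  · exact not_not.1 fun h => hs (hsimp.2 h)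

/-! ### The listing program -/

theorem HoldsGraph.congr {n : ℕ} {G : SimpleGraph (Fin n)} {σ σ' : State} (h : HoldsGraph G σ)
    (h0 : σ'.reg 0 = σ.reg 0) (ha : ∀ a ≤ 1, σ'.arr a = σ.arr a) : HoldsGraph G σ' := by
  have a0 : σ'.arr arrPos = σ.arr arrPos := ha 0 (by decide)
  have a1 : σ'.arr arrAdj = σ.arr arrAdj := ha 1 le_rfl
  refine ⟨h0.trans h.size, ?_, ?_, ?_⟩
  · rw [a0]
    exact h.start
  · rw [a0]
    exact h.mono
  · rw [a0, a1]
    exact h.lists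

theorem bijOn_update {f : ℕ → ℕ} {S : Set ℕ} {c u : ℕ} (h : Set.BijOn f (Set.Iio c) S)
    (hu : u ∉ S) : Set.BijOn (Function.update f c u) (Set.Iio (c + 1)) (insert u S) := by
  have hf : Set.EqOn f (Function.update f c u) (Set.Iio c) := fun i hi =>
    (Function.update_of_ne (ne_of_lt hi) _ _).symm
  have := (h.congr hf).insert (a := c) (by simpa using hu)
  rwa [Function.update_self, show insert c (Set.Iio c) = Set.Iio (c + 1) by ext; simp]
    at this

/-- Since a test preserves the input, `u` and the output, the rounds are independent, and
determinacy of the triangulation is not needed: every admissible one gives the right answer. The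
`20` per round covers the guard, the conditional append and the increment. -/
theorem listsAvoidable_listProg {test : Prog} {n W T : ℕ} {G : SimpleGraph (Fin n)}
    (hW : n + 2 ≤ W) (h : ∀ u, TestsByTriangulation test W T G u) :
    ListsAvoidable (listProg test) W (n * (T + 20) + 10) G := by
  intro σ hσ
  have hloop : ∀ (m k : ℕ) (τ : State), k + m = n → HoldsGraph G τ → τ.reg 1 = k → τ.reg 2 ≤ k →
      Set.BijOn (τ.arr 2) (Set.Iio (τ.reg 2)) (Fin.val '' {u | IsAvoidable G u ∧ u.val < k}) →
      ∃ t σ', Exec W (.loop (.lt (.var 1) (.var 0)) (.seq test (.seq (.ite (.var 3)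
        (.seq (.put 2 (.var 2) (.var 1)) (.set 2 (.add (.var 2) (.lit 1)))) .skip)
        (.set 1 (.add (.var 1) (.lit 1)))))) τ t σ' ∧ t ≤ m * (T + 20) + 4 ∧
        OutputLists {u | IsAvoidable G u} σ' := by
    intro m
    induction m with
    | zero =>
      intro k τ hk hτ h1 h2 hout
      have hn : τ.reg 0 = n := hτ.size
      refine ⟨4, τ, .loop_done _ ?_ ?_, by omega, ?_⟩
      · simp only [Expr.Fits]
        omega
      · exact Expr.eval_lt_eq_zero.2 (by simp only [Expr.eval]; omega)
      · have he : {u | IsAvoidable G u ∧ u.val < k} = {u : Fin n | IsAvoidable G u} := by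
          ext u
          exact and_iff_left (by omega)
        rwa [he] at hout
    | succ m ih =>
      intro k τ hk hτ h1 h2 hout
      have hn : τ.reg 0 = n := hτ.size
      obtain ⟨t, τ1, hex, ht, hr, ha, l, H, hl, hinc, -, hs1, hs0⟩ :=
        h ⟨k, by omega⟩ τ hτ h1
      have hτ1 : HoldsGraph G τ1 := hτ.congr (hr 0 (by decide)) fun a h => ha a (h.trans one_le_two)
      have hav : IsAvoidable G ⟨k, by omega⟩ ↔ IsSimplicial H ⟨k, by omega⟩ :=
        (hl.isMinimalTriangulation hinc).isAvoidable_iff (hl.not_fill hinc)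
      have q0 : τ1.reg 0 = n := hτ1.size
      have q1 : τ1.reg 1 = k := (hr 1 (by decide)).trans h1
      have q2 : τ1.reg 2 = τ.reg 2 := hr 2 le_rfl
      have a2 : τ1.arr 2 = τ.arr 2 := ha 2 le_rfl
      have hmid : ∃ t' ≤ 9, ∃ τ2, Exec W (.ite (.var 3)
          (.seq (.put 2 (.var 2) (.var 1)) (.set 2 (.add (.var 2) (.lit 1)))) .skip) τ1 t' τ2 ∧
          τ2.reg 0 = n ∧ τ2.reg 1 = k ∧ (∀ a ≤ 1, τ2.arr a = τ1.arr a) ∧ τ2.reg 2 ≤ k + 1 ∧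
          Set.BijOn (τ2.arr 2) (Set.Iio (τ2.reg 2))
            (Fin.val '' {u : Fin n | IsAvoidable G u ∧ u.val < k + 1}) := by
        by_cases hs : IsSimplicial H ⟨k, by omega⟩
        · have h3 : τ1.reg 3 = 1 := hs1 hs
          refine ⟨2 + (3 + 4), by norm_num, (τ1.setArr 2 (τ1.reg 2) (τ1.reg 1)).setReg 2
            (τ1.reg 2 + 1), .ite_true _ ?_ ?_ (.seq (.put 2 (.var 2) (.var 1) _ ?_ ?_)
              (.set 2 (.add (.var 2) (.lit 1)) _ ?_)), ?_, ?_, fun a ha => ?_, ?_, ?_⟩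
          · simp only [Expr.Fits]
            omega
          · rw [eval_var, h3]
            exact one_ne_zero
          · simp only [Expr.Fits]
            omega
          · simp only [Expr.Fits]
            omega
          · simp only [Expr.Fits, Expr.eval, setArr_reg]
            omega
          · rwa [setReg_ne (by decide)]
          · rwa [setReg_ne (by decide)]
          · rw [setReg_arr, setArr_ne (by omega)]
          · rw [setReg_same]
            omega
          · have he : Fin.val '' {u : Fin n | IsAvoidable G u ∧ u.val < k + 1} =
                insert k (Fin.val '' {u : Fin n | IsAvoidable G u ∧ u.val < k}) := by
              ext y
              constructor
              · rintro ⟨u, ⟨hu1, hu2⟩, rfl⟩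
                rcases Nat.lt_succ_iff_lt_or_eq.1 hu2 with hu | hu
                · exact .inr ⟨u, ⟨hu1, hu⟩, rfl⟩
                · exact .inl hu
              · rintro (rfl | ⟨u, ⟨hu1, hu2⟩, rfl⟩)
                · exact ⟨⟨y, by omega⟩, ⟨hav.2 hs, Nat.lt_succ_self y⟩, rfl⟩
                · exact ⟨u, ⟨hu1, Nat.lt_succ_of_lt hu2⟩, rfl⟩
            have := bijOn_update hout (u := k) (by
              rintro ⟨u, ⟨-, hu⟩, rfl⟩
              exact lt_irrefl _ hu)
            rw [he, setReg_same, setReg_arr, State.setArr, q1, q2]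
            simpa [a2] using this
        · have h3 : τ1.reg 3 = 0 := hs0 hs
          refine ⟨2 + 1, by norm_num, τ1, .ite_false _ ?_ h3 (.skip _), q0, q1, fun _ _ => rfl,
            by omega, ?_⟩
          · simp only [Expr.Fits]
            omega
          · have he : {u : Fin n | IsAvoidable G u ∧ u.val < k + 1} =
                {u : Fin n | IsAvoidable G u ∧ u.val < k} := by
              ext u
              refine and_congr_right fun hu => ⟨fun hk' => ?_, Nat.lt_succ_of_lt⟩
              refine lt_of_le_of_ne (Nat.lt_succ_iff.1 hk') ?_
              rintro rfl
              exact hs (hav.1 hu)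
            rw [he, a2, q2]
            exact hout
      obtain ⟨t', ht', τ2, hex2, g0, g1, ga, g2, hout2⟩ := hmid
      have hset : Exec W (.set 1 (.add (.var 1) (.lit 1))) τ2 4 (τ2.setReg 1 (τ2.reg 1 + 1)) :=
        .set 1 (.add (.var 1) (.lit 1)) τ2 (by simp only [Expr.Fits, Expr.eval]; omega)
      obtain ⟨t3, σ', hex3, ht3, hfin⟩ := ih (k + 1) (τ2.setReg 1 (τ2.reg 1 + 1)) (by omega)
        (hτ1.congr (by rw [setReg_ne (by decide), g0, q0]) ga) (by rw [setReg_same, g1])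
        (by rwa [setReg_ne (by decide)]) (by rwa [setReg_ne (by decide)])
      refine ⟨4 + (t + (t' + 4)) + t3, σ', .loop_step ?_ ?_ (.seq hex (.seq hex2 hset)) hex3, ?_,
        hfin⟩
      · simp only [Expr.Fits]
        omega
      · exact Expr.eval_lt_ne_zero.2 (by simp only [Expr.eval]; omega)
      · rw [Nat.succ_mul]
        omega
  obtain ⟨t, σ', hex, ht, hfin⟩ := hloop n 0 ((σ.setReg 1 0).setReg 2 0) (by omega)
    (hσ.congr (by simp) fun _ _ => rfl) (by simp) (by simp) (by simp)
  exact ⟨2 + (2 + t), σ', .seq (.set 1 (.lit 0) σ (by simp only [Expr.Fits]; omega))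
    (.seq (.set 2 (.lit 0) _ (by simp only [Expr.Fits]; omega)) hex), by omega, hfin⟩

theorem TestsByTriangulation.mono {test : Prog} {W T T' n : ℕ} {G : SimpleGraph (Fin n)} {u : Fin n}
    (h : TestsByTriangulation test W T G u) (hT : T ≤ T') :
    TestsByTriangulation test W T' G u := by
  intro σ hσ hu
  obtain ⟨t, σ', h1, h2, h3⟩ := h σ hσ hu
  exact ⟨t, σ', h1, h2.trans hT, h3⟩

theorem ListsAvoidable.mono {p : Prog} {W T T' n : ℕ} {G : SimpleGraph (Fin n)}
    (h : ListsAvoidable p W T G) (hT : T ≤ T') : ListsAvoidable p W T' G := by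
  intro σ hσ
  obtain ⟨t, σ', h1, h2, h3⟩ := h σ hσ
  exact ⟨t, σ', h1, h2.trans hT, h3⟩

end AvoidableVertices

theorem mainTheorem3 :
    (∀ (V : Type*) [Finite V] (G : SimpleGraph V) (u : V),
      (∃ l : List V, IsOrderingAt G u l) ∧
      ∀ l : List V, IsOrderingAt G u l →
        (∃ H : SimpleGraph V, IsVertexIncremental G l H) ∧
        ∀ H : SimpleGraph V, IsVertexIncremental G l H →
          IsMinimalTriangulation G H ∧ (∀ v : V, ¬ (H \ G).Adj u v) ∧
            (IsAvoidable G u ↔ IsSimplicial H u)) ∧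
    ∃ (test : Prog) (c C : ℕ), ∀ (n : ℕ) (G : SimpleGraph (Fin n)),
      (∀ u : Fin n,
        TestsByTriangulation test ((n + 2) ^ c) (C * (n * G.edgeSet.ncard + 1)) G u) ∧
      ListsAvoidable (listProg test) ((n + 2) ^ c)
        (C * (n ^ 2 * G.edgeSet.ncard + n + 1)) G := by
  refine ⟨fun V _ G u => ⟨exists_isOrderingAt G u, fun l hl => ⟨?_, fun H hH =>
    ⟨hl.isMinimalTriangulation hH, hl.not_fill hH,
      (hl.isMinimalTriangulation hH).isAvoidable_iff (hl.not_fill hH)⟩⟩⟩,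
    -- Each of the `n` rounds takes `20000 * (n * m + 1) + 20` units and the frame `10` more, which
    -- is at most `20030 * (n ^ 2 * m + n + 1)`.
    testProg, 36, 20030, fun n G => ⟨fun u => ?_, ?_⟩⟩
  · obtain ⟨H, hH, -⟩ := exists_isVertexIncremental G l hl.1
    exact ⟨H, hH⟩
  · exact (testsByTriangulation_testProg G u).mono (by omega)
  · refine (listsAvoidable_listProg (Nat.le_self_pow (by norm_num) _)
      (testsByTriangulation_testProg G)).mono ?_
    nlinarith [Nat.zero_le (n ^ 2 * G.edgeSet.ncard)]
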